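/- **Setting.** Virtual link diagrams are oriented and are considered up to planar isotopy and detour moves, i.e. a diagram is a finite oriented 4-valent graph (possibly with circles without vertices) with over/under information and a sign at each crossing (a Gauss diagram). Two diagrams are *equivalent* if they are related by oriented Reidemeister moves $\Omega1,\Omega2,\Omega3$ at classical crossings. A *biquandle* is a set $X$ with operations $\circ,\ast$ such that $x\circ x=x\ast x$; the maps $x\mapsto x\ast y$, $x\mapsto x\circ y$ and $S(x,y)=(y\ast x,x\circ y)$ are invertible; and $(x\circ z)\circ(y\circ z)=(x\circ y)\circ(z\ast y)$, $(y\circ z)\ast(x\circ z)=(y\ast x)\circ(z\ast x)$, $(z\ast x)\ast(y\ast x)=(z\ast y)\ast(x\circ y)$. Let $X$ be a finite biquandle. An *$X$-colouring* $f$ of a diagram assigns to each edge an element of $X$ so that at each crossing, with a pair of labels $(x,y)$, the following holds: at a positive crossing the outgoing under-edge is $x$, the incoming over-edge is $y$, the outgoing over-edge is $y\ast x$, the incoming under-edge is $x\circ y$; at a negative crossing the incoming under-edge is $x$, the outgoing over-edge is $y$, the incoming over-edge is $y\ast x$, the outgoing under-edge is $x\circ y$. A *4-valent graph with a cross structure*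 is a finite graph whose vertices have degree four, with the half-edges at each vertex split into two pairs of opposite ones; components that are circles without vertices are allowed. The decreasing first Reidemeister move removes a vertex at which a loop joins two non-opposite half-edges; the decreasing second move removes two distinct vertices joined by two edges that are non-opposite at both vertices; in both cases opposite half-edges at the removed vertices are joined. A graph is *$1$-irreducible* if no decreasing second move applies to it, and *$2$-irreducible* if no decreasing first or second move applies to it. Let $j\in\{1,2\}$. **Coefficients.** Let $R_j=\mathbb Z[\delta,A_{x,y},B_{x,y},C_{x,y},D_{x,y},E_{x,y},F_{x,y}\mid x,y\in X]/I_j$. For $x,y,z\in X$ write $P_1Q_2S_3=P_{x,y}Q_{y,z}S_{x\circ y,z\ast y}$ and $P^1Q^2S^3=P_{x,z}Q_{y\ast x,z\ast x}S_{x\circ z,y\circ z}$ for $P,Q,S\in\{A,B,C\}$. For $j=2$ the ideal $I_2$ is generated, over all $x,y,z\in X$, by - $\delta A_{x,x}+B_{x,x}+C_{x,x}-1$, $\ \delta D_{x,x}+E_{x,x}+F_{x,x}-1$; - (indices $x,y$ omitted) $AF+CD$, $\ BF+CE$, $\ AD-BE$, $\ AD+CF-1$, $\ \delta AD+AE+BD$;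 - $A_1A_2A_3+C_1C_2A_3-A^1A^2A^3-A^1C^2C^3$, $\ A_1B_2B_3+C_1B_2C_3-B^1B^2A^3-C^1B^2C^3$, $\ B_1A_2B_3+B_1C_2C_3-B^1A^2B^3-C^1C^2B^3$, $\ A_1C_2A_3+C_1A_2A_3-C^1A^2A^3$, $\ A_1A_2C_3-A^1A^2C^3-A^1C^2A^3$, $\ A_1C_2B_3-B^1B^2C^3-C^1B^2A^3$, $\ B_1C_2B_3+B_1A_2C_3-B^1A^2C^3$, $\ A_1B_2C_3+C_1B_2B_3-B^1C^2A^3$, $\ C_1A_2B_3-B^1C^2B^3-C^1A^2B^3$, $\ C_1C_2B_3-B^1C^2C^3$, $\ A_1C_2C_3-C^1C^2A^3$, $\ C_1A_2C_3-C^1A^2C^3$, $\ C_1C_2C_3$, $\ C^1C^2C^3$; - $A_1A_2B_3-(A^1B^2A^3+A^1A^2B^3+\delta A^1B^2B^3+B^1B^2B^3+A^1B^2C^3+A^1C^2B^3+C^1B^2B^3)$, $\ B^1A^2A^3-(B_1A_2A_3+A_1B_2A_3+\delta B_1B_2A_3+B_1B_2B_3+B_1C_2A_3+C_1B_2A_3+B_1B_2C_3)$.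 The ideal $I_1$ is generated by these polynomials together with $C_{x,x}$, $F_{x,x}$, $A_{x,y}F_{x,y}$, $C_{x,y}D_{x,y}$, $B_{x,y}F_{x,y}$, $C_{x,y}E_{x,y}$, $B_1C_2A_3$, $C_1B_2A_3$, $B_1B_2C_3$, $A^1B^2C^3$, $A^1C^2B^3$, $C^1B^2B^3$. **Bracket.** Let $R_j\mathfrak G_{j,\delta}$ be the $R_j$-module generated by 4-valent graphs with a cross structure modulo second Reidemeister moves (and also first ones if $j=2$) and $G\sqcup\bigcirc=\delta G$ for non-empty $G$. A state of a diagram $L$ replaces each crossing by a graphical vertex, by the smoothing that respects the orientation, or by the other smoothing; at a crossing with labels $(x,y)$ it contributes respectively $C_{x,y},A_{x,y},B_{x,y}$ if the crossing is positive and $F_{x,y},D_{x,y},E_{x,y}$ if it is negative. The bracket $[[L]](f)_j\in R_j\mathfrak G_{j,\delta}$ is the sum over all states of the product of the contributions times the resulting graph. Write $[[L]](f)_j$ as a linear combination of $j$-irreducible graphs, none of which is the disjoint union of a circle and a non-empty graph. A *leading term* of $[[L]](f)_j$ is a graph with non-zero coefficient in it that has the maximal number of vertices among all graphs with non-zero coefficients.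 **Theorem.** Let $X$ be a finite biquandle, $L$ an oriented virtual link diagram, $f$ an $X$-colouring of $L$, $j\in\{1,2\}$, and let $G$ be a leading term of $[[L]](f)_j$. Then every diagram equivalent to $L$ has at least as many crossings as $G$ has vertices. Moreover, if the number of vertices of $G$ equals the number of crossings of $L$, then $L$ is minimal in the following sense: for every diagram $L'$ equivalent to $L$ there is a state of $L'$ (some crossings are smoothed, and the others are replaced by vertices) whose graph is, up to circles without vertices, the 4-valent graph with a cross structure obtained from $L$ by replacing each crossing with a vertex. -/

import Mathlib

universe u

noncomputable section

/-- A biquandle: a set with two binary operations `x ⊚ y` and `x ⧆ y`. -/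
class Biquandle (X : Type u) where
  circ : X → X → X
  star : X → X → X
  circ_self : ∀ x, circ x x = star x x
  star_bijective : ∀ y, Function.Bijective fun x => star x y
  circ_bijective : ∀ y, Function.Bijective fun x => circ x y
  switch_bijective : Function.Bijective fun p : X × X => (star p.2 p.1, circ p.1 p.2)
  exchange_circ : ∀ x y z,
    circ (circ x z) (circ y z) = circ (circ x y) (star z y)
  exchange_mixed : ∀ x y z,
    star (circ y z) (circ x z) = circ (star y x) (star z x)
  exchange_star : ∀ x y z,
    star (star z x) (star y x) = star (star z y) (circ x y)

infixl:75 " ⊚ " => Biquandle.circ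
infixl:75 " ⧆ " => Biquandle.star

/-! ### Oriented virtual link diagrams -/

/-- An oriented virtual link diagram, up to planar isotopy and detour moves, given by its
Gauss diagram (virtual crossings are disregarded).

The oriented circles of the link are the cycles of the permutation `next` of a finite set `Pt` of
points; the oriented edge leaving the point `p` ends at `next p`.  Every (classical) crossing `c` is
passed twice: on the overcrossing strand at the point `pos (c, true)` and on the undercrossing
strand at the point `pos (c, false)`.  Together with the sign of the crossing this determines the
cyclic order of its four half-edges.  Points outside the range of `pos` are auxiliary marked
points in the interior of an edge; in particular a circle all of whose points are marked is a
component without crossings. -/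
structure LinkDiagram where
  Pt : Type
  Cr : Type
  finite_pt : Finite Pt
  finite_cr : Finite Cr
  next : Equiv.Perm Pt
  pos : Cr × Bool ↪ Pt
  sign : Cr → ℤˣ

namespace LinkDiagram

instance (L : LinkDiagram) : Finite L.Pt := L.finite_pt

instance (L : LinkDiagram) : Finite L.Cr := L.finite_cr

/-- The overcrossing point of a crossing. -/
def overPt (L : LinkDiagram) (c : L.Cr) : L.Pt := L.pos (c, true)

/-- The undercrossing point of a crossing. -/
def underPt (L : LinkDiagram) (c : L.Cr) : L.Pt := L.pos (c, false)

/-- The number of classical crossings. -/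
def crossingNumber (L : LinkDiagram) : ℕ := Nat.card L.Cr

open Classical in
/-- Put one more marked point (the point `none`) on the edge from `p` to `next p`. -/
def mark (L : LinkDiagram) (p : L.Pt) : LinkDiagram where
  Pt := Option L.Pt
  Cr := L.Cr
  finite_pt := inferInstance
  finite_cr := inferInstance
  next := (Equiv.optionCongr L.next).trans (Equiv.swap none (some (L.next p)))
  pos := L.pos.trans Function.Embedding.some
  sign := L.sign

/-- Remove the crossings in `S` by making virtual all their intersections: the strands stay, and
the points where they met the removed crossings become marked points. -/
def erase (L : LinkDiagram) (S : Set L.Cr) : LinkDiagram where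
  Pt := L.Pt
  Cr := {c : L.Cr // c ∉ S}
  finite_pt := inferInstance
  finite_cr := inferInstance
  next := L.next
  pos := (Function.Embedding.prodMap (Function.Embedding.subtype _)
    (Function.Embedding.refl Bool)).trans L.pos
  sign := fun c => L.sign c.1

/-- The points `p` and `q` are joined by an edge, which runs from `p` to `q` if `e = 1` and
from `q` to `p` if `e = -1`. -/
def Adjacent (L : LinkDiagram) (e : ℤˣ) (p q : L.Pt) : Prop :=
  (e = 1 ∧ L.next p = q) ∨ (e = -1 ∧ L.next q = p)

/-- The crossings `a`, `b`, `c` form a triangle to which a third Reidemeister move applies: the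
top strand passes over the middle strand at `a` and over the bottom strand at `b`, and the middle
strand passes over the bottom strand at `c`.  The condition on signs holds exactly for the
triangles that can be drawn in the plane without virtual crossings. -/
def IsTriangle (L : LinkDiagram) (a b c : L.Cr) : Prop :=
  a ≠ b ∧ a ≠ c ∧ b ≠ c ∧ ∃ e₁ e₂ e₃ : ℤˣ,
    L.Adjacent e₁ (L.overPt a) (L.overPt b) ∧
    L.Adjacent e₂ (L.underPt a) (L.overPt c) ∧
    L.Adjacent e₃ (L.underPt b) (L.underPt c) ∧
    L.sign a * e₁ * e₂ = L.sign b * e₁ * e₃ ∧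
    L.sign b * e₁ * e₃ = L.sign c * e₂ * e₃

open Classical in
/-- The result of the third Reidemeister move on the triangle `a`, `b`, `c`: on each of the three
strands the two crossings change places. -/
def slide (L : LinkDiagram) (a b c : L.Cr) : LinkDiagram where
  Pt := L.Pt
  Cr := L.Cr
  finite_pt := inferInstance
  finite_cr := inferInstance
  next := L.next
  pos := L.pos.trans (Equiv.swap (L.overPt a) (L.overPt b) * Equiv.swap (L.underPt a) (L.overPt c) *
    Equiv.swap (L.underPt b) (L.underPt c) : Equiv.Perm L.Pt).toEmbedding
  sign := L.sign

/-- The elementary steps between diagrams: isomorphism, a new marked point, and the decreasing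
first, decreasing second, and third oriented Reidemeister moves (in all their versions).  Planar
isotopies and detour moves do not change the Gauss diagram. -/
inductive Step : LinkDiagram → LinkDiagram → Prop
  | iso (L L' : LinkDiagram) (e : L.Pt ≃ L'.Pt) (g : L.Cr ≃ L'.Cr)
      (next_eq : ∀ p, e (L.next p) = L'.next (e p))
      (pos_eq : ∀ c t, e (L.pos (c, t)) = L'.pos (g c, t))
      (sign_eq : ∀ c, L.sign c = L'.sign (g c)) : Step L L'
  | mark (L : LinkDiagram) (p : L.Pt) : Step L (L.mark p)
  | first (L : LinkDiagram) (c : L.Cr) (t : Bool)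
      (h : L.next (L.pos (c, t)) = L.pos (c, !t)) : Step L (L.erase {c})
  | second (L : LinkDiagram) (a b : L.Cr) (h_sign : L.sign a = -L.sign b)
      (h_over : L.next (L.overPt a) = L.overPt b)
      (h_under : L.next (L.underPt a) = L.underPt b ∨ L.next (L.underPt b) = L.underPt a) :
      Step L (L.erase {a, b})
  | third (L : LinkDiagram) (a b c : L.Cr) (h : L.IsTriangle a b c) : Step L (L.slide a b c)

/-- Two diagrams are equivalent if they represent the same oriented virtual link. -/
def Equivalent (L L' : LinkDiagram) : Prop := Relation.EqvGen Step L L'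

end LinkDiagram

/-- An `X`-colouring of a diagram: `color p` is the colour of the edge from `p` to `next p`, so that
the edge arriving at `p` has the colour `color (next.symm p)`.  The colour does not change at a
marked point.  At a positive crossing the outgoing under-edge `x` and the incoming over-edge `y`
determine the outgoing over-edge `y ⧆ x` and the incoming under-edge `x ⊚ y`; at a negative
crossing incoming and outgoing edges are exchanged. -/
structure Coloring (L : LinkDiagram) (X : Type u) [Biquandle X] where
  color : L.Pt → X
  marked : ∀ p, p ∉ Set.range L.pos → color p = color (L.next.symm p)
  positive : ∀ c, L.sign c = 1 →
    color (L.overPt c) = color (L.next.symm (L.overPt c)) ⧆ color (L.underPt c) ∧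
    color (L.next.symm (L.underPt c)) = color (L.underPt c) ⊚ color (L.next.symm (L.overPt c))
  negative : ∀ c, L.sign c = -1 →
    color (L.next.symm (L.overPt c)) = color (L.overPt c) ⧆ color (L.next.symm (L.underPt c)) ∧
    color (L.underPt c) = color (L.next.symm (L.underPt c)) ⊚ color (L.overPt c)

/-- The pair of colours `(x, y)` that the skein relation sees at the crossing `c`. -/
def Coloring.labels {L : LinkDiagram} {X : Type u} [Biquandle X] (f : Coloring L X) (c : L.Cr) :
    X × X :=
  if L.sign c = 1 then (f.color (L.underPt c), f.color (L.next.symm (L.overPt c)))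
  else (f.color (L.next.symm (L.underPt c)), f.color (L.overPt c))

/-! ### Four-valent graphs with a cross structure -/

/-- A finite four-valent graph with a cross structure, possibly with circles without vertices.
Edges may be subdivided by 2-valent nodes, which are not counted as vertices.

`edge` interchanges the two half-edges of each edge, `opp` sends a half-edge to the opposite one at
the same vertex (or to the other one at the same 2-valent node).  The four half-edges at a vertex
`v` are `half (v, s, b)`, where `half (v, s, false)` and `half (v, s, true)` are opposite.  The
orbits of `opp` outside the range of `half` are the 2-valent nodes; a circle is a component all of
whose nodes are 2-valent. -/
structure FramedGraph where
  Half : Type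
  Vert : Type
  finite_half : Finite Half
  finite_vert : Finite Vert
  edge : Half → Half
  edge_edge : ∀ h, edge (edge h) = h
  edge_ne : ∀ h, edge h ≠ h
  opp : Half → Half
  opp_opp : ∀ h, opp (opp h) = h
  opp_ne : ∀ h, opp h ≠ h
  half : Vert × Bool × Bool ↪ Half
  opp_half : ∀ v s b, opp (half (v, s, b)) = half (v, s, !b)

namespace FramedGraph

instance (G : FramedGraph) : Finite G.Half := G.finite_half

instance (G : FramedGraph) : Finite G.Vert := G.finite_vert

/-- The number of (4-valent) vertices. -/
def vertexNumber (G : FramedGraph) : ℕ := Nat.card G.Vert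

open Classical in
/-- Put one more 2-valent node on the edge containing the half-edge `h`. -/
def subdivide (G : FramedGraph) (h : G.Half) : FramedGraph where
  Half := G.Half ⊕ Bool
  Vert := G.Vert
  finite_half := inferInstance
  finite_vert := inferInstance
  edge := Sum.elim
    (fun k => if k = h then Sum.inr false else if k = G.edge h then Sum.inr true
      else Sum.inl (G.edge k))
    (fun b => if b then Sum.inl (G.edge h) else Sum.inl h)
  edge_edge := by
    have h1 := G.edge_ne h
    have h2 := G.edge_edge
    rintro (k | b)
    · by_cases hk : k = h
      · simp [hk]
      · by_cases hk' : k = G.edge h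
        · simp [hk', h1]
        · have h3 : G.edge k ≠ h := fun e => hk' (by rw [← e, h2])
          have h4 : G.edge k ≠ G.edge h := fun e => hk (by rw [← h2 k, e, h2])
          simp [hk, hk', h3, h4, h2]
    · cases b <;> simp [h1]
  edge_ne := by
    rintro (k | b)
    · by_cases hk : k = h
      · simp [hk]
      · by_cases hk' : k = G.edge h
        · simp [hk', G.edge_ne h]
        · simp [hk, hk', G.edge_ne k]
    · cases b <;> simp
  opp := Sum.map G.opp not
  opp_opp := by rintro (k | b) <;> simp [G.opp_opp]
  opp_ne := by rintro (k | b) <;> simp [G.opp_ne]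
  half := G.half.trans Function.Embedding.inl
  opp_half := by intro v s b; simp [G.opp_half]

/-- The disjoint union with a circle without vertices. -/
def addCircle (G : FramedGraph) : FramedGraph where
  Half := G.Half ⊕ Bool
  Vert := G.Vert
  finite_half := inferInstance
  finite_vert := inferInstance
  edge := Sum.map G.edge not
  edge_edge := by rintro (k | b) <;> simp [G.edge_edge]
  edge_ne := by rintro (k | b) <;> simp [G.edge_ne]
  opp := Sum.map G.opp not
  opp_opp := by rintro (k | b) <;> simp [G.opp_opp]
  opp_ne := by rintro (k | b) <;> simp [G.opp_ne]
  half := G.half.trans Function.Embedding.inl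
  opp_half := by intro v s b; simp [G.opp_half]

/-- Remove the vertices in `S`, following the opposite half-edges: each removed vertex is replaced
by two 2-valent nodes. -/
def erase (G : FramedGraph) (S : Set G.Vert) : FramedGraph where
  Half := G.Half
  Vert := {v : G.Vert // v ∉ S}
  finite_half := inferInstance
  finite_vert := inferInstance
  edge := G.edge
  edge_edge := G.edge_edge
  edge_ne := G.edge_ne
  opp := G.opp
  opp_opp := G.opp_opp
  opp_ne := G.opp_ne
  half := (Function.Embedding.prodMap (Function.Embedding.subtype _)
    (Function.Embedding.refl (Bool × Bool))).trans G.half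
  opp_half := fun v s b => G.opp_half v.1 s b

/-- Elementary homeomorphisms: isomorphisms and subdivisions of an edge. -/
inductive HomeoStep : FramedGraph → FramedGraph → Prop
  | iso (G G' : FramedGraph) (e : G.Half ≃ G'.Half) (g : G.Vert ≃ G'.Vert)
      (edge_eq : ∀ h, e (G.edge h) = G'.edge (e h))
      (opp_eq : ∀ h, e (G.opp h) = G'.opp (e h))
      (half_eq : ∀ v i, ∃ i', e (G.half (v, i)) = G'.half (g v, i')) : HomeoStep G G'
  | subdivide (G : FramedGraph) (h : G.Half) : HomeoStep G (G.subdivide h)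

/-- Two graphs are the same 4-valent graph with a cross structure. -/
def Homeo (G G' : FramedGraph) : Prop := Relation.EqvGen HomeoStep G G'

/-- Some edge joins two half-edges at `v` that are not opposite. -/
def IsLoop (G : FramedGraph) (v : G.Vert) : Prop :=
  ∃ b b', G.edge (G.half (v, false, b)) = G.half (v, true, b')

/-- Two edges join `v` and `w`, and they are not opposite at `v` and not opposite at `w`. -/
def IsBigon (G : FramedGraph) (v w : G.Vert) : Prop :=
  v ≠ w ∧ ∃ s b b' d d', G.edge (G.half (v, false, b)) = G.half (w, s, b') ∧
    G.edge (G.half (v, true, d)) = G.half (w, !s, d')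

end FramedGraph

/-- The two versions of the bracket: in `two` graphs are considered modulo first and second
Reidemeister moves, in `one` modulo second Reidemeister moves only. -/
inductive Version
  | one
  | two

namespace FramedGraph

/-- The decreasing Reidemeister moves on graphs that are used in the given version. -/
inductive Decreases : Version → FramedGraph → FramedGraph → Prop
  | first (G : FramedGraph) (v : G.Vert) (h : G.IsLoop v) :
      Decreases Version.two G (G.erase {v})
  | second (j : Version) (G : FramedGraph) (v w : G.Vert) (h : G.IsBigon v w) :
      Decreases j G (G.erase {v, w})

/-- A graph is `j`-irreducible if no decreasing move of version `j` applies to it (after forgetting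
or inserting 2-valent nodes). -/
def Irreducible (j : Version) (G : FramedGraph) : Prop :=
  ∀ G', Homeo G G' → ∀ G'', ¬ Decreases j G' G''

/-- The graph is not the disjoint union of a circle and a non-empty graph. -/
def IsReduced (G : FramedGraph) : Prop :=
  ∀ G' : FramedGraph, Nonempty G'.Half → ¬ Homeo G G'.addCircle

/-- `G` and `G'` coincide up to components that are circles without vertices. -/
def HomeoUpToCircles (G G' : FramedGraph) : Prop :=
  ∃ m n : ℕ, Homeo (addCircle^[m] G) (addCircle^[n] G')

end FramedGraph

/-- A 4-valent graph with a cross structure, up to homeomorphism. -/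
def GraphClass : Type 1 := Quot FramedGraph.HomeoStep

/-- The class of a graph. -/
def FramedGraph.toClass (G : FramedGraph) : GraphClass := Quot.mk _ G

/-! ### The coefficient ring -/

/-- The variables: `δ` and the six families of skein variables. -/
inductive SkeinVar (X : Type u) : Type u
  | delta
  | A (x y : X)
  | B (x y : X)
  | C (x y : X)
  | D (x y : X)
  | E (x y : X)
  | F (x y : X)

/-- The polynomial ring over `ℤ` in all the variables. -/
abbrev SkeinPoly (X : Type u) : Type u := MvPolynomial (SkeinVar X) ℤ

namespace SkeinPoly

variable {X : Type u}

def δ : SkeinPoly X := MvPolynomial.X SkeinVar.delta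
def A (x y : X) : SkeinPoly X := MvPolynomial.X (SkeinVar.A x y)
def B (x y : X) : SkeinPoly X := MvPolynomial.X (SkeinVar.B x y)
def C (x y : X) : SkeinPoly X := MvPolynomial.X (SkeinVar.C x y)
def D (x y : X) : SkeinPoly X := MvPolynomial.X (SkeinVar.D x y)
def E (x y : X) : SkeinPoly X := MvPolynomial.X (SkeinVar.E x y)
def F (x y : X) : SkeinPoly X := MvPolynomial.X (SkeinVar.F x y)

/-- The polynomials coming from the first Reidemeister moves. -/
def firstRelations : Version → X → Set (SkeinPoly X)
  | Version.one, x =>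
    { δ * A x x + B x x - 1, δ * D x x + E x x - 1, C x x, F x x }
  | Version.two, x =>
    { δ * A x x + B x x + C x x - 1, δ * D x x + E x x + F x x - 1 }

/-- The polynomials coming from the second Reidemeister moves. -/
def secondRelations : Version → X → X → Set (SkeinPoly X)
  | Version.one, x, y =>
    { A x y * F x y, C x y * D x y, B x y * F x y, C x y * E x y,
      A x y * D x y - B x y * E x y,
      A x y * D x y + C x y * F x y - 1,
      δ * A x y * D x y + A x y * E x y + B x y * D x y }
  | Version.two, x, y =>
    { A x y * F x y + C x y * D x y, B x y * F x y + C x y * E x y,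
      A x y * D x y - B x y * E x y,
      A x y * D x y + C x y * F x y - 1,
      δ * A x y * D x y + A x y * E x y + B x y * D x y }

variable [Biquandle X]

/-- The polynomials coming from the third Reidemeister moves that are common to both versions. -/
def thirdRelationsCommon (x y z : X) : Set (SkeinPoly X) :=
  { A x y * A y z * A (x ⊚ y) (z ⧆ y) + C x y * C y z * A (x ⊚ y) (z ⧆ y)
      - (A x z * A (y ⧆ x) (z ⧆ x) * A (x ⊚ z) (y ⊚ z)
        + A x z * C (y ⧆ x) (z ⧆ x) * C (x ⊚ z) (y ⊚ z)),
    A x y * B y z * B (x ⊚ y) (z ⧆ y) + C x y * B y z * C (x ⊚ y) (z ⧆ y)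
      - (B x z * B (y ⧆ x) (z ⧆ x) * A (x ⊚ z) (y ⊚ z)
        + C x z * B (y ⧆ x) (z ⧆ x) * C (x ⊚ z) (y ⊚ z)),
    B x y * A y z * B (x ⊚ y) (z ⧆ y) + B x y * C y z * C (x ⊚ y) (z ⧆ y)
      - (B x z * A (y ⧆ x) (z ⧆ x) * B (x ⊚ z) (y ⊚ z)
        + C x z * C (y ⧆ x) (z ⧆ x) * B (x ⊚ z) (y ⊚ z)),
    A x y * C y z * A (x ⊚ y) (z ⧆ y) + C x y * A y z * A (x ⊚ y) (z ⧆ y)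
      - C x z * A (y ⧆ x) (z ⧆ x) * A (x ⊚ z) (y ⊚ z),
    A x y * A y z * C (x ⊚ y) (z ⧆ y)
      - (A x z * A (y ⧆ x) (z ⧆ x) * C (x ⊚ z) (y ⊚ z)
        + A x z * C (y ⧆ x) (z ⧆ x) * A (x ⊚ z) (y ⊚ z)),
    A x y * C y z * B (x ⊚ y) (z ⧆ y)
      - (B x z * B (y ⧆ x) (z ⧆ x) * C (x ⊚ z) (y ⊚ z)
        + C x z * B (y ⧆ x) (z ⧆ x) * A (x ⊚ z) (y ⊚ z)),
    B x y * C y z * B (x ⊚ y) (z ⧆ y) + B x y * A y z * C (x ⊚ y) (z ⧆ y)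
      - B x z * A (y ⧆ x) (z ⧆ x) * C (x ⊚ z) (y ⊚ z),
    A x y * B y z * C (x ⊚ y) (z ⧆ y) + C x y * B y z * B (x ⊚ y) (z ⧆ y)
      - B x z * C (y ⧆ x) (z ⧆ x) * A (x ⊚ z) (y ⊚ z),
    C x y * A y z * B (x ⊚ y) (z ⧆ y)
      - (B x z * C (y ⧆ x) (z ⧆ x) * B (x ⊚ z) (y ⊚ z)
        + C x z * A (y ⧆ x) (z ⧆ x) * B (x ⊚ z) (y ⊚ z)),
    C x y * C y z * B (x ⊚ y) (z ⧆ y)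
      - B x z * C (y ⧆ x) (z ⧆ x) * C (x ⊚ z) (y ⊚ z),
    A x y * C y z * C (x ⊚ y) (z ⧆ y)
      - C x z * C (y ⧆ x) (z ⧆ x) * A (x ⊚ z) (y ⊚ z),
    C x y * A y z * C (x ⊚ y) (z ⧆ y)
      - C x z * A (y ⧆ x) (z ⧆ x) * C (x ⊚ z) (y ⊚ z),
    C x y * C y z * C (x ⊚ y) (z ⧆ y),
    C x z * C (y ⧆ x) (z ⧆ x) * C (x ⊚ z) (y ⊚ z) }

/-- The remaining polynomials coming from the third Reidemeister moves. -/
def thirdRelations : Version → X → X → X → Set (SkeinPoly X)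
  | Version.one, x, y, z =>
    { B x y * C y z * A (x ⊚ y) (z ⧆ y),
      C x y * B y z * A (x ⊚ y) (z ⧆ y),
      B x y * B y z * C (x ⊚ y) (z ⧆ y),
      A x z * B (y ⧆ x) (z ⧆ x) * C (x ⊚ z) (y ⊚ z),
      A x z * C (y ⧆ x) (z ⧆ x) * B (x ⊚ z) (y ⊚ z),
      C x z * B (y ⧆ x) (z ⧆ x) * B (x ⊚ z) (y ⊚ z),
      A x y * A y z * B (x ⊚ y) (z ⧆ y)
        - (A x z * B (y ⧆ x) (z ⧆ x) * A (x ⊚ z) (y ⊚ z)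
          + A x z * A (y ⧆ x) (z ⧆ x) * B (x ⊚ z) (y ⊚ z)
          + δ * A x z * B (y ⧆ x) (z ⧆ x) * B (x ⊚ z) (y ⊚ z)
          + B x z * B (y ⧆ x) (z ⧆ x) * B (x ⊚ z) (y ⊚ z)),
      B x z * A (y ⧆ x) (z ⧆ x) * A (x ⊚ z) (y ⊚ z)
        - (B x y * A y z * A (x ⊚ y) (z ⧆ y)
          + A x y * B y z * A (x ⊚ y) (z ⧆ y)
          + δ * B x y * B y z * A (x ⊚ y) (z ⧆ y)
          + B x y * B y z * B (x ⊚ y) (z ⧆ y)) }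
  | Version.two, x, y, z =>
    { A x y * A y z * B (x ⊚ y) (z ⧆ y)
        - (A x z * B (y ⧆ x) (z ⧆ x) * A (x ⊚ z) (y ⊚ z)
          + A x z * A (y ⧆ x) (z ⧆ x) * B (x ⊚ z) (y ⊚ z)
          + δ * A x z * B (y ⧆ x) (z ⧆ x) * B (x ⊚ z) (y ⊚ z)
          + B x z * B (y ⧆ x) (z ⧆ x) * B (x ⊚ z) (y ⊚ z)
          + A x z * B (y ⧆ x) (z ⧆ x) * C (x ⊚ z) (y ⊚ z)
          + A x z * C (y ⧆ x) (z ⧆ x) * B (x ⊚ z) (y ⊚ z)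
          + C x z * B (y ⧆ x) (z ⧆ x) * B (x ⊚ z) (y ⊚ z)),
      B x z * A (y ⧆ x) (z ⧆ x) * A (x ⊚ z) (y ⊚ z)
        - (B x y * A y z * A (x ⊚ y) (z ⧆ y)
          + A x y * B y z * A (x ⊚ y) (z ⧆ y)
          + δ * B x y * B y z * A (x ⊚ y) (z ⧆ y)
          + B x y * B y z * B (x ⊚ y) (z ⧆ y)
          + B x y * C y z * A (x ⊚ y) (z ⧆ y)
          + C x y * B y z * A (x ⊚ y) (z ⧆ y)
          + B x y * B y z * C (x ⊚ y) (z ⧆ y)) }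

/-- The ideal `I_j`. -/
def relationIdeal (j : Version) (X : Type u) [Biquandle X] : Ideal (SkeinPoly X) :=
  Ideal.span ((⋃ x, firstRelations j x) ∪ (⋃ x, ⋃ y, secondRelations j x y) ∪
    ⋃ x, ⋃ y, ⋃ z, thirdRelationsCommon x y z ∪ thirdRelations j x y z)

end SkeinPoly

/-- The coefficient ring `R_j`. -/
abbrev SkeinRing (j : Version) (X : Type u) [Biquandle X] : Type u :=
  SkeinPoly X ⧸ SkeinPoly.relationIdeal j X

/-- The image of a polynomial in the coefficient ring. -/
def SkeinRing.mk (j : Version) {X : Type u} [Biquandle X] : SkeinPoly X →+* SkeinRing j X :=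
  Ideal.Quotient.mk _

/-! ### The module of graphs and the bracket -/

/-- The relations in the free module on graphs: second (and, in version `two`, first) Reidemeister
moves, and `G ⊔ ○ = δ G` for non-empty `G`. -/
def graphRelations (j : Version) (X : Type u) [Biquandle X] :
    Submodule (SkeinRing j X) (GraphClass →₀ SkeinRing j X) :=
  Submodule.span _
    ({ r | ∃ G G' : FramedGraph, FramedGraph.Decreases j G G' ∧
        r = Finsupp.single G.toClass 1 - Finsupp.single G'.toClass 1 } ∪
     { r | ∃ G : FramedGraph, Nonempty G.Half ∧
        r = Finsupp.single G.addCircle.toClass 1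
          - Finsupp.single G.toClass (SkeinRing.mk j SkeinPoly.δ) })

/-- The module `R_j 𝔊_{j,δ}` in which the bracket takes its values. -/
abbrev GraphModule (j : Version) (X : Type u) [Biquandle X] : Type (max u 1) :=
  (GraphClass →₀ SkeinRing j X) ⧸ graphRelations j X

/-- What is done with a crossing in a state: it becomes a graphical vertex, or it is smoothed
according to the orientation, or it is smoothed in the other way. -/
inductive Resolution
  | vertex
  | oriented
  | unoriented

/-- A state of a diagram. -/
abbrev LinkDiagram.State (L : LinkDiagram) : Type := L.Cr → Resolution

/-- Where a strand arriving at (or leaving) the point of a crossing continues in a state; here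
`(p, true)` is the half-edge leaving `p` and `(p, false)` is the half-edge arriving at `p`. -/
def LinkDiagram.State.opp {L : LinkDiagram} (s : L.State) (h : L.Pt × Bool) : L.Pt × Bool :=
  Function.extend L.pos
    (fun x => match s x.1 with
      | Resolution.vertex => (L.pos x, !h.2)
      | Resolution.oriented => (L.pos (x.1, !x.2), !h.2)
      | Resolution.unoriented => (L.pos (x.1, !x.2), h.2))
    (fun p => (p, !h.2)) h.1

theorem LinkDiagram.State.opp_pos {L : LinkDiagram} (s : L.State) (c : L.Cr) (t b : Bool) :
    LinkDiagram.State.opp s (L.pos (c, t), b) = match s c with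
      | Resolution.vertex => (L.pos (c, t), !b)
      | Resolution.oriented => (L.pos (c, !t), !b)
      | Resolution.unoriented => (L.pos (c, !t), b) := by
  simp [LinkDiagram.State.opp, L.pos.injective.extend_apply]

theorem LinkDiagram.State.opp_marked {L : LinkDiagram} (s : L.State) (p : L.Pt)
    (hp : p ∉ Set.range L.pos) (b : Bool) :
    LinkDiagram.State.opp s (p, b) = (p, !b) := by
  have : ¬ ∃ a, L.pos a = p := hp
  simp only [LinkDiagram.State.opp]
  rw [Function.extend_apply' _ _ _ this]

/-- The 4-valent graph with a cross structure (together with its circles) given by a state. -/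
def LinkDiagram.State.graph {L : LinkDiagram} (s : L.State) : FramedGraph where
  Half := L.Pt × Bool
  Vert := {c : L.Cr // s c = Resolution.vertex}
  finite_half := inferInstance
  finite_vert := inferInstance
  edge := fun h => if h.2 then (L.next h.1, false) else (L.next.symm h.1, true)
  edge_edge := by rintro ⟨p, b⟩; cases b <;> simp
  edge_ne := by rintro ⟨p, b⟩; cases b <;> simp
  opp := LinkDiagram.State.opp s
  opp_opp := by
    rintro ⟨p, b⟩
    by_cases hp : p ∈ Set.range L.pos
    · obtain ⟨⟨c, t⟩, rfl⟩ := hp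
      rcases hs : s c <;> simp [LinkDiagram.State.opp_pos, hs]
    · simp [LinkDiagram.State.opp_marked s p hp]
  opp_ne := by
    rintro ⟨p, b⟩
    by_cases hp : p ∈ Set.range L.pos
    · obtain ⟨⟨c, t⟩, rfl⟩ := hp
      rcases hs : s c <;> simp [LinkDiagram.State.opp_pos, hs]
    · simp [LinkDiagram.State.opp_marked s p hp]
  half :=
    { toFun := fun v => (L.pos (v.1.1, v.2.1), v.2.2)
      inj' := by
        intro v w h
        obtain ⟨⟨c, hc⟩, t, b⟩ := v
        obtain ⟨⟨c', hc'⟩, t', b'⟩ := w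
        simp only [Prod.mk.injEq, L.pos.injective.eq_iff] at h
        obtain ⟨⟨rfl, rfl⟩, rfl⟩ := h
        rfl }
  opp_half := by
    rintro ⟨c, hc⟩ t b
    change LinkDiagram.State.opp s (L.pos (c, t), b) = (L.pos (c, t), !b)
    simp [LinkDiagram.State.opp_pos, hc]

/-- The graph obtained from a diagram by replacing each crossing with a vertex. -/
def LinkDiagram.shadow (L : LinkDiagram) : FramedGraph :=
  LinkDiagram.State.graph (L := L) fun _ => Resolution.vertex

namespace Coloring

variable {L : LinkDiagram} {X : Type u} [Biquandle X]

/-- The skein variable contributed by the crossing `c` when it is resolved as `r`. -/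
def weight (f : Coloring L X) (c : L.Cr) (r : Resolution) : SkeinPoly X :=
  let x := (f.labels c).1
  let y := (f.labels c).2
  if L.sign c = 1 then
    match r with
    | Resolution.oriented => SkeinPoly.A x y
    | Resolution.unoriented => SkeinPoly.B x y
    | Resolution.vertex => SkeinPoly.C x y
  else
    match r with
    | Resolution.oriented => SkeinPoly.D x y
    | Resolution.unoriented => SkeinPoly.E x y
    | Resolution.vertex => SkeinPoly.F x y

/-- The parity-biquandle bracket `[[L]](f)_j` (finite sum over all states). -/
def bracket (j : Version) (f : Coloring L X) : GraphModule j X :=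
  Submodule.Quotient.mk (∑ᶠ s : L.State,
    Finsupp.single (LinkDiagram.State.graph s).toClass
      (SkeinRing.mk j (∏ᶠ c : L.Cr, f.weight c (s c))))

/-- `a` expresses `[[L]](f)_j` as a linear combination of `j`-irreducible graphs, none of which is
the disjoint union of a circle and a non-empty graph. -/
def IsIrreducibleExpansion (j : Version) (f : Coloring L X)
    (a : GraphClass →₀ SkeinRing j X) : Prop :=
  Submodule.Quotient.mk a = f.bracket j ∧
    ∀ H : FramedGraph, a H.toClass ≠ 0 → H.Irreducible j ∧ H.IsReduced

/-- `G` is a leading term of `[[L]](f)_j`. -/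
def IsLeadingTerm (j : Version) (f : Coloring L X) (G : FramedGraph) : Prop :=
  ∃ a : GraphClass →₀ SkeinRing j X, f.IsIrreducibleExpansion j a ∧ a G.toClass ≠ 0 ∧
    ∀ H : FramedGraph, a H.toClass ≠ 0 → H.vertexNumber ≤ G.vertexNumber

end Coloring

end

/-! The theorem rests on two facts: the bracket is an invariant of coloured diagrams, and the
coefficient of an irreducible graph can be read off from an element of the module of graphs.

Graphs. Circles without vertices are first ignored (`SameCore`). Two decreasing moves applied to the
same graph can always be joined again (`GenMove.exists_join`): moves at disjoint vertices commute;
two bigons with a common vertex lead to the same graph; and if a loop and a bigon share a vertex,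
then removing the loop creates a loop at the other vertex of the bigon. By the Church–Rosser
property, graphs connected by moves have a common descendant, so an irreducible graph without
superfluous circles is determined by its class (`Related.homeo`). The discarded circles are
recovered by counting closed curves that go straight through all vertices: a decreasing move keeps
these curves and a new circle adds one. Hence the assignment of `δ ^ (c(H) - c(G))` to the graphs
`H` related to `G`, where `c` counts these curves, and of `0` to all other graphs, respects the
relations of the module. The resulting linear form picks out the coefficient of `G` in every
irreducible expansion (`GraphModule.linearCombination_coeffClass_eq`,
`GraphModule.linearCombination_coeffClass_of_forall`).

Invariance. A Reidemeister move happens in a window with one, two or three strands. Every state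
graph is glued from a tangle outside the window and a state of the strands inside. Which ends of the
strands are joined, and how they meet the vertices, is a finite computation valid for all outer
tangles; after grouping equal graphs, the coefficients are exactly generators of the ideal
(`strandsBracket_kink`, `strandsBracket_bigon`, `strandsBracket_triangle`). The biquandle axioms say
that the colours outside the window extend to the other side of the move. Only one third move is
computed, the one with all crossings positive and all sides directed alike. The others follow by
inserting a cancelling pair of crossings, which replaces a triangle by one with two reversed sides
and one changed sign (`SlideInvariant.flip`, `PlanarSlideInvariant.all`).

Conclusion. If `G` has a non-zero coefficient in the bracket of `L`, then every equivalent diagram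
`L'` carries a colouring with the same bracket, so some state of `L'` is related to `G`. That state
reduces to `G` by decreasing moves, so `L'` has at least as many crossings as `G` has vertices. If
`L` itself has exactly that many crossings, the state of `L` found in this way smooths no crossing
and its reduction only removes circles, so `G` is the shadow of `L` up to circles. Finally, a
decreasing move can be imitated by smoothing the removed vertices (`SmoothsTo.of_decreases`), which
turns the reduction of the state of `L'` into a further smoothing, that is, into another state. -/

noncomputable section

/-! ### Paths through 2-valent nodes, and a criterion for homeomorphism -/

namespace FramedGraph

/-- The half-edges at vertices. -/
def stops (G : FramedGraph) : Set G.Half := Set.range G.half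

/-- `G.Trace K h k`: leaving `h` along its edge and going straight through all nodes outside of `K`,
one arrives at `k`. -/
inductive Trace (G : FramedGraph) (K : Set G.Half) : G.Half → G.Half → Prop
  | edge (h : G.Half) : Trace G K h (G.edge h)
  | cons {h k : G.Half} : G.edge h ∉ K → Trace G K (G.opp (G.edge h)) k → Trace G K h k

variable {G : FramedGraph} {K : Set G.Half}

theorem edge_inj {h k : G.Half} : G.edge h = G.edge k ↔ h = k :=
  ⟨fun e => by rw [← G.edge_edge h, e, G.edge_edge], fun e => by rw [e]⟩

theorem opp_inj {h k : G.Half} : G.opp h = G.opp k ↔ h = k :=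
  ⟨fun e => by rw [← G.opp_opp h, e, G.opp_opp], fun e => by rw [e]⟩

theorem edge_eq_comm {h k : G.Half} : G.edge h = k ↔ h = G.edge k :=
  ⟨fun e => by rw [← e, G.edge_edge], fun e => by rw [e, G.edge_edge]⟩

theorem opp_mem_stops {h : G.Half} (hh : h ∈ G.stops) : G.opp h ∈ G.stops := by
  obtain ⟨⟨v, s, b⟩, rfl⟩ := hh
  exact ⟨(v, s, !b), (G.opp_half v s b).symm⟩

theorem Trace.snoc {h k : G.Half} (t : G.Trace K h k) (hk : k ∉ K) :
    G.Trace K h (G.edge (G.opp k)) := by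
  induction t with
  | edge h => exact .cons hk (.edge _)
  | cons h1 _ ih => exact .cons h1 (ih hk)

theorem Trace.symm (hK : ∀ h ∈ K, G.opp h ∈ K) {h k : G.Half} (t : G.Trace K h k) :
    G.Trace K k h := by
  induction t with
  | edge h => simpa [G.edge_edge] using Trace.edge (K := K) (G.edge h)
  | @cons h k h1 _ ih =>
    have : G.opp (G.edge h) ∉ K := fun h2 => h1 (by simpa [G.opp_opp] using hK _ h2)
    simpa [G.opp_opp, G.edge_edge] using ih.snoc this

theorem Trace.unique {h k k' : G.Half} (t : G.Trace K h k) (t' : G.Trace K h k') (hk : k ∈ K)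
    (hk' : k' ∈ K) : k = k' := by
  induction t with
  | edge h =>
    cases t' with
    | edge => rfl
    | cons h1 _ => exact absurd hk h1
  | cons h1 _ ih =>
    cases t' with
    | edge => exact absurd hk' h1
    | cons _ t'' => exact ih t'' hk

theorem Trace.mono {K' : Set G.Half} (hK : K' ⊆ K) {h k : G.Half} (t : G.Trace K h k) :
    G.Trace K' h k := by
  induction t with
  | edge h => exact .edge h
  | cons h1 _ ih => exact .cons (fun h2 => h1 (hK h2)) ih

theorem Trace.trans {h k l : G.Half} (t : G.Trace K h k) (hk : k ∉ K)
    (t' : G.Trace K (G.opp k) l) : G.Trace K h l := by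
  induction t with
  | edge h => exact .cons hk t'
  | cons h1 _ ih => exact .cons h1 (ih hk t')

/-- The step `x ↦ edge (opp x)` is injective on a finite set, so its orbits are cycles. The orbit of
`opp h` begins with `edge h` and comes back to `opp h`, which lies in `K`; therefore a path leaving
`h` cannot avoid `K` forever. -/
theorem exists_trace (hK : ∀ h ∈ K, G.opp h ∈ K) {h : G.Half} (hh : h ∈ K) :
    ∃ k ∈ K, G.Trace K h k := by
  by_contra hcon
  push Not at hcon
  have key : ∀ n, G.Trace K h ((fun x => G.edge (G.opp x))^[n] (G.edge h)) := by
    intro n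
    induction n with
    | zero => exact .edge h
    | succ n ih =>
      rw [Function.iterate_succ_apply']
      exact ih.snoc fun h1 => hcon _ h1 ih
  have hinj : Function.Injective fun x => G.edge (G.opp x) := fun x y e => by
    simpa [edge_inj, opp_inj] using e
  obtain ⟨n, hn, hper⟩ := Function.Injective.mem_periodicPts hinj (G.opp h)
  obtain ⟨m, rfl⟩ := Nat.exists_eq_succ_of_ne_zero (Nat.pos_iff_ne_zero.1 hn)
  have := key m
  have h2 : (fun x => G.edge (G.opp x))^[m] (G.edge h) = G.opp h := by
    have h3 : (fun x => G.edge (G.opp x))^[m + 1] (G.opp h) = G.opp h := hper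
    rw [Function.iterate_succ_apply] at h3
    simpa [G.opp_opp] using h3
  rw [h2] at this
  exact hcon _ (hK _ hh) this

theorem homeo_of_bijective {G G' : FramedGraph} (f : G.Half → G'.Half) (hf : Function.Bijective f)
    (g : G.Vert ≃ G'.Vert) (h_edge : ∀ h, f (G.edge h) = G'.edge (f h))
    (h_opp : ∀ h, f (G.opp h) = G'.opp (f h))
    (h_half : ∀ v i, ∃ i', f (G.half (v, i)) = G'.half (g v, i')) : Homeo G G' :=
  .rel _ _ (.iso G G' (Equiv.ofBijective f hf) g h_edge h_opp h_half)

theorem subdivide_edge_self (h : G.Half) : (G.subdivide h).edge (Sum.inl h) = Sum.inr false :=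
  if_pos rfl

theorem subdivide_edge_edge (h : G.Half) :
    (G.subdivide h).edge (Sum.inl (G.edge h)) = Sum.inr true :=
  (if_neg (G.edge_ne h)).trans (if_pos rfl)

theorem subdivide_edge_of_ne {h k : G.Half} (h1 : k ≠ h) (h2 : k ≠ G.edge h) :
    (G.subdivide h).edge (Sum.inl k) = Sum.inl (G.edge k) :=
  (if_neg h1).trans (if_neg h2)

section Unsub

variable (G) (h : G.Half) (hh : h ∉ G.stops) (hne : G.edge h ≠ G.opp h)

open Classical in
/-- Remove a 2-valent node (which is not the only node of a circle) and join its edges. -/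
def unsub : FramedGraph where
  Half := {x : G.Half // x ≠ h ∧ x ≠ G.opp h}
  Vert := G.Vert
  finite_half := inferInstance
  finite_vert := inferInstance
  edge x :=
    if h1 : G.edge x = h then
      ⟨G.edge (G.opp h), fun e => hne (by rw [edge_eq_comm.1 e]), G.edge_ne _⟩
    else if h2 : G.edge x = G.opp h then ⟨G.edge h, G.edge_ne _, hne⟩
    else ⟨G.edge x, h1, h2⟩
  edge_edge := by
    rintro ⟨x, h1, h2⟩
    by_cases e1 : G.edge x = h
    · have e1' := edge_eq_comm.1 e1
      simp [e1, G.edge_edge, G.opp_ne h, ← e1']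
    · by_cases e2 : G.edge x = G.opp h
      · have e2' := edge_eq_comm.1 e2
        simp [e2, G.edge_edge, G.opp_ne h, ← e2']
      · simp [e1, e2, G.edge_edge, h1, h2]
  edge_ne := by
    rintro ⟨x, h1, h2⟩
    by_cases e1 : G.edge x = h
    · have e1' := edge_eq_comm.1 e1
      simp only [e1, dite_true, ne_eq, Subtype.mk.injEq]
      exact fun e => G.opp_ne h (edge_inj.1 (e.trans e1'))
    · by_cases e2 : G.edge x = G.opp h
      · have e2' := edge_eq_comm.1 e2
        simp only [e2, G.opp_ne, dite_true, dite_false, ne_eq, Subtype.mk.injEq]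
        exact fun e => G.opp_ne h (edge_inj.1 (e.trans e2')).symm
      · simp [e1, e2, G.edge_ne]
  opp x := ⟨G.opp x, fun e => x.2.2 ((G.opp_opp x.1).symm.trans (congrArg G.opp e)), fun e => x.2.1 (opp_inj.1 e)⟩
  opp_opp := by rintro ⟨x, h1, h2⟩; simp [G.opp_opp]
  opp_ne := by rintro ⟨x, h1, h2⟩; simp [G.opp_ne]
  half :=
    { toFun := fun i => ⟨G.half i, fun e => hh ⟨i, e⟩,
        fun e => hh (by simpa [G.opp_opp] using opp_mem_stops (G := G) ⟨i, e⟩)⟩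
      inj' := fun i i' e => G.half.injective (congrArg Subtype.val e) }
  opp_half := fun v s b => Subtype.ext (G.opp_half v s b)

theorem unsub_edge_of_eq (x : (G.unsub h hh hne).Half) (z : G.Half) (hz : z = h ∨ z = G.opp h)
    (hx : G.edge x.1 = G.opp z) : ((G.unsub h hh hne).edge x).1 = G.edge z := by
  rcases hz with rfl | rfl
  · simp [unsub, hx, G.opp_ne]
  · simp [unsub, hx, G.opp_opp]

theorem unsub_edge_of_ne (x : (G.unsub h hh hne).Half) (h1 : G.edge x.1 ≠ h)
    (h2 : G.edge x.1 ≠ G.opp h) : ((G.unsub h hh hne).edge x).1 = G.edge x.1 := by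
  simp [unsub, h1, h2]

/-- Subdividing the merged edge again restores the removed node: the two new half-edges play the
roles of `h` and `opp h`. -/
theorem homeo_unsub : Homeo G (G.unsub h hh hne) := by
  have hx0 : G.edge h ≠ h ∧ G.edge h ≠ G.opp h := ⟨G.edge_ne h, hne⟩
  set x0 : (G.unsub h hh hne).Half := ⟨G.edge h, hx0⟩ with hx0_def
  have hx1 : ((G.unsub h hh hne).edge x0).1 = G.edge (G.opp h) :=
    unsub_edge_of_eq G h hh hne _ _ (Or.inr rfl) (by simp [hx0_def, G.edge_edge, G.opp_opp])
  let f : ((G.unsub h hh hne).subdivide x0).Half → G.Half :=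
    Sum.elim Subtype.val fun b => if b then G.opp h else h
  have hf : Function.Bijective f := by
    constructor
    · rintro (⟨x, h1, h2⟩ | b) (⟨y, h3, h4⟩ | b') e
      · exact congrArg Sum.inl (Subtype.ext e)
      · cases b'
        · exact absurd e h1
        · exact absurd e h2
      · cases b
        · exact absurd e.symm h3
        · exact absurd e.symm h4
      · cases b <;> cases b'
        · rfl
        · exact absurd e.symm (G.opp_ne h)
        · exact absurd e (G.opp_ne h)
        · rfl
    · intro x
      by_cases h1 : x = h
      · exact ⟨Sum.inr false, h1.symm⟩
      · by_cases h2 : x = G.opp h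
        · exact ⟨Sum.inr true, h2.symm⟩
        · exact ⟨Sum.inl ⟨x, h1, h2⟩, rfl⟩
  refine .symm _ _ (.trans _ _ _ (.rel _ _ (.subdivide _ x0))
    (homeo_of_bijective f hf (Equiv.refl _) ?_ ?_ fun v i => ⟨i, rfl⟩))
  · rintro (x | b)
    · by_cases h1 : x = x0
      · subst h1
        rw [subdivide_edge_self]
        exact (G.edge_edge h).symm
      · by_cases h2 : x = (G.unsub h hh hne).edge x0
        · subst h2
          rw [subdivide_edge_edge]
          change G.opp h = G.edge ((G.unsub h hh hne).edge x0).1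
          rw [hx1, G.edge_edge]
        · rw [subdivide_edge_of_ne h1 h2]
          refine unsub_edge_of_ne G h hh hne x (fun e => h1 (Subtype.ext (edge_eq_comm.1 e))) fun e => h2 (Subtype.ext ?_)
          rw [hx1, edge_eq_comm.1 e]
    · cases b
      · rfl
      · exact hx1
  · rintro (x | b)
    · rfl
    · cases b
      · rfl
      · exact (G.opp_opp h).symm

/-- A path may enter the removed node, where it has no counterpart in the smaller graph. The second
statement covers this for the induction: a path leaving the removed node is then continued from any
`w` whose edge led into that node. -/
theorem trace_unsub (hK : ∀ k ∈ K, k ≠ h ∧ k ≠ G.opp h) {x y : G.Half} (t : G.Trace K x y)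
    (hy : y ≠ h ∧ y ≠ G.opp h) :
    (∀ hx : x ≠ h ∧ x ≠ G.opp h, (G.unsub h hh hne).Trace (Subtype.val ⁻¹' K) ⟨x, hx⟩ ⟨y, hy⟩) ∧
    ((x = h ∨ x = G.opp h) → ∀ w : (G.unsub h hh hne).Half, G.edge w.1 = G.opp x →
      (G.unsub h hh hne).Trace (Subtype.val ⁻¹' K) w ⟨y, hy⟩) := by
  have key : ∀ (x : G.Half), (x = h ∨ x = G.opp h) → G.edge x ≠ h ∧ G.edge x ≠ G.opp h := by
    rintro x (rfl | rfl)
    · exact ⟨G.edge_ne _, hne⟩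
    · exact ⟨fun e => hne (by rw [edge_eq_comm.1 e]), G.edge_ne _⟩
  induction t with
  | edge x =>
    refine ⟨fun hx => ?_, fun hx w hw => ?_⟩
    · have := unsub_edge_of_ne G h hh hne ⟨x, hx⟩ hy.1 hy.2
      rw [show (⟨G.edge x, hy⟩ : (G.unsub h hh hne).Half) = _ from Subtype.ext this.symm]
      exact .edge _
    · have := unsub_edge_of_eq G h hh hne w x hx hw
      rw [show (⟨G.edge x, hy⟩ : (G.unsub h hh hne).Half) = _ from Subtype.ext this.symm]
      exact .edge _
  | @cons x y h1 _ ih =>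
    obtain ⟨ih1, ih2⟩ := ih hy
    refine ⟨fun hx => ?_, fun hx w hw => ?_⟩
    · by_cases hx' : G.edge x ≠ h ∧ G.edge x ≠ G.opp h
      · have : (G.unsub h hh hne).edge ⟨x, hx⟩ = ⟨G.edge x, hx'⟩ :=
          Subtype.ext (unsub_edge_of_ne G h hh hne ⟨x, hx⟩ hx'.1 hx'.2)
        refine .cons (by rw [this]; exact h1) ?_
        rw [this]
        exact ih1 _
      · refine ih2 ?_ _ (by simp [G.opp_opp])
        by_cases h3 : G.edge x = h
        · exact Or.inr (by rw [h3])
        · have : G.edge x = G.opp h := by tauto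
          exact Or.inl (by rw [this, G.opp_opp])
    · have : (G.unsub h hh hne).edge w = ⟨G.edge x, key x hx⟩ :=
        Subtype.ext (unsub_edge_of_eq G h hh hne w x hx hw)
      refine .cons (by rw [this]; exact h1) ?_
      rw [this]
      exact ih1 _

end Unsub

/-- A set of half-edges that contains all half-edges at vertices and meets all components. -/
structure IsFull (G : FramedGraph) (K : Set G.Half) : Prop where
  half_mem : ∀ i, G.half i ∈ K
  opp_mem : ∀ h ∈ K, G.opp h ∈ K
  reach : ∀ h, ∃ k ∈ K, G.Trace K h k

/-- Nodes outside of `K` are removed one after another. When none is left, a path between two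
half-edges of `K` is a single edge. -/
theorem IsFull.exists_prune (G : FramedGraph) (K : Set G.Half) (hK : G.IsFull K) :
    ∃ (G' : FramedGraph) (e : K ≃ G'.Half) (g : G.Vert ≃ G'.Vert), Homeo G G' ∧
      (∀ x : K, G'.opp (e x) = e ⟨G.opp x, hK.opp_mem _ x.2⟩) ∧
      (∀ v i, e ⟨G.half (v, i), hK.half_mem _⟩ = G'.half (g v, i)) ∧
      ∀ x y : K, G.Trace K x y → G'.edge (e x) = e y := by
  generalize hn : Nat.card G.Half = n
  induction n using Nat.strong_induction_on generalizing G with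
  | _ n ih =>
    by_cases hu : ∀ h, h ∈ K
    · refine ⟨G, Equiv.subtypeUnivEquiv hu, Equiv.refl _, .refl _, fun x => rfl, fun v i => rfl, ?_⟩
      rintro x ⟨y, hy⟩ t
      change G.edge x = y
      change G.Trace K x y at t
      cases t with
      | edge => rfl
      | cons h1 _ => exact absurd (hu _) h1
    · push Not at hu
      obtain ⟨h, hh⟩ := hu
      have hs : h ∉ G.stops := fun ⟨i, hi⟩ => hh (hi ▸ hK.half_mem i)
      have ho : G.opp h ∉ K := fun h1 => hh (by simpa [G.opp_opp] using hK.opp_mem _ h1)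
      -- The node is not alone on a circle: a path on such a circle would never leave the node,
      -- although every component meets `K`.
      have hne : G.edge h ≠ G.opp h := by
        intro e
        obtain ⟨k, hk, t⟩ := hK.reach h
        have : ∀ x y, G.Trace K x y → x = h → y = G.opp h := by
          intro x y t
          induction t with
          | edge x => rintro rfl; exact e
          | cons _ _ ih => rintro rfl; exact ih (by rw [e, G.opp_opp])
        exact ho (this _ _ t rfl ▸ hk)
      have hK' : ∀ k ∈ K, k ≠ h ∧ k ≠ G.opp h := fun k hk =>
        ⟨fun e => hh (e ▸ hk), fun e => ho (e ▸ hk)⟩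
      have hfull : (G.unsub h hs hne).IsFull (Subtype.val ⁻¹' K) :=
        { half_mem := fun i => hK.half_mem i
          opp_mem := fun x hx => hK.opp_mem _ hx
          reach := fun x => by
            obtain ⟨k, hk, t⟩ := hK.reach x.1
            exact ⟨⟨k, hK' k hk⟩, hk, (trace_unsub G h hs hne hK' t (hK' k hk)).1 x.2⟩ }
      have hlt : Nat.card (G.unsub h hs hne).Half < n := by
        rw [← hn]
        exact Finite.card_subtype_lt (x := h) (by simp)
      obtain ⟨G', e, g, h1, h2, h3, h4⟩ := ih _ hlt _ _ hfull rfl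
      let e0 : K ≃ (Subtype.val ⁻¹' K : Set (G.unsub h hs hne).Half) :=
        { toFun := fun x => ⟨⟨x.1, hK' _ x.2⟩, x.2⟩
          invFun := fun x => ⟨x.1.1, x.2⟩
          left_inv := fun x => rfl
          right_inv := fun x => rfl }
      exact ⟨G', e0.trans e, g, .trans _ _ _ (homeo_unsub G h hs hne) h1, fun x => h2 (e0 x),
        fun v i => h3 v i, fun x y t => h4 _ _ ((trace_unsub G h hs hne hK' t (hK' _ y.2)).1 _)⟩

/-- Graphs with corresponding vertices and corresponding traces between kept half-edges are
homeomorphic. -/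
theorem homeo_of_trace {G G' : FramedGraph} {K : Set G.Half} {K' : Set G'.Half} (hK : G.IsFull K)
    (hK' : G'.IsFull K') (e : K ≃ K') (g : G.Vert ≃ G'.Vert)
    (h_opp : ∀ x : K, (e ⟨G.opp x, hK.opp_mem _ x.2⟩ : G'.Half) = G'.opp (e x))
    (h_half : ∀ v i, ∃ i', (e ⟨G.half (v, i), hK.half_mem _⟩ : G'.Half) = G'.half (g v, i'))
    (h_trace : ∀ x : K, ∃ y : K, G.Trace K x y ∧ G'.Trace K' (e x) (e y)) : Homeo G G' := by
  obtain ⟨G₁, e₁, g₁, a1, a2, a3, a4⟩ := hK.exists_prune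
  obtain ⟨G₂, e₂, g₂, b1, b2, b3, b4⟩ := hK'.exists_prune
  refine .trans _ _ _ a1 (.trans _ _ _ (.rel _ _ (.iso G₁ G₂ (e₁.symm.trans (e.trans e₂))
    (g₁.symm.trans (g.trans g₂)) ?_ ?_ ?_)) (.symm _ _ b1))
  · intro x
    obtain ⟨x, rfl⟩ := e₁.surjective x
    obtain ⟨y, t, t'⟩ := h_trace x
    simp [a4 _ _ t, b4 _ _ t']
  · intro x
    obtain ⟨x, rfl⟩ := e₁.surjective x
    simp only [a2, Equiv.trans_apply, Equiv.symm_apply_apply, b2]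
    exact congrArg e₂ (Subtype.ext (h_opp x))
  · intro v i
    obtain ⟨v, rfl⟩ := g₁.surjective v
    obtain ⟨i', hi⟩ := h_half v i
    refine ⟨i', ?_⟩
    simp only [← a3, Equiv.trans_apply, Equiv.symm_apply_apply, ← b3]
    exact congrArg e₂ (Subtype.ext hi)

end FramedGraph
end

/-! ### Graphs up to circles, and transport of vertices and links -/

noncomputable section

namespace FramedGraph

/-- Homeomorphisms, and adding circles without vertices. -/
inductive CoreStep : FramedGraph → FramedGraph → Prop
  | homeo {G G' : FramedGraph} : HomeoStep G G' → CoreStep G G'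
  | circle (G : FramedGraph) : CoreStep G G.addCircle

/-- Two graphs become homeomorphic when circles without vertices are removed. -/
def SameCore (G G' : FramedGraph) : Prop := Relation.EqvGen CoreStep G G'

theorem SameCore.refl (G : FramedGraph) : SameCore G G := Relation.EqvGen.refl _

theorem SameCore.symm {G G' : FramedGraph} (h : SameCore G G') : SameCore G' G :=
  Relation.EqvGen.symm _ _ h

theorem SameCore.trans {G G' G'' : FramedGraph} (h : SameCore G G') (h' : SameCore G' G'') :
    SameCore G G'' := Relation.EqvGen.trans _ _ _ h h'

theorem Homeo.sameCore {G G' : FramedGraph} (h : Homeo G G') : SameCore G G' :=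
  Relation.EqvGen.mono (fun _ _ h => .homeo h) _ _ h

theorem sameCore_addCircle (G : FramedGraph) : SameCore G G.addCircle := .rel _ _ (.circle G)

variable {G G' : FramedGraph}

theorem half_mem_stops (G : FramedGraph) (i : G.Vert × Bool × Bool) : G.half i ∈ G.stops := ⟨i, rfl⟩

theorem stops_erase_subset (S : Set G.Vert) : (G.erase S).stops ⊆ G.stops := by
  rintro _ ⟨⟨v, i⟩, rfl⟩
  exact ⟨(v.1, i), rfl⟩

theorem half_mem_stops_erase {S : Set G.Vert} {v : G.Vert} {i : Bool × Bool} :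
    G.half (v, i) ∈ (G.erase S).stops ↔ v ∉ S := by
  constructor
  · rintro ⟨⟨w, i'⟩, hw⟩
    have : (w.1, i') = (v, i) := G.half.injective hw
    have h1 : w.1 = v := (Prod.ext_iff.1 this).1
    exact h1 ▸ w.2
  · exact fun h => ⟨(⟨v, h⟩, i), rfl⟩

theorem Trace.erase {K : Set G.Half} {h k : G.Half} (S : Set G.Vert) (t : G.Trace K h k) :
    (G.erase S).Trace K h k := by
  induction t with
  | edge h => exact Trace.edge (G := G.erase S) h
  | cons h1 _ ih => exact Trace.cons (G := G.erase S) h1 ih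

/-- `G.Link x y`: some path joins the half-edges `x` and `y` at vertices through 2-valent nodes. -/
def Link (G : FramedGraph) (x y : G.Vert × Bool × Bool) : Prop :=
  G.Trace G.stops (G.half x) (G.half y)

theorem Link.symm {x y : G.Vert × Bool × Bool} (h : G.Link x y) : G.Link y x :=
  Trace.symm (fun _ => opp_mem_stops) h

theorem Link.unique {x y z : G.Vert × Bool × Bool} (h : G.Link x y) (h' : G.Link x z) : y = z :=
  G.half.injective (Trace.unique h h' (G.half_mem_stops _) (G.half_mem_stops _))

theorem exists_link (G : FramedGraph) (x : G.Vert × Bool × Bool) : ∃ y, G.Link x y := by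
  obtain ⟨k, ⟨y, rfl⟩, t⟩ := exists_trace (fun _ => opp_mem_stops) (G.half_mem_stops x)
  exact ⟨y, t⟩

theorem Link.erase {S : Set G.Vert} {v w : G.Vert} {i k : Bool × Bool} (h : G.Link (v, i) (w, k))
    (hv : v ∉ S) (hw : w ∉ S) : (G.erase S).Link (⟨v, hv⟩, i) (⟨w, hw⟩, k) :=
  (Trace.erase S h).mono (stops_erase_subset S)

/-- A correspondence of vertices and half-edges at vertices that preserves links and is compatible
with removing vertices, up to `R`. -/
structure Match (R : FramedGraph → FramedGraph → Prop) (G G' : FramedGraph) where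
  vert : G.Vert ≃ G'.Vert
  half : G.Vert × Bool × Bool ≃ G'.Vert × Bool × Bool
  fst_half : ∀ x, (half x).1 = vert x.1
  opp_half : ∀ v s b, (half (v, s, !b)).2 = ((half (v, s, b)).2.1, !(half (v, s, b)).2.2)
  link : ∀ {x y}, G.Link x y → G'.Link (half x) (half y)
  erase : ∀ S : Set G.Vert, R (G.erase S) (G'.erase (vert '' S))

namespace Match

variable {R : FramedGraph → FramedGraph → Prop}

/-- Opposite half-edges go to opposite half-edges by assumption. If both pairs at `v` went to the
same pair, the map would not be injective, so the two pairs stay distinct. -/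
theorem exists_half (m : Match R G G') (v : G.Vert) (s b : Bool) : ∃ s' b' c',
    m.half (v, s, b) = (m.vert v, s', b') ∧ m.half (v, s, !b) = (m.vert v, s', !b') ∧
    m.half (v, !s, b) = (m.vert v, !s', c') ∧ m.half (v, !s, !b) = (m.vert v, !s', !c') := by
  obtain ⟨s', b', e⟩ : ∃ s' b', m.half (v, s, b) = (m.vert v, s', b') :=
    ⟨_, _, Prod.ext (m.fst_half _) rfl⟩
  obtain ⟨t', c', e'⟩ : ∃ s' b', m.half (v, !s, b) = (m.vert v, s', b') :=
    ⟨_, _, Prod.ext (m.fst_half _) rfl⟩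
  have h1 : m.half (v, s, !b) = (m.vert v, s', !b') := Prod.ext (m.fst_half _) (by rw [m.opp_half, e])
  have h2 : m.half (v, !s, !b) = (m.vert v, t', !c') :=
    Prod.ext (m.fst_half _) (by rw [m.opp_half, e'])
  have ht : t' = !s' := by
    by_contra hne
    have hts : t' = s' := by revert hne; cases t' <;> cases s' <;> simp
    subst hts
    by_cases hb : b' = c'
    · subst hb
      have := m.half.injective (e.trans e'.symm)
      simp at this
    · have hb : c' = !b' := by revert hb; cases b' <;> cases c' <;> simp
      subst hb
      have := m.half.injective (h1.trans e'.symm)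
      simp at this
  subst ht
  exact ⟨s', b', c', e, h1, e', h2⟩

/-- Each half-edge at a vertex is linked to exactly one other, so a bijection preserving links also
reflects them. -/
theorem link_iff (m : Match R G G') {x y : G.Vert × Bool × Bool} :
    G'.Link (m.half x) (m.half y) ↔ G.Link x y := by
  refine ⟨fun h => ?_, m.link⟩
  obtain ⟨z, hz⟩ := G.exists_link x
  rwa [m.half.injective (h.unique (m.link hz))]

/-- The identity correspondence. -/
def refl (hR : Equivalence R) (G : FramedGraph) : Match R G G where
  vert := Equiv.refl _
  half := Equiv.refl _
  fst_half _ := rfl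
  opp_half _ _ _ := rfl
  link h := h
  erase S := by simpa using hR.refl _

/-- The inverse correspondence. -/
def symm (hR : Equivalence R) (m : Match R G G') : Match R G' G where
  vert := m.vert.symm
  half := m.half.symm
  fst_half x := by
    rw [Equiv.eq_symm_apply, ← m.fst_half, Equiv.apply_symm_apply]
  opp_half v s b := by
    obtain ⟨⟨v, s, b⟩, e⟩ := m.half.surjective (v, s, b)
    obtain ⟨s', b', c', h1, h2, -⟩ := m.exists_half v s b
    have h3 := e.symm.trans h1
    simp only [Prod.mk.injEq] at h3
    obtain ⟨rfl, rfl, rfl⟩ := h3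
    rw [← h1, ← h2]
    simp
  link {x y} h := by
    obtain ⟨x, rfl⟩ := m.half.surjective x
    obtain ⟨y, rfl⟩ := m.half.surjective y
    simpa [m.link_iff] using h
  erase S := by
    have := hR.symm (m.erase (m.vert.symm '' S))
    rwa [← Set.image_comp, m.vert.self_comp_symm, Set.image_id] at this

/-- The composition of two correspondences. -/
def trans (hR : Equivalence R) {G'' : FramedGraph} (m : Match R G G') (m' : Match R G' G'') :
    Match R G G'' where
  vert := m.vert.trans m'.vert
  half := m.half.trans m'.half
  fst_half x := by simp [m.fst_half, m'.fst_half]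
  opp_half v s b := by
    obtain ⟨s', b', c', h1, h2, -⟩ := m.exists_half v s b
    simp [h1, h2, m'.opp_half]
  link h := m'.link (m.link h)
  erase S := by
    have := hR.trans (m.erase S) (m'.erase _)
    rwa [← Set.image_comp] at this

end Match

/-- Used for isomorphisms, subdivisions and added circles alike: edges only have to become paths,
and `h_stops` ensures that no path is interrupted by a vertex that was not there before. -/
theorem exists_match_of_map {R : FramedGraph → FramedGraph → Prop} (f : G.Half → G'.Half) (hf : Function.Injective f) (g : G.Vert ≃ G'.Vert)
    (h_edge : ∀ h, G'.Trace G'.stops (f h) (f (G.edge h))) (h_opp : ∀ h, f (G.opp h) = G'.opp (f h))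
    (h_half : ∀ v i, ∃ i', f (G.half (v, i)) = G'.half (g v, i'))
    (h_stops : ∀ h, f h ∈ G'.stops → h ∈ G.stops)
    (h_erase : ∀ S : Set G.Vert, R (G.erase S) (G'.erase (g '' S))) :
    Nonempty (Match R G G') := by
  choose i hi using h_half
  let F : G.Vert × Bool × Bool → G'.Vert × Bool × Bool := fun x => (g x.1, i x.1 x.2)
  have hF : ∀ x, f (G.half x) = G'.half (F x) := fun x => hi x.1 x.2
  have hinj : Function.Injective F := fun x y e => by
    apply G.half.injective
    apply hf
    rw [hF, hF, e]
  have hbij : Function.Bijective F := by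
    -- There are equally many vertices, hence equally many half-edges at vertices, and injectivity
    -- suffices.
    refine hinj.bijective_of_nat_card_le (Nat.card_congr ?_).le
    exact Equiv.prodCongr g.symm (Equiv.refl _)
  refine ⟨⟨g, Equiv.ofBijective F hbij, fun _ => rfl, fun v s b => ?_, fun {x y} h => ?_, h_erase⟩⟩
  · have h1 : G'.half (F (v, s, !b)) = G'.half ((F (v, s, b)).1, (F (v, s, b)).2.1, !(F (v, s, b)).2.2) := by
      rw [← G'.opp_half, ← hF, ← G.opp_half, h_opp, hF]
    exact congrArg Prod.snd (G'.half.injective h1)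
  · have key : ∀ h k, G.Trace G.stops h k → G'.Trace G'.stops (f h) (f k) := by
      intro h k t
      induction t with
      | edge h => exact h_edge h
      | @cons h k h1 _ ih =>
        refine (h_edge h).trans (fun h2 => h1 (h_stops _ h2)) ?_
        rwa [← h_opp]
    change G'.Trace _ (G'.half (F x)) (G'.half (F y))
    rw [← hF, ← hF]
    exact key _ _ h

theorem HomeoStep.exists_match (h : HomeoStep G G') : Nonempty (Match Homeo G G') := by
  cases h with
  | iso _ e g edge_eq opp_eq half_eq =>
    refine exists_match_of_map e e.injective g (fun h => ?_) opp_eq half_eq ?_ ?_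
    · rw [edge_eq]
      exact .edge _
    · intro h hh
      obtain ⟨⟨v', i'⟩, hx⟩ := hh
      obtain ⟨v, rfl⟩ := g.surjective v'
      have hinj : Function.Injective fun i => e (G.half (v, i)) := fun a b e' => by simpa using e'
      choose i hi using half_eq v
      have hi_inj : Function.Injective i := fun a b e' => hinj (by simp [hi, e'])
      obtain ⟨a, rfl⟩ := (Finite.injective_iff_surjective.1 hi_inj) i'
      rw [← hi] at hx
      exact ⟨_, e.injective hx⟩
    · intro S
      refine (.rel _ _ (.iso _ _ e (g.subtypeEquiv fun v => by simp) edge_eq opp_eq ?_))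
      intro v i
      exact half_eq v.1 i
  | subdivide h =>
    refine exists_match_of_map (G' := G.subdivide h) Sum.inl Sum.inl_injective (Equiv.refl _)
      (fun k => ?_) (fun _ => rfl) (fun v i => ⟨i, rfl⟩) ?_ ?_
    · by_cases h1 : k = h
      · subst h1
        have h2 : (G.subdivide k).edge (Sum.inl k) = Sum.inr false := subdivide_edge_self k
        refine .cons ?_ ?_
        · rw [h2]
          rintro ⟨x, hx⟩
          cases hx
        · rw [h2]
          exact Trace.edge (G := G.subdivide k) (Sum.inr true)
      · by_cases h2 : k = G.edge h
        · subst h2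
          have h2 : (G.subdivide h).edge (Sum.inl (G.edge h)) = Sum.inr true := subdivide_edge_edge h
          refine .cons ?_ ?_
          · rw [h2]
            rintro ⟨x, hx⟩
            cases hx
          · rw [h2, G.edge_edge]
            exact Trace.edge (G := G.subdivide h) (Sum.inr false)
        · rw [← subdivide_edge_of_ne h1 h2]
          exact .edge _
    · rintro k ⟨x, hx⟩
      exact ⟨x, Sum.inl_injective hx⟩
    · intro S
      refine Eq.subst (motive := fun T => Homeo (G.erase S) ((G.subdivide h).erase T))
        (Set.image_id S).symm ?_
      exact (.rel _ _ (.subdivide (G.erase S) h))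

theorem Homeo.exists_match (h : Homeo G G') : Nonempty (Match Homeo G G') := by
  induction h with
  | rel _ _ h => exact h.exists_match
  | refl G => exact ⟨.refl (Relation.EqvGen.is_equivalence _) G⟩
  | symm _ _ _ ih => exact ⟨ih.some.symm (Relation.EqvGen.is_equivalence _)⟩
  | trans _ _ _ _ _ ih ih' => exact ⟨ih.some.trans (Relation.EqvGen.is_equivalence _) ih'.some⟩

/-- Makes loops and bigons meaningful for classes of graphs: a move seen in one representative can
be carried out in any other, with the same result up to circles. -/
theorem SameCore.exists_match (h : SameCore G G') : Nonempty (Match SameCore G G') := by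
  induction h with
  | rel G G' h =>
    cases h with
    | homeo h =>
      obtain ⟨m⟩ := h.exists_match
      exact ⟨⟨m.vert, m.half, m.fst_half, m.opp_half, m.link, fun S => (m.erase S).sameCore⟩⟩
    | circle =>
      refine exists_match_of_map (G := G) (G' := G.addCircle) Sum.inl Sum.inl_injective (Equiv.refl _)
        (fun k => .edge (G := G.addCircle) (Sum.inl k)) (fun _ => rfl) (fun v i => ⟨i, rfl⟩) ?_ ?_
      · rintro k ⟨x, hx⟩
        exact ⟨x, Sum.inl_injective hx⟩
      · intro S
        refine Eq.subst (motive := fun T => SameCore (G.erase S) (G.addCircle.erase T))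
          (Set.image_id S).symm ?_
        exact sameCore_addCircle (G.erase S)
  | refl G => exact ⟨.refl (Relation.EqvGen.is_equivalence _) G⟩
  | symm _ _ _ ih => exact ⟨ih.some.symm (Relation.EqvGen.is_equivalence _)⟩
  | trans _ _ _ _ _ ih ih' => exact ⟨ih.some.trans (Relation.EqvGen.is_equivalence _) ih'.some⟩

section DelCircle

variable (G) (h : G.Half) (hh : h ∉ G.stops) (he : G.edge h = G.opp h)

/-- Remove a circle with one node. -/
def delCircle : FramedGraph where
  Half := {x : G.Half // x ≠ h ∧ x ≠ G.opp h}
  Vert := G.Vert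
  finite_half := inferInstance
  finite_vert := inferInstance
  edge x := ⟨G.edge x, fun e => x.2.2 ((edge_eq_comm.1 e).trans he),
    fun e => x.2.1 (edge_inj.1 (e.trans he.symm))⟩
  edge_edge := by rintro ⟨x, h1, h2⟩; simp [G.edge_edge]
  edge_ne := by rintro ⟨x, h1, h2⟩; simp [G.edge_ne]
  opp x := ⟨G.opp x, fun e => x.2.2 ((G.opp_opp x.1).symm.trans (congrArg G.opp e)),
    fun e => x.2.1 (opp_inj.1 e)⟩
  opp_opp := by rintro ⟨x, h1, h2⟩; simp [G.opp_opp]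
  opp_ne := by rintro ⟨x, h1, h2⟩; simp [G.opp_ne]
  half :=
    { toFun := fun i => ⟨G.half i, fun e => hh ⟨i, e⟩,
        fun e => hh (by simpa [G.opp_opp] using opp_mem_stops (G := G) ⟨i, e⟩)⟩
      inj' := fun i i' e => G.half.injective (congrArg Subtype.val e) }
  opp_half := fun v s b => Subtype.ext (G.opp_half v s b)

theorem homeo_delCircle : Homeo G (G.delCircle h hh he).addCircle := by
  refine .symm _ _ (homeo_of_bijective (G := (G.delCircle h hh he).addCircle)
    (Sum.elim Subtype.val fun b => if b then G.opp h else h) ⟨?_, ?_⟩ (Equiv.refl _) ?_ ?_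
      fun v i => ⟨i, rfl⟩)
  · rintro (⟨x, h1, h2⟩ | b) (⟨y, h3, h4⟩ | b') e
    · exact congrArg Sum.inl (Subtype.ext e)
    · cases b'
      · exact absurd e h1
      · exact absurd e h2
    · cases b
      · exact absurd e.symm h3
      · exact absurd e.symm h4
    · cases b <;> cases b'
      · rfl
      · exact absurd e.symm (G.opp_ne h)
      · exact absurd e (G.opp_ne h)
      · rfl
  · intro x
    by_cases h1 : x = h
    · exact ⟨Sum.inr false, h1.symm⟩
    · by_cases h2 : x = G.opp h
      · exact ⟨Sum.inr true, h2.symm⟩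
      · exact ⟨Sum.inl ⟨x, h1, h2⟩, rfl⟩
  · rintro (x | b)
    · rfl
    · cases b
      · exact he.symm
      · exact edge_eq_comm.1 he
  · rintro (x | b)
    · rfl
    · cases b
      · rfl
      · exact (G.opp_opp h).symm

end DelCircle

theorem card_half_unsub_lt (h : G.Half) (hh : h ∉ G.stops) (hne : G.edge h ≠ G.opp h) :
    Nat.card (G.unsub h hh hne).Half < Nat.card G.Half :=
  Finite.card_subtype_lt (x := h) (by simp)

theorem card_half_delCircle_lt (h : G.Half) (hh : h ∉ G.stops) (he : G.edge h = G.opp h) :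
    Nat.card (G.delCircle h hh he).Half < Nat.card G.Half :=
  Finite.card_subtype_lt (x := h) (by simp)

/-- Every graph is homeomorphic to one with 2-valent nodes only on circles with one node. -/
theorem exists_homeo_tight (G : FramedGraph) :
    ∃ G', Homeo G G' ∧ ∀ h, h ∉ G'.stops → G'.edge h = G'.opp h := by
  generalize hn : Nat.card G.Half = n
  induction n using Nat.strong_induction_on generalizing G with
  | _ n ih =>
    by_cases hG : ∀ h, h ∉ G.stops → G.edge h = G.opp h
    · exact ⟨G, .refl _, hG⟩
    · push Not at hG
      obtain ⟨h, hh, hne⟩ := hG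
      obtain ⟨G', h1, h2⟩ := ih _ (hn ▸ card_half_unsub_lt h hh hne) _ rfl
      exact ⟨G', .trans _ _ _ (homeo_unsub G h hh hne) h1, h2⟩

/-- Up to circles all 2-valent nodes can be discarded: nodes with neighbours are merged into edges,
and the remaining ones are circles with a single node. In such a graph links are edges. -/
theorem exists_sameCore_stops (G : FramedGraph) : ∃ G', SameCore G G' ∧ ∀ h, h ∈ G'.stops := by
  obtain ⟨G, h0, hG⟩ := G.exists_homeo_tight
  suffices ∃ G', SameCore G G' ∧ ∀ h, h ∈ G'.stops by
    obtain ⟨G', h1, h2⟩ := this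
    exact ⟨G', h0.sameCore.trans h1, h2⟩
  clear h0
  generalize hn : Nat.card G.Half = n
  induction n using Nat.strong_induction_on generalizing G with
  | _ n ih =>
    by_cases hG' : ∀ h, h ∈ G.stops
    · exact ⟨G, .refl _, hG'⟩
    · push Not at hG'
      obtain ⟨h, hh⟩ := hG'
      obtain ⟨G', h1, h2⟩ := ih _ (hn ▸ card_half_delCircle_lt h hh (hG h hh)) _ (fun x hx => by
        refine Subtype.ext (hG x.1 ?_)
        rintro ⟨i, hi⟩
        exact hx ⟨i, Subtype.ext hi⟩) rfl
      exact ⟨G', (homeo_delCircle G h hh _).sameCore.trans ((sameCore_addCircle _).symm.trans h1), h2⟩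

end FramedGraph
end

/-! ### Loops and bigons seen through 2-valent nodes, and the exchange of the two vertices of a
bigon -/

noncomputable section

namespace FramedGraph

variable {G G' : FramedGraph}

/-- Some path joins two non-opposite half-edges at `v`. -/
def GenLoop (G : FramedGraph) (v : G.Vert) : Prop :=
  ∃ s b b', G.Link (v, s, b) (v, !s, b')

/-- Two paths join `v` and `w`, and they are not opposite at `v` and not opposite at `w`. -/
def GenBigon (G : FramedGraph) (v w : G.Vert) : Prop :=
  v ≠ w ∧ ∃ s s' b b' d d', G.Link (v, s, b) (w, s', b') ∧ G.Link (v, !s, d) (w, !s', d')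

theorem GenBigon.symm {v w : G.Vert} (h : G.GenBigon v w) : G.GenBigon w v := by
  obtain ⟨hne, s, s', b, b', d, d', h1, h2⟩ := h
  exact ⟨hne.symm, s', s, b', b, d', d, h1.symm, h2.symm⟩

/-- `S` is the set of vertices removed by a decreasing move (up to 2-valent nodes). -/
inductive GenMove (G : FramedGraph) : Version → Set G.Vert → Prop
  | loop (v : G.Vert) (h : G.GenLoop v) : GenMove G Version.two {v}
  | bigon (j : Version) (v w : G.Vert) (h : G.GenBigon v w) : GenMove G j {v, w}

theorem Decreases.exists_genMove {j : Version} (h : Decreases j G G') :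
    ∃ S, G.GenMove j S ∧ G' = G.erase S := by
  cases h with
  | first _ v h =>
    obtain ⟨b, b', e⟩ := h
    refine ⟨{v}, .loop v ⟨false, b, b', ?_⟩, rfl⟩
    change G.Trace _ _ (G.half (v, true, b'))
    rw [← e]
    exact .edge _
  | second _ _ v w h =>
    obtain ⟨hne, s, b, b', d, d', e, e'⟩ := h
    refine ⟨{v, w}, .bigon j v w ⟨hne, false, s, b, b', d, d', ?_, ?_⟩, rfl⟩
    · change G.Trace _ _ (G.half (w, s, b'))
      rw [← e]
      exact .edge _
    · change G.Trace _ _ (G.half (w, !s, d'))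
      rw [← e']
      exact .edge _

theorem GenLoop.map {R : FramedGraph → FramedGraph → Prop} (m : Match R G G') {v : G.Vert} (h : G.GenLoop v) : G'.GenLoop (m.vert v) := by
  obtain ⟨s, b, b', h⟩ := h
  obtain ⟨s', c, c', h1, -, h2, h3⟩ := m.exists_half v s b
  have h4 := m.link h
  rw [h1] at h4
  by_cases hb : b' = b
  · rw [hb, h2] at h4
    exact ⟨_, _, _, h4⟩
  · rw [show b' = !b by cases b <;> cases b' <;> simp_all, h3] at h4
    exact ⟨_, _, _, h4⟩

theorem GenBigon.map {R : FramedGraph → FramedGraph → Prop} (m : Match R G G') {v w : G.Vert} (h : G.GenBigon v w) :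
    G'.GenBigon (m.vert v) (m.vert w) := by
  obtain ⟨hne, s, s', b, b', d, d', h, h'⟩ := h
  refine ⟨fun e => hne (m.vert.injective e), ?_⟩
  have key : ∀ v s b d, ∃ t c e, m.half (v, s, b) = (m.vert v, t, c) ∧
      m.half (v, !s, d) = (m.vert v, !t, e) := by
    intro v s b d
    obtain ⟨s', c, c', h1, -, h2, h3⟩ := m.exists_half v s b
    by_cases hb : d = b
    · exact ⟨_, _, _, h1, hb ▸ h2⟩
    · rw [show d = !b by cases b <;> cases d <;> simp_all]
      exact ⟨_, _, _, h1, h3⟩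
  obtain ⟨t, c, e, h1, h2⟩ := key v s b d
  obtain ⟨t', c', e', h3, h4⟩ := key w s' b' d'
  have h5 := m.link h
  have h6 := m.link h'
  rw [h1, h3] at h5
  rw [h2, h4] at h6
  exact ⟨_, _, _, _, _, _, h5, h6⟩

theorem GenMove.map {R : FramedGraph → FramedGraph → Prop} (m : Match R G G') {j : Version} {S : Set G.Vert} (h : G.GenMove j S) :
    G'.GenMove j (m.vert '' S) := by
  cases h with
  | loop v h => simpa using GenMove.loop _ (h.map m)
  | bigon _ v w h => simpa [Set.image_pair] using GenMove.bigon j _ _ (h.map m)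

/-- Erasing other vertices only lengthens paths, so a loop or bigon that does not meet `S` survives.
This is why disjoint moves commute. -/
theorem GenMove.erase {j : Version} {S T : Set G.Vert} (h : G.GenMove j T) (hST : ∀ v ∈ T, v ∉ S) :
    (G.erase S).GenMove j (Subtype.val ⁻¹' T) := by
  cases h with
  | loop v h =>
    obtain ⟨s, b, b', h⟩ := h
    have hv : v ∉ S := hST _ rfl
    have e : (Subtype.val ⁻¹' {v} : Set {v // v ∉ S}) = {⟨v, hv⟩} := by
      ext x
      simp [Subtype.ext_iff]
    refine Eq.subst (motive := fun U => (G.erase S).GenMove _ U) e.symm ?_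
    exact .loop (G := G.erase S) ⟨v, hv⟩ ⟨s, b, b', h.erase hv hv⟩
  | bigon _ v w h =>
    obtain ⟨hne, s, s', b, b', d, d', h, h'⟩ := h
    have hv : v ∉ S := hST _ (by simp)
    have hw : w ∉ S := hST _ (by simp)
    have e : (Subtype.val ⁻¹' {v, w} : Set {v // v ∉ S}) = {⟨v, hv⟩, ⟨w, hw⟩} := by
      ext x
      simp [Subtype.ext_iff]
    refine Eq.subst (motive := fun U => (G.erase S).GenMove _ U) e.symm ?_
    exact .bigon (G := G.erase S) j ⟨v, hv⟩ ⟨w, hw⟩ ⟨fun e => hne (congrArg Subtype.val e),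
      s, s', b, b', d, d', h.erase hv hw, h'.erase hv hw⟩

theorem sameCore_erase_erase {S T : Set G.Vert} {S' : Set (G.erase S).Vert}
    (hT : ∀ v, v ∈ T ↔ v ∈ S ∨ ∃ h : v ∉ S, (⟨v, h⟩ : {v // v ∉ S}) ∈ S') :
    SameCore ((G.erase S).erase S') (G.erase T) := by
  refine Homeo.sameCore (.rel _ _ (.iso ((G.erase S).erase S') (G.erase T) (Equiv.refl G.Half)
    { toFun := fun v => ⟨v.1.1, fun h => ?_⟩
      invFun := fun v => ⟨⟨v.1, fun h => ?_⟩, fun h => ?_⟩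
      left_inv := fun v => rfl
      right_inv := fun v => rfl } (fun h => rfl) (fun h => rfl) fun v i => ⟨i, rfl⟩))
  · rcases (hT _).1 h with h1 | ⟨h1, h2⟩
    · exact v.1.2 h1
    · exact v.2 h2
  · exact v.2 ((hT _).2 (Or.inl h))
  · exact v.2 ((hT _).2 (Or.inr ⟨_, h⟩))

section Slide

variable {α : Type*} {E O : α → α} {T T' : α → α → Prop} {π : α → α} {a a' c c' p p' q q' : α}

/-- The setting is a bigon: `a, a'` and `c, c'` are the strands at one vertex, `p, p'` and `q, q'`
those at the other, and edges join `a` to `p` and `c` to `q`. `T` are paths when the first vertex is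
erased, `T'` when the second is. The half-edge `p` leads through the erased vertex to where `a'`
leads, so `π` sends `p` to `a'`, and likewise `p'` to `a`. The cases concern paths that return to
the bigon at once. -/
theorem slide_aux (hE : ∀ x, E (E x) = x) (hE' : ∀ x, E x ≠ x) (t1 : ∀ x, T x (E x))
    (t2 : ∀ x y, E x = a ∨ E x = a' ∨ E x = c ∨ E x = c' → T (O (E x)) y → T x y)
    (t1' : ∀ x, T' x (E x))
    (t2' : ∀ x y, E x = p ∨ E x = p' ∨ E x = q ∨ E x = q' → T' (O (E x)) y → T' x y)
    (oa : O a = a') (oa' : O a' = a) (oc' : O c' = c) (op : O p = p')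
    (op' : O p' = p) (oq' : O q' = q) (ea : E a = p) (ec : E c = q)
    (πp : π p = a') (πp' : π p' = a) (πq : π q = c') (πq' : π q' = c)
    (π_ne : ∀ x, x ≠ p → x ≠ p' → x ≠ q → x ≠ q' → x ≠ a → x ≠ a' → x ≠ c → x ≠ c' → π x = x)
    (hnd : [a, a', c, c', p, p', q, q'].Nodup) {x : α} (hx : x = p ∨ x = p') :
    ∃ y, (y ≠ a ∧ y ≠ a' ∧ y ≠ c ∧ y ≠ c') ∧ T x y ∧ T' (π x) (π y) := by
  simp only [List.nodup_cons, List.mem_cons, List.not_mem_nil, not_or, or_false] at hnd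
  obtain ⟨⟨n1, n2, n3, n4, n5, n6, n7⟩, ⟨n8, n9, n10, n11, n12, n13⟩, ⟨n14, n15, n16, n17, n18⟩,
    ⟨n19, n20, n21, n22⟩, ⟨n23, n24, n25⟩, ⟨n26, n27⟩, n28, -⟩ := hnd
  have ep : E p = a := by rw [← ea, hE]
  have eq : E q = c := by rw [← ec, hE]
  rcases hx with rfl | rfl
  · have ht : ∀ y, T a' y → T x y := fun y hy => t2 _ _ (by simp [ep]) (by rwa [ep, oa])
    rw [πp]
    by_cases h1 : E a' = c'
    · refine ⟨q, by grind, ht _ (t2 _ _ (by simp [h1]) ?_), ?_⟩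
      · rw [h1, oc', ← ec]
        exact t1 _
      · rw [πq, ← h1]
        exact t1' _
    · refine ⟨E a', by grind, ht _ (t1 _), ?_⟩
      by_cases h2 : E a' = p'
      · refine t2' _ _ (by simp [h2]) ?_
        rw [h2, op', πp', ← ep]
        exact t1' _
      · by_cases h3 : E a' = q'
        · refine t2' _ _ (by simp [h3]) ?_
          rw [h3, oq', πq', ← eq]
          exact t1' _
        · rw [π_ne _ (by grind) h2 (by grind) h3 (by grind) (by grind) (by grind) h1]
          exact t1' _
  · have ht : ∀ y, T' x y → T' a y := fun y hy => t2' _ _ (by simp [ea]) (by rwa [ea, op])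
    rw [πp']
    by_cases h0 : E x = a'
    · refine ⟨p, by grind, t2 _ _ (by simp [h0]) ?_, ht _ ?_⟩
      · rw [h0, oa', ← ea]
        exact t1 _
      · rw [πp, ← h0]
        exact t1' _
    by_cases h1 : E x = c'
    · refine ⟨q, by grind, t2 _ _ (by simp [h1]) ?_, ht _ ?_⟩
      · rw [h1, oc', ← ec]
        exact t1 _
      · rw [πq, ← h1]
        exact t1' _
    · refine ⟨E x, by grind, t1 _, ht _ ?_⟩
      by_cases h3 : E x = q'
      · refine t2' _ _ (by simp [h3]) ?_
        rw [h3, oq', πq', ← eq]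
        exact t1' _
      · rw [π_ne _ (by grind) (hE' x) (by grind) h3 (by grind) (by grind) (by grind) h1]
        exact t1' _

/-- The situation is symmetric under exchange of the two strands, so `slide_aux` settles starting
points on either of them; all other starting points are fixed by `π`. -/
theorem slide_exists_trace (hE : ∀ x, E (E x) = x) (hE' : ∀ x, E x ≠ x) (t1 : ∀ x, T x (E x))
    (t2 : ∀ x y, E x = a ∨ E x = a' ∨ E x = c ∨ E x = c' → T (O (E x)) y → T x y)
    (t1' : ∀ x, T' x (E x))
    (t2' : ∀ x y, E x = p ∨ E x = p' ∨ E x = q ∨ E x = q' → T' (O (E x)) y → T' x y)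
    (oa : O a = a') (oa' : O a' = a) (oc : O c = c') (oc' : O c' = c) (op : O p = p')
    (op' : O p' = p) (oq : O q = q') (oq' : O q' = q) (ea : E a = p) (ec : E c = q)
    (πp : π p = a') (πp' : π p' = a) (πq : π q = c') (πq' : π q' = c)
    (π_ne : ∀ x, x ≠ p → x ≠ p' → x ≠ q → x ≠ q' → x ≠ a → x ≠ a' → x ≠ c → x ≠ c' → π x = x)
    (hnd : [a, a', c, c', p, p', q, q'].Nodup) {x : α} (hx : x ≠ a ∧ x ≠ a' ∧ x ≠ c ∧ x ≠ c') :
    ∃ y, (y ≠ a ∧ y ≠ a' ∧ y ≠ c ∧ y ≠ c') ∧ T x y ∧ T' (π x) (π y) := by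
  by_cases hxp : x = p ∨ x = p'
  · exact slide_aux hE hE' t1 t2 t1' t2' oa oa' oc' op op' oq' ea ec πp πp' πq πq' π_ne hnd hxp
  by_cases hxq : x = q ∨ x = q'
  · obtain ⟨y, ⟨h1, h2, h3, h4⟩, h⟩ := slide_aux (π := π) hE hE' t1 (fun x y h => t2 x y (by tauto)) t1'
      (fun x y h => t2' x y (by tauto)) oc oc' oa' oq oq' op' ec ea πq πq' πp πp'
      (fun x h1 h2 h3 h4 h5 h6 h7 h8 => π_ne x h3 h4 h1 h2 h7 h8 h5 h6)
      (by simp only [List.nodup_cons, List.mem_cons, List.not_mem_nil, not_or, or_false] at hnd ⊢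
          grind) hxq
    exact ⟨y, ⟨h3, h4, h1, h2⟩, h⟩
  simp only [List.nodup_cons, List.mem_cons, List.not_mem_nil, not_or, or_false] at hnd
  obtain ⟨⟨n1, n2, n3, n4, n5, n6, n7⟩, ⟨n8, n9, n10, n11, n12, n13⟩, ⟨n14, n15, n16, n17, n18⟩,
    ⟨n19, n20, n21, n22⟩, ⟨n23, n24, n25⟩, ⟨n26, n27⟩, n28, -⟩ := hnd
  have ep : E p = a := by rw [← ea, hE]
  have eq : E q = c := by rw [← ec, hE]
  rw [π_ne x (by grind) (by grind) (by grind) (by grind) (by grind) (by grind) (by grind) (by grind)]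
  by_cases h0 : E x = a'
  · refine ⟨p, by grind, t2 _ _ (by simp [h0]) ?_, ?_⟩
    · rw [h0, oa', ← ea]
      exact t1 _
    · rw [πp, ← h0]
      exact t1' _
  by_cases h1 : E x = c'
  · refine ⟨q, by grind, t2 _ _ (by simp [h1]) ?_, ?_⟩
    · rw [h1, oc', ← ec]
      exact t1 _
    · rw [πq, ← h1]
      exact t1' _
  refine ⟨E x, by grind, t1 _, ?_⟩
  by_cases h2 : E x = p'
  · refine t2' _ _ (by simp [h2]) ?_
    rw [h2, op', πp', ← ep]
    exact t1' _
  by_cases h3 : E x = q'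
  · refine t2' _ _ (by simp [h3]) ?_
    rw [h3, oq', πq', ← eq]
    exact t1' _
  rw [π_ne _ (by grind) h2 (by grind) h3 (by grind) h0 (by grind) h1]
  exact t1' _

end Slide

theorem half_eq_of_fst_eq (v : G.Vert) (s b d : Bool) (i : Bool × Bool) :
    G.half (v, i) = G.half (v, s, b) ∨ G.half (v, i) = G.half (v, s, !b) ∨
    G.half (v, i) = G.half (v, !s, d) ∨ G.half (v, i) = G.half (v, !s, !d) := by
  obtain ⟨s', b'⟩ := i
  cases s <;> cases s' <;> cases b <;> cases b' <;> cases d <;> simp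

/-- The half-edges that are not at `v`. -/
def awayFrom (G : FramedGraph) (v : G.Vert) : Set G.Half := {x | ∀ i, x ≠ G.half (v, i)}

theorem mem_awayFrom {v : G.Vert} (s b d : Bool) {x : G.Half} : x ∈ G.awayFrom v ↔
    x ≠ G.half (v, s, b) ∧ x ≠ G.half (v, s, !b) ∧ x ≠ G.half (v, !s, d) ∧ x ≠ G.half (v, !s, !d) := by
  constructor
  · exact fun h => ⟨h _, h _, h _, h _⟩
  · rintro ⟨h1, h2, h3, h4⟩ i rfl
    rcases half_eq_of_fst_eq v s b d i with h | h | h | h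
    · exact h1 h
    · exact h2 h
    · exact h3 h
    · exact h4 h

/-- Each of the two strands through the erased vertex `v` also passes through `w`, so every
component that contains a half-edge of `v` contains half-edges away from `v`. -/
theorem isFull_erase_awayFrom {v w : G.Vert} (hvw : v ≠ w)
    {s t b c d e : Bool} (h1 : G.edge (G.half (v, s, b)) = G.half (w, t, c))
    (h2 : G.edge (G.half (v, !s, d)) = G.half (w, !t, e)) :
    (G.erase {v}).IsFull (G.awayFrom v) := by
  have hopp : ∀ h ∈ G.awayFrom v, G.opp h ∈ G.awayFrom v := by
    rintro h hh ⟨s, b⟩ e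
    exact hh (s, !b) (by rw [← G.opp_half, ← e, G.opp_opp])
  refine ⟨fun x i e => x.1.2 (congrArg Prod.fst (G.half.injective e)), hopp, ?_⟩
  have hw : ∀ i, G.half (w, i) ∈ G.awayFrom v := fun i k e =>
    hvw (congrArg Prod.fst (G.half.injective e)).symm
  have t1 : (G.erase {v}).Trace (G.awayFrom v) (G.half (v, s, b)) (G.half (w, t, c)) := by
    rw [← h1]
    exact .edge (G := G.erase {v}) _
  have t2 : (G.erase {v}).Trace (G.awayFrom v) (G.half (v, !s, d)) (G.half (w, !t, e)) := by
    rw [← h2]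
    exact .edge (G := G.erase {v}) _
  intro h
  by_cases hh : h ∈ G.awayFrom v
  · exact exists_trace (G := G.erase {v}) hopp hh
  by_cases hh' : G.edge h ∈ G.awayFrom v
  · exact ⟨_, hh', .edge (G := G.erase {v}) _⟩
  have hh'' := hh'
  erw [mem_awayFrom s b d] at hh'
  have hcon1 : G.opp (G.edge h) = G.half (v, s, b) → ∃ k ∈ G.awayFrom v, (G.erase {v}).Trace (G.awayFrom v) h k :=
    fun e => ⟨_, hw _, .cons (G := G.erase {v}) hh'' (by change (G.erase {v}).Trace (G.awayFrom v) (G.opp (G.edge h)) _; rw [e]; exact t1)⟩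
  have hcon2 : G.opp (G.edge h) = G.half (v, !s, d) → ∃ k ∈ G.awayFrom v, (G.erase {v}).Trace (G.awayFrom v) h k :=
    fun e => ⟨_, hw _, .cons (G := G.erase {v}) hh'' (by change (G.erase {v}).Trace (G.awayFrom v) (G.opp (G.edge h)) _; rw [e]; exact t2)⟩
  have hv : ∀ i k, G.half (w, i) ≠ G.half (v, k) := fun i => hw i
  by_cases e2 : G.edge h = G.half (v, s, !b)
  · exact hcon1 (by rw [e2, G.opp_half, Bool.not_not])
  by_cases e4 : G.edge h = G.half (v, !s, !d)
  · exact hcon2 (by rw [e4, G.opp_half, Bool.not_not])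
  have e13 : G.edge h = G.half (v, s, b) ∨ G.edge h = G.half (v, !s, d) := by tauto
  rcases e13 with e1 | e1
  · have := edge_eq_comm.1 e1
    rw [h1] at this
    exact (hh (this.symm ▸ hw (t, c))).elim
  · have := edge_eq_comm.1 e1
    rw [h2] at this
    exact (hh (this.symm ▸ hw (!t, e))).elim

open Equiv Classical in
-- When one vertex of a bigon is erased, its two strands still cross once, at the other vertex.
-- Which vertex is kept is only a matter of where on the bigon the crossing is drawn.
theorem sameCore_erase_of_edge {v w : G.Vert} (hvw : v ≠ w)
    {s t b c d e : Bool} (h1 : G.edge (G.half (v, s, b)) = G.half (w, t, c))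
    (h2 : G.edge (G.half (v, !s, d)) = G.half (w, !t, e)) :
    SameCore (G.erase {v}) (G.erase {w}) := by
  have hnd : [G.half (v, s, b), G.half (v, s, !b), G.half (v, !s, d), G.half (v, !s, !d),
      G.half (w, t, c), G.half (w, t, !c), G.half (w, !t, e), G.half (w, !t, !e)].Nodup := by
    simp [hvw, G.half.injective.eq_iff]
  set a := G.half (v, s, b) with ha
  set a' := G.half (v, s, !b) with ha'
  set k := G.half (v, !s, d) with hk
  set k' := G.half (v, !s, !d) with hk'
  set p := G.half (w, t, c) with hp
  set p' := G.half (w, t, !c) with hp'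
  set q := G.half (w, !t, e) with hq
  set q' := G.half (w, !t, !e) with hq'
  -- A half-edge of `w` on the bigon becomes the half-edge of `v` off the bigon on the same strand,
  -- and conversely: both ways the strand is cut into the same two directions.
  let π : Equiv.Perm G.Half := swap p a' * swap p' a * swap q k' * swap q' k
  have hnd' := hnd
  simp only [List.nodup_cons, List.mem_cons, List.not_mem_nil, not_or, or_false] at hnd'
  obtain ⟨⟨n1, n2, n3, n4, n5, n6, n7⟩, ⟨n8, n9, n10, n11, n12, n13⟩, ⟨n14, n15, n16, n17, n18⟩,
    ⟨n19, n20, n21, n22⟩, ⟨n23, n24, n25⟩, ⟨n26, n27⟩, n28, -⟩ := hnd'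
  have πp : π p = a' := by simp only [π, Perm.mul_apply]; grind
  have πp' : π p' = a := by simp only [π, Perm.mul_apply]; grind
  have πq : π q = k' := by simp only [π, Perm.mul_apply]; grind
  have πq' : π q' = k := by simp only [π, Perm.mul_apply]; grind
  have πa : π a = p' := by simp only [π, Perm.mul_apply]; grind
  have πa' : π a' = p := by simp only [π, Perm.mul_apply]; grind
  have πk : π k = q' := by simp only [π, Perm.mul_apply]; grind
  have πk' : π k' = q := by simp only [π, Perm.mul_apply]; grind
  have π_ne : ∀ x, x ≠ p → x ≠ p' → x ≠ q → x ≠ q' → x ≠ a → x ≠ a' → x ≠ k → x ≠ k' → π x = x := by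
    intro x m1 m2 m3 m4 m5 m6 m7 m8
    simp only [π, Perm.mul_apply, swap_apply_of_ne_of_ne m4 m7, swap_apply_of_ne_of_ne m3 m8,
      swap_apply_of_ne_of_ne m2 m5, swap_apply_of_ne_of_ne m1 m6]
  have hπK : ∀ x, x ∈ G.awayFrom v ↔ π x ∈ G.awayFrom w := by
    intro x
    rw [mem_awayFrom s b d, mem_awayFrom t c e]
    change (x ≠ a ∧ x ≠ a' ∧ x ≠ k ∧ x ≠ k') ↔ (π x ≠ p ∧ π x ≠ p' ∧ π x ≠ q ∧ π x ≠ q')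
    rw [← πa, ← πa', ← πk, ← πk']
    simp only [ne_eq, π.injective.eq_iff]
    tauto
  have h1' : G.edge p = a := by rw [← h1, G.edge_edge]
  have h2' : G.edge q = k := by rw [← h2, G.edge_edge]
  have oa : G.opp a = a' := G.opp_half _ _ _
  have ok : G.opp k = k' := G.opp_half _ _ _
  have op : G.opp p = p' := G.opp_half _ _ _
  have oq : G.opp q = q' := G.opp_half _ _ _
  have oa' : G.opp a' = a := by rw [← oa, G.opp_opp]
  have ok' : G.opp k' = k := by rw [← ok, G.opp_opp]
  have op' : G.opp p' = p := by rw [← op, G.opp_opp]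
  have oq' : G.opp q' = q := by rw [← oq, G.opp_opp]
  have πopp : ∀ x, x ∈ G.awayFrom v → π (G.opp x) = G.opp (π x) := by
    intro x hx
    by_cases e1 : x = p
    · rw [e1, op, πp, πp', oa']
    by_cases e2 : x = p'
    · rw [e2, op', πp, πp', oa]
    by_cases e3 : x = q
    · rw [e3, oq, πq, πq', ok']
    by_cases e4 : x = q'
    · rw [e4, oq', πq, πq', ok]
    rw [mem_awayFrom s b d] at hx
    obtain ⟨m1, m2, m3, m4⟩ := hx
    have ho : ∀ {y z}, G.opp y = z → x ≠ y → G.opp x ≠ z := fun e hne e' =>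
      hne (opp_inj.1 (e'.trans e.symm))
    rw [π_ne x e1 e2 e3 e4 m1 m2 m3 m4, π_ne _ (ho op' e2) (ho op e1) (ho oq' e4) (ho oq e3)
      (ho oa' m2) (ho oa m1) (ho ok' m4) (ho ok m3)]
  have e1 : ∀ x, x ≠ v → x ∈ ({v}ᶜ : Set G.Vert) := fun x hx => hx
  let g : {x : G.Vert // x ∉ ({v} : Set G.Vert)} ≃ {x : G.Vert // x ∉ ({w} : Set G.Vert)} :=
    (swap v w).subtypeEquiv fun x => by
      simp only [Set.mem_singleton_iff, not_iff_not]
      exact ⟨fun e => by rw [e, swap_apply_left], fun e => by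
        rw [← (swap v w).injective.eq_iff, e, swap_apply_left]⟩
  refine Homeo.sameCore (homeo_of_trace (isFull_erase_awayFrom hvw h1 h2)
    (isFull_erase_awayFrom hvw.symm h1' h2') (π.subtypeEquiv hπK) g (fun x => πopp _ x.2) ?_ ?_)
  · rintro ⟨x, hx⟩ i
    change ∃ i', π (G.half (x, i)) = G.half (swap v w x, i')
    by_cases hxw : x = w
    · subst hxw
      rw [swap_apply_right]
      rcases half_eq_of_fst_eq (G := G) x t c e i with h | h | h | h <;> rw [h]
      · exact ⟨_, πp⟩
      · exact ⟨_, πp'⟩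
      · exact ⟨_, πq⟩
      · exact ⟨_, πq'⟩
    · have hxv : x ≠ v := hx
      rw [swap_apply_of_ne_of_ne hxv hxw]
      have hv : ∀ k, G.half (x, i) ≠ G.half (v, k) := fun k e =>
        hxv (congrArg Prod.fst (G.half.injective e))
      have hw : ∀ k, G.half (x, i) ≠ G.half (w, k) := fun k e =>
        hxw (congrArg Prod.fst (G.half.injective e))
      exact ⟨i, π_ne _ (hw _) (hw _) (hw _) (hw _) (hv _) (hv _) (hv _) (hv _)⟩
  · intro x
    obtain ⟨y, hy, hT, hT'⟩ := slide_exists_trace (E := G.edge) (O := G.opp)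
      (T := (G.erase {v}).Trace (G.awayFrom v)) (T' := (G.erase {w}).Trace (G.awayFrom w)) (π := π)
      (a := a) (a' := a') (c := k) (c' := k') (p := p) (p' := p') (q := q) (q' := q')
      G.edge_edge G.edge_ne (fun x => .edge (G := G.erase {v}) x)
      (fun x y h tr => .cons (G := G.erase {v})
        (fun h' => by
          have h'' := (mem_awayFrom s b d).1 h'
          change G.edge x ≠ a ∧ G.edge x ≠ a' ∧ G.edge x ≠ k ∧ G.edge x ≠ k' at h''
          tauto) tr)
      (fun x => .edge (G := G.erase {w}) x)
      (fun x y h tr => .cons (G := G.erase {w})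
        (fun h' => by
          have h'' := (mem_awayFrom t c e).1 h'
          change G.edge x ≠ p ∧ G.edge x ≠ p' ∧ G.edge x ≠ q ∧ G.edge x ≠ q' at h''
          tauto) tr)
      oa oa' ok ok' op op' oq oq' h1 h2 πp πp' πq πq' π_ne hnd ((mem_awayFrom s b d).1 x.2)
    exact ⟨⟨y, (mem_awayFrom s b d).2 hy⟩, hT, hT'⟩

end FramedGraph
end

/-! ### Confluence of the decreasing moves -/

noncomputable section

namespace FramedGraph

variable {G G' : FramedGraph}

/-- Without 2-valent nodes the sides of the bigon are edges, and the previous case applies. -/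
theorem GenBigon.sameCore_erase {v w : G.Vert} (h : G.GenBigon v w) :
    SameCore (G.erase {v}) (G.erase {w}) := by
  obtain ⟨G', hG, hG'⟩ := G.exists_sameCore_stops
  obtain ⟨m⟩ := hG.exists_match
  have key : ∀ x y, G'.Link x y → G'.edge (G'.half x) = G'.half y := by
    intro x y t
    change G'.Trace _ _ _ at t
    generalize G'.half y = k at t
    cases t with
    | edge => rfl
    | cons h1 _ => exact absurd (hG' _) h1
  obtain ⟨hne, s, s', b, b', d, d', h1, h2⟩ := h.map m
  have h3 := sameCore_erase_of_edge hne (key _ _ h1) (key _ _ h2)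
  have e1 := m.erase {v}
  have e2 := m.erase {w}
  rw [Set.image_singleton] at e1 e2
  exact e1.trans (h3.trans e2.symm)

theorem sameCore_erase_singleton {v w : G.Vert} (hw : w ∉ ({v} : Set G.Vert)) :
    SameCore ((G.erase {v}).erase {(⟨w, hw⟩ : {x // x ∉ ({v} : Set G.Vert)})}) (G.erase {v, w}) := by
  refine sameCore_erase_erase fun x => ⟨?_, ?_⟩
  · rintro (rfl | rfl)
    · exact Or.inl rfl
    · exact Or.inr ⟨hw, rfl⟩
  · rintro (h | ⟨h, e⟩)
    · exact Or.inl h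
    · exact Or.inr (congrArg Subtype.val e)

/-- If `w ≠ u`, the two bigons leave `v` through opposite half-edges on each strand. Once `v` is
erased, their sides join to the sides of a bigon between `w` and `u`, so erasing `w` or `u` next
gives the same graph. -/
theorem GenBigon.sameCore_erase_pair {v w u : G.Vert} (hw : G.GenBigon v w) (hu : G.GenBigon v u) :
    SameCore (G.erase {v, w}) (G.erase {v, u}) := by
  by_cases hwu : w = u
  · rw [hwu]
    exact .refl _
  obtain ⟨hvw, s, s', b, b', d, d', h1, h2⟩ := hw
  obtain ⟨hvu, t, t', c, c', e, e', h3, h4⟩ := hu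
  -- Naming the sides of the second bigon in the other order aligns its strands at `v` with those of
  -- the first.
  wlog hst : t = s generalizing t t' c c' e e'
  · have : t = !s := by revert hst; cases t <;> cases s <;> simp
    subst this
    exact this (!!s) (!t') e e' c c' h4 (by simpa using h3) (by simp)
  subst hst
  -- A half-edge is linked to only one other, so a common half-edge would force `w = u`.
  have hcb : c = !b := by
    by_contra hne
    have : c = b := by revert hne; cases c <;> cases b <;> simp
    subst this
    exact hwu (congrArg Prod.fst (h1.unique h3))
  have hed : e = !d := by
    by_contra hne
    have : e = d := by revert hne; cases e <;> cases d <;> simp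
    subst this
    exact hwu (congrArg Prod.fst (h2.unique h4))
  subst hcb hed
  have hvw' : w ∉ ({v} : Set G.Vert) := fun e => hvw (Set.mem_singleton_iff.1 e).symm
  have hvu' : u ∉ ({v} : Set G.Vert) := fun e => hvu (Set.mem_singleton_iff.1 e).symm
  have key : ∀ {w u : G.Vert} {i k : Bool × Bool} {s b : Bool} (hw : w ∉ ({v} : Set G.Vert))
      (hu : u ∉ ({v} : Set G.Vert)), G.Link (v, s, b) (w, i) → G.Link (v, s, !b) (u, k) →
      (G.erase {v}).Link (⟨w, hw⟩, i) (⟨u, hu⟩, k) := by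
    intro w u i k s b hw hu h h'
    refine Trace.trans (G := G.erase {v}) (k := G.half (v, s, b)) ?_ ?_ ?_
    · exact (Trace.erase {v} h.symm).mono (stops_erase_subset _)
    · exact fun h => half_mem_stops_erase.1 h rfl
    · change (G.erase {v}).Trace (G.erase {v}).stops (G.opp _) (G.half (u, k))
      rw [G.opp_half]
      exact (Trace.erase {v} h').mono (stops_erase_subset _)
  have hb : (G.erase {v}).GenBigon ⟨w, hvw'⟩ ⟨u, hvu'⟩ :=
    ⟨fun e => hwu (congrArg Subtype.val e), s', t', b', c', d', e', key _ _ h1 h3, key _ _ h2 h4⟩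
  have hsame := hb.sameCore_erase
  refine SameCore.trans (SameCore.symm ?_) (hsame.trans ?_)
  · exact sameCore_erase_singleton _
  · exact sameCore_erase_singleton _

/-- Graphs up to circles without vertices. -/
def coreSetoid : Setoid FramedGraph := ⟨SameCore, SameCore.refl, SameCore.symm, SameCore.trans⟩

/-- The class of a graph up to circles without vertices. -/
def core (G : FramedGraph) : Quotient coreSetoid := Quotient.mk _ G

theorem core_eq_core : G.core = G'.core ↔ SameCore G G' := Quotient.eq (r := coreSetoid)

/-- Decreasing moves on classes of graphs. -/
def CoreDecreases (j : Version) (a b : Quotient coreSetoid) : Prop :=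
  ∃ (G : FramedGraph) (S : Set G.Vert), G.GenMove j S ∧ a = G.core ∧ b = (G.erase S).core

/-- Matches transport the move from the representative in which it was given to `G`, so that two
moves starting from one class can be compared in a single graph. -/
theorem CoreDecreases.exists_genMove {j : Version} {b : Quotient coreSetoid}
    (h : CoreDecreases j G.core b) : ∃ S, G.GenMove j S ∧ b = (G.erase S).core := by
  obtain ⟨G', S, h1, h2, rfl⟩ := h
  obtain ⟨m⟩ := (core_eq_core.1 h2).symm.exists_match
  exact ⟨_, h1.map m, core_eq_core.2 (m.erase S)⟩

/-- The loop takes one half-edge of each strand at `v`, and the bigon takes the two others. After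
`v` is erased, one side of the bigon, the loop and the other side form a loop at `w`. Removing it
has the same effect as the second move. -/
theorem GenLoop.core_erase {v w : G.Vert} (h : G.GenLoop v) (hb : G.GenBigon v w) :
    CoreDecreases Version.two (G.erase {v}).core (G.erase {v, w}).core := by
  obtain ⟨s, b, b', h0⟩ := h
  obtain ⟨hvw, t, t', c, c', e, e', h1, h2⟩ := hb
  wlog hst : t = s generalizing t t' c c' e e'
  · have : t = !s := by revert hst; cases t <;> cases s <;> simp
    subst this
    exact this (!!s) (!t') e e' c c' h2 (by simpa using h1) (by simp)
  subst hst
  have hcb : c = !b := by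
    by_contra hne
    have : c = b := by revert hne; cases c <;> cases b <;> simp
    subst this
    exact hvw (congrArg Prod.fst (h0.unique h1))
  have heb : e = !b' := by
    by_contra hne
    have : e = b' := by revert hne; cases e <;> cases b' <;> simp
    subst this
    exact hvw (congrArg Prod.fst (h0.symm.unique h2))
  subst hcb heb
  have hvw' : w ∉ ({v} : Set G.Vert) := fun e => hvw (Set.mem_singleton_iff.1 e).symm
  have hmem : ∀ i, G.half (v, i) ∉ (G.erase {v}).stops := fun i h =>
    half_mem_stops_erase.1 h rfl
  have hl : (G.erase {v}).GenLoop ⟨w, hvw'⟩ := by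
    refine ⟨t', c', e', ?_⟩
    refine Trace.trans (G := G.erase {v}) (k := G.half (v, t, !b)) ?_ (hmem _) ?_
    · exact (Trace.erase {v} h1.symm).mono (stops_erase_subset _)
    · change (G.erase {v}).Trace (G.erase {v}).stops (G.opp _) (G.half (w, !t', e'))
      rw [G.opp_half, Bool.not_not]
      refine Trace.trans (G := G.erase {v}) (k := G.half (v, !t, b')) ?_ (hmem _) ?_
      · exact (Trace.erase {v} h0).mono (stops_erase_subset _)
      · change (G.erase {v}).Trace (G.erase {v}).stops (G.opp _) (G.half (w, !t', e'))
        rw [G.opp_half]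
        exact (Trace.erase {v} h2).mono (stops_erase_subset _)
  refine ⟨_, _, .loop _ hl, rfl, core_eq_core.2 (SameCore.symm ?_)⟩
  exact sameCore_erase_singleton _

open Relation in
-- The local diamond, with at most one further move on each side. Disjoint moves are performed one
-- after the other; overlapping ones are two bigons with a common vertex, a loop and a bigon, or the
-- same loop twice.
theorem GenMove.exists_join {j : Version} {S T : Set G.Vert} (hS : G.GenMove j S)
    (hT : G.GenMove j T) : ∃ d, ReflGen (CoreDecreases j) (G.erase S).core d ∧
      ReflGen (CoreDecreases j) (G.erase T).core d := by
  by_cases hd : ∀ v ∈ T, v ∉ S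
  · refine ⟨(G.erase (S ∪ T)).core, .single ⟨_, _, hT.erase hd, rfl, ?_⟩,
      .single ⟨_, _, hS.erase (fun v hv hv' => hd v hv' hv), rfl, ?_⟩⟩
    · refine core_eq_core.2 (SameCore.symm (sameCore_erase_erase fun v => ?_))
      simp only [Set.mem_union]
      tauto
    · refine core_eq_core.2 (SameCore.symm (sameCore_erase_erase fun v => ?_))
      simp only [Set.mem_union]
      tauto
  have hsame : ∀ {v w u : G.Vert}, G.GenBigon v w → G.GenBigon v u →
      ∃ d, ReflGen (CoreDecreases j) (G.erase {v, w}).core d ∧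
        ReflGen (CoreDecreases j) (G.erase {v, u}).core d := fun hw hu =>
    ⟨_, .refl, by rw [core_eq_core.2 (hw.sameCore_erase_pair hu)]⟩
  push Not at hd
  obtain ⟨z, hzT, hzS⟩ := hd
  cases hS with
  | loop v h =>
    obtain rfl : z = v := hzS
    cases hT with
    | loop v' h' =>
      obtain rfl : z = v' := hzT
      exact ⟨_, .refl, .refl⟩
    | bigon _ v' w' h' =>
      rcases hzT with rfl | rfl
      · exact ⟨_, .single (h.core_erase h'), .refl⟩
      · refine ⟨_, .single (h.core_erase h'.symm), ?_⟩
        rw [Set.pair_comm]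
  | bigon _ v w h =>
    cases hT with
    | loop v' h' =>
      obtain rfl : z = v' := hzT
      rcases hzS with rfl | rfl
      · exact ⟨_, .refl, .single (h'.core_erase h)⟩
      · refine ⟨_, ?_, .single (h'.core_erase h.symm)⟩
        rw [Set.pair_comm]
    | bigon _ v' w' h' =>
      rcases hzS with rfl | rfl <;> rcases hzT with rfl | rfl
      · exact hsame h h'
      · have := hsame h h'.symm
        rwa [Set.pair_comm z v'] at this
      · have := hsame h.symm h'
        rwa [Set.pair_comm z v] at this
      · have := hsame h.symm h'.symm
        rwa [Set.pair_comm z v, Set.pair_comm z v'] at this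

open Relation in
-- Since the diamond closes with at most one step on one side, the Church–Rosser theorem applies
-- directly, without an argument about termination.
theorem join_coreDecreases {j : Version} {a b : Quotient coreSetoid}
    (h : EqvGen (CoreDecreases j) a b) : Join (ReflTransGen (CoreDecreases j)) a b := by
  have hcr : ∀ a b c, CoreDecreases j a b → CoreDecreases j a c →
      ∃ d, ReflGen (CoreDecreases j) b d ∧ ReflTransGen (CoreDecreases j) c d := by
    intro a b c hb hc
    induction a using Quotient.inductionOn with
    | _ G =>
      obtain ⟨S, hS, rfl⟩ := CoreDecreases.exists_genMove (G := G) hb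
      obtain ⟨T, hT, rfl⟩ := CoreDecreases.exists_genMove (G := G) hc
      obtain ⟨d, h1, h2⟩ := hS.exists_join hT
      exact ⟨d, h1, h2.to_reflTransGen⟩
  induction h with
  | rel x y h => exact ⟨y, .single h, .refl⟩
  | refl x => exact ⟨x, .refl, .refl⟩
  | symm _ _ _ ih =>
    obtain ⟨z, h, h'⟩ := ih
    exact ⟨z, h', h⟩
  | trans _ _ _ _ _ ih ih' =>
    obtain ⟨z, h1, h2⟩ := ih
    obtain ⟨w, h3, h4⟩ := ih'
    obtain ⟨v, h5, h6⟩ := church_rosser hcr h2 h3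
    exact ⟨v, h1.trans h5, h4.trans h6⟩

end FramedGraph
end

/-! ### Normal forms of graphs, and the number of straight circuits -/

noncomputable section

namespace FramedGraph

variable {G G' : FramedGraph}

theorem Link.edge_eq_of_tight (hG : ∀ h, h ∉ G.stops → G.edge h = G.opp h)
    {x y : G.Vert × Bool × Bool} (h : G.Link x y) : G.edge (G.half x) = G.half y := by
  change G.Trace _ _ _ at h
  generalize G.half y = k at h
  generalize hx : G.half x = z at h
  cases h with
  | edge => rfl
  | cons h1 _ =>
    have h2 := hG _ h1
    rw [G.edge_edge] at h2
    have h3 : G.edge z = G.opp z := by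
      conv_rhs => rw [h2]
      rw [G.opp_opp]
    rw [h3, ← hx] at h1
    exact absurd (opp_mem_stops (G.half_mem_stops x)) h1

theorem GenMove.decreases_of_tight {j : Version} {S : Set G.Vert} (h : G.GenMove j S)
    (hG : ∀ h, h ∉ G.stops → G.edge h = G.opp h) : Decreases j G (G.erase S) := by
  cases h with
  | loop v h =>
    obtain ⟨s, b, b', h⟩ := h
    refine .first G v ?_
    cases s with
    | false => exact ⟨b, b', h.edge_eq_of_tight hG⟩
    | true => exact ⟨b', b, h.symm.edge_eq_of_tight hG⟩
  | bigon _ v w h =>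
    obtain ⟨hne, s, s', b, b', d, d', h1, h2⟩ := h
    refine .second _ G v w ⟨hne, ?_⟩
    cases s with
    | false => exact ⟨s', b, b', d, d', h1.edge_eq_of_tight hG, h2.edge_eq_of_tight hG⟩
    | true =>
      refine ⟨!s', d, d', b, b', h2.edge_eq_of_tight hG, ?_⟩
      rw [Bool.not_not]
      exact h1.edge_eq_of_tight hG

/-- In a homeomorphic graph whose 2-valent nodes all lie on one-node circles, links between vertices
are edges, and the general move becomes a decreasing move in the literal sense. -/
theorem GenMove.exists_decreases {j : Version} {S : Set G.Vert} (h : G.GenMove j S) :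
    ∃ G' G'', Homeo G G' ∧ Decreases j G' G'' ∧ Homeo G'' (G.erase S) := by
  obtain ⟨G', h1, h2⟩ := G.exists_homeo_tight
  obtain ⟨m⟩ := h1.exists_match
  exact ⟨G', _, h1, (h.map m).decreases_of_tight h2, .symm _ _ (m.erase S)⟩

theorem Homeo.nonempty_half_iff (h : Homeo G G') : Nonempty G.Half ↔ Nonempty G'.Half := by
  induction h with
  | rel G G' h =>
    cases h with
    | iso _ e => exact e.nonempty_congr
    | subdivide h => exact ⟨fun _ => ⟨Sum.inr true⟩, fun _ => ⟨h⟩⟩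
  | refl => rfl
  | symm _ _ _ ih => exact ih.symm
  | trans _ _ _ _ _ ih ih' => exact ih.trans ih'

theorem IsReduced.homeo (h : G.IsReduced) (e : Homeo G G') : G'.IsReduced :=
  fun K hK e' => h K hK (.trans _ _ _ e e')

/-- A circle with one node splits off, so in a reduced graph nothing can remain besides it. -/
theorem IsReduced.eq_of_tight (h : G.IsReduced) (hG : ∀ h, h ∉ G.stops → G.edge h = G.opp h)
    {x : G.Half} (hx : x ∉ G.stops) (y : G.Half) : y = x ∨ y = G.opp x := by
  by_contra hy
  push Not at hy
  exact h (G.delCircle x hx (hG x hx)) ⟨(⟨y, hy⟩ : {z // z ≠ x ∧ z ≠ G.opp x})⟩ (homeo_delCircle G x hx (hG x hx))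

theorem SameCore.homeo_of_stops (h : SameCore G G') (hG : ∀ h, h ∈ G.stops)
    (hG' : ∀ h, h ∈ G'.stops) : Homeo G G' := by
  obtain ⟨m⟩ := h.exists_match
  let e : G.Vert × Bool × Bool ≃ G.Half := Equiv.ofBijective G.half ⟨G.half.injective, hG⟩
  let e' : G'.Vert × Bool × Bool ≃ G'.Half := Equiv.ofBijective G'.half ⟨G'.half.injective, hG'⟩
  have hf : ∀ x, e' (m.half (e.symm (G.half x))) = G'.half (m.half x) := fun x => by
    rw [show G.half x = e x from rfl, e.symm_apply_apply]
    rfl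
  refine homeo_of_bijective (fun x => e' (m.half (e.symm x)))
    (e'.bijective.comp (m.half.bijective.comp e.symm.bijective)) m.vert ?_ ?_ ?_
  · intro k
    obtain ⟨x, rfl⟩ := hG k
    obtain ⟨y, hy⟩ := G.exists_link x
    rw [hy.edge_eq_of_tight fun h hh => absurd (hG h) hh, hf, hf,
      (m.link hy).edge_eq_of_tight fun h hh => absurd (hG' h) hh]
  · intro k
    obtain ⟨⟨v, s, b⟩, rfl⟩ := hG k
    obtain ⟨s', b', c', h1, h2, -⟩ := m.exists_half v s b
    rw [G.opp_half, hf, hf, h1, h2, G'.opp_half]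
  · intro v i
    refine ⟨(m.half (v, i)).2, ?_⟩
    rw [hf]
    exact congrArg G'.half (Prod.ext (m.fst_half _) rfl)

open Classical in
-- A reduced graph either has no circle or is a single circle. The core does not distinguish the
-- circle from the empty graph, which is why non-emptiness enters as a separate condition; it
-- matches the relation `G ⊔ ○ = δ G` being imposed for non-empty `G` only.
theorem SameCore.homeo_of_isReduced (h : SameCore G G') (hG : G.IsReduced) (hG' : G'.IsReduced)
    (hne : Nonempty G.Half ↔ Nonempty G'.Half) : Homeo G G' := by
  obtain ⟨T, h1, hT⟩ := G.exists_homeo_tight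
  obtain ⟨T', h1', hT'⟩ := G'.exists_homeo_tight
  refine .trans _ _ _ h1 (.trans _ _ _ ?_ (.symm _ _ h1'))
  have hr := hG.homeo h1
  have hr' := hG'.homeo h1'
  have hs : SameCore T T' := h1.sameCore.symm.trans (h.trans h1'.sameCore)
  have hne' : Nonempty T.Half ↔ Nonempty T'.Half :=
    h1.nonempty_half_iff.symm.trans (hne.trans h1'.nonempty_half_iff)
  clear h1 h1' hG hG' hne h
  obtain ⟨m⟩ := hs.exists_match
  have key : ∀ {T : FramedGraph}, T.IsReduced → (∀ h, h ∉ T.stops → T.edge h = T.opp h) →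
      ∀ x, x ∉ T.stops → IsEmpty T.Vert := by
    intro T h hT x hx
    refine ⟨fun v => hx ?_⟩
    rcases h.eq_of_tight hT hx (T.half (v, false, false)) with e | e
    · exact ⟨_, e⟩
    · exact ⟨(v, false, true), by
        rw [← T.opp_opp x, ← e, T.opp_half]
        rfl⟩
  have key' : ∀ {T T' : FramedGraph}, (T.Vert ≃ T'.Vert) → IsEmpty T.Vert → (∀ h, h ∈ T'.stops) →
      ¬ Nonempty T'.Half := by
    rintro T T' e hT hT' ⟨x⟩
    obtain ⟨⟨v, -⟩, -⟩ := hT' x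
    exact hT.false (e.symm v)
  by_cases hx : ∀ x, x ∈ T.stops
  · by_cases hy : ∀ y, y ∈ T'.stops
    · exact hs.homeo_of_stops hx hy
    · push Not at hy
      obtain ⟨y, hy⟩ := hy
      -- One graph would be a circle and the other one empty.
      exact absurd (hne'.2 ⟨y⟩) (key' m.vert.symm (key hr' hT' y hy) hx)
  · push Not at hx
    obtain ⟨x, hx⟩ := hx
    by_cases hy : ∀ y, y ∈ T'.stops
    · exact absurd (hne'.1 ⟨x⟩) (key' m.vert (key hr hT x hx) hy)
    · push Not at hy
      obtain ⟨y, hy⟩ := hy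
      have hxx := T.opp_ne x
      have hyy := T'.opp_ne y
      have he := hT x hx
      have he' := hT' y hy
      have hV := key hr hT x hx
      have hf : ∀ z, z = x ∨ z = T.opp x := hr.eq_of_tight hT hx
      have hf' : ∀ z, z = y ∨ z = T'.opp y := hr'.eq_of_tight hT' hy
      refine homeo_of_bijective (fun z => if z = x then y else T'.opp y) ⟨?_, ?_⟩ m.vert ?_ ?_
        fun v => hV.elim v
      · intro z w
        rcases hf z with rfl | rfl <;> rcases hf w with rfl | rfl <;> simp [hxx, hyy, hyy.symm]
      · intro z
        rcases hf' z with rfl | rfl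
        · exact ⟨x, if_pos rfl⟩
        · exact ⟨T.opp x, if_neg hxx⟩
      · intro z
        have h2 : T.edge (T.opp x) = x := by rw [← he, T.edge_edge]
        have h3 : T'.edge (T'.opp y) = y := by rw [← he', T'.edge_edge]
        rcases hf z with rfl | rfl <;> simp [he, h2, h3, he', hxx]
      · intro z
        rcases hf z with rfl | rfl <;> simp [T.opp_opp, T'.opp_opp, hxx]

/-- Two graphs are connected by decreasing moves and their inverses, up to circles without
vertices. -/
def Related (j : Version) (G G' : FramedGraph) : Prop :=
  Relation.EqvGen (CoreDecreases j) G.core G'.core ∧ (Nonempty G.Half ↔ Nonempty G'.Half)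

theorem Related.symm {j : Version} (h : Related j G G') : Related j G' G :=
  ⟨.symm _ _ h.1, h.2.symm⟩

theorem Related.trans {j : Version} {G'' : FramedGraph} (h : Related j G G')
    (h' : Related j G' G'') : Related j G G'' :=
  ⟨.trans _ _ _ h.1 h'.1, h.2.trans h'.2⟩

theorem Homeo.related (j : Version) (h : Homeo G G') : Related j G G' :=
  ⟨by rw [core_eq_core.2 h.sameCore]; exact .refl _, h.nonempty_half_iff⟩

theorem Decreases.related {j : Version} (h : Decreases j G G') : Related j G G' := by
  obtain ⟨S, hS, rfl⟩ := h.exists_genMove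
  exact ⟨.rel _ _ ⟨G, S, hS, rfl, rfl⟩, Iff.rfl⟩

theorem related_addCircle (j : Version) (h : Nonempty G.Half) : Related j G G.addCircle :=
  ⟨by rw [core_eq_core.2 (sameCore_addCircle G)]; exact .refl _,
    ⟨fun _ => ⟨Sum.inr true⟩, fun _ => h⟩⟩

theorem Irreducible.not_genMove {j : Version} (h : G.Irreducible j) (S : Set G.Vert) :
    ¬ G.GenMove j S := by
  intro hS
  obtain ⟨G', G'', h1, h2, -⟩ := hS.exists_decreases
  exact h _ h1 _ h2

theorem Irreducible.eq_core {j : Version} (h : G.Irreducible j) {a : Quotient coreSetoid}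
    (ha : Relation.ReflTransGen (CoreDecreases j) G.core a) : a = G.core := by
  rcases ha.cases_head with e | ⟨b, hb, -⟩
  · exact e.symm
  · obtain ⟨S, hS, -⟩ := CoreDecreases.exists_genMove hb
    exact absurd hS (h.not_genMove S)

/-- Irreducible graphs are determined by their class modulo the moves. -/
theorem Related.homeo {j : Version} (h : Related j G G') (h1 : G.Irreducible j) (h2 : G.IsReduced)
    (h1' : G'.Irreducible j) (h2' : G'.IsReduced) : Homeo G G' := by
  obtain ⟨a, ha, ha'⟩ := join_coreDecreases h.1
  exact (core_eq_core.1 ((h1.eq_core ha).symm.trans (h1'.eq_core ha'))).homeo_of_isReduced h2 h2' h.2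

/-- Consecutive half-edges of a curve that goes straight at all vertices. -/
def Next (G : FramedGraph) (h k : G.Half) : Prop := k = G.edge h ∨ k = G.opp h

/-- A closed curve obtained by going straight at all vertices. -/
def Circuit (G : FramedGraph) : Type := Quot G.Next

instance (G : FramedGraph) : Finite G.Circuit := Quot.finite G.Next

/-- The circuit of a half-edge. -/
def circuit (G : FramedGraph) (h : G.Half) : G.Circuit := Quot.mk _ h

theorem circuit_edge (G : FramedGraph) (h : G.Half) : G.circuit (G.edge h) = G.circuit h :=
  (Quot.sound (r := G.Next) (Or.inl rfl)).symm

theorem circuit_opp (G : FramedGraph) (h : G.Half) : G.circuit (G.opp h) = G.circuit h :=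
  (Quot.sound (r := G.Next) (Or.inr rfl)).symm

/-- A function on the half-edges that is constant on circuits. -/
def Circuit.lift {G : FramedGraph} {α : Type*} (f : G.Half → α) (h1 : ∀ h, f (G.edge h) = f h)
    (h2 : ∀ h, f (G.opp h) = f h) : G.Circuit → α :=
  Quot.lift f (by
    rintro h _ (rfl | rfl)
    · exact (h1 h).symm
    · exact (h2 h).symm)

theorem circuit_surjective (G : FramedGraph) : Function.Surjective G.circuit := Quot.mk_surjective

/-- The number of circuits. -/
def circuitNumber (G : FramedGraph) : ℕ := Nat.card G.Circuit

theorem HomeoStep.circuitNumber_eq (h : HomeoStep G G') : G.circuitNumber = G'.circuitNumber := by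
  cases h with
  | iso _ e g edge_eq opp_eq half_eq =>
    refine Nat.card_congr (Quot.congr e fun a b => ?_)
    rw [Next, Next, ← edge_eq, ← opp_eq, e.injective.eq_iff, e.injective.eq_iff]
  | subdivide h =>
    have hT : (G.subdivide h).circuit (Sum.inr true) = (G.subdivide h).circuit (Sum.inr false) :=
      circuit_opp (G.subdivide h) (Sum.inr false)
    have hF : (G.subdivide h).circuit (Sum.inr false) = (G.subdivide h).circuit (Sum.inl h) := by
      rw [← circuit_edge (G.subdivide h) (Sum.inl h), subdivide_edge_self]
    have hE : (G.subdivide h).circuit (Sum.inr true) =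
        (G.subdivide h).circuit (Sum.inl (G.edge h)) := by
      rw [← circuit_edge (G.subdivide h) (Sum.inl (G.edge h)), subdivide_edge_edge]
    refine Nat.card_congr
      { toFun := Circuit.lift (fun k => (G.subdivide h).circuit (Sum.inl k)) ?_ ?_
        invFun := Circuit.lift (Sum.elim G.circuit fun _ => G.circuit h) ?_ ?_
        left_inv := ?_
        right_inv := ?_ }
    · intro k
      by_cases h1 : k = h
      · rw [h1, ← hE, hT, hF]
      · by_cases h2 : k = G.edge h
        · rw [h2, G.edge_edge, ← hE, hT, hF]
        · rw [← subdivide_edge_of_ne h1 h2]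
          exact circuit_edge (G.subdivide h) (Sum.inl k)
    · intro k
      exact circuit_opp (G.subdivide h) (Sum.inl k)
    · rintro (k | b)
      · by_cases h1 : k = h
        · rw [h1, subdivide_edge_self]
          rfl
        · by_cases h2 : k = G.edge h
          · rw [h2, subdivide_edge_edge]
            exact (G.circuit_edge h).symm
          · rw [subdivide_edge_of_ne h1 h2]
            exact G.circuit_edge k
      · cases b
        · rfl
        · exact G.circuit_edge h
    · rintro (k | b)
      · exact G.circuit_opp k
      · rfl
    · intro x
      obtain ⟨k, rfl⟩ := G.circuit_surjective x
      rfl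
    · intro x
      obtain ⟨k | b, rfl⟩ := (G.subdivide h).circuit_surjective x
      · rfl
      · cases b
        · exact hF.symm
        · exact (hT.trans hF).symm

theorem Homeo.circuitNumber_eq (h : Homeo G G') : G.circuitNumber = G'.circuitNumber := by
  induction h with
  | rel _ _ h => exact h.circuitNumber_eq
  | refl => rfl
  | symm _ _ _ ih => exact ih.symm
  | trans _ _ _ _ _ ih ih' => exact ih.trans ih'

/-- Erasing vertices leaves `edge` and `opp` unchanged, so the curves going straight are literally
the same. -/
theorem Decreases.circuitNumber_eq {j : Version} (h : Decreases j G G') :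
    G.circuitNumber = G'.circuitNumber := by
  obtain ⟨S, -, rfl⟩ := h.exists_genMove
  rfl

theorem circuitNumber_addCircle (G : FramedGraph) :
    G.addCircle.circuitNumber = G.circuitNumber + 1 := by
  rw [circuitNumber, circuitNumber, ← Finite.card_option]
  refine Nat.card_congr
    { toFun := Circuit.lift (Sum.elim (fun k => some (G.circuit k)) fun _ => none) ?_ ?_
      invFun := fun x => x.elim (G.addCircle.circuit (Sum.inr false))
        (Circuit.lift (fun k => G.addCircle.circuit (Sum.inl k)) ?_ ?_)
      left_inv := ?_
      right_inv := ?_ }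
  · rintro (k | b)
    · exact congrArg some (G.circuit_edge k)
    · rfl
  · rintro (k | b)
    · exact congrArg some (G.circuit_opp k)
    · rfl
  · intro k
    exact G.addCircle.circuit_edge (Sum.inl k)
  · intro k
    exact G.addCircle.circuit_opp (Sum.inl k)
  · intro x
    obtain ⟨k | b, rfl⟩ := G.addCircle.circuit_surjective x
    · rfl
    · cases b
      · rfl
      · exact (G.addCircle.circuit_edge (Sum.inr false)).symm
  · rintro (_ | x)
    · rfl
    · obtain ⟨k, rfl⟩ := G.circuit_surjective x
      rfl

theorem Homeo.vertexNumber_eq (h : Homeo G G') : G.vertexNumber = G'.vertexNumber := by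
  obtain ⟨m⟩ := h.exists_match
  exact Nat.card_congr m.vert

theorem Decreases.vertexNumber_lt {j : Version} (h : Decreases j G G') :
    G'.vertexNumber < G.vertexNumber := by
  obtain ⟨S, hS, rfl⟩ := h.exists_genMove
  obtain ⟨v, hv⟩ : ∃ v, v ∈ S := by
    cases hS with
    | loop v => exact ⟨v, rfl⟩
    | bigon _ v w => exact ⟨v, Or.inl rfl⟩
  exact Finite.card_subtype_lt (x := v) (by simpa using hv)

/-- Simplification of graphs by decreasing moves and removal of circles. -/
inductive Reduces (j : Version) : FramedGraph → FramedGraph → Prop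
  | refl (G : FramedGraph) : Reduces j G G
  | homeo {G G' N : FramedGraph} : Homeo G G' → Reduces j G' N → Reduces j G N
  | decreases {G G' N : FramedGraph} : Decreases j G G' → Reduces j G' N → Reduces j G N
  | circle {G N : FramedGraph} : Nonempty G.Half → Reduces j G N → Reduces j G.addCircle N

/-- Terminates because a decreasing move lowers the number of vertices and keeps the circuits, while
dropping a circle lowers the number of circuits and keeps the vertices. -/
theorem exists_reduces (j : Version) (G : FramedGraph) :
    ∃ N, Reduces j G N ∧ N.Irreducible j ∧ N.IsReduced := by
  generalize hn : G.vertexNumber + G.circuitNumber = n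
  induction n using Nat.strong_induction_on generalizing G with
  | _ n ih =>
    by_cases h1 : G.Irreducible j
    · by_cases h2 : G.IsReduced
      · exact ⟨G, .refl _, h1, h2⟩
      · simp only [IsReduced, not_forall, not_not] at h2
        obtain ⟨G', hne, h⟩ := h2
        have e1 := h.vertexNumber_eq
        have e2 := h.circuitNumber_eq
        rw [circuitNumber_addCircle] at e2
        rw [show G'.addCircle.vertexNumber = G'.vertexNumber from rfl] at e1
        obtain ⟨N, h3, h4⟩ := ih (G'.vertexNumber + G'.circuitNumber) (by omega) G' rfl
        exact ⟨N, .homeo h (.circle hne h3), h4⟩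
    · simp only [Irreducible, not_forall, not_not] at h1
      obtain ⟨G', h, G'', h'⟩ := h1
      have e1 := h.vertexNumber_eq
      have e2 := h.circuitNumber_eq
      have e3 := h'.vertexNumber_lt
      have e4 := h'.circuitNumber_eq
      obtain ⟨N, h3, h4⟩ := ih (G''.vertexNumber + G''.circuitNumber) (by omega) G'' rfl
      exact ⟨N, .homeo h (.decreases h' h3), h4⟩

variable {j : Version}

theorem Reduces.related (h : Reduces j G G') : Related j G G' := by
  induction h with
  | refl G => exact Homeo.related j (.refl G)
  | homeo h _ ih => exact (h.related j).trans ih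
  | decreases h _ ih => exact h.related.trans ih
  | circle h _ ih => exact (related_addCircle j h).symm.trans ih

theorem Reduces.vertexNumber_le (h : Reduces j G G') : G'.vertexNumber ≤ G.vertexNumber := by
  induction h with
  | refl G => exact le_rfl
  | homeo h _ ih => exact h.vertexNumber_eq ▸ ih
  | decreases h _ ih => exact ih.trans h.vertexNumber_lt.le
  | circle _ _ ih => exact ih

theorem Reduces.circuitNumber_le (h : Reduces j G G') : G'.circuitNumber ≤ G.circuitNumber := by
  induction h with
  | refl G => exact le_rfl
  | homeo h _ ih => exact h.circuitNumber_eq ▸ ih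
  | decreases h _ ih => exact h.circuitNumber_eq ▸ ih
  | @circle G N _ _ ih =>
    rw [circuitNumber_addCircle]
    omega

/-- If no vertex is lost, no decreasing move has been used, and the reduction consists of
homeomorphisms and removals of circles. -/
theorem Reduces.sameCore (h : Reduces j G G') (hv : G.vertexNumber ≤ G'.vertexNumber) :
    SameCore G G' := by
  induction h with
  | refl G => exact .refl _
  | homeo h _ ih => exact h.sameCore.trans (ih (h.vertexNumber_eq ▸ hv))
  | decreases h h' _ => exact absurd (h'.vertexNumber_le.trans_lt h.vertexNumber_lt) (not_lt.2 hv)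
  | circle _ _ ih => exact (sameCore_addCircle _).symm.trans (ih hv)

/-- The normal form is reached from any related graph without creating circuits, and it is unique.
Hence the exponent of `δ` attached to a related graph is a genuine difference of natural numbers. -/
theorem Related.circuitNumber_le (h : Related j G G') (h1 : G'.Irreducible j) (h2 : G'.IsReduced) :
    G'.circuitNumber ≤ G.circuitNumber := by
  obtain ⟨N, h3, h4, h5⟩ := exists_reduces j G
  rw [((h3.related.symm.trans h).homeo h4 h5 h1 h2).circuitNumber_eq.symm]
  exact h3.circuitNumber_le

theorem Related.exists_reduces (h : Related j G G') (h1 : G'.Irreducible j) (h2 : G'.IsReduced) :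
    ∃ N, Reduces j G N ∧ Homeo N G' := by
  obtain ⟨N, h3, h4, h5⟩ := FramedGraph.exists_reduces j G
  exact ⟨N, h3, (h3.related.symm.trans h).homeo h4 h5 h1 h2⟩

end FramedGraph
end

/-! ### Decreasing moves as smoothings of vertices -/

noncomputable section

namespace FramedGraph

variable {G G' : FramedGraph}

/-- A smoothing of some of the vertices: `op` joins each half-edge at a smoothed vertex to a
non-opposite one at the same vertex. -/
structure Smoothing (G : FramedGraph) where
  set : Set G.Vert
  op : G.Half → G.Half
  op_op : ∀ h, op (op h) = h
  op_ne : ∀ h, op h ≠ h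
  op_of_forall_ne : ∀ h, (∀ v ∈ set, ∀ i, h ≠ G.half (v, i)) → op h = G.opp h
  op_half : ∀ v ∈ set, ∀ i, ∃ i', op (G.half (v, i)) = G.half (v, i')
  op_half_ne : ∀ v ∈ set, ∀ i, op (G.half (v, i)) ≠ G.opp (G.half (v, i))

theorem half_ne_of_not_mem {S : Set G.Vert} {v : G.Vert} (hv : v ∉ S) (i : Bool × Bool) :
    ∀ w ∈ S, ∀ i', G.half (v, i) ≠ G.half (w, i') := by
  rintro w hw i' e
  obtain ⟨rfl, -⟩ := Prod.ext_iff.1 (G.half.injective e)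
  exact hv hw

namespace Smoothing

theorem op_eq_opp (σ : G.Smoothing) {v : G.Vert} (hv : v ∉ σ.set) (i : Bool × Bool) :
    σ.op (G.half (v, i)) = G.opp (G.half (v, i)) :=
  σ.op_of_forall_ne _ (half_ne_of_not_mem hv i)

/-- The graph obtained by smoothing. -/
def graph (σ : G.Smoothing) : FramedGraph where
  Half := G.Half
  Vert := {v : G.Vert // v ∉ σ.set}
  finite_half := inferInstance
  finite_vert := inferInstance
  edge := G.edge
  edge_edge := G.edge_edge
  edge_ne := G.edge_ne
  opp := σ.op
  opp_opp := σ.op_op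
  opp_ne := σ.op_ne
  half := (Function.Embedding.prodMap (Function.Embedding.subtype _)
    (Function.Embedding.refl (Bool × Bool))).trans G.half
  opp_half := fun v s b => (σ.op_eq_opp v.2 _).trans (G.opp_half v.1 s b)

/-- The smoothing at no vertices. -/
def trivial (G : FramedGraph) : G.Smoothing where
  set := ∅
  op := G.opp
  op_op := G.opp_opp
  op_ne := G.opp_ne
  op_of_forall_ne := fun _ _ => rfl
  op_half := by simp
  op_half_ne := by simp

theorem homeo_trivial (G : FramedGraph) : Homeo G (trivial G).graph :=
  .rel _ _ (.iso _ _ (Equiv.refl _) ⟨fun v => ⟨v, id⟩, fun v => v.1, fun _ => rfl, fun _ => rfl⟩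
    (fun _ => rfl) (fun _ => rfl) fun _ i => ⟨i, rfl⟩)

end Smoothing

/-- A map of half-edges under which the vertices correspond to each other. -/
structure VertexMap (G G' : FramedGraph) where
  map : G.Half ↪ G'.Half
  vert : G.Vert ≃ G'.Vert
  map_opp : ∀ h, map (G.opp h) = G'.opp (map h)
  map_half : ∀ v i, ∃ i', map (G.half (v, i)) = G'.half (vert v, i')

theorem VertexMap.exists_half (m : VertexMap G G') (v : G.Vert) (i' : Bool × Bool) :
    ∃ i, m.map (G.half (v, i)) = G'.half (m.vert v, i') := by
  choose F hF using m.map_half v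
  have hinj : Function.Injective F := fun x y e => by
    have h := (hF x).trans ((congrArg (fun z => G'.half (m.vert v, z)) e).trans (hF y).symm)
    exact (Prod.ext_iff.1 (G.half.injective (m.map.injective h))).2
  obtain ⟨i, rfl⟩ := Finite.surjective_of_injective hinj i'
  exact ⟨i, hF i⟩

namespace Smoothing

open Classical in
/-- Transport of a smoothing along a map. -/
def push (σ : G.Smoothing) (m : VertexMap G G') : G'.Smoothing where
  set := m.vert '' σ.set
  op h := if hh : ∃ k, m.map k = h then m.map (σ.op hh.choose) else G'.opp h
  op_op h := by
    by_cases hh : ∃ k, m.map k = h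
    · obtain ⟨k, rfl⟩ := hh
      simp [σ.op_op]
    · have : ¬ ∃ k, m.map k = G'.opp h := by
        rintro ⟨k, hk⟩
        exact hh ⟨G.opp k, by rw [m.map_opp, hk, G'.opp_opp]⟩
      simp only [hh, dite_false, this, G'.opp_opp]
  op_ne h := by
    by_cases hh : ∃ k, m.map k = h
    · obtain ⟨k, rfl⟩ := hh
      simp [σ.op_ne]
    · simp only [hh, dite_false]
      exact G'.opp_ne h
  op_of_forall_ne h hne := by
    by_cases hh : ∃ k, m.map k = h
    · obtain ⟨k, rfl⟩ := hh
      simp only [EmbeddingLike.apply_eq_iff_eq, exists_eq, dite_true, Classical.choose_eq]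
      rw [σ.op_of_forall_ne, m.map_opp]
      rintro v hv i rfl
      obtain ⟨i', hi'⟩ := m.map_half v i
      exact hne _ ⟨v, hv, rfl⟩ i' hi'
    · simp only [hh, dite_false]
  op_half := by
    rintro _ ⟨v, hv, rfl⟩ i
    obtain ⟨i1, h1⟩ := m.exists_half v i
    obtain ⟨i2, h2⟩ := σ.op_half v hv i1
    obtain ⟨i3, h3⟩ := m.map_half v i2
    refine ⟨i3, ?_⟩
    rw [← h1]
    simp [h2, h3]
  op_half_ne := by
    rintro _ ⟨v, hv, rfl⟩ i
    obtain ⟨i1, h1⟩ := m.exists_half v i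
    rw [← h1]
    simp [← m.map_opp, σ.op_half_ne v hv]

theorem push_op_map (σ : G.Smoothing) (m : VertexMap G G') (h : G.Half) :
    (σ.push m).op (m.map h) = m.map (σ.op h) := by
  simp [push]

theorem push_op_of_notMem (σ : G.Smoothing) (m : VertexMap G G') {h : G'.Half}
    (hh : ∀ k, m.map k ≠ h) : (σ.push m).op h = G'.opp h := by
  have : ¬ ∃ k, m.map k = h := fun ⟨k, hk⟩ => hh k hk
  simp [push, this]

/-- Away from the smoothed vertices `op` is `opp`, which the map respects; at a smoothed vertex `op`
stays at that vertex, whose half-edges all lie in the image. -/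
theorem exists_map_eq_op (σ : G'.Smoothing) (m : VertexMap G G') (h : G.Half) :
    ∃ k, m.map k = σ.op (m.map h) := by
  by_cases hh : ∀ v ∈ σ.set, ∀ i, m.map h ≠ G'.half (v, i)
  · exact ⟨G.opp h, by rw [σ.op_of_forall_ne _ hh, m.map_opp]⟩
  · push Not at hh
    obtain ⟨v, hv, i, hi⟩ := hh
    obtain ⟨v, rfl⟩ := m.vert.surjective v
    obtain ⟨i', hi'⟩ := σ.op_half _ hv i
    obtain ⟨i'', h''⟩ := m.exists_half v i'
    exact ⟨_, by rw [h'', hi, hi']⟩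

/-- The inverse image of a smoothing. -/
def pull (σ : G'.Smoothing) (m : VertexMap G G') : G.Smoothing where
  set := m.vert ⁻¹' σ.set
  op h := (exists_map_eq_op σ m h).choose
  op_op h := by
    apply m.map.injective
    rw [(exists_map_eq_op σ m _).choose_spec, (exists_map_eq_op σ m _).choose_spec, σ.op_op]
  op_ne h e := by
    have := (exists_map_eq_op σ m h).choose_spec
    rw [e] at this
    exact σ.op_ne _ this.symm
  op_of_forall_ne h hne := by
    apply m.map.injective
    rw [(exists_map_eq_op σ m _).choose_spec, m.map_opp, σ.op_of_forall_ne]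
    intro v hv i e
    obtain ⟨v, rfl⟩ := m.vert.surjective v
    obtain ⟨i', h'⟩ := m.exists_half v i
    exact hne v hv i' (m.map.injective (e.trans h'.symm))
  op_half v hv i := by
    obtain ⟨i1, h1⟩ := m.map_half v i
    obtain ⟨i2, h2⟩ := σ.op_half _ hv i1
    obtain ⟨i3, h3⟩ := m.exists_half v i2
    refine ⟨i3, m.map.injective ?_⟩
    rw [(exists_map_eq_op σ m _).choose_spec, h1, h2, h3]
  op_half_ne v hv i e := by
    obtain ⟨i1, h1⟩ := m.map_half v i
    have := (exists_map_eq_op σ m (G.half (v, i))).choose_spec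
    rw [e, m.map_opp, h1] at this
    exact σ.op_half_ne _ hv i1 this.symm

theorem map_pull_op (σ : G'.Smoothing) (m : VertexMap G G') (h : G.Half) :
    m.map ((σ.pull m).op h) = σ.op (m.map h) :=
  (exists_map_eq_op σ m h).choose_spec

end Smoothing

/-- `N` is obtained from `G` by smoothing some vertices, up to circles. -/
def SmoothsTo (G N : FramedGraph) : Prop := ∃ σ : G.Smoothing, SameCore σ.graph N

theorem smoothsTo_refl (G : FramedGraph) : SmoothsTo G G :=
  ⟨_, (Smoothing.homeo_trivial G).sameCore.symm⟩

/-- The isomorphism of the smoothed graphs. -/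
theorem Smoothing.homeo_of_equiv (σ : G.Smoothing) (σ' : G'.Smoothing) (e : G.Half ≃ G'.Half)
    (g : G.Vert ≃ G'.Vert) (hg : ∀ v, v ∉ σ.set ↔ g v ∉ σ'.set)
    (h_edge : ∀ h, e (G.edge h) = G'.edge (e h)) (h_op : ∀ h, e (σ.op h) = σ'.op (e h))
    (h_half : ∀ v i, ∃ i', e (G.half (v, i)) = G'.half (g v, i')) : Homeo σ.graph σ'.graph :=
  .rel _ _ (.iso _ _ e (g.subtypeEquiv hg) h_edge h_op fun v i => h_half v.1 i)

/-- Inclusion into a subdivision. -/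
def subdivideMap (G : FramedGraph) (h : G.Half) : VertexMap G (G.subdivide h) where
  map := Function.Embedding.inl
  vert := Equiv.refl _
  map_opp _ := rfl
  map_half _ i := ⟨i, rfl⟩

/-- Inclusion into the union with a circle. -/
def addCircleMap (G : FramedGraph) : VertexMap G G.addCircle where
  map := Function.Embedding.inl
  vert := Equiv.refl _
  map_opp _ := rfl
  map_half _ i := ⟨i, rfl⟩

theorem HomeoStep.smoothsTo_iff {N : FramedGraph} (h : HomeoStep G G') :
    SmoothsTo G N ↔ SmoothsTo G' N := by
  cases h with
  | iso _ e g edge_eq opp_eq half_eq =>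
    let m : VertexMap G G' := ⟨e.toEmbedding, g, opp_eq, half_eq⟩
    constructor
    · rintro ⟨σ, hσ⟩
      refine ⟨σ.push m, (Homeo.sameCore ?_).symm.trans hσ⟩
      exact σ.homeo_of_equiv (σ.push m) e g (fun v => not_congr (g.injective.mem_set_image).symm) edge_eq
        (fun h => (σ.push_op_map m h).symm) half_eq
    · rintro ⟨σ, hσ⟩
      refine ⟨σ.pull m, (Homeo.sameCore ?_).trans hσ⟩
      exact (σ.pull m).homeo_of_equiv σ e g (fun v => Iff.rfl) edge_eq
        (fun h => σ.map_pull_op m h) half_eq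
  | subdivide k =>
    let m := G.subdivideMap k
    constructor
    · rintro ⟨σ, hσ⟩
      refine ⟨σ.push m, (Homeo.sameCore ?_).symm.trans hσ⟩
      refine .trans _ (σ.graph.subdivide k) _ (.rel _ _ (.subdivide _ _)) (.rel _ _ ?_)
      refine .iso _ _ (Equiv.refl _) ((Equiv.refl _).subtypeEquiv fun v => ?_) (fun _ => rfl) ?_
        fun v i => ⟨i, rfl⟩
      · exact not_congr ((Equiv.refl _).injective.mem_set_image).symm
      · rintro (h | b)
        · exact (σ.push_op_map m h).symm
        · exact (σ.push_op_of_notMem m fun k => Sum.inl_ne_inr).symm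
    · rintro ⟨σ, hσ⟩
      refine ⟨σ.pull m, (Homeo.sameCore ?_).trans hσ⟩
      refine .trans _ ((σ.pull m).graph.subdivide k) _ (.rel _ _ (.subdivide _ _)) (.rel _ _ ?_)
      refine .iso _ _ (Equiv.refl _) (Equiv.refl _) (fun _ => rfl) ?_ fun v i => ⟨i, rfl⟩
      rintro (h | b)
      · exact σ.map_pull_op m h
      · refine (σ.op_of_forall_ne (Sum.inr b) fun v _ i => ?_).symm
        exact Sum.inr_ne_inl

theorem Homeo.smoothsTo_iff {N : FramedGraph} (h : Homeo G G') :
    SmoothsTo G N ↔ SmoothsTo G' N := by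
  induction h with
  | rel _ _ h => exact h.smoothsTo_iff
  | refl => rfl
  | symm _ _ _ ih => exact ih.symm
  | trans _ _ _ _ _ ih ih' => exact ih.trans ih'

theorem SmoothsTo.addCircle {N : FramedGraph} (h : SmoothsTo G N) : SmoothsTo G.addCircle N := by
  obtain ⟨σ, hσ⟩ := h
  let m := G.addCircleMap
  refine ⟨σ.push m, ((sameCore_addCircle σ.graph).trans (Homeo.sameCore ?_)).symm.trans hσ⟩
  refine .rel _ _ (.iso _ _ (Equiv.refl _) ((Equiv.refl _).subtypeEquiv fun v => ?_)
    (fun _ => rfl) ?_ fun v i => ⟨i, rfl⟩)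
  · exact not_congr ((Equiv.refl _).injective.mem_set_image).symm
  · rintro (h | b)
    · exact (σ.push_op_map m h).symm
    · exact (σ.push_op_of_notMem m fun k => Sum.inl_ne_inr).symm

/-- If an involution `θ` of the half-edges at the vertices in `S` preserves the edges and changes
the opposite half-edges, then removing `S` is a smoothing. -/
theorem SmoothsTo.of_erase {N : FramedGraph} {S : Set G.Vert} (θ : G.Half → G.Half)
    (hθ : ∀ h, θ (θ h) = h) (h_edge : ∀ h, θ (G.edge h) = G.edge (θ h))
    (h_off : ∀ h, (∀ v ∈ S, ∀ i, h ≠ G.half (v, i)) → θ h = h)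
    (h_half : ∀ v ∈ S, ∀ i, ∃ i', θ (G.half (v, i)) = G.half (v, i'))
    (h_ne : ∀ v ∈ S, ∀ i, θ (G.opp (θ (G.half (v, i)))) ≠ G.opp (G.half (v, i)))
    (h : SmoothsTo (G.erase S) N) : SmoothsTo G N := by
  obtain ⟨σ, hσ⟩ := h
  have hmem : ∀ v : {v // v ∉ S}, ∀ i, θ (G.half (v.1, i)) = G.half (v.1, i) := fun v i =>
    h_off _ (half_ne_of_not_mem v.2 i)
  -- In the erased graph the points of `S` are not vertices, so `σ` goes straight there.
  have hS : ∀ v ∈ S, ∀ i, σ.op (G.half (v, i)) = G.opp (G.half (v, i)) := fun v hv i =>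
    σ.op_of_forall_ne _ fun w _ i' => half_ne_of_not_mem (S := {v}ᶜ) (by simp) i w.1
      (fun e => w.2 (e ▸ hv)) i'
  let τ : G.Smoothing :=
    -- This is the union of `S` with the vertices smoothed by `σ`. Conjugating by `θ` makes `θ` an
    -- isomorphism between the two smoothed graphs.
    { set := {v | ∀ hv : v ∉ S, (⟨v, hv⟩ : {v // v ∉ S}) ∈ σ.set}
      op := fun h => θ (σ.op (θ h))
      op_op := fun h => (congrArg θ ((congrArg σ.op (hθ _)).trans (σ.op_op _))).trans (hθ h)
      op_ne := fun h e => σ.op_ne (θ h) (by rw [← hθ (σ.op (θ h)), e])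
      op_of_forall_ne := fun h hh => by
        have h1 : ∀ v ∈ S, ∀ i, h ≠ G.half (v, i) := fun v hv => hh v fun hv' => absurd hv hv'
        rw [h_off h h1, σ.op_of_forall_ne h fun v hv i => hh v.1 (fun _ => hv) i]
        refine h_off _ fun v hv i e => h1 v hv (i.1, !i.2) ?_
        rw [← G.opp_half, ← e]
        exact (G.opp_opp h).symm
      op_half := fun v hv i => by
        by_cases hvS : v ∈ S
        · obtain ⟨i1, h1⟩ := h_half v hvS i
          obtain ⟨i2, h2⟩ := h_half v hvS (i1.1, !i1.2)
          exact ⟨i2, by rw [h1, hS v hvS, ← h2, ← G.opp_half]⟩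
        · obtain ⟨i1, h1⟩ := σ.op_half _ (hv hvS) i
          refine ⟨i1, ?_⟩
          rw [hmem ⟨v, hvS⟩]
          exact (congrArg θ h1).trans (hmem ⟨v, hvS⟩ i1)
      op_half_ne := fun v hv i => by
        by_cases hvS : v ∈ S
        · obtain ⟨i1, h1⟩ := h_half v hvS i
          have := h_ne v hvS i
          rwa [h1, ← hS v hvS, ← h1] at this
        · obtain ⟨i1, h1⟩ := σ.op_half _ (hv hvS) i
          rw [hmem ⟨v, hvS⟩]
          have h2 := σ.op_half_ne _ (hv hvS) i
          intro e
          refine h2 (Eq.trans ?_ e)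
          exact h1.trans ((hmem ⟨v, hvS⟩ i1).symm.trans (congrArg θ h1).symm) }
  refine ⟨τ, (Homeo.sameCore ?_).trans hσ⟩
  have e1 : ∀ v : {v : G.Vert // v ∉ τ.set}, v.1 ∉ S := fun v hv => v.2 fun hv' => absurd hv hv'
  refine .rel _ _ (.iso _ _ (Function.Involutive.toPerm θ hθ)
    ⟨fun v => ⟨⟨v.1, e1 v⟩, fun h => v.2 fun _ => h⟩, fun v => ⟨v.1.1, fun h => v.2 (h v.1.2)⟩,
      fun _ => rfl, fun _ => rfl⟩ h_edge ?_ ?_)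
  · intro h
    exact hθ (σ.op (θ h))
  · intro v i
    exact ⟨i, hmem ⟨v.1, e1 v⟩ i⟩

open Classical in
theorem swap_half (v w : G.Vert) (s b b' : Bool) (i : Bool × Bool) :
    Equiv.swap (G.half (v, s, b)) (G.half (v, !s, b')) (G.half (w, i)) =
      G.half (w, if v = w then Equiv.swap (s, b) (!s, b') i else i) := by
  rw [Function.Embedding.swap_apply]
  congr 1
  by_cases h : v = w
  · subst h
    rw [if_pos rfl, Equiv.swap_apply_def, Equiv.swap_apply_def]
    obtain ⟨t, c⟩ := i
    simp only [Prod.mk.injEq, true_and]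
    split_ifs <;> rfl
  · rw [if_neg h, Equiv.swap_apply_of_ne_of_ne] <;>
    · intro e
      exact h (Prod.ext_iff.1 e).1.symm

/-- Conjugation of the passage to the opposite half-edge by a transposition across the two strands
joins each half-edge to one of the other strand: it turns going straight into a smoothing. -/
theorem swap_flip_ne : ∀ (s b b' : Bool) (i : Bool × Bool),
    Equiv.swap (s, b) (!s, b') ((Equiv.swap (s, b) (!s, b') i).1,
      !(Equiv.swap (s, b) (!s, b') i).2) ≠ (i.1, !i.2) := by
  decide

open Classical in
-- Going straight through a loop and running through it backwards give the same curve up to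
-- homeomorphism, and the latter is a smoothing of the vertex. For a bigon, each strand can take the
-- other side between the two vertices, which are then both smoothed.
theorem SmoothsTo.of_decreases {N : FramedGraph} {j : Version} (h : Decreases j G G')
    (h' : SmoothsTo G' N) : SmoothsTo G N := by
  cases h with
  | first _ v h =>
    obtain ⟨b, b', h⟩ := h
    have hs := fun w i => swap_half (G := G) v w false b b' i
    rw [Bool.not_false] at hs
    -- The involution exchanges the two ends of the loop, and so commutes with `edge`.
    refine h'.of_erase (Equiv.swap (G.half (v, false, b)) (G.half (v, true, b')))
      (fun _ => Equiv.swap_apply_self _ _ _) ?_ ?_ ?_ ?_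
    · intro k
      have h2 : G.edge (G.half (v, true, b')) = G.half (v, false, b) := by rw [← h, G.edge_edge]
      rw [Equiv.swap_apply_def, Equiv.swap_apply_def, edge_eq_comm, edge_eq_comm, h, h2]
      split_ifs with h3 h4 h4
      · exact absurd (h.trans (h3.symm.trans h4)) (G.edge_ne _)
      · exact h.symm
      · exact h2.symm
      · rfl
    · intro k hk
      exact Equiv.swap_apply_of_ne_of_ne (hk v rfl _) (hk v rfl _)
    · intro w _ i
      exact ⟨_, hs w i⟩
    · rintro w rfl ⟨s, c⟩
      rw [hs, if_pos rfl, ← Prod.mk.eta (p := Equiv.swap _ _ _), G.opp_half, hs, if_pos rfl, G.opp_half]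
      exact fun e => swap_flip_ne false b b' (s, c) (Prod.ext_iff.1 (G.half.injective e)).2
  | second _ _ v w h =>
    obtain ⟨hne, s, b, b', d, d', h1, h2⟩ := h
    have h1' : G.edge (G.half (w, s, b')) = G.half (v, false, b) := by rw [← h1, G.edge_edge]
    have h2' : G.edge (G.half (w, !s, d')) = G.half (v, true, d) := by rw [← h2, G.edge_edge]
    have hs := fun u i => swap_half (G := G) v u false b d i
    have hs' := fun u i => swap_half (G := G) w u s b' d' i
    rw [Bool.not_false] at hs
    have hsv : ∀ i, (Equiv.swap (G.half (v, false, b)) (G.half (v, true, d)))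
        (Equiv.swap (G.half (w, s, b')) (G.half (w, !s, d')) (G.half (v, i))) =
        G.half (v, Equiv.swap (false, b) (true, d) i) := by
      intro i
      rw [hs', if_neg hne.symm, hs, if_pos rfl]
    have hsw : ∀ i, (Equiv.swap (G.half (v, false, b)) (G.half (v, true, d)))
        (Equiv.swap (G.half (w, s, b')) (G.half (w, !s, d')) (G.half (w, i))) =
        G.half (w, Equiv.swap (s, b') (!s, d') i) := by
      intro i
      rw [hs', if_pos rfl, hs, if_neg hne]
    have hoff : ∀ k, (∀ u ∈ ({v, w} : Set G.Vert), ∀ i, k ≠ G.half (u, i)) →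
        (Equiv.swap (G.half (v, false, b)) (G.half (v, true, d)))
        (Equiv.swap (G.half (w, s, b')) (G.half (w, !s, d')) k) = k := by
      intro k hk
      rw [Equiv.swap_apply_of_ne_of_ne (hk w (Or.inr rfl) _) (hk w (Or.inr rfl) _),
        Equiv.swap_apply_of_ne_of_ne (hk v (Or.inl rfl) _) (hk v (Or.inl rfl) _)]
    have hcases : ∀ k, (∀ u ∈ ({v, w} : Set G.Vert), ∀ i, k ≠ G.half (u, i)) ∨
        (∃ i, k = G.half (v, i)) ∨ ∃ i, k = G.half (w, i) := by
      intro k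
      by_contra hk
      push Not at hk
      obtain ⟨⟨u, rfl | rfl, i, hi⟩, hk1, hk2⟩ := hk
      · exact hk1 i hi
      · exact hk2 i hi
    refine h'.of_erase (fun k => (Equiv.swap (G.half (v, false, b)) (G.half (v, true, d)))
        (Equiv.swap (G.half (w, s, b')) (G.half (w, !s, d')) k)) ?_ ?_ hoff ?_ ?_
    · intro k
      rcases hcases k with hk | ⟨i, rfl⟩ | ⟨i, rfl⟩
      · simp only [hoff k hk]
      · simp only [hsv, Equiv.swap_apply_self]
      · simp only [hsw, Equiv.swap_apply_self]
    · intro k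
      -- The two sides of the bigon carry the transposition at `w` to that at `v`; the product of
      -- both therefore commutes with `edge`.
      have e1 : ∀ z, Equiv.swap (G.half (v, false, b)) (G.half (v, true, d)) (G.edge z) =
          G.edge (Equiv.swap (G.half (w, s, b')) (G.half (w, !s, d')) z) := by
        intro z
        rw [Equiv.swap_apply_def, Equiv.swap_apply_def, edge_eq_comm, edge_eq_comm, h1, h2]
        split_ifs
        · exact h2'.symm
        · exact h1'.symm
        · rfl
      have e2 : ∀ z, Equiv.swap (G.half (w, s, b')) (G.half (w, !s, d')) (G.edge z) =
          G.edge (Equiv.swap (G.half (v, false, b)) (G.half (v, true, d)) z) := by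
        intro z
        apply edge_inj.1
        rw [← e1, G.edge_edge, G.edge_edge]
      have hc : ∀ z, Equiv.swap (G.half (v, false, b)) (G.half (v, true, d))
          (Equiv.swap (G.half (w, s, b')) (G.half (w, !s, d')) z) =
          Equiv.swap (G.half (w, s, b')) (G.half (w, !s, d'))
          (Equiv.swap (G.half (v, false, b)) (G.half (v, true, d)) z) := by
        intro z
        rcases hcases z with hk | ⟨i, rfl⟩ | ⟨i, rfl⟩
        · rw [hoff z hk, Equiv.swap_apply_of_ne_of_ne (hk v (Or.inl rfl) _) (hk v (Or.inl rfl) _),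
            Equiv.swap_apply_of_ne_of_ne (hk w (Or.inr rfl) _) (hk w (Or.inr rfl) _)]
        · rw [hsv, hs, if_pos rfl, hs', if_neg hne.symm]
        · rw [hsw, hs, if_neg hne, hs', if_pos rfl]
      simp only [e2, e1, hc]
    · rintro u (rfl | rfl) i
      · exact ⟨_, hsv i⟩
      · exact ⟨_, hsw i⟩
    · rintro u (rfl | rfl) ⟨t, c⟩
      · rw [hsv, ← Prod.mk.eta (p := Equiv.swap _ _ _), G.opp_half, hsv, G.opp_half]
        exact fun e => swap_flip_ne false b d (t, c) (Prod.ext_iff.1 (G.half.injective e)).2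
      · rw [hsw, ← Prod.mk.eta (p := Equiv.swap _ _ _), G.opp_half, hsw, G.opp_half]
        exact fun e => swap_flip_ne s b' d' (t, c) (Prod.ext_iff.1 (G.half.injective e)).2

theorem Reduces.smoothsTo {j : Version} {N : FramedGraph} (h : Reduces j G N) : SmoothsTo G N := by
  induction h with
  | refl G => exact smoothsTo_refl G
  | homeo h _ ih => exact h.smoothsTo_iff.2 ih
  | decreases h _ ih => exact .of_decreases h ih
  | circle _ _ ih => exact ih.addCircle

/-- Exchange of the last two summands. -/
def sumSwap {α β : Type} : (α ⊕ β) ⊕ β ≃ (α ⊕ β) ⊕ β where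
  toFun := Sum.elim (Sum.map Sum.inl id) fun b => Sum.inl (Sum.inr b)
  invFun := Sum.elim (Sum.map Sum.inl id) fun b => Sum.inl (Sum.inr b)
  left_inv := by rintro ((_ | _) | _) <;> rfl
  right_inv := by rintro ((_ | _) | _) <;> rfl

theorem HomeoStep.addCircle (h : HomeoStep G G') : Homeo G.addCircle G'.addCircle := by
  cases h with
  | iso _ e g edge_eq opp_eq half_eq =>
    refine .rel _ _ (.iso _ _ (Equiv.sumCongr e (Equiv.refl _)) g ?_ ?_ ?_)
    · rintro (h | b)
      · exact congrArg Sum.inl (edge_eq h)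
      · rfl
    · rintro (h | b)
      · exact congrArg Sum.inl (opp_eq h)
      · rfl
    · intro v i
      obtain ⟨i', h⟩ := half_eq v i
      exact ⟨i', congrArg Sum.inl h⟩
  | subdivide h =>
    refine .trans _ (G.addCircle.subdivide (Sum.inl h)) _ (.rel _ _ (.subdivide _ _))
      (.symm _ _ (.rel _ _ ?_))
    refine .iso _ _ sumSwap (Equiv.refl _) ?_ ?_
      fun v i => ⟨i, rfl⟩
    · have key : ∀ {x y}, (G.subdivide h).edge x = y →
          sumSwap ((G.subdivide h).addCircle.edge (Sum.inl x)) = sumSwap (Sum.inl y) := by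
        rintro x _ rfl
        rfl
      rintro ((k | b) | b)
      · by_cases h1 : k = h
        · subst h1
          exact (key (subdivide_edge_self k)).trans
            (subdivide_edge_self (G := G.addCircle) (Sum.inl k)).symm
        · by_cases h2 : k = G.edge h
          · subst h2
            exact (key (subdivide_edge_edge h)).trans
              (subdivide_edge_edge (G := G.addCircle) (Sum.inl h)).symm
          · exact (key (subdivide_edge_of_ne h1 h2)).trans
              (subdivide_edge_of_ne (G := G.addCircle) (fun e => h1 (Sum.inl_injective e))
                fun e => h2 (Sum.inl_injective e)).symm
      · cases b <;> rfl
      · exact (subdivide_edge_of_ne (G := G.addCircle) Sum.inr_ne_inl Sum.inr_ne_inl).symm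
    · rintro ((k | b) | b) <;> rfl

theorem Homeo.addCircle (h : Homeo G G') : Homeo G.addCircle G'.addCircle := by
  induction h with
  | rel _ _ h => exact h.addCircle
  | refl => exact .refl _
  | symm _ _ _ ih => exact ih.symm
  | trans _ _ _ _ _ ih ih' => exact ih.trans _ _ _ ih'

theorem Homeo.addCircle_iterate (h : Homeo G G') (m : ℕ) :
    Homeo (FramedGraph.addCircle^[m] G) (FramedGraph.addCircle^[m] G') := by
  induction m generalizing G G' with
  | zero => exact h
  | succ m ih => exact ih h.addCircle

/-- Circles added in the middle of a chain are moved to its ends: for transitivity each of the two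
homeomorphisms receives the circles of the other. -/
theorem SameCore.homeoUpToCircles (h : SameCore G G') : HomeoUpToCircles G G' := by
  induction h with
  | rel _ _ h =>
    cases h with
    | homeo h => exact ⟨0, 0, .rel _ _ h⟩
    | circle => exact ⟨1, 0, .refl _⟩
  | refl => exact ⟨0, 0, .refl _⟩
  | symm _ _ _ ih =>
    obtain ⟨m, n, h⟩ := ih
    exact ⟨n, m, .symm _ _ h⟩
  | trans a b c _ _ ih ih' =>
    obtain ⟨m, n, h⟩ := ih
    obtain ⟨m', n', h'⟩ := ih'
    refine ⟨m' + m, n + n', ?_⟩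
    have h1 := h.addCircle_iterate m'
    have h2 := h'.addCircle_iterate n
    simp only [← Function.iterate_add_apply] at h1 h2
    rw [Nat.add_comm m' n] at h1
    exact .trans _ _ _ h1 h2

end FramedGraph
end

/-! ### Coefficients of irreducible graphs, and minimality from invariance -/

noncomputable section

open FramedGraph

theorem FramedGraph.Homeo.toClass_eq {G G' : FramedGraph} (h : Homeo G G') :
    G.toClass = G'.toClass := Quot.eqvGen_sound h

theorem FramedGraph.toClass_surjective : Function.Surjective FramedGraph.toClass :=
  Quot.mk_surjective

theorem FramedGraph.related_refl (j : Version) (G : FramedGraph) : Related j G G :=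
  Homeo.related j (.refl G)

namespace LinkDiagram.State

variable {L : LinkDiagram}

/-- A matching between the two strands of a crossing either reverses the direction at all four
half-edges or keeps it at all of them: these are the oriented and the unoriented smoothing, and
there is no third one. -/
theorem bool_matching : ∀ γ : Bool → Bool → Bool, (∀ t b, γ (!t) (γ t b) = b) →
    (γ true true = false → ∀ t b, γ t b = !b) ∧ (γ true true ≠ false → ∀ t b, γ t b = b) := by
  decide

open Classical in
/-- Smoothing some of the vertices of a state gives a state. -/
theorem exists_eq_smoothing (s : L.State) (σ : (graph s).Smoothing) :
    ∃ s' : L.State, Homeo σ.graph (graph s') := by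
  -- The partner is neither the half-edge itself nor the opposite one, so it lies on the other
  -- strand of the crossing.
  have hβ : ∀ (v : (graph s).Vert), v ∈ σ.set → ∀ t b, ∃ b',
      σ.op (L.pos (v.1, t), b) = (L.pos (v.1, !t), b') := by
    intro v hv t b
    obtain ⟨⟨t', b'⟩, h⟩ := σ.op_half v hv (t, b)
    have h1 := σ.op_ne ((graph s).half (v, t, b))
    have h2 := σ.op_half_ne v hv (t, b)
    rw [(graph s).opp_half] at h2
    rw [h] at h1 h2
    by_cases ht : t' = t
    · subst ht
      by_cases hb : b' = b
      · exact absurd (by rw [hb]) h1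
      · exact absurd (by rw [show b' = !b by revert hb; cases b <;> cases b' <;> simp]) h2
    · obtain rfl : t' = !t := by revert ht; cases t <;> cases t' <;> simp
      exact ⟨b', h⟩
  choose! β hβ using hβ
  let s' : L.State := fun c =>
    if hc : s c = Resolution.vertex then
      if (⟨c, hc⟩ : (graph s).Vert) ∈ σ.set then
        if β ⟨c, hc⟩ true true = false then Resolution.oriented else Resolution.unoriented
      else Resolution.vertex
    else s c
  have hs : ∀ v : (graph s).Vert, v ∉ σ.set ↔ s' v.1 = Resolution.vertex := by
    rintro ⟨c, hc⟩
    by_cases hv : (⟨c, hc⟩ : (graph s).Vert) ∈ σ.set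
    · by_cases hb : β ⟨c, hc⟩ true true = false
      · simp [s', hc, hv, hb]
        exact hv
      · simp [s', hc, hv, hb]
        exact hv
    · simp [s', hc, hv]
      exact hv
  have hs' : ∀ c, s' c = Resolution.vertex → s c = Resolution.vertex := by
    intro c hc
    by_contra h
    simp only [s', h, dite_false] at hc
  refine ⟨s', .rel _ _ (.iso _ _ (Equiv.refl _)
    ⟨fun v => ⟨v.1.1, (hs v.1).1 v.2⟩,
      fun c => ⟨⟨c.1, hs' _ c.2⟩, (hs ⟨c.1, hs' _ c.2⟩).2 c.2⟩, fun _ => rfl, fun _ => rfl⟩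
    (fun _ => rfl) ?_ fun v i => ⟨i, rfl⟩)⟩
  rintro ⟨p, b⟩
  change σ.op (p, b) = opp s' (p, b)
  by_cases hp : p ∈ Set.range L.pos
  · obtain ⟨⟨c, t⟩, rfl⟩ := hp
    rw [opp_pos]
    by_cases hc : s c = Resolution.vertex
    · by_cases hv : (⟨c, hc⟩ : (graph s).Vert) ∈ σ.set
      · have h1 : ∀ t b, β ⟨c, hc⟩ (!t) (β ⟨c, hc⟩ t b) = b := by
          intro t b
          have h := σ.op_op (L.pos (c, t), b)
          rw [hβ ⟨c, hc⟩ hv, hβ ⟨c, hc⟩ hv] at h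
          exact (Prod.ext_iff.1 h).2
        rw [hβ ⟨c, hc⟩ hv]
        obtain ⟨h2, h3⟩ := bool_matching _ h1
        by_cases hb : β ⟨c, hc⟩ true true = false
        · have hsc : s' c = Resolution.oriented := by simp [s', hc, hv, hb]
          rw [hsc, h2 hb]
        · have hsc : s' c = Resolution.unoriented := by simp [s', hc, hv, hb]
          rw [hsc, h3 hb]
      · have hsc : s' c = Resolution.vertex := by simp [s', hc, hv]
        rw [hsc]
        exact (σ.op_eq_opp hv (t, b)).trans ((graph s).opp_half ⟨c, hc⟩ t b)
    · have hsc : s' c = s c := by simp [s', hc]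
      rw [hsc, ← opp_pos]
      refine σ.op_of_forall_ne (L.pos (c, t), b) fun v _ i e => hc ?_
      obtain ⟨rfl, -⟩ := Prod.ext_iff.1 (L.pos.injective (Prod.ext_iff.1 e).1)
      exact v.2
  · rw [opp_marked s' p hp, ← opp_marked s p hp]
    exact σ.op_of_forall_ne (p, b) fun v _ i e => hp ⟨_, (Prod.ext_iff.1 e).1.symm⟩

theorem vertexNumber_graph_le (s : L.State) : (graph s).vertexNumber ≤ L.crossingNumber :=
  Finite.card_subtype_le _

theorem exists_smoothing {N : FramedGraph} (s : L.State) (h : SmoothsTo (graph s) N) :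
    ∃ s' : L.State, SameCore (graph s') N := by
  obtain ⟨σ, hσ⟩ := h
  obtain ⟨s', h⟩ := exists_eq_smoothing s σ
  exact ⟨s', h.sameCore.symm.trans hσ⟩

theorem eq_vertex_of_vertexNumber (s : L.State) (h : L.crossingNumber ≤ (graph s).vertexNumber) :
    s = fun _ => Resolution.vertex := by
  by_contra hs
  obtain ⟨c, hc⟩ := Function.ne_iff.1 hs
  exact absurd h (not_le.2 (Finite.card_subtype_lt (x := c) hc))

end LinkDiagram.State

namespace GraphModule

variable {X : Type u} [Biquandle X]

open Classical in
/-- The coefficient at an irreducible graph `G` of the class of a graph. -/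
def coeffClass (j : Version) (X : Type u) [Biquandle X] (G : FramedGraph) :
    GraphClass → SkeinRing j X :=
  Quot.lift (fun H => if Related j H G then
    SkeinRing.mk j SkeinPoly.δ ^ (H.circuitNumber - G.circuitNumber) else 0) (by
    intro H H' h
    have h' : Homeo H H' := .rel _ _ h
    have e : Related j H G ↔ Related j H' G :=
      ⟨(h'.related j).symm.trans, (h'.related j).trans⟩
    simp only [e, h'.circuitNumber_eq])

theorem coeffClass_of_related {j : Version} {G H : FramedGraph} (h : Related j H G) :
    coeffClass j X G H.toClass =
      SkeinRing.mk j SkeinPoly.δ ^ (H.circuitNumber - G.circuitNumber) := if_pos h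

theorem coeffClass_of_not_related {j : Version} {G H : FramedGraph} (h : ¬ Related j H G) :
    coeffClass j X G H.toClass = 0 := if_neg h

/-- The linear form vanishes on the relations. A decreasing move changes neither relatedness to `G`
nor the number of circuits, and a circle raises the exponent by one, which is multiplication by `δ`.
-/
theorem linearCombination_coeffClass_eq {j : Version} {G : FramedGraph} (h1 : G.Irreducible j)
    (h2 : G.IsReduced) {a b : GraphClass →₀ SkeinRing j X}
    (h : (Submodule.Quotient.mk a : GraphModule j X) = Submodule.Quotient.mk b) :
    Finsupp.linearCombination _ (coeffClass j X G) a =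
      Finsupp.linearCombination _ (coeffClass j X G) b := by
  rw [Submodule.Quotient.eq] at h
  rw [← sub_eq_zero, ← map_sub, ← LinearMap.mem_ker]
  revert h
  generalize a - b = c
  intro h
  refine (Submodule.span_le.2 ?_ : graphRelations j X ≤ _) h
  rintro _ (⟨H, H', hd, rfl⟩ | ⟨H, hne, rfl⟩)
  · have e : Related j H G ↔ Related j H' G := ⟨hd.related.symm.trans, hd.related.trans⟩
    rw [SetLike.mem_coe, LinearMap.mem_ker, map_sub, Finsupp.linearCombination_single,
      Finsupp.linearCombination_single, one_smul, one_smul, sub_eq_zero]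
    by_cases hr : Related j H G
    · rw [coeffClass_of_related hr, coeffClass_of_related (e.1 hr), hd.circuitNumber_eq]
    · rw [coeffClass_of_not_related hr, coeffClass_of_not_related fun h => hr (e.2 h)]
  · have hd := related_addCircle j hne
    have e : Related j H G ↔ Related j H.addCircle G := ⟨hd.symm.trans, hd.trans⟩
    rw [SetLike.mem_coe, LinearMap.mem_ker, map_sub, Finsupp.linearCombination_single,
      Finsupp.linearCombination_single, one_smul, sub_eq_zero]
    by_cases hr : Related j H G
    · have hle := hr.circuitNumber_le h1 h2
      rw [coeffClass_of_related hr, coeffClass_of_related (e.1 hr), circuitNumber_addCircle,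
        Nat.sub_add_comm hle, pow_succ', smul_eq_mul]
    · rw [coeffClass_of_not_related hr, coeffClass_of_not_related fun h => hr (e.2 h), smul_zero]

/-- By uniqueness of normal forms, no other graph of an irreducible expansion is related to `G`; at
`G` itself the exponent is zero. -/
theorem linearCombination_coeffClass_of_forall {j : Version} {G : FramedGraph}
    {a : GraphClass →₀ SkeinRing j X} (ha : a G.toClass ≠ 0)
    (h : ∀ H : FramedGraph, a H.toClass ≠ 0 → H.Irreducible j ∧ H.IsReduced) :
    Finsupp.linearCombination _ (coeffClass j X G) a = a G.toClass := by
  classical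
  obtain ⟨h1, h2⟩ := h G ha
  rw [Finsupp.linearCombination_apply, Finsupp.sum, Finset.sum_eq_single G.toClass]
  · rw [coeffClass_of_related (related_refl j G), Nat.sub_self, pow_zero, smul_eq_mul, mul_one]
  · intro c hc hne
    obtain ⟨H, rfl⟩ := FramedGraph.toClass_surjective c
    obtain ⟨h3, h4⟩ := h H (Finsupp.mem_support_iff.1 hc)
    rw [coeffClass_of_not_related, smul_zero]
    intro hr
    exact hne (hr.homeo h3 h4 h1 h2).toClass_eq
  · intro hn
    rw [Finsupp.notMem_support_iff.1 hn, zero_smul]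

end GraphModule

namespace Coloring

variable {L : LinkDiagram} {X : Type u} [Biquandle X]

/-- The coefficient of `G` is a sum over states in which only states related to `G` contribute; as
it is non-zero, there must be one. -/
theorem exists_state_related {j : Version} (f : Coloring L X) {G : FramedGraph}
    {a : GraphClass →₀ SkeinRing j X} (hf : Submodule.Quotient.mk a = f.bracket j)
    (ha : a G.toClass ≠ 0)
    (h : ∀ H : FramedGraph, a H.toClass ≠ 0 → H.Irreducible j ∧ H.IsReduced) :
    ∃ s : L.State, Related j (LinkDiagram.State.graph s) G := by
  classical
  obtain ⟨h1, h2⟩ := h G ha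
  have e := GraphModule.linearCombination_coeffClass_eq h1 h2 hf
  rw [GraphModule.linearCombination_coeffClass_of_forall ha h] at e
  have : Finite Resolution := Finite.of_injective
    (fun r : Resolution => match r with
      | .vertex => (0 : Fin 3) | .oriented => 1 | .unoriented => 2)
    (by rintro (_ | _ | _) (_ | _ | _) h <;> simp at h <;> rfl)
  have := Fintype.ofFinite L.State
  rw [finsum_eq_sum_of_fintype, map_sum] at e
  rw [e] at ha
  obtain ⟨s, -, hs⟩ := Finset.exists_ne_zero_of_sum_ne_zero ha
  refine ⟨s, ?_⟩
  by_contra hr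
  rw [Finsupp.linearCombination_single, GraphModule.coeffClass_of_not_related hr, smul_zero] at hs
  exact hs rfl

end Coloring

namespace LinkDiagram

/-- The colourings of the two diagrams have the same brackets. -/
def SameBrackets (j : Version) (X : Type u) [Biquandle X] (L L' : LinkDiagram) : Prop :=
  (∀ f : Coloring L X, ∃ f' : Coloring L' X, f'.bracket j = f.bracket j) ∧
    ∀ f : Coloring L' X, ∃ f' : Coloring L X, f'.bracket j = f.bracket j

namespace SameBrackets

variable {j : Version} {X : Type u} [Biquandle X] {L L' L'' : LinkDiagram}

theorem refl (L : LinkDiagram) : SameBrackets j X L L := ⟨fun f => ⟨f, rfl⟩, fun f => ⟨f, rfl⟩⟩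

theorem symm (h : SameBrackets j X L L') : SameBrackets j X L' L := ⟨h.2, h.1⟩

theorem trans (h : SameBrackets j X L L') (h' : SameBrackets j X L' L'') :
    SameBrackets j X L L'' := by
  constructor
  · intro f
    obtain ⟨f', e⟩ := h.1 f
    obtain ⟨f'', e'⟩ := h'.1 f'
    exact ⟨f'', e'.trans e⟩
  · intro f
    obtain ⟨f', e⟩ := h'.2 f
    obtain ⟨f'', e'⟩ := h.2 f'
    exact ⟨f'', e'.trans e⟩

end SameBrackets

theorem Equivalent.sameBrackets_of_step {j : Version} {X : Type u} [Biquandle X]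
    {L L' : LinkDiagram} (hstep : ∀ {L L' : LinkDiagram}, Step L L' → SameBrackets j X L L')
    (h : L.Equivalent L') : SameBrackets j X L L' := by
  induction h with
  | rel _ _ h => exact hstep h
  | refl => exact .refl _
  | symm _ _ _ ih => exact ih.symm
  | trans _ _ _ _ _ ih ih' => exact ih.trans ih'

end LinkDiagram

/-- All consequences of invariance. The relation between a state and `G` is turned into a chain of
reductions, which bounds the number of vertices; the same chain, read as a sequence of smoothings,
yields the state of `L'`. -/
theorem Coloring.IsLeadingTerm.minimal {X : Type u} [Biquandle X] {j : Version} {L : LinkDiagram}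
    {f : Coloring L X} {G : FramedGraph} (hG : f.IsLeadingTerm j G)
    (hinv : ∀ {L' : LinkDiagram}, L.Equivalent L' → LinkDiagram.SameBrackets j X L L') :
    (∀ L' : LinkDiagram, L.Equivalent L' → G.vertexNumber ≤ L'.crossingNumber) ∧
    (G.vertexNumber = L.crossingNumber →
      ∀ L' : LinkDiagram, L.Equivalent L' →
        ∃ s : L'.State, (LinkDiagram.State.graph s).HomeoUpToCircles L.shadow) := by
  obtain ⟨a, ⟨hf, ha⟩, haG, -⟩ := hG
  obtain ⟨h1, h2⟩ := ha G haG
  have key : ∀ {L' : LinkDiagram}, L.Equivalent L' → ∃ (s : L'.State) (N : FramedGraph),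
      Reduces j (LinkDiagram.State.graph s) N ∧ Homeo N G := by
    intro L' hL'
    obtain ⟨f', hf'⟩ := (hinv hL').1 f
    obtain ⟨s, hs⟩ := f'.exists_state_related (hf.trans hf'.symm) haG ha
    exact ⟨s, hs.exists_reduces h1 h2⟩
  refine ⟨fun L' hL' => ?_, fun hn L' hL' => ?_⟩
  · obtain ⟨s, N, hN, hN'⟩ := key hL'
    rw [← hN'.vertexNumber_eq]
    exact hN.vertexNumber_le.trans s.vertexNumber_graph_le
  · obtain ⟨s, N, hN, hN'⟩ := key (.refl L)
    have hv : N.vertexNumber = L.crossingNumber := hN'.vertexNumber_eq.trans hn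
    -- The state of `L` reduces to a graph with as many vertices as `L` has crossings, so it smooths
    -- nothing and the reduction loses no vertex.
    have hs := s.eq_vertex_of_vertexNumber (hv ▸ hN.vertexNumber_le)
    have e1 : SameCore L.shadow G := by
      have := (hN.sameCore (hv ▸ s.vertexNumber_graph_le)).trans hN'.sameCore
      rw [hs] at this
      exact this
    obtain ⟨s', N', hN1, hN2⟩ := key hL'
    obtain ⟨s'', hs''⟩ := s'.exists_smoothing hN1.smoothsTo
    exact ⟨s'', ((hs''.trans hN2.sameCore).trans e1.symm).homeoUpToCircles⟩

end

/-! ### Tangles and their gluing -/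

noncomputable section

open FramedGraph

/-- A part of a four-valent graph with a cross structure, with open ends indexed by `P`; the end
of the edge at the port `p` is `Sum.inl p`. -/
structure Tangle (P : Type) where
  Loc : Type
  Vert : Type
  finite_loc : Finite Loc
  finite_vert : Finite Vert
  edge : P ⊕ Loc → P ⊕ Loc
  edge_edge : ∀ h, edge (edge h) = h
  edge_ne : ∀ h, edge h ≠ h
  opp : Loc → Loc
  opp_opp : ∀ h, opp (opp h) = h
  opp_ne : ∀ h, opp h ≠ h
  half : Vert × Bool × Bool ↪ Loc
  opp_half : ∀ v s b, opp (half (v, s, b)) = half (v, s, !b)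

namespace Tangle

variable {P : Type}

instance (T : Tangle P) : Finite T.Loc := T.finite_loc

instance (T : Tangle P) : Finite T.Vert := T.finite_vert

/-- The opposite half-edge in a union of two tangles. -/
def glueOpp (O T : Tangle P) : (P ⊕ O.Loc) ⊕ (P ⊕ T.Loc) → (P ⊕ O.Loc) ⊕ (P ⊕ T.Loc)
  | .inl (.inl p) => .inr (.inl p)
  | .inr (.inl p) => .inl (.inl p)
  | .inl (.inr l) => .inl (.inr (O.opp l))
  | .inr (.inr l) => .inr (.inr (T.opp l))

/-- The half-edges at the vertices of a union of two tangles. -/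
def glueHalf (O T : Tangle P) : (O.Vert ⊕ T.Vert) × Bool × Bool → (P ⊕ O.Loc) ⊕ (P ⊕ T.Loc)
  | (.inl v, i) => .inl (.inr (O.half (v, i)))
  | (.inr v, i) => .inr (.inr (T.half (v, i)))

/-- The union of two tangles along the ports, which become 2-valent nodes. -/
def glue [Finite P] (O T : Tangle P) : FramedGraph where
  Half := (P ⊕ O.Loc) ⊕ (P ⊕ T.Loc)
  Vert := O.Vert ⊕ T.Vert
  finite_half := inferInstance
  finite_vert := inferInstance
  edge := Sum.map O.edge T.edge
  edge_edge := by rintro (h | h) <;> simp [O.edge_edge, T.edge_edge]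
  edge_ne := by rintro (h | h) <;> simp [O.edge_ne, T.edge_ne]
  opp := glueOpp O T
  opp_opp := by rintro ((p | l) | (p | l)) <;> simp [glueOpp, O.opp_opp, T.opp_opp]
  opp_ne := by rintro ((p | l) | (p | l)) <;> simp [glueOpp, O.opp_ne, T.opp_ne]
  half := ⟨glueHalf O T, by
    rintro ⟨v | v, i⟩ ⟨w | w, i'⟩ h
    · have := O.half.injective (Sum.inr_injective (Sum.inl_injective h))
      simp_all
    · cases h
    · cases h
    · have := T.half.injective (Sum.inr_injective (Sum.inr_injective h))
      simp_all⟩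
  opp_half := by
    rintro (v | v) s b
    · exact congrArg (fun l => Sum.inl (Sum.inr l)) (O.opp_half v s b)
    · exact congrArg (fun l => Sum.inr (Sum.inr l)) (T.opp_half v s b)

/-- Going along edges of a tangle, straight through the nodes outside of `K`. -/
inductive Trace (T : Tangle P) (K : Set T.Loc) : P ⊕ T.Loc → P ⊕ T.Loc → Prop
  | edge (h : P ⊕ T.Loc) : Trace T K h (T.edge h)
  | cons {h k : P ⊕ T.Loc} {l : T.Loc} : T.edge h = .inr l → l ∉ K →
      Trace T K (.inr (T.opp l)) k → Trace T K h k

/-- The ports and the half-edges in `K`. -/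
def ends {T : Tangle P} (K : Set T.Loc) : Set (P ⊕ T.Loc) := {x | ∀ l, x = .inr l → l ∈ K}

/-- The half-edges of a union of tangles where the half-edges of the second tangle outside of `K`
are omitted. -/
def glueEnds [Finite P] (O : Tangle P) {T : Tangle P} (K : Set T.Loc) : Set (O.glue T).Half :=
  {x | ∀ l, x = Sum.inr (Sum.inr l) → l ∈ K}

variable [Finite P] {O T T' : Tangle P}

theorem Trace.glue {K : Set T.Loc} (O : Tangle P) {h k : P ⊕ T.Loc} (t : T.Trace K h k)
    {K' : Set (O.glue T).Half} (hK : ∀ l, .inr (.inr l) ∈ K' → l ∈ K) :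
    (O.glue T).Trace K' (.inr h) (.inr k) := by
  induction t with
  | edge h => exact .edge (G := O.glue T) (.inr h)
  | @cons h k l h1 h2 _ ih =>
    have e : (O.glue T).edge (.inr h) = .inr (.inr l) := congrArg Sum.inr h1
    refine .cons (fun h3 => h2 (hK l ?_)) ?_
    · rwa [e] at h3
    · rw [e]
      exact ih

/-- A correspondence between parts `K` and `K'` of two tangles that contain all vertices and meet
all components. -/
structure Match (T T' : Tangle P) (K : Set T.Loc) (K' : Set T'.Loc) (e : T.Loc → T'.Loc) : Prop where
  half_mem : ∀ i, T.half i ∈ K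
  half_mem' : ∀ i, T'.half i ∈ K'
  opp_mem : ∀ l ∈ K, T.opp l ∈ K
  map_mem : ∀ l ∈ K, e l ∈ K'
  map_opp : ∀ l ∈ K, e (T.opp l) = T'.opp (e l)
  inj : ∀ l ∈ K, ∀ l' ∈ K, e l = e l' → l = l'
  surj : ∀ l' ∈ K', ∃ l ∈ K, e l = l'
  trace : ∀ x ∈ ends K, ∃ y ∈ ends K, T.Trace K x y ∧ T'.Trace K' (Sum.map id e x) (Sum.map id e y)
  reach : ∀ l, ∃ y ∈ ends K, T.Trace K (.inr l) y
  reach' : ∀ l, ∃ y ∈ ends K', T'.Trace K' (.inr l) y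

/-- The outer tangle and both copies of the ports are kept completely, so only the inner tangle has
to be examined. -/
theorem isFull_glueEnds (O : Tangle P) {K : Set T.Loc} (half_mem : ∀ i, T.half i ∈ K)
    (opp_mem : ∀ l ∈ K, T.opp l ∈ K) (reach : ∀ l, ∃ y ∈ ends K, T.Trace K (.inr l) y)
    (reach_port : ∀ p, ∃ y ∈ ends K, T.Trace K (.inl p) y) :
    (O.glue T).IsFull (glueEnds O K) where
  half_mem := by
    rintro ⟨v | v, i⟩ l h
    · cases h
    · cases h
      exact half_mem _
  opp_mem := by
    rintro ((p | l) | (p | l)) hx m h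
    · cases h
    · cases h
    · cases h
    · cases h
      exact opp_mem _ (hx _ rfl)
  reach := by
    have key : ∀ x, (∃ y ∈ ends K, T.Trace K x y) →
        ∃ k ∈ glueEnds O K, (O.glue T).Trace (glueEnds O K) (.inr x) k := by
      rintro x ⟨y, hy, t⟩
      exact ⟨.inr y, fun l h => hy l (Sum.inr_injective h), t.glue O fun l hl => hl l rfl⟩
    rintro (x | (p | l))
    · exact ⟨.inl (O.edge x), (fun l h => by cases h), FramedGraph.Trace.edge (G := O.glue T) (.inl x)⟩
    · exact key _ (reach_port p)
    · exact key _ (reach l)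

/-- Reduces a homeomorphism for every outer tangle to one comparison inside: it is enough that paths
between ports and kept half-edges of the two inner tangles correspond, since the outer parts
coincide. -/
theorem Match.homeo {K : Set T.Loc} {K' : Set T'.Loc} {e : T.Loc → T'.Loc} (m : Match T T' K K' e)
    (O : Tangle P) (g : T.Vert ≃ T'.Vert)
    (h_half : ∀ v i, ∃ i', e (T.half (v, i)) = T'.half (g v, i')) :
    Homeo (O.glue T) (O.glue T') := by
  have hK := isFull_glueEnds O m.half_mem m.opp_mem m.reach fun p => by
    obtain ⟨y, hy, t, -⟩ := m.trace (.inl p) fun l h => by cases h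
    exact ⟨y, hy, t⟩
  have hmap : ∀ y ∈ ends K, Sum.map id e y ∈ ends K' := by
    rintro (p | l) hy l' h
    · cases h
    · cases h
      exact m.map_mem _ (hy l rfl)
  have opp_mem' : ∀ l ∈ K', T'.opp l ∈ K' := by
    intro l hl
    obtain ⟨k, hk, rfl⟩ := m.surj l hl
    rw [← m.map_opp k hk]
    exact m.map_mem _ (m.opp_mem k hk)
  have hK' := isFull_glueEnds O m.half_mem' opp_mem' m.reach' fun p => by
    obtain ⟨y, hy, -, t⟩ := m.trace (.inl p) fun l h => by cases h
    exact ⟨_, hmap y hy, t⟩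
  let f : glueEnds O K → glueEnds O K' := fun x =>
    ⟨Sum.map id (Sum.map id e) x.1, by
      obtain ⟨x | (p | l), hx⟩ := x
      · intro l h
        cases h
      · intro l h
        cases h
      · intro l h
        cases h
        exact m.map_mem _ (hx _ rfl)⟩
  have hf : Function.Bijective f := by
    constructor
    · rintro ⟨x | (p | l), hx⟩ ⟨y | (q | k), hy⟩ h <;> have h := congrArg Subtype.val h <;>
        first
        | (cases h; done)
        | (cases h; rfl)
        | (have := m.inj l (hx _ rfl) k (hy _ rfl) (Sum.inr_injective (Sum.inr_injective h))
           subst this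
           rfl)
    · rintro ⟨x | (p | l), hx⟩
      · exact ⟨⟨.inl x, fun l h => by cases h⟩, rfl⟩
      · exact ⟨⟨.inr (.inl p), fun l h => by cases h⟩, rfl⟩
      · obtain ⟨k, hk, rfl⟩ := m.surj l (hx _ rfl)
        exact ⟨⟨.inr (.inr k), fun l h => by cases h; exact hk⟩, rfl⟩
  refine homeo_of_trace hK hK' (Equiv.ofBijective f hf) (Equiv.sumCongr (Equiv.refl _) g) ?_ ?_ ?_
  · rintro ⟨(p | l) | (p | l), hx⟩
    · rfl
    · rfl
    · rfl
    · exact congrArg (fun l => Sum.inr (Sum.inr l)) (m.map_opp l (hx _ rfl))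
  · rintro (v | v) i
    · exact ⟨i, rfl⟩
    · obtain ⟨i', h⟩ := h_half v i
      exact ⟨i', congrArg (fun l => Sum.inr (Sum.inr l)) h⟩
  · rintro ⟨x | x, hx⟩
    · exact ⟨⟨.inl (O.edge x), fun l h => by cases h⟩,
        FramedGraph.Trace.edge (G := O.glue T) (.inl x),
        FramedGraph.Trace.edge (G := O.glue T') (.inl x)⟩
    · obtain ⟨y, hy, t, t'⟩ := m.trace x fun l h => hx l (congrArg Sum.inr h)
      exact ⟨⟨.inr y, fun l h => hy l (Sum.inr_injective h)⟩, t.glue O fun l hl => hl l rfl,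
        t'.glue O (K' := glueEnds O K') fun l hl => hl l rfl⟩

/-- The union with a circle without vertices. -/
def addCircle (T : Tangle P) : Tangle P where
  Loc := T.Loc ⊕ Bool
  Vert := T.Vert
  finite_loc := inferInstance
  finite_vert := inferInstance
  edge := Sum.elim (fun p => Sum.map id Sum.inl (T.edge (.inl p)))
    (Sum.elim (fun l => Sum.map id Sum.inl (T.edge (.inr l))) fun b => .inr (.inr !b))
  edge_edge := by
    have key : ∀ x y, T.edge x = y → T.edge y = x := by
      rintro x _ rfl
      exact T.edge_edge x
    rintro (p | l | b)
    · rcases h : T.edge (.inl p) with q | l <;> simp [h, key _ _ h]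
    · rcases h : T.edge (.inr l) with q | l <;> simp [h, key _ _ h]
    · simp
  edge_ne := by
    rintro (p | l | b)
    · have h1 := T.edge_ne (.inl p)
      rcases h : T.edge (.inl p) with q | l <;> simp_all
    · have h1 := T.edge_ne (.inr l)
      rcases h : T.edge (.inr l) with q | l <;> simp_all
    · simp
  opp := Sum.map T.opp not
  opp_opp := by rintro (k | b) <;> simp [T.opp_opp]
  opp_ne := by rintro (k | b) <;> simp [T.opp_ne]
  half := T.half.trans Function.Embedding.inl
  opp_half := by intro v s b; simp [T.opp_half]

theorem homeo_glue_addCircle (O T : Tangle P) :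
    Homeo (O.glue T.addCircle) (O.glue T).addCircle := by
  refine .rel _ _ (.iso _ _ ⟨Sum.elim (fun x => .inl (.inl x)) (Sum.elim (fun p => .inl (.inr (.inl p)))
      (Sum.elim (fun l => .inl (.inr (.inr l))) .inr)),
    Sum.elim (Sum.elim .inl fun x => .inr (Sum.map id .inl x)) fun b => .inr (.inr (.inr b)),
    ?_, ?_⟩ (Equiv.refl _) ?_ ?_ ?_)
  · rintro (x | p | l | b) <;> rfl
  · rintro ((x | p | l) | b) <;> rfl
  · have key : ∀ (x : P ⊕ T.Loc) (y), T.edge x = y →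
        T.addCircle.edge (Sum.map id Sum.inl x) = Sum.map id Sum.inl y := by
      rintro (p | l) _ rfl <;> rfl
    rintro (x | p | l | b)
    · rfl
    · rcases h : T.edge (.inl p) with q | l
      · refine (congrArg _ (congrArg Sum.inr (key _ _ h))).trans (congrArg (fun z => Sum.inl (Sum.inr z)) h).symm
      · refine (congrArg _ (congrArg Sum.inr (key _ _ h))).trans (congrArg (fun z => Sum.inl (Sum.inr z)) h).symm
    · rcases h : T.edge (.inr l) with q | l
      · refine (congrArg _ (congrArg Sum.inr (key _ _ h))).trans (congrArg (fun z => Sum.inl (Sum.inr z)) h).symm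
      · refine (congrArg _ (congrArg Sum.inr (key _ _ h))).trans (congrArg (fun z => Sum.inl (Sum.inr z)) h).symm
    · rfl
  · rintro ((p | x) | p | l | b) <;> rfl
  · rintro (v | v) i <;> exact ⟨i, rfl⟩

/-- Remove vertices. -/
def erase (T : Tangle P) (S : Set T.Vert) : Tangle P where
  Loc := T.Loc
  Vert := {v : T.Vert // v ∉ S}
  finite_loc := inferInstance
  finite_vert := inferInstance
  edge := T.edge
  edge_edge := T.edge_edge
  edge_ne := T.edge_ne
  opp := T.opp
  opp_opp := T.opp_opp
  opp_ne := T.opp_ne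
  half := (Function.Embedding.prodMap (Function.Embedding.subtype _)
    (Function.Embedding.refl (Bool × Bool))).trans T.half
  opp_half := fun v s b => T.opp_half v.1 s b

theorem homeo_glue_erase (O T : Tangle P) (S : Set (O.glue T).Vert) (S' : Set T.Vert)
    (hS : ∀ v, .inl v ∉ S) (hS' : ∀ v, .inr v ∈ S ↔ v ∈ S') :
    Homeo ((O.glue T).erase S) (O.glue (T.erase S')) := by
  refine .rel _ _ (.iso _ _ (Equiv.refl _)
    ⟨fun v => match v with
      | ⟨.inl v, _⟩ => .inl v
      | ⟨.inr v, hv⟩ => .inr ⟨v, fun h => hv ((hS' v).2 h)⟩,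
    fun v => match v with
      | .inl v => ⟨.inl v, hS v⟩
      | .inr v => ⟨.inr v.1, fun h => v.2 ((hS' _).1 h)⟩, ?_, ?_⟩ (fun _ => rfl) ?_ ?_)
  · rintro ⟨v | v, hv⟩ <;> rfl
  · rintro (v | v) <;> rfl
  · rintro ((p | l) | (p | l)) <;> rfl
  · rintro ⟨v | v, hv⟩ i <;> exact ⟨i, rfl⟩

theorem Trace.link {x y : T.Vert × Bool × Bool} (O : Tangle P)
    (t : T.Trace (Set.range T.half) (.inr (T.half x)) (.inr (T.half y))) :
    (O.glue T).Link (.inr x.1, x.2) (.inr y.1, y.2) := by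
  refine t.glue O ?_
  rintro l ⟨⟨v | v, i⟩, h⟩
  · cases h
  · exact ⟨(v, i), Sum.inr_injective (Sum.inr_injective h)⟩

end Tangle

end

/-! ### Cutting a graph into tangles, and computing paths -/

noncomputable section

open FramedGraph

namespace Tangle

variable {P : Type}

/-- A criterion for a graph to be cut into two tangles. -/
theorem homeo_glue [Finite P] {G : FramedGraph} {O T : Tangle P} (port : P → T.Loc)
    (h_port : ∀ p, T.edge (.inl p) = .inr (port p)) (f : O.Loc ⊕ T.Loc ≃ G.Half)
    (g : O.Vert ⊕ T.Vert ≃ G.Vert)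
    (h_loc : ∀ l l', T.edge (.inr l) = .inr l' → G.edge (f (.inr l)) = f (.inr l'))
    (h_out : ∀ l l', O.edge (.inr l) = .inr l' → G.edge (f (.inl l)) = f (.inl l'))
    (h_out_loc : ∀ p l, O.edge (.inl p) = .inr l → G.edge (f (.inl l)) = f (.inr (port p)))
    (h_loc_loc : ∀ p q, O.edge (.inl p) = .inl q → G.edge (f (.inr (port p))) = f (.inr (port q)))
    (opp_out : ∀ l, f (.inl (O.opp l)) = G.opp (f (.inl l)))
    (opp_loc : ∀ l, f (.inr (T.opp l)) = G.opp (f (.inr l)))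
    (half_out : ∀ v i, f (.inl (O.half (v, i))) = G.half (g (.inl v), i))
    (half_loc : ∀ v i, f (.inr (T.half (v, i))) = G.half (g (.inr v), i)) :
    Homeo G (O.glue T) := by
  let emb : O.Loc ⊕ T.Loc → (O.glue T).Half := Sum.map .inr .inr
  let K : Set (O.glue T).Half := Set.range emb
  have hp1 : ∀ p, (.inl (.inl p) : (O.glue T).Half) ∉ K := by
    rintro p ⟨l | l, h⟩
    · exact Sum.inr_ne_inl (Sum.inl_injective h)
    · cases h
  have hp2 : ∀ p, (.inr (.inl p) : (O.glue T).Half) ∉ K := by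
    rintro p ⟨l | l, h⟩
    · cases h
    · exact Sum.inr_ne_inl (Sum.inr_injective h)
  have t_port : ∀ p, (O.glue T).Trace K (.inr (.inl p)) (.inr (.inr (port p))) := fun p => by
    have h := FramedGraph.Trace.edge (G := O.glue T) (K := K) (.inr (.inl p))
    rwa [show (O.glue T).edge (.inr (.inl p)) = .inr (.inr (port p)) from congrArg Sum.inr (h_port p)] at h
  have t_out : ∀ p l, O.edge (.inl p) = .inr l →
      (O.glue T).Trace K (.inl (.inl p)) (.inl (.inr l)) := fun p l hl => by
    have h := FramedGraph.Trace.edge (G := O.glue T) (K := K) (.inl (.inl p))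
    rwa [show (O.glue T).edge (.inl (.inl p)) = .inl (.inr l) from congrArg Sum.inl hl] at h
  have t_out' : ∀ p q, O.edge (.inl p) = .inl q →
      (O.glue T).Trace K (.inl (.inl p)) (.inr (.inr (port q))) := fun p q hq => by
    have e : (O.glue T).edge (.inl (.inl p)) = .inl (.inl q) := congrArg Sum.inl hq
    refine .cons (e ▸ hp1 q) ?_
    rw [e]
    exact t_port q
  have opp_mem : ∀ x ∈ K, (O.glue T).opp x ∈ K := by
    rintro _ ⟨l | l, rfl⟩
    · exact ⟨.inl (O.opp l), rfl⟩
    · exact ⟨.inr (T.opp l), rfl⟩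
  have hK : (O.glue T).IsFull K :=
    { half_mem := by
        rintro ⟨v | v, i⟩
        · exact ⟨.inl (O.half (v, i)), rfl⟩
        · exact ⟨.inr (T.half (v, i)), rfl⟩
      opp_mem := opp_mem
      reach := by
        rintro ((p | l) | (p | l))
        · rcases h : O.edge (.inl p) with q | l
          · exact ⟨_, ⟨.inr (port q), rfl⟩, t_out' p q h⟩
          · exact ⟨_, ⟨.inl l, rfl⟩, t_out p l h⟩
        · exact exists_trace opp_mem ⟨.inl l, rfl⟩
        · exact ⟨_, ⟨.inr (port p), rfl⟩, t_port p⟩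
        · exact exists_trace opp_mem ⟨.inr l, rfl⟩ }
  -- In `G` every half-edge is kept, while the ports of the glued graph are bridged by paths.
  have hU : G.IsFull Set.univ := ⟨fun _ => trivial, fun _ _ => trivial, fun h => ⟨_, trivial, .edge h⟩⟩
  have hemb : Function.Injective emb := Sum.map_injective.2 ⟨Sum.inr_injective, Sum.inr_injective⟩
  have hG : ∀ x y, G.edge (f x) = f y → G.edge (f y) = f x := fun x y h => by rw [← h, G.edge_edge]
  have key : ∀ x, ∃ y, G.edge (f x) = f y ∧ (O.glue T).Trace K (emb x) (emb y) := by
    have e0 : ∀ x y, (O.glue T).edge x = y → (O.glue T).Trace K x y := by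
      rintro x _ rfl
      exact .edge x
    rintro (l | l)
    · rcases h : O.edge (.inr l) with p | l'
      · have h' : O.edge (.inl p) = .inr l := by rw [← h, O.edge_edge]
        refine ⟨.inr (port p), h_out_loc p l h', ?_⟩
        have e : (O.glue T).edge (.inl (.inr l)) = .inl (.inl p) := congrArg Sum.inl h
        refine FramedGraph.Trace.cons (e ▸ hp1 p) ?_
        change (O.glue T).Trace K ((O.glue T).opp ((O.glue T).edge (.inl (.inr l)))) _
        rw [e]
        exact t_port p
      · exact ⟨.inl l', h_out l l' h, e0 _ _ (congrArg Sum.inl h)⟩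
    · rcases h : T.edge (.inr l) with p | l'
      · have h' : (.inr (port p) : P ⊕ T.Loc) = .inr l := by rw [← h_port, ← h, T.edge_edge]
        obtain rfl := Sum.inr_injective h'
        have e : (O.glue T).edge (.inr (.inr (port p))) = .inr (.inl p) := congrArg Sum.inr h
        have key : ∀ k, (O.glue T).Trace K (.inl (.inl p)) k →
            (O.glue T).Trace K (emb (.inr (port p))) k := by
          intro k hk
          refine FramedGraph.Trace.cons (e ▸ hp2 p) ?_
          change (O.glue T).Trace K ((O.glue T).opp ((O.glue T).edge (.inr (.inr (port p))))) _
          rw [e]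
          exact hk
        rcases ho : O.edge (.inl p) with q | m
        · exact ⟨.inr (port q), h_loc_loc p q ho, key _ (t_out' p q ho)⟩
        · exact ⟨.inl m, hG _ _ (h_out_loc p m ho), key _ (t_out p m ho)⟩
      · exact ⟨.inr l', h_loc l l' h, e0 _ _ (congrArg Sum.inr h)⟩
  let r : K ≃ O.Loc ⊕ T.Loc := (Equiv.ofInjective emb hemb).symm
  have hr : ∀ (x : O.Loc ⊕ T.Loc) (y : K), y.1 = emb x → r y = x := by
    rintro x ⟨_, hy⟩ rfl
    exact Equiv.ofInjective_symm_apply hemb x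
  refine .symm _ _ (homeo_of_trace hK hU (r.trans (f.trans (Equiv.Set.univ _).symm)) g ?_ ?_ ?_)
  · rintro ⟨_, l | l, rfl⟩
    · exact (congrArg f (hr (.inl (O.opp l)) _ rfl)).trans ((opp_out l).trans
        (congrArg (fun z => G.opp (f z)) (hr (.inl l) _ rfl).symm))
    · exact (congrArg f (hr (.inr (T.opp l)) _ rfl)).trans ((opp_loc l).trans
        (congrArg (fun z => G.opp (f z)) (hr (.inr l) _ rfl).symm))
  · rintro (v | v) i
    · exact ⟨i, (congrArg f (hr (.inl (O.half (v, i))) _ rfl)).trans (half_out v i)⟩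
    · exact ⟨i, (congrArg f (hr (.inr (T.half (v, i))) _ rfl)).trans (half_loc v i)⟩
  · rintro ⟨_, x, rfl⟩
    obtain ⟨y, hy, t⟩ := key x
    refine ⟨⟨emb y, y, rfl⟩, t, ?_⟩
    change G.Trace _ (f (r _)) (f (r _))
    rw [hr x _ rfl, hr y _ rfl, ← hy]
    exact .edge _

/-- Follow the tangle until a port or a half-edge satisfying `K` is reached, in at most `n` steps. -/
def walk (T : Tangle P) (K : T.Loc → Bool) : ℕ → P ⊕ T.Loc → P ⊕ T.Loc
  | 0, x => T.edge x
  | n + 1, x => match T.edge x with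
    | .inl p => .inl p
    | .inr l => bif K l then .inr l else T.walk K n (.inr (T.opp l))

theorem trace_walk (T : Tangle P) (K : T.Loc → Bool) (n : ℕ) (x : P ⊕ T.Loc) :
    T.Trace {l | K l = true} x (T.walk K n x) := by
  induction n generalizing x with
  | zero => exact .edge x
  | succ n ih =>
    have h0 := Trace.edge (K := {l | K l = true}) x
    rw [walk]
    rcases h : T.edge x with p | l
    · rwa [h] at h0
    · change T.Trace _ x (bif K l then .inr l else T.walk K n (.inr (T.opp l)))
      rcases hl : K l with _ | _
      · exact .cons h (by simp [hl]) (ih _)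
      · rwa [h] at h0

/-- Whether a half-edge is a port or satisfies `K`. -/
def isEnd {T : Tangle P} (K : T.Loc → Bool) : P ⊕ T.Loc → Bool := Sum.elim (fun _ => true) K

theorem isEnd_iff {T : Tangle P} {K : T.Loc → Bool} {x : P ⊕ T.Loc} :
    isEnd K x = true ↔ x ∈ ends {l | K l = true} := by
  rcases x with p | l
  · simp [isEnd, ends]
  · simp [isEnd, ends]

/-- With a bounded number of steps the existence of paths becomes an equation between computable
functions, so that concrete tangles can be compared by evaluation. -/
theorem match_of_walk {T T' : Tangle P} {K : T.Loc → Bool} {K' : T'.Loc → Bool} (n : ℕ)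
    {e : T.Loc → T'.Loc} (half_mem : ∀ i, K (T.half i)) (half_mem' : ∀ i, K' (T'.half i))
    (h_loc : ∀ l, K l → K (T.opp l) ∧ K' (e l) ∧ e (T.opp l) = T'.opp (e l) ∧
      ∀ l', K l' → e l = e l' → l = l')
    (surj : ∀ l', K' l' → ∃ l, K l ∧ e l = l')
    (h_walk : ∀ x, isEnd K x → T'.walk K' n (Sum.map id e x) = Sum.map id e (T.walk K n x))
    (h_reach : ∀ x, isEnd K (T.walk K n x))
    (h_reach' : ∀ x, isEnd K' (T'.walk K' n x)) :
    Match T T' {l | K l = true} {l | K' l = true} e where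
  half_mem := half_mem
  half_mem' := half_mem'
  opp_mem l hl := (h_loc l hl).1
  map_mem l hl := (h_loc l hl).2.1
  map_opp l hl := (h_loc l hl).2.2.1
  inj l hl l' hl' h := (h_loc l hl).2.2.2 l' hl' h
  surj := surj
  trace x hx := ⟨_, isEnd_iff.1 (h_reach x), T.trace_walk K n x, by
    rw [← h_walk x (isEnd_iff.2 hx)]
    exact T'.trace_walk K' n _⟩
  reach l := ⟨_, isEnd_iff.1 (h_reach (.inr l)), T.trace_walk K n _⟩
  reach' l := ⟨_, isEnd_iff.1 (h_reach' (.inr l)), T'.trace_walk K' n _⟩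

end Tangle

end

/-! ### Crossings on strands, with decidable comparisons of their states -/

noncomputable section

open FramedGraph

instance : DecidableEq Resolution := fun a b => by
  cases a <;> cases b <;> first | exact isTrue rfl | exact isFalse (fun h => by cases h)

namespace Tangle

/-- The positions on `n` strands with two points each. -/
abbrev Position (n : ℕ) : Type := Fin n × Bool

/-- The positions of the overcrossing and undercrossing points of `n` crossings on `n` strands. -/
abbrev Layout (n : ℕ) : Type := Fin n × Bool ≃ Position n

variable {n : ℕ} {P : Type}

/-- The edges of `n` oriented strands with two points each. -/
def strandEdge : Position n ⊕ Position n × Bool → Position n ⊕ Position n × Bool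
  | .inl p => .inr (p, p.2)
  | .inr (p, b) => if b = p.2 then .inl p else .inr ((p.1, !p.2), !b)

/-- The continuation of a strand arriving at or leaving a crossing. -/
def strandOpp (ℓ : Layout n) (ρ : Fin n → Option Resolution) (l : Position n × Bool) :
    Position n × Bool :=
  match ρ (ℓ.symm l.1).1 with
  | some .oriented => (ℓ ((ℓ.symm l.1).1, !(ℓ.symm l.1).2), !l.2)
  | some .unoriented => (ℓ ((ℓ.symm l.1).1, !(ℓ.symm l.1).2), l.2)
  | _ => (l.1, !l.2)

theorem strandOpp_apply (ℓ : Layout n) (ρ : Fin n → Option Resolution) (k : Fin n) (t b : Bool) :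
    strandOpp ℓ ρ (ℓ (k, t), b) = match ρ k with
      | some .oriented => (ℓ (k, !t), !b)
      | some .unoriented => (ℓ (k, !t), b)
      | _ => (ℓ (k, t), !b) := by
  simp only [strandOpp, Equiv.symm_apply_apply]

/-- A state of `n` crossings on `n` strands; for `ρ k = none` the crossing `k` is virtual. -/
def strands (ℓ : Layout n) (ρ : Fin n → Option Resolution) : Tangle (Position n) where
  Loc := Position n × Bool
  Vert := {k : Fin n // ρ k = some .vertex}
  finite_loc := inferInstance
  finite_vert := inferInstance
  edge := strandEdge
  edge_edge := by
    rintro (⟨i, c⟩ | ⟨⟨i, c⟩, b⟩)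
    · simp [strandEdge]
    · cases c <;> cases b <;> simp [strandEdge]
  edge_ne := by
    rintro (⟨i, c⟩ | ⟨⟨i, c⟩, b⟩)
    · simp [strandEdge]
    · cases c <;> cases b <;> simp [strandEdge]
  opp := strandOpp ℓ ρ
  opp_opp := by
    rintro ⟨p, b⟩
    obtain ⟨⟨k, t⟩, rfl⟩ := ℓ.surjective p
    rcases h : ρ k with _ | _ | _ | _ <;> simp [strandOpp_apply, h]
  opp_ne := by
    rintro ⟨p, b⟩
    obtain ⟨⟨k, t⟩, rfl⟩ := ℓ.surjective p
    rcases h : ρ k with _ | _ | _ | _ <;> simp [strandOpp_apply, h]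
  half := ⟨fun v => (ℓ (v.1.1, v.2.1), v.2.2), by
    rintro ⟨⟨k, hk⟩, t, b⟩ ⟨⟨k', hk'⟩, t', b'⟩ h
    simp only [Prod.mk.injEq, ℓ.injective.eq_iff] at h
    obtain ⟨⟨rfl, rfl⟩, rfl⟩ := h
    rfl⟩
  opp_half := by
    rintro ⟨k, hk⟩ t b
    change strandOpp ℓ ρ (ℓ (k, t), b) = (ℓ (k, t), !b)
    simp [strandOpp_apply, hk]

/-- The half-edges at vertices. -/
def atVertex (ℓ : Layout n) (ρ : Fin n → Option Resolution) : (strands ℓ ρ).Loc → Bool :=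
  fun l => ρ (ℓ.symm l.1).1 = some .vertex

/-- Following the strands until a port or a vertex is reached. -/
def strandWalk (ℓ : Layout n) (ρ : Fin n → Option Resolution) :
    Position n ⊕ Position n × Bool → Position n ⊕ Position n × Bool :=
  -- There are `2 * n` nodes and a path between ends passes each at most once, so this bound is
  -- enough; that the walk has in fact ended is checked wherever it is used.
  (strands ℓ ρ).walk (atVertex ℓ ρ) (2 * n)

/-- Whether a half-edge is at a port or at a vertex. -/
def strandEnd (ℓ : Layout n) (ρ : Fin n → Option Resolution) :
    Position n ⊕ Position n × Bool → Bool :=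
  isEnd (T := strands ℓ ρ) (atVertex ℓ ρ)

/-- The map of half-edges given by a permutation `γ` of the crossings and, at each crossing, an
exchange of the two strands and of their directions. -/
def relabel (ℓ ℓ' : Layout n) (γ : Equiv.Perm (Fin n)) (σ : Fin n → Bool) (β : Fin n × Bool → Bool)
    (l : Position n × Bool) : Position n × Bool :=
  (ℓ' (γ (ℓ.symm l.1).1, xor (ℓ.symm l.1).2 (σ (ℓ.symm l.1).1)), xor l.2 (β (ℓ.symm l.1)))

theorem relabel_apply (ℓ ℓ' : Layout n) (γ : Equiv.Perm (Fin n)) (σ : Fin n → Bool)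
    (β : Fin n × Bool → Bool) (k : Fin n) (t b : Bool) :
    relabel ℓ ℓ' γ σ β (ℓ (k, t), b) = (ℓ' (γ k, xor t (σ k)), xor b (β (k, t))) := by
  simp only [relabel, Equiv.symm_apply_apply]

/-- A decidable condition for two states of strands to be the same tangle. -/
def SameStrands (ℓ ℓ' : Layout n) (ρ ρ' : Fin n → Option Resolution) (γ : Equiv.Perm (Fin n))
    (σ : Fin n → Bool) (β : Fin n × Bool → Bool) : Prop :=
  (∀ k, ρ k = some .vertex ↔ ρ' (γ k) = some .vertex) ∧
  ∀ x, strandEnd ℓ ρ (strandWalk ℓ ρ x) ∧ strandEnd ℓ' ρ' (strandWalk ℓ' ρ' x) ∧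
    (strandEnd ℓ ρ x → strandWalk ℓ' ρ' (Sum.map id (relabel ℓ ℓ' γ σ β) x) =
      Sum.map id (relabel ℓ ℓ' γ σ β) (strandWalk ℓ ρ x))

instance (ℓ ℓ' : Layout n) (ρ ρ' : Fin n → Option Resolution) (γ : Equiv.Perm (Fin n))
    (σ : Fin n → Bool) (β : Fin n × Bool → Bool) : Decidable (SameStrands ℓ ℓ' ρ ρ' γ σ β) := by
  unfold SameStrands
  infer_instance

/-- The finite check covers all outer tangles at once. Requiring every walk to end at a port or a
vertex also excludes hidden circles, which would spoil the homeomorphism. -/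
theorem SameStrands.homeo {ℓ ℓ' : Layout n} {ρ ρ' : Fin n → Option Resolution}
    {γ : Equiv.Perm (Fin n)} {σ : Fin n → Bool} {β : Fin n × Bool → Bool}
    (h : SameStrands ℓ ℓ' ρ ρ' γ σ β) (O : Tangle (Position n)) :
    Homeo (O.glue (strands ℓ ρ)) (O.glue (strands ℓ' ρ')) := by
  obtain ⟨hγ, h⟩ := h
  have hm : ∀ {ℓ : Layout n} {ρ : Fin n → Option Resolution} {k t b},
      atVertex ℓ ρ (ℓ (k, t), b) = true ↔ ρ k = some .vertex := by
    intros
    simp [atVertex]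
  have ho : ∀ {ℓ : Layout n} {ρ : Fin n → Option Resolution} {k t b}, ρ k = some .vertex →
      (strands ℓ ρ).opp (ℓ (k, t), b) = (ℓ (k, t), !b) := by
    intro ℓ ρ k t b hk
    change strandOpp ℓ ρ (ℓ (k, t), b) = _
    simp [strandOpp_apply, hk]
  refine (match_of_walk (T := strands ℓ ρ) (T' := strands ℓ' ρ') (K := atVertex ℓ ρ)
    (K' := atVertex ℓ' ρ') (2 * n) (e := relabel ℓ ℓ' γ σ β) ?_ ?_ ?_ ?_ (fun x => (h x).2.2)
    (fun x => (h x).1) (fun x => (h x).2.1)).homeo O (γ.subtypeEquiv hγ) ?_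
  · rintro ⟨⟨k, hk⟩, t, b⟩
    exact hm.2 hk
  · rintro ⟨⟨k, hk⟩, t, b⟩
    exact hm.2 hk
  · rintro ⟨p, b⟩ hl
    obtain ⟨⟨k, t⟩, rfl⟩ := ℓ.surjective p
    have hk := hm.1 hl
    have hk' := (hγ k).1 hk
    rw [ho hk]
    refine ⟨hl, ?_, ?_, ?_⟩
    · rw [relabel_apply]
      exact hm.2 hk'
    · have e := relabel_apply ℓ ℓ' γ σ β k t b
      refine (relabel_apply ℓ ℓ' γ σ β k t (!b)).trans
        (Eq.trans ?_ ((congrArg (strands ℓ' ρ').opp e).trans (ho hk')).symm)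
      cases b <;> cases β (k, t) <;> rfl
    · rintro ⟨p', b'⟩ hl' e
      obtain ⟨⟨k', t'⟩, rfl⟩ := ℓ.surjective p'
      have e := (relabel_apply ℓ ℓ' γ σ β k t b).symm.trans
        (e.trans (relabel_apply ℓ ℓ' γ σ β k' t' b'))
      simp only [Prod.mk.injEq, ℓ'.injective.eq_iff, γ.injective.eq_iff] at e
      obtain ⟨⟨rfl, e1⟩, e2⟩ := e
      obtain rfl : t = t' := by simpa using e1
      obtain rfl : b = b' := by simpa using e2
      rfl
  · rintro ⟨p, b⟩ hl
    obtain ⟨⟨k, t⟩, rfl⟩ := ℓ'.surjective p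
    obtain ⟨k, rfl⟩ := γ.surjective k
    refine ⟨(ℓ (k, xor t (σ k)), xor b (β (k, xor t (σ k)))), hm.2 ((hγ k).2 (hm.1 hl)), ?_⟩
    refine (relabel_apply ℓ ℓ' γ σ β k _ _).trans ?_
    rw [Bool.xor_assoc, Bool.xor_assoc, Bool.xor_self, Bool.xor_self, Bool.xor_false, Bool.xor_false]
  · rintro ⟨k, hk⟩ ⟨t, b⟩
    exact ⟨(xor t (σ k), xor b (β (k, t))), relabel_apply ℓ ℓ' γ σ β k t b⟩


/-- The two half-edges at the node of `l`. -/
def circleMark (ℓ : Layout n) (ρ : Fin n → Option Resolution) (l k : Position n × Bool) : Bool :=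
  k = l ∨ k = strandOpp ℓ ρ l

/-- Following the strands until a port or the half-edges at the node of `l` are reached. -/
def circleWalk (ℓ : Layout n) (ρ : Fin n → Option Resolution) (l : Position n × Bool) :
    Position n ⊕ Position n × Bool → Position n ⊕ Position n × Bool :=
  (strands ℓ ρ).walk (circleMark ℓ ρ l) (2 * n)

/-- Following the strands, together with an additional circle, until a port or the circle is
reached. -/
def addCircleWalk (ℓ : Layout n) (ρ : Fin n → Option Resolution) :
    Position n ⊕ (Position n × Bool) ⊕ Bool → Position n ⊕ (Position n × Bool) ⊕ Bool :=
  walk (strands ℓ ρ).addCircle Sum.isRight (2 * n)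

/-- Whether a half-edge is at a port or at the node of `l`. -/
def circleEnd (ℓ : Layout n) (ρ : Fin n → Option Resolution) (l : Position n × Bool) :
    Position n ⊕ Position n × Bool → Bool :=
  isEnd (T := strands ℓ ρ) (circleMark ℓ ρ l)

/-- Whether a half-edge is at a port or on the additional circle. -/
def addCircleEnd : Position n ⊕ (Position n × Bool) ⊕ Bool → Bool :=
  Sum.elim (fun _ => true) Sum.isRight

/-- Marking of the half-edge `l`. -/
def circleMap (l k : Position n × Bool) : (Position n × Bool) ⊕ Bool := .inr (k = l)

/-- A decidable condition for one state to be the union of another one and the circle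
through `l`. -/
def HasCircle (ℓ ℓ' : Layout n) (ρ ρ' : Fin n → Option Resolution) (l : Position n × Bool) : Prop :=
  (∀ k, ρ k ≠ some .vertex ∧ ρ' k ≠ some .vertex) ∧
  (∀ x, (circleEnd ℓ ρ l x → addCircleWalk ℓ' ρ'
      (Sum.map id (circleMap l) x) = Sum.map id (circleMap l) (circleWalk ℓ ρ l x)) ∧
    circleEnd ℓ ρ l (circleWalk ℓ ρ l x)) ∧
  ∀ x, addCircleEnd (addCircleWalk ℓ' ρ' x)

instance (ℓ ℓ' : Layout n) (ρ ρ' : Fin n → Option Resolution) (l : Position n × Bool) :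
    Decidable (HasCircle ℓ ℓ' ρ ρ' l) := by
  unfold HasCircle
  infer_instance

/-- There are no vertices, so on the left it is enough to keep the one node of `l`, which represents
the circle, and on the right the added circle. All other nodes are bridged by walks. -/
theorem HasCircle.homeo {ℓ ℓ' : Layout n} {ρ ρ' : Fin n → Option Resolution}
    {l : Position n × Bool} (h : HasCircle ℓ ℓ' ρ ρ' l) (O : Tangle (Position n)) :
    Homeo (O.glue (strands ℓ ρ)) (O.glue (strands ℓ' ρ')).addCircle := by
  obtain ⟨hv, h1, h2⟩ := h
  have hE : IsEmpty (strands ℓ ρ).Vert := ⟨fun v => (hv v.1).1 v.2⟩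
  have hE' : IsEmpty (strands ℓ' ρ').addCircle.Vert := ⟨fun v => (hv v.1).2 v.2⟩
  have hne : strandOpp ℓ ρ l ≠ l := (strands ℓ ρ).opp_ne l
  have hoo : strandOpp ℓ ρ (strandOpp ℓ ρ l) = l := (strands ℓ ρ).opp_opp l
  have hmark : ∀ {k}, circleMark ℓ ρ l k = true ↔ k = l ∨ k = strandOpp ℓ ρ l :=
    decide_eq_true_iff
  refine .trans _ _ _ ?_ (homeo_glue_addCircle O (strands ℓ' ρ'))
  refine (match_of_walk (T := strands ℓ ρ) (T' := (strands ℓ' ρ').addCircle)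
    (K := circleMark ℓ ρ l) (K' := Sum.isRight) (2 * n)
    (e := circleMap l) ?_ ?_ ?_ ?_ ?_ ?_ ?_).homeo O (Equiv.equivOfIsEmpty _ _) ?_
  · exact fun i => hE.elim i.1
  · exact fun i => hE'.elim i.1
  · intro (k : Position n × Bool) hk
    refine ⟨hmark.2 ?_, rfl, congrArg Sum.inr ?_, ?_⟩
    · rcases hmark.1 hk with rfl | rfl
      · exact .inr rfl
      · exact .inl hoo
    · rcases hmark.1 hk with rfl | rfl
      · exact (decide_eq_false hne).trans (congrArg not (decide_eq_true rfl)).symm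
      · exact (decide_eq_true hoo).trans (congrArg not (decide_eq_false hne)).symm
    · intro (k' : Position n × Bool) hk' e
      have e : decide (k = l) = decide (k' = l) := Sum.inr_injective e
      rcases hmark.1 hk with rfl | rfl <;> rcases hmark.1 hk' with rfl | rfl
      · rfl
      · rw [decide_eq_true rfl, decide_eq_false hne] at e
        cases e
      · rw [decide_eq_true rfl, decide_eq_false hne] at e
        cases e
      · rfl
  · rintro (k | b) hk
    · cases hk
    · cases b
      · exact ⟨strandOpp ℓ ρ l, hmark.2 (.inr rfl), congrArg Sum.inr (decide_eq_false hne)⟩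
      · exact ⟨l, hmark.2 (.inl rfl), congrArg Sum.inr (decide_eq_true rfl)⟩
  · exact fun x hx => (h1 x).1 hx
  · exact fun x => (h1 x).2
  · exact h2
  · exact fun v => hE.elim v

theorem atVertex_apply {ℓ : Layout n} {ρ : Fin n → Option Resolution} {k : Fin n} {t b : Bool} :
    atVertex ℓ ρ (ℓ (k, t), b) = true ↔ ρ k = some .vertex := by
  refine decide_eq_true_iff.trans ?_
  change ρ (ℓ.symm (ℓ (k, t))).1 = _ ↔ _
  rw [ℓ.symm_apply_apply]

theorem setOf_atVertex (ℓ : Layout n) (ρ : Fin n → Option Resolution) :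
    {l | atVertex ℓ ρ l = true} = Set.range (strands ℓ ρ).half := by
  ext ⟨p, b⟩
  obtain ⟨⟨k, t⟩, rfl⟩ := ℓ.surjective p
  constructor
  · intro h
    exact ⟨(⟨k, atVertex_apply.1 h⟩, t, b), rfl⟩
  · rintro ⟨⟨⟨k', hk'⟩, t', b'⟩, h⟩
    obtain ⟨h, -⟩ := Prod.ext_iff.1 h
    obtain ⟨rfl, -⟩ := Prod.ext_iff.1 (ℓ.injective h)
    exact atVertex_apply.2 hk'

/-- A computed walk inside the strands is a link in every graph glued from them, so loops and bigons
can be found by evaluation. -/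
theorem link_of_strandWalk {ℓ : Layout n} {ρ : Fin n → Option Resolution} (O : Tangle (Position n))
    {k k' : Fin n} {t b t' b' : Bool} (hk : ρ k = some .vertex) (hk' : ρ k' = some .vertex)
    (h : strandWalk ℓ ρ (.inr (ℓ (k, t), b)) = .inr (ℓ (k', t'), b')) :
    (O.glue (strands ℓ ρ)).Link (Sum.inr ⟨k, hk⟩, t, b) (Sum.inr ⟨k', hk'⟩, t', b') := by
  refine Trace.link (T := strands ℓ ρ) (x := (⟨k, hk⟩, t, b))
    (y := (⟨k', hk'⟩, t', b')) O ?_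
  rw [← setOf_atVertex]
  have := (strands ℓ ρ).trace_walk (atVertex ℓ ρ) (2 * n) (.inr (ℓ (k, t), b))
  exact Eq.subst (motive := fun y => (strands ℓ ρ).Trace _ _ y) h this

/-- A decidable condition for a decreasing second move. -/
def HasBigon (ℓ : Layout n) (ρ : Fin n → Option Resolution) (k k' : Fin n) : Prop :=
  k ≠ k' ∧ ρ k = some .vertex ∧ ρ k' = some .vertex ∧ ∃ s s' b b' d d',
    strandWalk ℓ ρ (.inr (ℓ (k, s), b)) = .inr (ℓ (k', s'), b') ∧
    strandWalk ℓ ρ (.inr (ℓ (k, !s), d)) = .inr (ℓ (k', !s'), d')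

instance (ℓ : Layout n) (ρ : Fin n → Option Resolution) (k k' : Fin n) :
    Decidable (HasBigon ℓ ρ k k') := by
  unfold HasBigon
  infer_instance

/-- A decidable condition for a decreasing first move. -/
def HasLoop (ℓ : Layout n) (ρ : Fin n → Option Resolution) (k : Fin n) : Prop :=
  ρ k = some .vertex ∧ ∃ s b b',
    strandWalk ℓ ρ (.inr (ℓ (k, s), b)) = .inr (ℓ (k, !s), b')

instance (ℓ : Layout n) (ρ : Fin n → Option Resolution) (k : Fin n) :
    Decidable (HasLoop ℓ ρ k) := by
  unfold HasLoop
  infer_instance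

theorem HasBigon.genMove {ℓ : Layout n} {ρ : Fin n → Option Resolution} {k k' : Fin n}
    (h : HasBigon ℓ ρ k k') (j : Version) (O : Tangle (Position n)) :
    (O.glue (strands ℓ ρ)).GenMove j {.inr ⟨k, h.2.1⟩, .inr ⟨k', h.2.2.1⟩} := by
  obtain ⟨hne, hk, hk', s, s', b, b', d, d', h1, h2⟩ := h
  refine .bigon j _ _ ⟨?_, s, s', b, b', d, d', link_of_strandWalk O hk hk' h1,
    link_of_strandWalk O hk hk' h2⟩
  intro e
  exact hne (congrArg Subtype.val (Sum.inr_injective e))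

theorem HasLoop.genMove {ℓ : Layout n} {ρ : Fin n → Option Resolution} {k : Fin n}
    (h : HasLoop ℓ ρ k) (O : Tangle (Position n)) :
    (O.glue (strands ℓ ρ)).GenMove .two {.inr ⟨k, h.1⟩} := by
  obtain ⟨hk, s, b, b', h1⟩ := h
  exact .loop _ ⟨s, b, b', link_of_strandWalk O hk hk h1⟩

/-- Erasing a vertex and declaring the crossing virtual both mean that the strands go straight
there; thus the result of a decreasing move is again a state of strands. -/
theorem homeo_glue_erase_strands (ℓ : Layout n) (ρ ρ' : Fin n → Option Resolution)
    (hρ : ∀ k, ρ' k = ρ k ∨ ρ k = some .vertex ∧ ρ' k = none) (O : Tangle (Position n))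
    (S : Set (O.glue (strands ℓ ρ)).Vert) (hS : ∀ v, .inl v ∉ S)
    (hS' : ∀ v : (strands ℓ ρ).Vert, .inr v ∈ S ↔ ρ' v.1 = none) :
    Homeo ((O.glue (strands ℓ ρ)).erase S) (O.glue (strands ℓ ρ')) := by
  have hv : ∀ v : {v : (strands ℓ ρ).Vert // v ∉ {v : (strands ℓ ρ).Vert | ρ' v.1 = none}},
      ρ' v.1.1 = some .vertex := fun v => by
    rcases hρ v.1.1 with h | h
    · rw [h]
      exact v.1.2
    · exact absurd h.2 v.2
  have hv' : ∀ k, ρ' k = some .vertex → ρ k = some .vertex := fun k hk => by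
    rcases hρ k with h | h
    · rw [← h, hk]
    · exact h.1
  refine .trans _ _ _ (homeo_glue_erase O (strands ℓ ρ) S {v | ρ' v.1 = none} hS hS') (.rel _ _ ?_)
  refine .iso _ _ (Equiv.refl _) (Equiv.sumCongr (Equiv.refl _)
    ⟨fun v => ⟨v.1.1, hv v⟩, fun v => ⟨⟨v.1, hv' _ v.2⟩, fun h => by
      have h : ρ' v.1 = none := h
      rw [v.2] at h
      cases h⟩, fun _ => rfl, fun _ => rfl⟩) (fun _ => rfl) ?_ ?_
  · rintro ((p | l) | (p | ⟨p, b⟩))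
    · rfl
    · rfl
    · rfl
    · refine congrArg (fun l => Sum.inr (Sum.inr l)) ?_
      change strandOpp ℓ ρ (p, b) = strandOpp ℓ ρ' (p, b)
      rcases hρ (ℓ.symm p).1 with h | h
      · simp only [strandOpp, h]
      · simp only [strandOpp, h]
  · rintro (v | v) i
    · exact ⟨i, rfl⟩
    · exact ⟨i, rfl⟩

end Tangle

end

/-! ### The linear algebra of the third move -/

noncomputable section

open FramedGraph

instance : Fintype Resolution :=
  ⟨{.vertex, .oriented, .unoriented}, by rintro (_ | _ | _) <;> simp⟩

theorem sum_resolution {M : Type*} [AddCommMonoid M] (f : Resolution → M) :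
    ∑ i, f i = f .vertex + (f .oriented + f .unoriented) := by
  change ∑ i ∈ {Resolution.vertex, Resolution.oriented, Resolution.unoriented}, f i = _
  rw [Finset.sum_insert (by simp), Finset.sum_insert (by simp), Finset.sum_singleton]

/-- `u` and `v` are the graphs of the states on the two sides of the move. Apart from the two states
with three vertices, whose coefficients vanish, the graphs fall into fourteen classes, and the
difference of the coefficients of each class is one of the relations. Six hypotheses are weighted by
their coefficients: there the graph has a loop, which can be removed only in version `two`, while in
version `one` the coefficient is zero. -/
theorem third_sum {R M : Type*} [CommRing R] [AddCommGroup M] [Module R M] (d : R) (p q r p' q' r' : Resolution → R)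
    (u v : Resolution → Resolution → Resolution → M)
    (e1 : p .oriented * q .oriented * r .oriented + p .vertex * q .vertex * r .oriented - (p' .oriented * q' .oriented * r' .oriented + p' .oriented * q' .vertex * r' .vertex) = 0)
    (e2 : p .oriented * q .unoriented * r .unoriented + p .vertex * q .unoriented * r .vertex - (p' .unoriented * q' .unoriented * r' .oriented + p' .vertex * q' .unoriented * r' .vertex) = 0)
    (e3 : p .unoriented * q .oriented * r .unoriented + p .unoriented * q .vertex * r .vertex - (p' .unoriented * q' .oriented * r' .unoriented + p' .vertex * q' .vertex * r' .unoriented) = 0)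
    (e4 : p .oriented * q .vertex * r .oriented + p .vertex * q .oriented * r .oriented - p' .vertex * q' .oriented * r' .oriented = 0)
    (e5 : p .oriented * q .oriented * r .vertex - (p' .oriented * q' .oriented * r' .vertex + p' .oriented * q' .vertex * r' .oriented) = 0)
    (e6 : p .oriented * q .vertex * r .unoriented - (p' .unoriented * q' .unoriented * r' .vertex + p' .vertex * q' .unoriented * r' .oriented) = 0)
    (e7 : p .unoriented * q .vertex * r .unoriented + p .unoriented * q .oriented * r .vertex - p' .unoriented * q' .oriented * r' .vertex = 0)
    (e8 : p .oriented * q .unoriented * r .vertex + p .vertex * q .unoriented * r .unoriented - p' .unoriented * q' .vertex * r' .oriented = 0)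
    (e9 : p .vertex * q .oriented * r .unoriented - (p' .unoriented * q' .vertex * r' .unoriented + p' .vertex * q' .oriented * r' .unoriented) = 0)
    (e10 : p .vertex * q .vertex * r .unoriented - p' .unoriented * q' .vertex * r' .vertex = 0)
    (e11 : p .oriented * q .vertex * r .vertex - p' .vertex * q' .vertex * r' .oriented = 0)
    (e12 : p .vertex * q .oriented * r .vertex - p' .vertex * q' .oriented * r' .vertex = 0)
    (e13 : p .vertex * q .vertex * r .vertex = 0)
    (e14 : p' .vertex * q' .vertex * r' .vertex = 0)
    (e15 : p .oriented * q .oriented * r .unoriented - (p' .oriented * q' .unoriented * r' .oriented + p' .oriented * q' .oriented * r' .unoriented + d * p' .oriented * q' .unoriented * r' .unoriented + p' .unoriented * q' .unoriented * r' .unoriented + p' .oriented * q' .unoriented * r' .vertex + p' .oriented * q' .vertex * r' .unoriented + p' .vertex * q' .unoriented * r' .unoriented) = 0)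
    (e16 : p' .unoriented * q' .oriented * r' .oriented - (p .unoriented * q .oriented * r .oriented + p .oriented * q .unoriented * r .oriented + d * p .unoriented * q .unoriented * r .oriented + p .unoriented * q .unoriented * r .unoriented + p .unoriented * q .vertex * r .oriented + p .vertex * q .unoriented * r .oriented + p .unoriented * q .unoriented * r .vertex) = 0)
    (h1 : u .vertex .vertex .oriented = u .oriented .oriented .oriented)
    (h2 : v .oriented .oriented .oriented = u .oriented .oriented .oriented)
    (h3 : v .oriented .vertex .vertex = u .oriented .oriented .oriented)
    (h4 : u .vertex .unoriented .vertex = u .oriented .unoriented .unoriented)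
    (h5 : v .unoriented .unoriented .oriented = u .oriented .unoriented .unoriented)
    (h6 : v .vertex .unoriented .vertex = u .oriented .unoriented .unoriented)
    (h7 : u .unoriented .vertex .vertex = u .unoriented .oriented .unoriented)
    (h8 : v .unoriented .oriented .unoriented = u .unoriented .oriented .unoriented)
    (h9 : v .vertex .vertex .unoriented = u .unoriented .oriented .unoriented)
    (h10 : u .vertex .oriented .oriented = u .oriented .vertex .oriented)
    (h11 : v .vertex .oriented .oriented = u .oriented .vertex .oriented)
    (h12 : v .oriented .oriented .vertex = u .oriented .oriented .vertex)
    (h13 : v .oriented .vertex .oriented = u .oriented .oriented .vertex)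
    (h14 : v .unoriented .unoriented .vertex = u .oriented .vertex .unoriented)
    (h15 : v .vertex .unoriented .oriented = u .oriented .vertex .unoriented)
    (h16 : u .unoriented .oriented .vertex = u .unoriented .vertex .unoriented)
    (h17 : v .unoriented .oriented .vertex = u .unoriented .vertex .unoriented)
    (h18 : u .vertex .unoriented .unoriented = u .oriented .unoriented .vertex)
    (h19 : v .unoriented .vertex .oriented = u .oriented .unoriented .vertex)
    (h20 : v .unoriented .vertex .unoriented = u .vertex .oriented .unoriented)
    (h21 : v .vertex .oriented .unoriented = u .vertex .oriented .unoriented)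
    (h22 : v .unoriented .vertex .vertex = u .vertex .vertex .unoriented)
    (h23 : v .vertex .vertex .oriented = u .oriented .vertex .vertex)
    (h24 : v .vertex .oriented .vertex = u .vertex .oriented .vertex)
    (h25 : v .oriented .unoriented .oriented = u .oriented .oriented .unoriented)
    (h26 : v .oriented .oriented .unoriented = u .oriented .oriented .unoriented)
    (h27 : v .unoriented .unoriented .unoriented = u .oriented .oriented .unoriented)
    (h28 : v .oriented .unoriented .unoriented = d • u .oriented .oriented .unoriented)
    (h29 : (p' .oriented * q' .unoriented * r' .vertex) • v .oriented .unoriented .vertex = (p' .oriented * q' .unoriented * r' .vertex) • u .oriented .oriented .unoriented)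
    (h30 : (p' .oriented * q' .vertex * r' .unoriented) • v .oriented .vertex .unoriented = (p' .oriented * q' .vertex * r' .unoriented) • u .oriented .oriented .unoriented)
    (h31 : (p' .vertex * q' .unoriented * r' .unoriented) • v .vertex .unoriented .unoriented = (p' .vertex * q' .unoriented * r' .unoriented) • u .oriented .oriented .unoriented)
    (h32 : u .unoriented .oriented .oriented = v .unoriented .oriented .oriented)
    (h33 : u .oriented .unoriented .oriented = v .unoriented .oriented .oriented)
    (h34 : u .unoriented .unoriented .unoriented = v .unoriented .oriented .oriented)
    (h35 : u .unoriented .unoriented .oriented = d • v .unoriented .oriented .oriented)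
    (h36 : (p .unoriented * q .vertex * r .oriented) • u .unoriented .vertex .oriented = (p .unoriented * q .vertex * r .oriented) • v .unoriented .oriented .oriented)
    (h37 : (p .vertex * q .unoriented * r .oriented) • u .vertex .unoriented .oriented = (p .vertex * q .unoriented * r .oriented) • v .unoriented .oriented .oriented)
    (h38 : (p .unoriented * q .unoriented * r .vertex) • u .unoriented .unoriented .vertex = (p .unoriented * q .unoriented * r .vertex) • v .unoriented .oriented .oriented) :
    ∑ i, ∑ j, ∑ k, (p i * q j * r k) • u i j k = ∑ i, ∑ j, ∑ k, (p' i * q' j * r' k) • v i j k := by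
  simp only [sum_resolution]
  -- The weighted identities must be used before the unweighted ones change the graphs.
  rw [h29, h30, h31, h36, h37, h38]
  rw [h1, h2, h3, h4, h5, h6, h7, h8, h9, h10, h11, h12, h13, h14, h15, h16, h17, h18, h19, h20, h21, h22, h23, h24, h25, h26, h27, h28, h32, h33, h34, h35]
  rw [e13, e14]
  linear_combination (norm := module) e1 • (u .oriented .oriented .oriented) + e2 • (u .oriented .unoriented .unoriented) + e3 • (u .unoriented .oriented .unoriented) + e4 • (u .oriented .vertex .oriented) + e5 • (u .oriented .oriented .vertex) + e6 • (u .oriented .vertex .unoriented) + e7 • (u .unoriented .vertex .unoriented) + e8 • (u .oriented .unoriented .vertex) + e9 • (u .vertex .oriented .unoriented) + e10 • (u .vertex .vertex .unoriented) + e11 • (u .oriented .vertex .vertex) + e12 • (u .vertex .oriented .vertex) + e15 • (u .oriented .oriented .unoriented) - e16 • (v .unoriented .oriented .oriented)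

end

/-! ### Values of graphs and relations between skein coefficients -/

noncomputable section

open FramedGraph

variable {X : Type u} [Biquandle X] {j : Version}

/-- The image of `δ` in the coefficient ring. -/
def loopCoeff (j : Version) (X : Type u) [Biquandle X] : SkeinRing j X :=
  SkeinRing.mk j SkeinPoly.δ

namespace FramedGraph

/-- The class of a graph in the module of graphs. -/
def value (j : Version) (X : Type u) [Biquandle X] (G : FramedGraph) : GraphModule j X :=
  Submodule.Quotient.mk (Finsupp.single G.toClass 1)

theorem mk_single (G : FramedGraph) (r : SkeinRing j X) :
    (Submodule.Quotient.mk (Finsupp.single G.toClass r) : GraphModule j X) = r • value j X G := by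
  rw [value, ← Submodule.Quotient.mk_smul, Finsupp.smul_single, smul_eq_mul, mul_one]

theorem Homeo.value_eq {G G' : FramedGraph} (h : Homeo G G') : value j X G = value j X G' := by
  rw [value, value, h.toClass_eq]

theorem value_addCircle (G : FramedGraph) (h : Nonempty G.Half) :
    value j X G.addCircle = loopCoeff j X • value j X G := by
  rw [← mk_single, value, Submodule.Quotient.eq]
  exact Submodule.subset_span (.inr ⟨G, h, rfl⟩)

theorem Decreases.value_eq {G G' : FramedGraph} (h : Decreases j G G') :
    value j X G = value j X G' := by
  rw [value, value, Submodule.Quotient.eq]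
  exact Submodule.subset_span (.inl ⟨G, G', h, rfl⟩)

theorem GenMove.value_eq {G : FramedGraph} {S : Set G.Vert} (h : G.GenMove j S) :
    value j X G = value j X (G.erase S) := by
  obtain ⟨G', G'', h1, h2, h3⟩ := h.exists_decreases
  rw [h1.value_eq, h2.value_eq, h3.value_eq]

end FramedGraph

namespace Tangle

variable {n : ℕ} {ℓ ℓ' : Layout n} {ρ ρ' : Fin n → Option Resolution} (O : Tangle (Position n))

/-- The value of the graph composed of an outer tangle and a state of strands. -/
def strandsValue (j : Version) (X : Type u) [Biquandle X] (O : Tangle (Position n)) (ℓ : Layout n)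
    (ρ : Fin n → Option Resolution) : GraphModule j X :=
  (O.glue (strands ℓ ρ)).value j X

theorem SameStrands.value_eq {γ : Equiv.Perm (Fin n)} {σ : Fin n → Bool}
    {β : Fin n × Bool → Bool} (h : SameStrands ℓ ℓ' ρ ρ' γ σ β) :
    strandsValue j X O ℓ ρ = strandsValue j X O ℓ' ρ' :=
  (h.homeo O).value_eq

theorem HasCircle.value_eq {l : Position n × Bool} (h : HasCircle ℓ ℓ' ρ ρ' l) :
    strandsValue j X O ℓ ρ = loopCoeff j X • strandsValue j X O ℓ' ρ' :=
  (h.homeo O).value_eq.trans (value_addCircle _ ⟨.inr (.inl l.1)⟩)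

theorem HasBigon.value_eq {k k' : Fin n} (h : HasBigon ℓ ρ k k')
    (hρ : ρ' = fun i => if i = k ∨ i = k' then none else ρ i) :
    strandsValue j X O ℓ ρ = strandsValue j X O ℓ ρ' := by
  refine (h.genMove j O).value_eq.trans (homeo_glue_erase_strands ℓ ρ ρ' ?_ O _ ?_ ?_).value_eq
  · intro i
    subst hρ
    by_cases e : i = k ∨ i = k'
    · refine .inr ⟨?_, by simp [e]⟩
      rcases e with rfl | rfl
      · exact h.2.1
      · exact h.2.2.1
    · exact .inl (by simp [e])
  · rintro v (e | e) <;> cases e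
  · rintro ⟨i, hi⟩
    subst hρ
    constructor
    · rintro (e | e)
      · have e := congrArg Subtype.val (Sum.inr_injective e)
        simp only at e
        simp [e]
      · have e := congrArg Subtype.val (Sum.inr_injective e)
        simp only at e
        simp [e]
    · intro e
      by_cases e' : i = k ∨ i = k'
      · rcases e' with rfl | rfl
        · exact .inl rfl
        · exact .inr rfl
      · simp [e', hi] at e

theorem HasLoop.value_eq {k : Fin n} (h : HasLoop ℓ ρ k)
    (hρ : ρ' = fun i => if i = k then none else ρ i) :
    strandsValue .two X O ℓ ρ = strandsValue .two X O ℓ ρ' := by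
  refine (h.genMove O).value_eq.trans (homeo_glue_erase_strands ℓ ρ ρ' ?_ O _ ?_ ?_).value_eq
  · intro i
    subst hρ
    by_cases e : i = k
    · exact .inr ⟨e ▸ h.1, by simp [e]⟩
    · exact .inl (by simp [e])
  · rintro v e
    cases e
  · rintro ⟨i, hi⟩
    subst hρ
    constructor
    · intro e
      have e := congrArg Subtype.val (Sum.inr_injective e)
      simp only at e
      simp [e]
    · intro e
      by_cases e' : i = k
      · subst e'
        exact rfl
      · simp [e', hi] at e

end Tangle

namespace SkeinPoly

theorem mk_eq_zero_of_first {x : X} {p : SkeinPoly X} (hp : p ∈ firstRelations j x) :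
    SkeinRing.mk j p = 0 :=
  Ideal.Quotient.eq_zero_iff_mem.2 (Ideal.subset_span (.inl (.inl (Set.mem_iUnion.2 ⟨x, hp⟩))))

theorem mk_eq_zero_of_second {x y : X} {p : SkeinPoly X} (hp : p ∈ secondRelations j x y) :
    SkeinRing.mk j p = 0 :=
  Ideal.Quotient.eq_zero_iff_mem.2 (Ideal.subset_span (.inl (.inr
    (Set.mem_iUnion.2 ⟨x, Set.mem_iUnion.2 ⟨y, hp⟩⟩))))

theorem mk_eq_zero_of_third {x y z : X} {p : SkeinPoly X}
    (hp : p ∈ thirdRelationsCommon x y z ∪ thirdRelations j x y z) : SkeinRing.mk j p = 0 :=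
  Ideal.Quotient.eq_zero_iff_mem.2 (Ideal.subset_span (.inr
    (Set.mem_iUnion.2 ⟨x, Set.mem_iUnion.2 ⟨y, Set.mem_iUnion.2 ⟨z, hp⟩⟩⟩)))

end SkeinPoly

/-- The skein variable of a crossing with given sign and labels. -/
def skeinWeight (s : ℤˣ) (x y : X) (r : Resolution) : SkeinPoly X :=
  if s = 1 then
    match r with
    | .oriented => SkeinPoly.A x y
    | .unoriented => SkeinPoly.B x y
    | .vertex => SkeinPoly.C x y
  else
    match r with
    | .oriented => SkeinPoly.D x y
    | .unoriented => SkeinPoly.E x y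
    | .vertex => SkeinPoly.F x y

/-- The image of the skein variable in the coefficient ring. -/
def skeinCoeff (j : Version) (s : ℤˣ) (x y : X) (r : Resolution) : SkeinRing j X :=
  SkeinRing.mk j (skeinWeight s x y r)

/-- At a kink both labels agree. In version `one` the vertex term vanishes, so one formula serves
both versions. -/
theorem skeinCoeff_first (s : ℤˣ) (x : X) :
    loopCoeff j X * skeinCoeff j s x x .oriented + skeinCoeff j s x x .unoriented +
      skeinCoeff j s x x .vertex = 1 ∧ (j = .one → skeinCoeff j s x x .vertex = 0) := by
  have h := fun p => SkeinPoly.mk_eq_zero_of_first (j := j) (x := x) (p := p)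
  rcases Int.units_eq_one_or s with rfl | rfl <;> cases j <;>
    simp [SkeinPoly.firstRelations] at h <;> simp [skeinCoeff, skeinWeight, loopCoeff]
  · obtain ⟨h1, h2, h3, h4⟩ := h
    exact ⟨by rw [h3]; linear_combination h1, h3⟩
  · linear_combination h.1
  · obtain ⟨h1, h2, h3, h4⟩ := h
    exact ⟨by rw [h4]; linear_combination h2, h4⟩
  · linear_combination h.2

/-- In version `one` the mixed products are zero individually, hence also their sums; stating both
allows a common treatment of the two versions. -/
theorem skeinCoeff_second (x y : X) {p q : Resolution → SkeinRing j X}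
    (hp : p = skeinCoeff j 1 x y) (hq : q = skeinCoeff j (-1) x y) :
    p .vertex * q .oriented + p .oriented * q .vertex = 0 ∧
    p .vertex * q .unoriented + p .unoriented * q .vertex = 0 ∧
    p .oriented * q .oriented = p .unoriented * q .unoriented ∧
    p .oriented * q .oriented + p .vertex * q .vertex = 1 ∧
    loopCoeff j X * p .oriented * q .oriented + p .oriented * q .unoriented +
      p .unoriented * q .oriented = 0 ∧
    (j = .one → p .vertex * q .oriented = 0 ∧ p .oriented * q .vertex = 0 ∧
      p .vertex * q .unoriented = 0 ∧ p .unoriented * q .vertex = 0) := by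
  subst hp hq
  have h := fun p => SkeinPoly.mk_eq_zero_of_second (j := j) (x := x) (y := y) (p := p)
  cases j <;>
    simp [SkeinPoly.secondRelations] at h <;> simp [skeinCoeff, skeinWeight, loopCoeff]
  · obtain ⟨h1, h2, h3, h4, h5, h6, h7⟩ := h
    refine ⟨?_, ?_, ?_, ?_, ?_, h2, h1, h4, h3⟩
    · rw [h1, h2, add_zero]
    · rw [h3, h4, add_zero]
    · linear_combination h5
    · linear_combination h6
    · linear_combination h7
  · obtain ⟨h1, h2, h5, h6, h7⟩ := h
    refine ⟨?_, ?_, ?_, ?_, ?_⟩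
    · linear_combination h1
    · linear_combination h2
    · linear_combination h5
    · linear_combination h6
    · linear_combination h7

end

/-! ### The local brackets of a kink and of a bigon -/

noncomputable section

open FramedGraph Tangle

variable {X : Type u} [Biquandle X] {j : Version}

/-- On strands with two points, `x` lists where the crossings are. -/
def layoutOf {n : ℕ} (top bottom : Fin n → Position n) (front back : Fin n → Fin n × Bool)
    (h : ∀ x : Fin n × Bool, (fun p : Position n => if p.2 then back p.1 else front p.1)
      (if x.2 then top x.1 else bottom x.1) = x)
    (h' : ∀ p : Position n, (fun x : Fin n × Bool => if x.2 then top x.1 else bottom x.1)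
      (if p.2 then back p.1 else front p.1) = p) : Layout n where
  toFun x := if x.2 then top x.1 else bottom x.1
  invFun p := if p.2 then back p.1 else front p.1
  left_inv := h
  right_inv := h'

/-- A kink, which is overcrossing first if `t` is true. -/
def kinkLayout (t : Bool) : Layout 1 :=
  layoutOf ![(0, !t)] ![(0, t)] ![(0, t)] ![(0, !t)] (by decide +revert) (by decide +revert)

/-- A pair of strands which cross twice; they are antiparallel if `t` is true. -/
def bigonLayout (t : Bool) : Layout 2 :=
  layoutOf ![(0, false), (0, true)] ![(1, t), (1, !t)] ![(0, true), (bif t then 1 else 0, false)]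
    ![(1, true), (bif t then 0 else 1, false)] (by decide +revert) (by decide +revert)

/-- A triangle of three strands. -/
def triangleLayout : Layout 3 :=
  layoutOf ![(0, false), (0, true), (1, true)] ![(1, false), (2, false), (2, true)]
    ![(0, true), (0, false), (1, false)] ![(1, true), (2, true), (2, false)] (by decide) (by decide)

/-- The triangle on the other side. -/
def triangleLayout' : Layout 3 :=
  layoutOf ![(0, true), (0, false), (1, false)] ![(1, true), (2, true), (2, false)]
    ![(1, true), (2, true), (2, false)] ![(0, true), (0, false), (1, false)] (by decide) (by decide)

/-- The bracket of strands with the weights `w`, in an outer tangle. -/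
def strandsBracket {n : ℕ} (j : Version) (X : Type u) [Biquandle X] (O : Tangle (Position n))
    (ℓ : Layout n) (w : Fin n → Resolution → SkeinRing j X) : GraphModule j X :=
  ∑ ρ : Fin n → Resolution, (∏ k, w k (ρ k)) • strandsValue j X O ℓ fun k => some (ρ k)

/-- The oriented smoothing splits off a circle, the other smoothing leaves the plain strand, and the
vertex carries a loop. The coefficients `δ A + B + C` add up to one. -/
theorem strandsBracket_kink (O : Tangle (Position 1)) (t : Bool) (s : ℤˣ) (x : X) :
    strandsBracket j X O (kinkLayout t) (fun _ => skeinCoeff j s x x) =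
      strandsValue j X O (kinkLayout t) fun _ => none := by
  have e : strandsBracket j X O (kinkLayout t) (fun _ => skeinCoeff j s x x) =
      ∑ r, skeinCoeff j s x x r • strandsValue j X O (kinkLayout t) fun _ => some r := by
    refine Fintype.sum_equiv (Equiv.funUnique (Fin 1) Resolution) _ _ fun ρ => ?_
    have : (fun k => some (ρ k)) = fun _ => some (ρ default) :=
      funext fun k => by rw [Subsingleton.elim k default]
    simp [this]
  rw [e, sum_resolution]
  have h1 : (strandsValue j X O (kinkLayout t) fun _ => some .oriented) = loopCoeff j X •
      strandsValue j X O (kinkLayout t) fun _ => none := by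
    cases t
    · exact HasCircle.value_eq O (l := ((0, false), true)) (by decide +kernel)
    · exact HasCircle.value_eq O (l := ((0, false), true)) (by decide +kernel)
  have h2 : (strandsValue j X O (kinkLayout t) fun _ => some .unoriented) =
      strandsValue j X O (kinkLayout t) fun _ => none := by
    cases t
    · exact SameStrands.value_eq O (γ := 1) (σ := fun _ => false) (β := fun _ => false)
        (by decide +kernel)
    · exact SameStrands.value_eq O (γ := 1) (σ := fun _ => false) (β := fun _ => false)
        (by decide +kernel)
  have h3 : j = .two → (strandsValue j X O (kinkLayout t) fun _ => some .vertex) =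
      strandsValue j X O (kinkLayout t) fun _ => none := by
    rintro rfl
    refine HasLoop.value_eq O (k := 0) ?_ (by decide)
    cases t <;> decide +kernel
  obtain ⟨e1, e2⟩ := skeinCoeff_first (j := j) s x
  rw [h1, h2]
  rcases j with _ | _
  · rw [e2 rfl] at e1 ⊢
    linear_combination (norm := module) e1 • strandsValue Version.one X O (kinkLayout t) fun _ => none
  · rw [h3 rfl]
    linear_combination (norm := module) e1 • strandsValue Version.two X O (kinkLayout t) fun _ => none

theorem sum_fin_two {M : Type*} [AddCommMonoid M] (f : (Fin 2 → Resolution) → M) :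
    ∑ ρ, f ρ = ∑ a, ∑ b, f ![a, b] := by
  rw [← Fintype.sum_prod_type']
  exact Fintype.sum_equiv (finTwoArrowEquiv Resolution) _ _ fun ρ => by
    congr 1
    funext k
    fin_cases k <;> rfl

/-- `m` is the value of the two strands without crossings and `g` that of the pattern in which both
ends on each side are joined. The first statement is for parallel strands, where two oriented
smoothings give `m`; the second is for antiparallel strands, where the two kinds of smoothing
exchange their roles. -/
theorem second_sum {R M : Type*} [CommRing R] [AddCommGroup M] [Module R M] (d : R)
    (p q : Resolution → R) (u : Resolution → Resolution → M) (m g : M)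
    (e3 : p .oriented * q .oriented + p .vertex * q .vertex = 1)
    (e4 : d * p .oriented * q .oriented + p .oriented * q .unoriented +
      p .unoriented * q .oriented = 0)
    (e5 : p .oriented * q .oriented = p .unoriented * q .unoriented)
    (hc : u .vertex .vertex = m) :
    (p .vertex * q .oriented + p .oriented * q .vertex = 0 →
      u .oriented .oriented = m → u .oriented .unoriented = g → u .unoriented .oriented = g →
      u .unoriented .unoriented = d • g → u .vertex .oriented = u .oriented .vertex →
      (p .vertex * q .unoriented) • u .vertex .unoriented = (p .vertex * q .unoriented) • g →
      (p .unoriented * q .vertex) • u .unoriented .vertex = (p .unoriented * q .vertex) • g →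
      p .vertex * q .unoriented + p .unoriented * q .vertex = 0 →
      ∑ a, ∑ b, (p a * q b) • u a b = m) ∧
    (p .vertex * q .unoriented + p .unoriented * q .vertex = 0 →
      u .unoriented .unoriented = m → u .oriented .unoriented = g → u .unoriented .oriented = g →
      u .oriented .oriented = d • g → u .vertex .unoriented = u .unoriented .vertex →
      (p .vertex * q .oriented) • u .vertex .oriented = (p .vertex * q .oriented) • g →
      (p .oriented * q .vertex) • u .oriented .vertex = (p .oriented * q .vertex) • g →
      p .vertex * q .oriented + p .oriented * q .vertex = 0 →
      ∑ a, ∑ b, (p a * q b) • u a b = m) := by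
  constructor
  · intro e1 h1 h2 h3 h4 h5 h6 h7 e2
    simp only [sum_resolution]
    rw [h6, h7, h1, h2, h3, h4, h5, hc]
    linear_combination (norm := module) e1 • u .oriented .vertex + e2 • g + e4 • g + e3 • m -
      (d * e5) • g
  · intro e1 h1 h2 h3 h4 h5 h6 h7 e2
    simp only [sum_resolution]
    rw [h6, h7, h1, h2, h3, h4, h5, hc]
    linear_combination (norm := module) e1 • u .unoriented .vertex + e2 • g + e4 • g + e3 • m -
      e5 • m

/-- Handles terms with a loop: in version `two` the loop is removed, in version `one` the
coefficient vanishes. -/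
theorem weighted_smul_eq {r : SkeinRing j X} {x y : GraphModule j X} (h1 : j = .one → r = 0)
    (h2 : j = .two → x = y) : r • x = r • y := by
  cases j
  · rw [h1 rfl]
    exact (zero_smul (SkeinRing .one X) x).trans (zero_smul (SkeinRing .one X) y).symm
  · rw [h2 rfl]

theorem strandsBracket_bigon (O : Tangle (Position 2)) (t : Bool) (s : ℤˣ) (x y : X) :
    strandsBracket j X O (bigonLayout t) ![skeinCoeff j s x y, skeinCoeff j (-s) x y] =
      strandsValue j X O (bigonLayout t) fun _ => none := by
  rw [strandsBracket, sum_fin_two]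
  simp only [Fin.prod_univ_two]
  have key : ∀ p q : Resolution → SkeinRing j X,
      (p .vertex * q .oriented + p .oriented * q .vertex = 0 ∧
      p .vertex * q .unoriented + p .unoriented * q .vertex = 0 ∧
      p .oriented * q .oriented = p .unoriented * q .unoriented ∧
      p .oriented * q .oriented + p .vertex * q .vertex = 1 ∧
      loopCoeff j X * p .oriented * q .oriented + p .oriented * q .unoriented +
        p .unoriented * q .oriented = 0 ∧
      (j = .one → p .vertex * q .oriented = 0 ∧ p .oriented * q .vertex = 0 ∧
        p .vertex * q .unoriented = 0 ∧ p .unoriented * q .vertex = 0)) →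
      ∑ a, ∑ b, (p a * q b) • strandsValue j X O (bigonLayout t) (fun k => some (![a, b] k)) =
        strandsValue j X O (bigonLayout t) fun _ => none := by
    rintro p q ⟨e1, e2, e5, e3, e4, e6⟩
    have hs := second_sum (loopCoeff j X) p q
      (fun a b => strandsValue j X O (bigonLayout t) (fun k => some (![a, b] k)))
      (strandsValue j X O (bigonLayout t) fun _ => none)
      (strandsValue j X O (bigonLayout t) fun k => some (![.oriented, .unoriented] k)) e3 e4 e5
      (HasBigon.value_eq O (k := 0) (k' := 1) (by cases t <;> decide +kernel) (by decide))
    cases t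
    · exact hs.1 e1
        (SameStrands.value_eq O (γ := 1) (σ := fun _ => false) (β := fun _ => false)
          (by decide +kernel))
        rfl
        (SameStrands.value_eq O (γ := 1) (σ := fun _ => false) (β := fun _ => false)
          (by decide +kernel))
        (HasCircle.value_eq O (l := ((0, false), true)) (by decide +kernel))
        (SameStrands.value_eq O (γ := Equiv.swap 0 1) (σ := fun _ => true) (β := fun _ => false)
          (by decide +kernel))
        (weighted_smul_eq (fun e => (e6 e).2.2.1) (by
          rintro rfl
          exact (HasLoop.value_eq O (k := 0) (by decide +kernel) rfl).trans
            (SameStrands.value_eq O (γ := 1) (σ := fun _ => false) (β := fun _ => false)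
              (by decide +kernel))))
        (weighted_smul_eq (fun e => (e6 e).2.2.2) (by
          rintro rfl
          exact (HasLoop.value_eq O (k := 1) (by decide +kernel) rfl).trans
            (SameStrands.value_eq O (γ := 1) (σ := fun _ => false) (β := fun _ => false)
              (by decide +kernel))))
        e2
    · exact hs.2 e2
        (SameStrands.value_eq O (γ := 1) (σ := fun _ => false) (β := fun _ => false)
          (by decide +kernel))
        rfl
        (SameStrands.value_eq O (γ := 1) (σ := fun _ => false) (β := fun _ => false)
          (by decide +kernel))
        (HasCircle.value_eq O (l := ((0, false), true)) (by decide +kernel))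
        (SameStrands.value_eq O (γ := Equiv.swap 0 1) (σ := fun _ => true) (β := fun _ => true)
          (by decide +kernel))
        (weighted_smul_eq (fun e => (e6 e).1) (by
          rintro rfl
          exact (HasLoop.value_eq O (k := 0) (by decide +kernel) rfl).trans
            (SameStrands.value_eq O (γ := 1) (σ := fun _ => false) (β := fun _ => false)
              (by decide +kernel))))
        (weighted_smul_eq (fun e => (e6 e).2.1) (by
          rintro rfl
          exact (HasLoop.value_eq O (k := 1) (by decide +kernel) rfl).trans
            (SameStrands.value_eq O (γ := 1) (σ := fun _ => false) (β := fun _ => false)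
              (by decide +kernel))))
        e1
  refine key _ _ ?_
  -- If the first crossing is negative, the two coefficient functions are interchanged, and the
  -- relations are symmetric under this.
  rcases Int.units_eq_one_or s with rfl | rfl
  · exact skeinCoeff_second x y rfl rfl
  · obtain ⟨h1, h2, h3, h4, h5, h6⟩ := skeinCoeff_second (j := j) x y rfl rfl
    simp only [neg_neg, Matrix.cons_val_zero, Matrix.cons_val_one]
    refine ⟨?_, ?_, ?_, ?_, ?_, fun e => ?_⟩
    · linear_combination h1
    · linear_combination h2
    · linear_combination h3
    · linear_combination h4
    · linear_combination h5
    · obtain ⟨k1, k2, k3, k4⟩ := h6 e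
      exact ⟨by linear_combination k2, by linear_combination k1, by linear_combination k4,
        by linear_combination k3⟩

end

/-! ### The local bracket of a triangle -/

noncomputable section

open FramedGraph Tangle

variable {X : Type u} [Biquandle X] {j : Version}

/-- In version `one` the six additional generators vanish, so the two long relations may be written
with these terms as in version `two`. -/
theorem skeinCoeff_third (x y z : X) {d : SkeinRing j X} {p q r p' q' r' : Resolution → SkeinRing j X}
    (hd : d = loopCoeff j X) (hp : p = skeinCoeff j 1 x y) (hq : q = skeinCoeff j 1 y z)
    (hr : r = skeinCoeff j 1 (x ⊚ y) (z ⧆ y)) (hp' : p' = skeinCoeff j 1 x z)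
    (hq' : q' = skeinCoeff j 1 (y ⧆ x) (z ⧆ x)) (hr' : r' = skeinCoeff j 1 (x ⊚ z) (y ⊚ z)) :
p .oriented * q .oriented * r .oriented + p .vertex * q .vertex * r .oriented - (p' .oriented * q'
      .oriented * r' .oriented + p' .oriented * q' .vertex * r' .vertex) = 0 ∧
p .oriented * q .unoriented * r .unoriented + p .vertex * q .unoriented * r .vertex - (p'
      .unoriented * q' .unoriented * r' .oriented + p' .vertex * q' .unoriented * r' .vertex) = 0
      ∧
p .unoriented * q .oriented * r .unoriented + p .unoriented * q .vertex * r .vertex - (p'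
      .unoriented * q' .oriented * r' .unoriented + p' .vertex * q' .vertex * r' .unoriented) = 0
      ∧
p .oriented * q .vertex * r .oriented + p .vertex * q .oriented * r .oriented - p' .vertex * q'
      .oriented * r' .oriented = 0 ∧
p .oriented * q .oriented * r .vertex - (p' .oriented * q' .oriented * r' .vertex + p' .oriented *
      q' .vertex * r' .oriented) = 0 ∧
p .oriented * q .vertex * r .unoriented - (p' .unoriented * q' .unoriented * r' .vertex + p'
      .vertex * q' .unoriented * r' .oriented) = 0 ∧
p .unoriented * q .vertex * r .unoriented + p .unoriented * q .oriented * r .vertex - p'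
      .unoriented * q' .oriented * r' .vertex = 0 ∧
p .oriented * q .unoriented * r .vertex + p .vertex * q .unoriented * r .unoriented - p'
      .unoriented * q' .vertex * r' .oriented = 0 ∧
p .vertex * q .oriented * r .unoriented - (p' .unoriented * q' .vertex * r' .unoriented + p'
      .vertex * q' .oriented * r' .unoriented) = 0 ∧
p .vertex * q .vertex * r .unoriented - p' .unoriented * q' .vertex * r' .vertex = 0 ∧
p .oriented * q .vertex * r .vertex - p' .vertex * q' .vertex * r' .oriented = 0 ∧
p .vertex * q .oriented * r .vertex - p' .vertex * q' .oriented * r' .vertex = 0 ∧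
p .vertex * q .vertex * r .vertex = 0 ∧
p' .vertex * q' .vertex * r' .vertex = 0 ∧
p .oriented * q .oriented * r .unoriented - (p' .oriented * q' .unoriented * r' .oriented + p'
      .oriented * q' .oriented * r' .unoriented + d * p' .oriented * q' .unoriented * r'
      .unoriented + p' .unoriented * q' .unoriented * r' .unoriented + p' .oriented * q'
      .unoriented * r' .vertex + p' .oriented * q' .vertex * r' .unoriented + p' .vertex * q'
      .unoriented * r' .unoriented) = 0 ∧
p' .unoriented * q' .oriented * r' .oriented - (p .unoriented * q .oriented * r .oriented + p
      .oriented * q .unoriented * r .oriented + d * p .unoriented * q .unoriented * r .oriented +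
      p .unoriented * q .unoriented * r .unoriented + p .unoriented * q .vertex * r .oriented + p
      .vertex * q .unoriented * r .oriented + p .unoriented * q .unoriented * r .vertex) = 0 ∧
    (j = .one → p' .oriented * q' .unoriented * r' .vertex = 0 ∧
      p' .oriented * q' .vertex * r' .unoriented = 0 ∧
      p' .vertex * q' .unoriented * r' .unoriented = 0 ∧
      p .unoriented * q .vertex * r .oriented = 0 ∧
      p .vertex * q .unoriented * r .oriented = 0 ∧
      p .unoriented * q .unoriented * r .vertex = 0) := by
  subst hd hp hq hr hp' hq' hr'
  have h := fun p => SkeinPoly.mk_eq_zero_of_third (j := j) (x := x) (y := y) (z := z) (p := p)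
  rcases j with _ | _ <;>
    simp only [SkeinPoly.thirdRelationsCommon, SkeinPoly.thirdRelations, Set.mem_union,
      Set.mem_insert_iff, Set.mem_singleton_iff, or_imp, forall_and, forall_eq, map_add, map_sub,
      map_mul] at h <;>
    simp only [skeinCoeff, skeinWeight, loopCoeff, if_true]
  · obtain ⟨⟨h1, h2, h3, h4, h5, h6, h7, h8, h9, h10, h11, h12, h13, h14⟩, k1, k2, k3, k4, k5, k6, h15, h16⟩ := h
    refine ⟨h1, h2, h3, h4, h5, h6, h7, h8, h9, h10, h11, h12, h13, h14, ?_, ?_,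
      fun _ => ⟨k4, k5, k6, k1, k2, k3⟩⟩
    · linear_combination h15 - k4 - k5 - k6
    · linear_combination h16 - k1 - k2 - k3
  · obtain ⟨⟨h1, h2, h3, h4, h5, h6, h7, h8, h9, h10, h11, h12, h13, h14⟩, h15, h16⟩ := h
    exact ⟨h1, h2, h3, h4, h5, h6, h7, h8, h9, h10, h11, h12, h13, h14, h15, h16,
      fun e => Version.noConfusion e⟩

/-- The two orders of summation adapt the numbering of the crossings along the strands to the order
of the factors in the relations, on the two sides of the move. -/
theorem sum_fin_three {M : Type*} [AddCommMonoid M] (f : (Fin 3 → Resolution) → M) :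
    (∑ ρ, f ρ = ∑ a, ∑ b, ∑ c, f ![b, c, a]) ∧ ∑ ρ, f ρ = ∑ a, ∑ b, ∑ c, f ![b, a, c] := by
  constructor
  · rw [Fintype.sum_equiv (⟨fun ρ => (ρ 2, ρ 0, ρ 1), fun t => ![t.2.1, t.2.2, t.1],
      fun ρ => funext fun k => by fin_cases k <;> rfl, fun t => rfl⟩ :
      (Fin 3 → Resolution) ≃ Resolution × Resolution × Resolution) f
      (fun t => f ![t.2.1, t.2.2, t.1])
      fun ρ => congrArg f (funext fun k => by fin_cases k <;> rfl)]
    simp only [Fintype.sum_prod_type]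
  · rw [Fintype.sum_equiv (⟨fun ρ => (ρ 1, ρ 0, ρ 2), fun t => ![t.2.1, t.1, t.2.2],
      fun ρ => funext fun k => by fin_cases k <;> rfl, fun t => rfl⟩ :
      (Fin 3 → Resolution) ≃ Resolution × Resolution × Resolution) f
      (fun t => f ![t.2.1, t.1, t.2.2])
      fun ρ => congrArg f (funext fun k => by fin_cases k <;> rfl)]
    simp only [Fintype.sum_prod_type]

/-- Each identity between state graphs comes from one of four causes: a relabelling of vertices, the
removal of a bigon, the splitting off of a circle, or a loop weighted as above. All are found by
evaluating walks. -/
theorem strandsBracket_triangle (O : Tangle (Position 3)) (x y z : X) :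
    strandsBracket j X O triangleLayout
        ![skeinCoeff j 1 y z, skeinCoeff j 1 (x ⊚ y) (z ⧆ y), skeinCoeff j 1 x y] =
      strandsBracket j X O triangleLayout'
        ![skeinCoeff j 1 (y ⧆ x) (z ⧆ x), skeinCoeff j 1 x z,
          skeinCoeff j 1 (x ⊚ z) (y ⊚ z)] := by
  obtain ⟨e1, e2, e3, e4, e5, e6, e7, e8, e9, e10, e11, e12, e13, e14, e15, e16, e17⟩ :=
    skeinCoeff_third (j := j) x y z rfl rfl rfl rfl rfl rfl rfl
  rw [strandsBracket, strandsBracket, (sum_fin_three _).1, (sum_fin_three _).2]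
  refine Eq.trans ?_ ((third_sum (loopCoeff j X) _ _ _ _ _ _
    (fun a b c => strandsValue j X O triangleLayout fun k => some (![b, c, a] k))
    (fun a b c => strandsValue j X O triangleLayout' fun k => some (![b, a, c] k))
    e1 e2 e3 e4 e5 e6 e7 e8 e9 e10 e11 e12 e13 e14 e15 e16
    ?_ ?_ ?_ ?_ ?_ ?_ ?_ ?_ ?_ ?_ ?_ ?_ ?_ ?_ ?_ ?_ ?_ ?_ ?_ ?_ ?_ ?_ ?_ ?_ ?_ ?_ ?_ ?_ ?_ ?_ ?_ ?_ ?_ ?_ ?_ ?_ ?_ ?_).trans ?_)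
  · refine Finset.sum_congr rfl fun a _ => Finset.sum_congr rfl fun b _ =>
      Finset.sum_congr rfl fun c _ => congrArg (· • _) ((Fin.prod_univ_three _).trans ?_)
    exact (mul_comm _ _).trans (mul_assoc _ _ _).symm
  · exact (HasBigon.value_eq O (k := 2) (k' := 0) (by decide +kernel) rfl).trans
        (SameStrands.value_eq O (γ := 1) (σ := fun _ => false) (β := fun _ => false) (by decide +kernel))
  · exact SameStrands.value_eq O (γ := 1) (σ := fun _ => false) (β := fun _ => false) (by decide +kernel)
  · exact (HasBigon.value_eq O (k := 0) (k' := 2) (by decide +kernel) rfl).trans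
        (SameStrands.value_eq O (γ := 1) (σ := fun _ => false) (β := fun _ => false) (by decide +kernel))
  · exact (HasBigon.value_eq O (k := 2) (k' := 1) (by decide +kernel) rfl).trans
        (SameStrands.value_eq O (γ := 1) (σ := fun _ => false) (β := fun _ => false) (by decide +kernel))
  · exact SameStrands.value_eq O (γ := 1) (σ := fun _ => false) (β := fun _ => false) (by decide +kernel)
  · exact (HasBigon.value_eq O (k := 1) (k' := 2) (by decide +kernel) rfl).trans
        (SameStrands.value_eq O (γ := 1) (σ := fun _ => false) (β := fun _ => false) (by decide +kernel))
  · exact (HasBigon.value_eq O (k := 0) (k' := 1) (by decide +kernel) rfl).trans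
        (SameStrands.value_eq O (γ := 1) (σ := fun _ => false) (β := fun _ => false) (by decide +kernel))
  · exact SameStrands.value_eq O (γ := 1) (σ := fun _ => false) (β := fun _ => false) (by decide +kernel)
  · exact (HasBigon.value_eq O (k := 1) (k' := 0) (by decide +kernel) rfl).trans
        (SameStrands.value_eq O (γ := 1) (σ := fun _ => false) (β := fun _ => false) (by decide +kernel))
  · exact SameStrands.value_eq O (γ := (finRotate 3)) (σ := fun _ => false) (β := fun _ => false) (by decide +kernel)
  · exact SameStrands.value_eq O (γ := (Equiv.swap 0 1)) (σ := fun _ => false) (β := fun _ => false) (by decide +kernel)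
  · exact SameStrands.value_eq O (γ := (Equiv.swap 1 2)) (σ := fun _ => false) (β := fun _ => false) (by decide +kernel)
  · exact SameStrands.value_eq O (γ := (Equiv.swap 0 1)) (σ := fun _ => false) (β := fun _ => false) (by decide +kernel)
  · exact SameStrands.value_eq O (γ := (finRotate 3)) (σ := fun _ => true) (β := fun x => !x.2) (by decide +kernel)
  · exact SameStrands.value_eq O (γ := (Equiv.swap 0 1)) (σ := fun _ => false) (β := fun _ => false) (by decide +kernel)
  · exact SameStrands.value_eq O (γ := (Equiv.swap 0 1)) (σ := fun _ => true) (β := fun x => !x.2) (by decide +kernel)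
  · exact SameStrands.value_eq O (γ := (finRotate 3)) (σ := fun _ => true) (β := fun x => !x.2) (by decide +kernel)
  · exact SameStrands.value_eq O (γ := (Equiv.swap 1 2)) (σ := fun _ => true) (β := fun x => !x.2) (by decide +kernel)
  · exact SameStrands.value_eq O (γ := (Equiv.swap 0 1)) (σ := fun _ => false) (β := fun _ => false) (by decide +kernel)
  · exact SameStrands.value_eq O (γ := (finRotate 3).symm) (σ := fun _ => true) (β := fun x => x.2) (by decide +kernel)
  · exact SameStrands.value_eq O (γ := (Equiv.swap 1 2)) (σ := fun _ => false) (β := fun _ => false) (by decide +kernel)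
  · exact SameStrands.value_eq O (γ := (Equiv.swap 0 2)) (σ := fun _ => true) (β := fun x => if x.1 = 0 then x.2 else !x.2) (by decide +kernel)
  · exact SameStrands.value_eq O (γ := (Equiv.swap 0 1)) (σ := fun _ => false) (β := fun _ => false) (by decide +kernel)
  · exact SameStrands.value_eq O (γ := (Equiv.swap 1 2)) (σ := fun _ => false) (β := fun _ => false) (by decide +kernel)
  · exact SameStrands.value_eq O (γ := 1) (σ := fun _ => false) (β := fun _ => false) (by decide +kernel)
  · exact SameStrands.value_eq O (γ := 1) (σ := fun _ => false) (β := fun _ => false) (by decide +kernel)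
  · exact SameStrands.value_eq O (γ := 1) (σ := fun _ => false) (β := fun _ => false) (by decide +kernel)
  · exact HasCircle.value_eq O (l := ((0, false), true)) (by decide +kernel)
  · refine weighted_smul_eq (fun e => (e17 e).1) ?_
    rintro rfl
    exact (HasLoop.value_eq O (k := 2) (by decide +kernel) rfl).trans
      (SameStrands.value_eq O (γ := 1) (σ := fun _ => false) (β := fun _ => false) (by decide +kernel))
  · refine weighted_smul_eq (fun e => (e17 e).2.1) ?_
    rintro rfl
    exact (HasLoop.value_eq O (k := 0) (by decide +kernel) rfl).trans
      (SameStrands.value_eq O (γ := 1) (σ := fun _ => false) (β := fun _ => false) (by decide +kernel))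
  · refine weighted_smul_eq (fun e => (e17 e).2.2.1) ?_
    rintro rfl
    exact (HasLoop.value_eq O (k := 1) (by decide +kernel) rfl).trans
      (SameStrands.value_eq O (γ := 1) (σ := fun _ => false) (β := fun _ => false) (by decide +kernel))
  · exact SameStrands.value_eq O (γ := 1) (σ := fun _ => false) (β := fun _ => false) (by decide +kernel)
  · exact SameStrands.value_eq O (γ := 1) (σ := fun _ => false) (β := fun _ => false) (by decide +kernel)
  · exact SameStrands.value_eq O (γ := 1) (σ := fun _ => false) (β := fun _ => false) (by decide +kernel)
  · exact HasCircle.value_eq O (l := ((0, false), true)) (by decide +kernel)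
  · refine weighted_smul_eq (fun e => (e17 e).2.2.2.1) ?_
    rintro rfl
    exact (HasLoop.value_eq O (k := 0) (by decide +kernel) rfl).trans
      (SameStrands.value_eq O (γ := 1) (σ := fun _ => false) (β := fun _ => false) (by decide +kernel))
  · refine weighted_smul_eq (fun e => (e17 e).2.2.2.2.1) ?_
    rintro rfl
    exact (HasLoop.value_eq O (k := 2) (by decide +kernel) rfl).trans
      (SameStrands.value_eq O (γ := 1) (σ := fun _ => false) (β := fun _ => false) (by decide +kernel))
  · refine weighted_smul_eq (fun e => (e17 e).2.2.2.2.2) ?_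
    rintro rfl
    exact (HasLoop.value_eq O (k := 1) (by decide +kernel) rfl).trans
      (SameStrands.value_eq O (γ := 1) (σ := fun _ => false) (β := fun _ => false) (by decide +kernel))
  · refine Finset.sum_congr rfl fun a _ => Finset.sum_congr rfl fun b _ =>
      Finset.sum_congr rfl fun c _ => congrArg (· • _) (Eq.trans ?_ (Fin.prod_univ_three _).symm)
    exact congrArg (· * _) (mul_comm _ _)

end

/-! ### Windows in a diagram and the tangle outside -/

noncomputable section

open FramedGraph Tangle

/-- The half-edge at the other end of an edge of a diagram. -/
def LinkDiagram.halfEdge (K : LinkDiagram) (h : K.Pt × Bool) : K.Pt × Bool :=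
  if h.2 then (K.next h.1, false) else (K.next.symm h.1, true)

theorem LinkDiagram.halfEdge_halfEdge (K : LinkDiagram) (h : K.Pt × Bool) :
    K.halfEdge (K.halfEdge h) = h := by
  obtain ⟨p, b⟩ := h
  cases b <;> simp [LinkDiagram.halfEdge]

theorem LinkDiagram.halfEdge_ne (K : LinkDiagram) (h : K.Pt × Bool) : K.halfEdge h ≠ h := by
  obtain ⟨p, b⟩ := h
  cases b <;> simp [LinkDiagram.halfEdge]

/-- Parts of strands of a diagram, with two marked points on each of them. -/
structure LinkDiagram.Window (K : LinkDiagram) (n : ℕ) where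
  pt : Position n ↪ K.Pt
  marked : ∀ p x, K.pos x ≠ pt p
  next_eq : ∀ i, K.next (pt (i, false)) = pt (i, true)

namespace LinkDiagram.Window

variable {K : LinkDiagram} {n : ℕ} (W : K.Window n)

/-- The half-edges outside of the window and those at its ends. -/
abbrev OuterHalf : Type := {h : K.Pt × Bool // ∀ p, h.1 = W.pt p → h.2 = p.2}

/-- The only half-edges excluded are the two ends of the inner edge of each strand, and these are
joined to each other; so no edge leads from the outside to an excluded half-edge. -/
theorem halfEdge_mem (h : W.OuterHalf) :
    ∀ p, (K.halfEdge h.1).1 = W.pt p → (K.halfEdge h.1).2 = p.2 := by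
  obtain ⟨⟨q, b⟩, h⟩ := h
  rintro ⟨i, c⟩ e
  cases b <;> cases c <;> simp only [halfEdge, if_true, Bool.false_eq_true, if_false] at e ⊢
  · have := h (i, true) (by rw [← W.next_eq, ← e, Equiv.apply_symm_apply])
    simp at this
  · rw [← W.next_eq] at e
    have := h (i, false) (K.next.injective e)
    simp at this

/-- The half-edges outside of the window and the ports. -/
def outerEquiv : Position n ⊕ {h : K.Pt × Bool // h.1 ∉ Set.range W.pt} ≃ W.OuterHalf := by
  refine Equiv.ofBijective (Sum.elim
    (fun p => ⟨(W.pt p, p.2), fun p' e => by rw [W.pt.injective e]⟩)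
    (fun h => ⟨h.1, fun p e => (h.2 ⟨p, e.symm⟩).elim⟩)) ⟨?_, ?_⟩
  · rintro (p | h) (p' | h') e
    · exact congrArg _ (W.pt.injective (congrArg (fun x => x.1.1) e))
    · exact (h'.2 ⟨p, congrArg (fun x => x.1.1) e⟩).elim
    · exact (h.2 ⟨p', (congrArg (fun x => x.1.1) e).symm⟩).elim
    · have e : h.1 = h'.1 := congrArg (fun x : W.OuterHalf => x.1) e
      exact congrArg _ (Subtype.ext e)
  · rintro ⟨⟨q, b⟩, h⟩
    by_cases hq : q ∈ Set.range W.pt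
    · obtain ⟨p, rfl⟩ := hq
      exact ⟨.inl p, Subtype.ext (Prod.ext rfl (h p rfl).symm)⟩
    · exact ⟨.inr ⟨(q, b), hq⟩, rfl⟩

/-- The part of a state outside of the window. -/
def outer (u : K.State) : Tangle (Position n) where
  Loc := {h : K.Pt × Bool // h.1 ∉ Set.range W.pt}
  Vert := {c : K.Cr // u c = .vertex}
  finite_loc := inferInstance
  finite_vert := inferInstance
  edge x := W.outerEquiv.symm ⟨K.halfEdge (W.outerEquiv x).1, W.halfEdge_mem _⟩
  edge_edge x := by
    rw [Equiv.symm_apply_eq]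
    refine Subtype.ext ?_
    simp only [Equiv.apply_symm_apply]
    exact K.halfEdge_halfEdge _
  edge_ne x := by
    rw [Ne, Equiv.symm_apply_eq]
    exact fun e => K.halfEdge_ne _ (congrArg Subtype.val e)
  opp h := ⟨LinkDiagram.State.opp u h.1, by
    obtain ⟨⟨q, b⟩, h⟩ := h
    by_cases hq : q ∈ Set.range K.pos
    · obtain ⟨⟨c, t⟩, rfl⟩ := hq
      rintro ⟨p, e⟩
      rw [LinkDiagram.State.opp_pos] at e
      rcases hu : u c with _ | _ | _ <;> simp only [hu] at e <;> exact W.marked _ _ e.symm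
    · rw [LinkDiagram.State.opp_marked u q hq]
      exact h⟩
  opp_opp h := Subtype.ext ((LinkDiagram.State.graph u).opp_opp h.1)
  opp_ne h e := (LinkDiagram.State.graph u).opp_ne h.1 (congrArg Subtype.val e)
  half := ⟨fun x => ⟨(K.pos (x.1.1, x.2.1), x.2.2), fun ⟨p, e⟩ => W.marked _ _ e.symm⟩,
    fun _ _ e => (LinkDiagram.State.graph u).half.injective (congrArg Subtype.val e)⟩
  opp_half v s b := Subtype.ext ((LinkDiagram.State.graph u).opp_half v s b)

/-- Allows an arbitrary state inside the window, with real or virtual crossings, so that filled and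
unfilled diagrams have the same outer tangle. -/
theorem homeo_glue_outer (u : K.State) (ℓ : Layout n) (ρ : Fin n → Option Resolution)
    {G : FramedGraph} (F : K.Pt × Bool ≃ G.Half)
    (g : {c : K.Cr // u c = .vertex} ⊕ {k : Fin n // ρ k = some .vertex} ≃ G.Vert)
    (h_edge : ∀ h, G.edge (F h) = F (K.halfEdge h))
    (opp_out : ∀ h : K.Pt × Bool, h.1 ∉ Set.range W.pt →
      F (LinkDiagram.State.opp u h) = G.opp (F h))
    (opp_loc : ∀ p b, F (W.pt (strandOpp ℓ ρ (p, b)).1, (strandOpp ℓ ρ (p, b)).2) =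
      G.opp (F (W.pt p, b)))
    (half_out : ∀ v t b, F (K.pos (v.1, t), b) = G.half (g (.inl v), t, b))
    (half_loc : ∀ v t b, F (W.pt (ℓ (v.1, t)), b) = G.half (g (.inr v), t, b)) :
    Homeo G ((W.outer u).glue (strands ℓ ρ)) := by
  have key : ∀ x y, (W.outer u).edge x = y →
      K.halfEdge (W.outerEquiv x).1 = (W.outerEquiv y).1 := by
    rintro x y rfl
    exact (congrArg Subtype.val (W.outerEquiv.apply_symm_apply
      ⟨K.halfEdge (W.outerEquiv x).1, W.halfEdge_mem _⟩)).symm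
  let f : {h : K.Pt × Bool // h.1 ∉ Set.range W.pt} ⊕ Position n × Bool ≃ K.Pt × Bool :=
    Equiv.ofBijective (Sum.elim (fun h => h.1) fun x => (W.pt x.1, x.2)) (by
      constructor
      · rintro (h | ⟨p, b⟩) (h' | ⟨p', b'⟩) e
        · exact congrArg _ (Subtype.ext e)
        · exact (h.2 ⟨p', (congrArg Prod.fst e).symm⟩).elim
        · exact (h'.2 ⟨p, congrArg Prod.fst e⟩).elim
        · have e1 := W.pt.injective (congrArg Prod.fst e)
          have e2 : b = b' := congrArg Prod.snd e
          simp only at e1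
          rw [e1, e2]
      · rintro ⟨q, b⟩
        by_cases hq : q ∈ Set.range W.pt
        · obtain ⟨p, rfl⟩ := hq
          exact ⟨.inr (p, b), rfl⟩
        · exact ⟨.inl ⟨(q, b), hq⟩, rfl⟩)
  refine homeo_glue (O := W.outer u) (T := strands ℓ ρ) (fun p => (p, p.2)) (fun p => rfl)
    (f.trans F) g ?_ ?_ ?_ ?_ ?_ ?_ ?_ ?_
  · rintro ⟨⟨i, c⟩, b⟩ ⟨p', b'⟩ e
    have e : strandEdge (.inr ((i, c), b)) = .inr (p', b') := e
    refine (h_edge _).trans (congrArg F ?_)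
    change K.halfEdge (W.pt (i, c), b) = (W.pt p', b')
    cases b <;> cases c <;> simp only [strandEdge, reduceCtorEq, if_true, if_false, Bool.not_true,
      Bool.not_false, Sum.inr.injEq, Prod.mk.injEq, Bool.true_eq_false, Bool.false_eq_true] at e
    · obtain ⟨rfl, rfl⟩ := e
      simp [halfEdge, ← W.next_eq]
    · obtain ⟨rfl, rfl⟩ := e
      simp [halfEdge, W.next_eq]
  · exact fun l l' e => (h_edge _).trans (congrArg F (key _ _ e))
  · exact fun p l e => (h_edge _).trans (congrArg F
      ((congrArg K.halfEdge (key _ _ e)).symm.trans (K.halfEdge_halfEdge _)))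
  · exact fun p q e => (h_edge _).trans (congrArg F (key _ _ e))
  · exact fun l => opp_out _ l.2
  · exact fun l => opp_loc l.1 l.2
  · exact fun v i => half_out v i.1 i.2
  · exact fun v i => half_loc v i.1 i.2

end LinkDiagram.Window

end

/-! ### Diagrams with crossings inserted in a window -/

noncomputable section

open FramedGraph Tangle

variable {X : Type u} [Biquandle X] {j : Version}

/-- The relation between the colours at a crossing of sign `s`: `oi` and `oo` are the colours of the
incoming and the outgoing over-edge, `ui` and `uo` those of the under-edges. -/
def CrossingRule (s : ℤˣ) (oi oo ui uo : X) : Prop :=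
  (s = 1 → oo = oi ⧆ uo ∧ ui = uo ⊚ oi) ∧ (s = -1 → oi = oo ⧆ ui ∧ uo = ui ⊚ oo)

/-- The labels of a crossing. -/
def crossingLabels (s : ℤˣ) (oi oo ui uo : X) : X × X :=
  if s = 1 then (uo, oi) else (ui, oo)

namespace LinkDiagram

/-- The coefficient of a state for given colours of the edges. -/
def stateCoeff (j : Version) (L : LinkDiagram) (color : L.Pt → X) (c : L.Cr) (r : Resolution) :
    SkeinRing j X :=
  let x := crossingLabels (L.sign c) (color (L.next.symm (L.overPt c))) (color (L.overPt c))
    (color (L.next.symm (L.underPt c))) (color (L.underPt c))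
  skeinCoeff j (L.sign c) x.1 x.2 r

theorem _root_.Coloring.bracket_eq {L : LinkDiagram} [Fintype L.State] [Fintype L.Cr]
    (f : Coloring L X) : f.bracket j =
      ∑ s : L.State, (∏ c, L.stateCoeff j f.color c (s c)) • (State.graph s).value j X := by
  rw [Coloring.bracket, finsum_eq_sum_of_fintype, ← Submodule.mkQ_apply, map_sum]
  refine Finset.sum_congr rfl fun s _ => ?_
  rw [Submodule.mkQ_apply, mk_single, finprod_eq_prod_of_fintype, map_prod]
  rfl

variable {K : LinkDiagram} {n : ℕ}

/-- The diagram obtained by adding crossings at the marked points in a window. -/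
def fill (K : LinkDiagram) (W : K.Window n) (ℓ : Layout n) (sg : Fin n → ℤˣ) : LinkDiagram where
  Pt := K.Pt
  Cr := K.Cr ⊕ Fin n
  finite_pt := inferInstance
  finite_cr := inferInstance
  next := K.next
  pos := ⟨fun x => match x with
    | (.inl c, t) => K.pos (c, t)
    | (.inr k, t) => W.pt (ℓ (k, t)), by
    rintro ⟨c | k, t⟩ ⟨c' | k', t'⟩ e
    · have e := K.pos.injective e
      simp only [Prod.mk.injEq] at e
      rw [e.1, e.2]
    · exact (W.marked _ _ e).elim
    · exact (W.marked _ _ e.symm).elim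
    · have e := ℓ.injective (W.pt.injective e)
      simp only [Prod.mk.injEq] at e
      rw [e.1, e.2]⟩
  sign := Sum.elim K.sign sg

namespace Window

variable (W : K.Window n) {ℓ ℓ' : Layout n} {sg sg' : Fin n → ℤˣ}

theorem range_pos_fill {q : K.Pt} :
    q ∈ Set.range (K.fill W ℓ sg).pos ↔ q ∈ Set.range K.pos ∨ q ∈ Set.range W.pt := by
  constructor
  · rintro ⟨⟨c | k, t⟩, rfl⟩
    · exact .inl ⟨(c, t), rfl⟩
    · exact .inr ⟨ℓ (k, t), rfl⟩
  · rintro (⟨⟨c, t⟩, rfl⟩ | ⟨p, rfl⟩)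
    · exact ⟨(.inl c, t), rfl⟩
    · obtain ⟨⟨k, t⟩, rfl⟩ := ℓ.surjective p
      exact ⟨(.inr k, t), rfl⟩

/-- A state of the filled diagram is a state outside together with resolutions of the new crossings,
and its graph is cut accordingly. -/
theorem homeo_graph_fill (u : K.State) (ρ : Fin n → Resolution) :
    Homeo (State.graph (L := K.fill W ℓ sg) (Sum.elim u ρ))
      ((W.outer u).glue (strands ℓ fun k => some (ρ k))) := by
  refine W.homeo_glue_outer u ℓ _ (Equiv.refl (K.Pt × Bool)) (Equiv.ofBijective (Sum.elim
    (fun v => ⟨.inl v.1, v.2⟩) fun v => ⟨.inr v.1, Option.some_injective _ v.2⟩) ⟨?_, ?_⟩)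
    (fun _ => rfl) ?_ ?_ (fun _ _ _ => rfl) (fun _ _ _ => rfl)
  · rintro (⟨v, hv⟩ | ⟨v, hv⟩) (⟨w, hw⟩ | ⟨w, hw⟩) e <;>
      have e := congrArg Subtype.val e <;> cases e <;> rfl
  · rintro ⟨v | v, hv⟩
    · exact ⟨.inl ⟨v, hv⟩, rfl⟩
    · exact ⟨.inr ⟨v, congrArg some hv⟩, rfl⟩
  · rintro ⟨q, b⟩ hq
    by_cases h : q ∈ Set.range K.pos
    · obtain ⟨⟨c, t⟩, rfl⟩ := h
      exact (State.opp_pos u c t b).trans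
        (State.opp_pos (L := K.fill W ℓ sg) (Sum.elim u ρ) (.inl c) t b).symm
    · refine (State.opp_marked u q h b).trans
        (State.opp_marked (L := K.fill W ℓ sg) (Sum.elim u ρ) q ?_ b).symm
      exact fun e => (W.range_pos_fill.1 e).elim h hq
  · intro p b
    obtain ⟨⟨k, t⟩, rfl⟩ := ℓ.surjective p
    rw [strandOpp_apply]
    refine Eq.trans ?_
        (State.opp_pos (L := K.fill W ℓ sg) (Sum.elim u ρ) (.inr k) t b).symm
    rcases h : ρ k with _ | _ | _ <;> simp only [Sum.elim_inr, h] <;> rfl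

/-- The unfilled diagram is the filled one with all new crossings virtual, whatever their layout. -/
theorem homeo_graph_self (u : K.State) :
    Homeo (State.graph u) ((W.outer u).glue (strands ℓ fun _ => none)) := by
  refine W.homeo_glue_outer u ℓ _ (Equiv.refl (K.Pt × Bool))
    (@Equiv.sumEmpty {c : K.Cr // u c = .vertex} {_k : Fin n // none = some Resolution.vertex}
      ⟨fun v => nomatch v.2⟩)
    (fun _ => rfl) (fun _ _ => rfl) ?_ (fun _ _ _ => rfl) (fun v => nomatch v.2)
  intro p b
  obtain ⟨⟨k, t⟩, rfl⟩ := ℓ.surjective p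
  rw [strandOpp_apply]
  refine (State.opp_marked u _ ?_ b).symm
  rintro ⟨x, hx⟩
  exact W.marked _ _ hx

end Window

end LinkDiagram

namespace Tangle

variable {n : ℕ} (ℓ : Layout n) (sg : Fin n → ℤˣ) (a m b : Fin n → X)

/-- The colour before a position, if `a` and `m` are the colours of the first and the second edge of
each strand. -/
def before (a m : Fin n → X) (p : Position n) : X := if p.2 then m p.1 else a p.1

/-- The colours `a`, `m` and `b` of the successive edges of strands satisfy the rules at the
crossings. -/
def IsColored : Prop :=
  ∀ k, CrossingRule (sg k) (before a m (ℓ (k, true))) (before m b (ℓ (k, true)))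
    (before a m (ℓ (k, false))) (before m b (ℓ (k, false)))

/-- The coefficients of the crossings of coloured strands. -/
def strandsCoeff (j : Version) (k : Fin n) : Resolution → SkeinRing j X :=
  let x := crossingLabels (sg k) (before a m (ℓ (k, true))) (before m b (ℓ (k, true)))
    (before a m (ℓ (k, false))) (before m b (ℓ (k, false)))
  skeinCoeff j (sg k) x.1 x.2

end Tangle

namespace LinkDiagram.Window

variable {K : LinkDiagram} {n : ℕ} (W : K.Window n) {ℓ ℓ' : Layout n} {sg sg' : Fin n → ℤˣ}

/-- The combination of the values `g` of the states outside of the window. -/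
def outerSum (_ : K.Window n) (color : K.Pt → X) (g : K.State → GraphModule j X) :
    GraphModule j X :=
  letI := Fintype.ofFinite K.Cr
  letI := Fintype.ofFinite K.State
  ∑ u : K.State, (∏ c, K.stateCoeff j color c (u c)) • g u

theorem bracket_self (f : Coloring K X) : f.bracket j = W.outerSum f.color fun u =>
    strandsValue j X (W.outer u) ℓ fun _ => none := by
  let _ := Fintype.ofFinite K.Cr
  let _ := Fintype.ofFinite K.State
  rw [f.bracket_eq]
  exact Finset.sum_congr rfl fun u _ => congrArg _ (W.homeo_graph_self u).value_eq

/-- Coefficients multiply and graphs are glued, so the sum over states of the whole diagram splits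
into a sum over outer states whose terms contain the bracket of the strands. -/
theorem bracket_fill (f : Coloring (K.fill W ℓ sg) X) :
    f.bracket j = W.outerSum f.color fun u => strandsBracket j X (W.outer u) ℓ
      (strandsCoeff ℓ sg (fun i => f.color (K.next.symm (W.pt (i, false))))
        (fun i => f.color (W.pt (i, false))) (fun i => f.color (W.pt (i, true))) j) := by
  let _ := Fintype.ofFinite K.Cr
  let _ := Fintype.ofFinite K.State
  let _ : Fintype (K.fill W ℓ sg).Cr := inferInstanceAs (Fintype (K.Cr ⊕ Fin n))
  let _ : Fintype (K.Cr ⊕ Fin n → Resolution) := Fintype.ofFinite _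
  refine (@Coloring.bracket_eq X _ j (K.fill W ℓ sg) (inferInstanceAs
    (Fintype (K.Cr ⊕ Fin n → Resolution))) _ f).trans ?_
  simp only [outerSum, strandsBracket, Finset.smul_sum]
  rw [← Fintype.sum_prod_type']
  refine (Fintype.sum_equiv (Equiv.sumArrowEquivProdArrow K.Cr (Fin n) Resolution).symm _ _
    fun x => ?_).symm
  obtain ⟨u, ρ⟩ := x
  have e1 : (∏ c, (K.fill W ℓ sg).stateCoeff j f.color c ((Sum.elim u ρ : _ → Resolution) c)) =
      (∏ c, K.stateCoeff j f.color c (u c)) * ∏ k, (K.fill W ℓ sg).stateCoeff j f.color (.inr k)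
        (ρ k) := Fintype.prod_sum_type _
  have e2 : ∀ k, (K.fill W ℓ sg).stateCoeff j f.color (.inr k) = strandsCoeff ℓ sg
      (fun i => f.color (K.next.symm (W.pt (i, false))))
      (fun i => f.color (W.pt (i, false))) (fun i => f.color (W.pt (i, true))) j k := by
    have e3 : ∀ p, f.color (K.next.symm (W.pt p)) = before
        (fun i => f.color (K.next.symm (W.pt (i, false)))) (fun i => f.color (W.pt (i, false))) p := by
      rintro ⟨i, c⟩
      cases c
      · rfl
      · rw [← W.next_eq, Equiv.symm_apply_apply]
        rfl
    have e4 : ∀ p, f.color (W.pt p) = before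
        (fun i => f.color (W.pt (i, false))) (fun i => f.color (W.pt (i, true))) p := by
      rintro ⟨i, c⟩
      cases c <;> rfl
    intro k
    funext r
    simp only [strandsCoeff, ← e3, ← e4]
    rfl
  refine Eq.trans ?_ (congrArg₂ (· • ·) e1 (W.homeo_graph_fill (sg := sg) u ρ).value_eq).symm
  simp only [e2]
  have e3 : ∀ (r s : SkeinRing j X) (v : GraphModule j X), r • s • v = (r * s) • v :=
    fun r s v => (mul_smul r s v).symm
  exact e3 _ _ _

end LinkDiagram.Window

end

/-! ### Recolouring a window and comparing brackets -/

noncomputable section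

open FramedGraph Tangle

variable {X : Type u} [Biquandle X] {j : Version}

namespace LinkDiagram.Window

variable {K : LinkDiagram} {n : ℕ} (W : K.Window n) {ℓ ℓ' : Layout n} {sg sg' : Fin n → ℤˣ}

/-- Change the colours of the middle edges of the strands in a window. -/
def recolor (color : K.Pt → X) (m : Fin n → X) : K.Pt → X :=
  Function.extend (fun i => W.pt (i, false)) m color

theorem recolor_pt (color : K.Pt → X) (m : Fin n → X) (i : Fin n) :
    W.recolor color m (W.pt (i, false)) = m i :=
  Function.Injective.extend_apply (f := fun i => W.pt (i, false))
    (fun i i' e => congrArg Prod.fst (W.pt.injective e)) m color i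

theorem recolor_of_ne (color : K.Pt → X) (m : Fin n → X) {q : K.Pt}
    (hq : ∀ i, q ≠ W.pt (i, false)) : W.recolor color m q = color q :=
  Function.extend_apply' _ _ _ fun ⟨i, e⟩ => hq i e.symm

theorem recolor_pt_true (color : K.Pt → X) (m : Fin n → X) (i : Fin n) :
    W.recolor color m (W.pt (i, true)) = color (W.pt (i, true)) :=
  W.recolor_of_ne color m fun i' e => by simpa using congrArg Prod.snd (W.pt.injective e)

theorem recolor_next_symm (color : K.Pt → X) (m : Fin n → X) {q : K.Pt}
    (hq : ∀ i, q ≠ W.pt (i, true)) :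
    W.recolor color m (K.next.symm q) = color (K.next.symm q) :=
  W.recolor_of_ne color m fun i e => hq i (by rw [← W.next_eq, ← e, Equiv.apply_symm_apply])

theorem recolor_next_symm_pt (color : K.Pt → X) (m : Fin n → X) (i : Fin n) :
    W.recolor color m (K.next.symm (W.pt (i, false))) = color (K.next.symm (W.pt (i, false))) :=
  W.recolor_next_symm color m fun i' e => by simpa using congrArg Prod.snd (W.pt.injective e)

theorem recolor_pos (color : K.Pt → X) (m : Fin n → X) (x : K.Cr × Bool) :
    W.recolor color m (K.pos x) = color (K.pos x) :=
  W.recolor_of_ne color m fun _ => W.marked _ _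

theorem recolor_next_symm_pos (color : K.Pt → X) (m : Fin n → X) (x : K.Cr × Bool) :
    W.recolor color m (K.next.symm (K.pos x)) = color (K.next.symm (K.pos x)) :=
  W.recolor_next_symm color m fun _ => W.marked _ _

/-- The middle edges of a window join two marked points, so no crossing outside sees their colours.
-/
theorem outerSum_recolor (color : K.Pt → X) (m : Fin n → X) (g : K.State → GraphModule j X) :
    W.outerSum (W.recolor color m) g = W.outerSum color g := by
  simp only [outerSum, stateCoeff, overPt, underPt, recolor_pos, recolor_next_symm_pos]

/-- The colours of the edges before a window. -/
def colorsIn (color : K.Pt → X) (i : Fin n) : X := color (K.next.symm (W.pt (i, false)))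

/-- The colours of the middle edges in a window. -/
def colorsMid (color : K.Pt → X) (i : Fin n) : X := color (W.pt (i, false))

/-- The colours of the edges after a window. -/
def colorsOut (color : K.Pt → X) (i : Fin n) : X := color (W.pt (i, true))

theorem colorsIn_recolor (color : K.Pt → X) (m : Fin n → X) :
    W.colorsIn (W.recolor color m) = W.colorsIn color :=
  funext fun i => W.recolor_next_symm_pt color m i

theorem colorsMid_recolor (color : K.Pt → X) (m : Fin n → X) :
    W.colorsMid (W.recolor color m) = m :=
  funext fun i => W.recolor_pt color m i

theorem colorsOut_recolor (color : K.Pt → X) (m : Fin n → X) :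
    W.colorsOut (W.recolor color m) = W.colorsOut color :=
  funext fun i => W.recolor_pt_true color m i

theorem color_next_symm_pt (color : K.Pt → X) (p : Position n) :
    color (K.next.symm (W.pt p)) = before (W.colorsIn color) (W.colorsMid color) p := by
  obtain ⟨i, c⟩ := p
  cases c
  · rfl
  · rw [← W.next_eq, Equiv.symm_apply_apply]
    rfl

theorem color_pt (color : K.Pt → X) (p : Position n) :
    color (W.pt p) = before (W.colorsMid color) (W.colorsOut color) p := by
  obtain ⟨i, c⟩ := p
  cases c <;> rfl

/-- The colours of the edges in a diagram with crossings added in a window. -/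
def fillColor (f : Coloring (K.fill W ℓ sg) X) : K.Pt → X := f.color

theorem bracket_fill_eq (f : Coloring (K.fill W ℓ sg) X) :
    f.bracket j = W.outerSum (W.fillColor f) fun u => strandsBracket j X (W.outer u) ℓ
      (strandsCoeff ℓ sg (W.colorsIn (W.fillColor f)) (W.colorsMid (W.fillColor f))
        (W.colorsOut (W.fillColor f)) j) :=
  W.bracket_fill f

theorem isColored (f : Coloring (K.fill W ℓ sg) X) :
    IsColored ℓ sg (W.colorsIn (W.fillColor f)) (W.colorsMid (W.fillColor f)) (W.colorsOut (W.fillColor f)) := by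
  intro k
  rw [← W.color_next_symm_pt, ← W.color_pt, ← W.color_next_symm_pt, ← W.color_pt]
  exact ⟨fun h => f.positive (.inr k) h, fun h => f.negative (.inr k) h⟩

theorem next_symm_pt_true (i : Fin n) : K.next.symm (W.pt (i, true)) = W.pt (i, false) := by
  rw [← W.next_eq, Equiv.symm_apply_apply]

/-- A colouring of a diagram with a window, from the colours in the window. -/
theorem exists_coloring_fill {color : K.Pt → X} {m : Fin n → X}
    (marked : ∀ q, q ∉ Set.range K.pos → q ∉ Set.range W.pt → color q = color (K.next.symm q))
    (crossing : ∀ c, CrossingRule (K.sign c) (color (K.next.symm (K.overPt c))) (color (K.overPt c))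
      (color (K.next.symm (K.underPt c))) (color (K.underPt c)))
    (h : IsColored ℓ sg (W.colorsIn color) m (W.colorsOut color)) :
    ∃ f : Coloring (K.fill W ℓ sg) X, (W.fillColor f) = W.recolor color m := by
  have key : ∀ c, CrossingRule ((K.fill W ℓ sg).sign c)
      (W.recolor color m (K.next.symm ((K.fill W ℓ sg).overPt c)))
      (W.recolor color m ((K.fill W ℓ sg).overPt c))
      (W.recolor color m (K.next.symm ((K.fill W ℓ sg).underPt c)))
      (W.recolor color m ((K.fill W ℓ sg).underPt c)) := by
    rintro (c | k)
    · have := crossing c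
      rw [overPt, underPt, ← W.recolor_pos color m, ← W.recolor_pos color m,
        ← W.recolor_next_symm_pos color m, ← W.recolor_next_symm_pos color m] at this
      exact this
    · have := h k
      rw [← W.colorsMid_recolor color m, ← W.colorsIn_recolor color m,
        ← W.colorsOut_recolor color m, ← W.color_next_symm_pt, ← W.color_pt,
        ← W.color_next_symm_pt, ← W.color_pt] at this
      exact this
  refine ⟨⟨W.recolor color m, fun q hq => ?_, fun c => (key c).1, fun c => (key c).2⟩, rfl⟩
  have h1 : q ∉ Set.range K.pos := fun e => hq (W.range_pos_fill.2 (.inl e))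
  have h2 : q ∉ Set.range W.pt := fun e => hq (W.range_pos_fill.2 (.inr e))
  exact (W.recolor_of_ne color m fun i e => h2 ⟨_, e.symm⟩).trans ((marked q h1 h2).trans
    (W.recolor_next_symm color m fun i e => h2 ⟨_, e.symm⟩).symm)

theorem marked_of_fill (f : Coloring (K.fill W ℓ sg) X) (q : K.Pt) (h1 : q ∉ Set.range K.pos)
    (h2 : q ∉ Set.range W.pt) : (W.fillColor f) q = (W.fillColor f) (K.next.symm q) :=
  f.marked q fun e => (W.range_pos_fill.1 e).elim h1 h2

theorem crossing_of_fill (f : Coloring (K.fill W ℓ sg) X) (c : K.Cr) :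
    CrossingRule (K.sign c) (W.fillColor f (K.next.symm (K.overPt c))) (W.fillColor f (K.overPt c))
      (W.fillColor f (K.next.symm (K.underPt c))) (W.fillColor f (K.underPt c)) :=
  ⟨f.positive (.inl c), f.negative (.inl c)⟩

theorem exists_fill_fill (f : Coloring (K.fill W ℓ sg) X)
    (h : ∀ a m b : Fin n → X, IsColored ℓ sg a m b → ∃ m', IsColored ℓ' sg' a m' b ∧
      ∀ O, strandsBracket j X O ℓ' (strandsCoeff ℓ' sg' a m' b j) =
        strandsBracket j X O ℓ (strandsCoeff ℓ sg a m b j)) :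
    ∃ f' : Coloring (K.fill W ℓ' sg') X, f'.bracket j = f.bracket j := by
  obtain ⟨m', h1, h2⟩ := h _ _ _ (W.isColored f)
  obtain ⟨f', hf'⟩ := W.exists_coloring_fill (W.marked_of_fill f) (W.crossing_of_fill f) h1
  refine ⟨f', ?_⟩
  have e := W.bracket_fill_eq (j := j) f'
  rw [hf'] at e
  refine e.trans ((W.outerSum_recolor _ _ _).trans (Eq.trans ?_ (W.bracket_fill_eq f).symm))
  refine congrArg (W.outerSum (W.fillColor f)) (funext fun u => Eq.trans ?_ (h2 _))
  rw [W.colorsIn_recolor, W.colorsMid_recolor, W.colorsOut_recolor]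

/-- Invariance reduced to strands: colours at the ends must extend over the other layout, and the
local brackets must agree for every outer tangle. -/
theorem sameBrackets_fill_fill
    (h : ∀ a m b : Fin n → X, IsColored ℓ sg a m b → ∃ m', IsColored ℓ' sg' a m' b ∧
      ∀ O, strandsBracket j X O ℓ' (strandsCoeff ℓ' sg' a m' b j) =
        strandsBracket j X O ℓ (strandsCoeff ℓ sg a m b j))
    (h' : ∀ a m b : Fin n → X, IsColored ℓ' sg' a m b → ∃ m', IsColored ℓ sg a m' b ∧
      ∀ O, strandsBracket j X O ℓ (strandsCoeff ℓ sg a m' b j) =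
        strandsBracket j X O ℓ' (strandsCoeff ℓ' sg' a m b j)) :
    SameBrackets j X (K.fill W ℓ sg) (K.fill W ℓ' sg') :=
  ⟨fun f => W.exists_fill_fill f h, fun f => W.exists_fill_fill f h'⟩

/-- The version for moves that remove all crossings of the window. Then the colours must pass
through unchanged, and every choice of incoming colours must be possible. -/
theorem sameBrackets_fill_self
    (h : ∀ a m b : Fin n → X, IsColored ℓ sg a m b → a = b ∧
      ∀ O, strandsBracket j X O ℓ (strandsCoeff ℓ sg a m b j) = strandsValue j X O ℓ fun _ => none)
    (h' : ∀ a : Fin n → X, ∃ m, IsColored ℓ sg a m a) :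
    SameBrackets j X (K.fill W ℓ sg) K := by
  constructor
  · intro f
    obtain ⟨h1, h2⟩ := h _ _ _ (W.isColored f)
    have hc := W.crossing_of_fill f
    have key : ∀ c, CrossingRule (K.sign c)
        (W.recolor (W.fillColor f) (W.colorsIn (W.fillColor f)) (K.next.symm (K.overPt c)))
        (W.recolor (W.fillColor f) (W.colorsIn (W.fillColor f)) (K.overPt c))
        (W.recolor (W.fillColor f) (W.colorsIn (W.fillColor f)) (K.next.symm (K.underPt c)))
        (W.recolor (W.fillColor f) (W.colorsIn (W.fillColor f)) (K.underPt c)) := by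
      intro c
      rw [overPt, underPt, W.recolor_pos, W.recolor_pos, W.recolor_next_symm_pos,
        W.recolor_next_symm_pos]
      exact hc c
    -- Without crossings in the window each strand carries its incoming colour throughout; it fits
    -- at the far end because the incoming and outgoing colours agree.
    refine ⟨⟨W.recolor (W.fillColor f) (W.colorsIn (W.fillColor f)), fun q hq => ?_, fun c => (key c).1,
      fun c => (key c).2⟩, ?_⟩
    · by_cases h2 : q ∈ Set.range W.pt
      · obtain ⟨⟨i, c⟩, rfl⟩ := h2
        cases c
        · rw [W.recolor_pt, W.recolor_next_symm_pt]
          rfl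
        · rw [W.next_symm_pt_true, W.recolor_pt, W.recolor_pt_true]
          exact (congrFun h1 i).symm
      · rw [W.recolor_of_ne _ _ fun i e => h2 ⟨_, e.symm⟩,
          W.recolor_next_symm _ _ fun i e => h2 ⟨_, e.symm⟩]
        exact W.marked_of_fill f q hq h2
    · rw [W.bracket_self (ℓ := ℓ)]
      refine (W.outerSum_recolor _ _ _).trans (Eq.trans ?_ (W.bracket_fill_eq f).symm)
      exact congrArg (W.outerSum (W.fillColor f)) (funext fun u => (h2 _).symm)
  · intro f
    have e1 : ∀ p, f.color (W.pt p) = f.color (K.next.symm (W.pt p)) := fun p =>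
      f.marked _ fun ⟨x, e⟩ => W.marked _ _ e
    have e2 : W.colorsIn f.color = W.colorsOut f.color := funext fun i => by
      rw [colorsIn, colorsOut, e1 (i, true), W.next_symm_pt_true, e1 (i, false)]
    obtain ⟨m, hm⟩ := h' (W.colorsIn f.color)
    obtain ⟨f', hf'⟩ := W.exists_coloring_fill (color := f.color) (m := m) (ℓ := ℓ) (sg := sg)
      (fun q hq _ => f.marked q hq) (fun c => ⟨f.positive c, f.negative c⟩) (by rwa [← e2])
    refine ⟨f', ?_⟩
    have e := W.bracket_fill_eq (j := j) f'
    rw [hf'] at e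
    rw [W.bracket_self (ℓ := ℓ)]
    refine e.trans ((W.outerSum_recolor _ _ _).trans
      (congrArg (W.outerSum f.color) (funext fun u => ?_)))
    refine Eq.trans ?_ ((h _ _ _ hm).2 _)
    rw [W.colorsIn_recolor, W.colorsMid_recolor, W.colorsOut_recolor, e2]

end LinkDiagram.Window

end

/-! ### Isomorphisms and marked points -/

noncomputable section

open FramedGraph Tangle

variable {X : Type u} [Biquandle X] {j : Version}

theorem Coloring.crossing {L : LinkDiagram} (f : Coloring L X) (c : L.Cr) :
    CrossingRule (L.sign c) (f.color (L.next.symm (L.overPt c))) (f.color (L.overPt c))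
      (f.color (L.next.symm (L.underPt c))) (f.color (L.underPt c)) :=
  ⟨f.positive c, f.negative c⟩

/-- Brackets agree term by term if a bijection of crossings respects the coefficients and every
state has homeomorphic graphs. -/
theorem Coloring.bracket_congr {L L' : LinkDiagram} (f : Coloring L X) (f' : Coloring L' X)
    (g : L.Cr ≃ L'.Cr)
    (h_coeff : ∀ c, L.stateCoeff j f.color c = L'.stateCoeff j f'.color (g c))
    (h_graph : ∀ s : L'.State, Homeo (LinkDiagram.State.graph (L := L) (s ∘ g))
      (LinkDiagram.State.graph s)) : f'.bracket j = f.bracket j := by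
  let _ := Fintype.ofFinite L.Cr
  let _ := Fintype.ofFinite L'.Cr
  let _ := Fintype.ofFinite L.State
  let _ := Fintype.ofFinite L'.State
  rw [f.bracket_eq, f'.bracket_eq]
  refine Fintype.sum_equiv (g.symm.arrowCongr (Equiv.refl _)) _ _ fun s => ?_
  refine congrArg₂ (· • ·) ?_ (h_graph s).value_eq.symm
  refine Fintype.prod_equiv g.symm _ _ fun c => ?_
  rw [h_coeff, Equiv.apply_symm_apply]
  simp

namespace LinkDiagram

theorem exists_coloring_of_iso {L L' : LinkDiagram} (e : L.Pt ≃ L'.Pt) (g : L.Cr ≃ L'.Cr)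
    (next_eq : ∀ p, e (L.next p) = L'.next (e p))
    (pos_eq : ∀ c t, e (L.pos (c, t)) = L'.pos (g c, t))
    (sign_eq : ∀ c, L.sign c = L'.sign (g c)) (f : Coloring L X) :
    ∃ f' : Coloring L' X, f'.bracket j = f.bracket j := by
  have h1 : ∀ c t, e.symm (L'.pos (g c, t)) = L.pos (c, t) := fun c t => by
    rw [← pos_eq, Equiv.symm_apply_apply]
  have h2 : ∀ q, e.symm (L'.next.symm q) = L.next.symm (e.symm q) := fun q => by
    refine L.next.injective (e.injective ?_)
    rw [next_eq, Equiv.apply_symm_apply, Equiv.apply_symm_apply, Equiv.apply_symm_apply,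
      Equiv.apply_symm_apply]
  have key : ∀ c t, e.symm (L'.next.symm (L'.pos (g c, t))) = L.next.symm (L.pos (c, t)) :=
    fun c t => by rw [h2, h1]
  have hc : ∀ c, CrossingRule (L'.sign (g c))
      (f.color (e.symm (L'.next.symm (L'.overPt (g c))))) (f.color (e.symm (L'.overPt (g c))))
      (f.color (e.symm (L'.next.symm (L'.underPt (g c)))))
      (f.color (e.symm (L'.underPt (g c)))) := fun c => by
    simp only [overPt, underPt, h1, key, ← sign_eq]
    exact f.crossing c
  refine ⟨⟨fun q => f.color (e.symm q), fun q hq => ?_, fun c => ?_, fun c => ?_⟩, ?_⟩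
  · rw [h2]
    refine f.marked _ ?_
    rintro ⟨⟨c, t⟩, h⟩
    exact hq ⟨(g c, t), by rw [← pos_eq, h, Equiv.apply_symm_apply]⟩
  · have := (hc (g.symm c)).1
    rwa [Equiv.apply_symm_apply] at this
  · have := (hc (g.symm c)).2
    rwa [Equiv.apply_symm_apply] at this
  · refine f.bracket_congr _ g (fun c => ?_) fun s => ?_
    · funext r
      simp only [stateCoeff, overPt, underPt, h1, key, ← sign_eq]
    · refine .rel _ _ (.iso _ _ (e.prodCongr (Equiv.refl Bool))
        (g.subtypeEquiv fun c => Iff.rfl) ?_ ?_ ?_)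
      · rintro ⟨p, b⟩
        cases b
        · refine Prod.ext ?_ rfl
          change e (L.next.symm p) = L'.next.symm (e p)
          rw [Equiv.eq_symm_apply, ← next_eq, Equiv.apply_symm_apply]
        · exact Prod.ext (next_eq p) rfl
      · rintro ⟨p, b⟩
        by_cases hp : p ∈ Set.range L.pos
        · obtain ⟨⟨c, t⟩, rfl⟩ := hp
          refine (congrArg (e.prodCongr (Equiv.refl Bool))
            (State.opp_pos (L := L) (s ∘ g) c t b)).trans (Eq.trans ?_
            ((congrArg (fun x => State.opp s (x, b)) (pos_eq c t)).trans
              (State.opp_pos s (g c) t b)).symm)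
          rcases h : s (g c) with _ | _ | _ <;> simp [h, pos_eq]
        · refine (congrArg (e.prodCongr (Equiv.refl Bool))
            (State.opp_marked (L := L) (s ∘ g) p hp b)).trans
            (State.opp_marked s (e p) ?_ b).symm
          rintro ⟨⟨c, t⟩, h⟩
          refine hp ⟨(g.symm c, t), e.injective ?_⟩
          rw [pos_eq, Equiv.apply_symm_apply, h]
      · rintro ⟨c, hc⟩ ⟨t, b⟩
        exact ⟨(t, b), Prod.ext (pos_eq c t) rfl⟩

theorem sameBrackets_of_iso {L L' : LinkDiagram} (e : L.Pt ≃ L'.Pt) (g : L.Cr ≃ L'.Cr)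
    (next_eq : ∀ p, e (L.next p) = L'.next (e p))
    (pos_eq : ∀ c t, e (L.pos (c, t)) = L'.pos (g c, t))
    (sign_eq : ∀ c, L.sign c = L'.sign (g c)) : SameBrackets j X L L' := by
  refine ⟨exists_coloring_of_iso e g next_eq pos_eq sign_eq,
    exists_coloring_of_iso e.symm g.symm (fun q => ?_) (fun c t => ?_) fun c => ?_⟩
  · rw [Equiv.symm_apply_eq, next_eq, Equiv.apply_symm_apply]
  · rw [Equiv.symm_apply_eq, pos_eq, Equiv.apply_symm_apply]
  · rw [sign_eq, Equiv.apply_symm_apply]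

theorem mark_next_none (L : LinkDiagram) (p : L.Pt) :
    (L.mark p).next none = some (L.next p) := by
  classical
  exact Equiv.swap_apply_left (none : Option L.Pt) (some (L.next p))

theorem mark_next_self (L : LinkDiagram) (p : L.Pt) : (L.mark p).next (some p) = none := by
  classical
  exact Equiv.swap_apply_right (none : Option L.Pt) (some (L.next p))

theorem mark_next_of_ne (L : LinkDiagram) {p q : L.Pt} (h : q ≠ p) :
    (L.mark p).next (some q) = some (L.next q) := by
  classical
  exact Equiv.swap_apply_of_ne_of_ne (Option.some_ne_none (L.next q)) fun e =>
    h (L.next.injective (Option.some_injective _ e))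

/-- The colours of the edges after the insertion of a marked point. -/
def markColor (L : LinkDiagram) (p : L.Pt) (color : L.Pt → X) (q : (L.mark p).Pt) : X :=
  Option.elim (show Option L.Pt from q) (color p) color

theorem mark_next_symm_none (L : LinkDiagram) (p : L.Pt) :
    (L.mark p).next.symm none = some p :=
  (Equiv.symm_apply_eq _).2 (L.mark_next_self p).symm

theorem mark_next_symm_next (L : LinkDiagram) (p : L.Pt) :
    (L.mark p).next.symm (some (L.next p)) = none :=
  (Equiv.symm_apply_eq _).2 (L.mark_next_none p).symm

theorem mark_next_symm_of_ne (L : LinkDiagram) {p q : L.Pt} (h : q ≠ L.next p) :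
    (L.mark p).next.symm (some q) = some (L.next.symm q) :=
  (Equiv.symm_apply_eq _).2 (by
    rw [L.mark_next_of_ne fun e => h (by rw [← e, Equiv.apply_symm_apply]),
      Equiv.apply_symm_apply])

theorem markColor_next_symm (L : LinkDiagram) (p : L.Pt) (color : L.Pt → X) (q : L.Pt) :
    L.markColor p color ((L.mark p).next.symm (some q)) = color (L.next.symm q) := by
  by_cases h : q = L.next p
  · rw [h, L.mark_next_symm_next, Equiv.symm_apply_apply]
    rfl
  · rw [L.mark_next_symm_of_ne h]
    rfl

/-- The half-edges of a graph with a further 2-valent node. -/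
def markHalf (P : Type) : (P × Bool) ⊕ Bool ≃ Option P × Bool where
  toFun := Sum.elim (fun h => (some h.1, h.2)) fun b => (none, b)
  invFun x := x.1.elim (.inr x.2) fun q => .inl (q, x.2)
  left_inv := by rintro (⟨q, b⟩ | b) <;> rfl
  right_inv := by rintro ⟨_ | q, b⟩ <;> rfl

/-- A marked point on a diagram is a subdivision in every state graph. -/
theorem homeo_graph_mark (L : LinkDiagram) (p : L.Pt) (s : L.State) :
    Homeo (State.graph s) (State.graph (L := L.mark p) s) := by
  refine .trans _ _ _ (.rel _ _ (.subdivide _ (p, true))) (.rel _ _ (.iso _ _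
    (markHalf L.Pt) (Equiv.refl _) ?_ ?_ ?_))
  · rintro (⟨q, b⟩ | b)
    · cases b
      · by_cases h : q = L.next p
        · subst h
          refine (congrArg (markHalf L.Pt) ((State.graph s).subdivide_edge_edge (p, true))).trans ?_
          exact Prod.ext (L.mark_next_symm_next p).symm rfl
        · refine (congrArg (markHalf L.Pt) ((State.graph s).subdivide_edge_of_ne
            (h := (p, true)) (k := (q, false)) (fun e => by cases e)
            fun e => h (congrArg Prod.fst e))).trans ?_
          exact Prod.ext (L.mark_next_symm_of_ne h).symm rfl
      · by_cases h : q = p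
        · subst h
          refine (congrArg (markHalf L.Pt) ((State.graph s).subdivide_edge_self (q, true))).trans ?_
          exact Prod.ext (L.mark_next_self q).symm rfl
        · refine (congrArg (markHalf L.Pt) ((State.graph s).subdivide_edge_of_ne
            (h := (p, true)) (k := (q, true)) (fun e => h (congrArg Prod.fst e))
            fun e => by cases e)).trans ?_
          exact Prod.ext (L.mark_next_of_ne h).symm rfl
    · cases b
      · exact Prod.ext (L.mark_next_symm_none p).symm rfl
      · exact Prod.ext (L.mark_next_none p).symm rfl
  · rintro (⟨q, b⟩ | b)
    · by_cases hq : q ∈ Set.range L.pos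
      · obtain ⟨⟨c, t⟩, rfl⟩ := hq
        refine Eq.trans ?_ (State.opp_pos (L := L.mark p) s c t b).symm
        refine (congrArg (fun x : L.Pt × Bool => (some x.1, x.2)) (State.opp_pos s c t b)).trans ?_
        rcases h : s c with _ | _ | _ <;> simp only [h] <;> rfl
      · refine Eq.trans ?_ (State.opp_marked (L := L.mark p) s (some q) ?_ b).symm
        · exact congrArg (fun x : L.Pt × Bool => (some x.1, x.2)) (State.opp_marked s q hq b)
        · rintro ⟨x, e⟩
          exact hq ⟨x, Option.some_injective _ e⟩
    · refine (State.opp_marked (L := L.mark p) s none ?_ b).symm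
      rintro ⟨x, e⟩
      cases e
  · rintro v ⟨t, b⟩
    exact ⟨(t, b), rfl⟩

theorem sameBrackets_mark (L : LinkDiagram) (p : L.Pt) : SameBrackets j X L (L.mark p) := by
  have hc : ∀ (color : L.Pt → X) c, L.stateCoeff j color c =
      (L.mark p).stateCoeff j (L.markColor p color) c := by
    intro color c
    funext r
    have h1 : ∀ x, L.markColor p color ((L.mark p).next.symm ((L.mark p).pos x)) =
      color (L.next.symm (L.pos x)) := fun x => L.markColor_next_symm p color _
    simp only [stateCoeff, overPt, underPt, h1]
    rfl
  have hr : ∀ (color : L.Pt → X) c, CrossingRule (L.sign c)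
        (color (L.next.symm (L.overPt c))) (color (L.overPt c))
        (color (L.next.symm (L.underPt c))) (color (L.underPt c)) ↔
      CrossingRule ((L.mark p).sign c)
        (L.markColor p color ((L.mark p).next.symm ((L.mark p).overPt c)))
        (L.markColor p color ((L.mark p).overPt c))
        (L.markColor p color ((L.mark p).next.symm ((L.mark p).underPt c)))
        (L.markColor p color ((L.mark p).underPt c)) := by
    intro color c
    have h1 : ∀ x, L.markColor p color ((L.mark p).next.symm ((L.mark p).pos x)) =
      color (L.next.symm (L.pos x)) := fun x => L.markColor_next_symm p color _
    simp only [overPt, underPt, h1]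
    rfl
  constructor
  · intro f
    refine ⟨⟨L.markColor p f.color, ?_, fun c => ((hr _ c).1 (f.crossing c)).1,
      fun c => ((hr _ c).1 (f.crossing c)).2⟩, f.bracket_congr _ (Equiv.refl _) (hc f.color)
      (L.homeo_graph_mark p)⟩
    rintro (_ | q) hq
    · exact (congrArg (L.markColor p f.color) (L.mark_next_symm_none p)).symm
    · refine Eq.trans ?_ (L.markColor_next_symm p f.color q).symm
      exact f.marked q fun ⟨x, e⟩ => hq ⟨x, congrArg some e⟩
  · intro f
    let color : L.Pt → X := fun q => f.color (some q)
    -- The condition at the new marked point forces its colour to be that of `p`, so restricting the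
    -- colouring loses nothing.
    have e : f.color = L.markColor p color := by
      funext q
      rcases q with _ | q
      · refine (f.marked none ?_).trans (congrArg f.color (L.mark_next_symm_none p))
        rintro ⟨x, e⟩
        cases e
      · rfl
    have h1 : ∀ q, q ∉ Set.range L.pos → color q = color (L.next.symm q) := fun q hq => by
      rw [← L.markColor_next_symm p color q, ← e]
      exact f.marked (some q) fun ⟨x, h⟩ => hq ⟨x, Option.some_injective _ h⟩
    have h2 : ∀ c, CrossingRule (L.sign c) (color (L.next.symm (L.overPt c)))
        (color (L.overPt c)) (color (L.next.symm (L.underPt c))) (color (L.underPt c)) :=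
      fun c => (hr color c).2 (e ▸ f.crossing c)
    have h3 : ∀ c, L.stateCoeff j color c = (L.mark p).stateCoeff j f.color c := fun c => by
      rw [e]
      exact hc color c
    exact ⟨⟨color, h1, fun c => (h2 c).1, fun c => (h2 c).2⟩, (Coloring.bracket_congr
      (L := L) ⟨color, h1, fun c => (h2 c).1, fun c => (h2 c).2⟩ f (Equiv.refl L.Cr) h3
      (L.homeo_graph_mark p)).symm⟩

end LinkDiagram

end

/-! ### Colours of kinks, bigons and triangles -/

noncomputable section

open FramedGraph Tangle

variable {X : Type u} [Biquandle X] {j : Version}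

/-- The hypothesis says that the switch map sends `(x, y)` to the diagonal. By `x ⊚ x = x ⧆ x` the
switch maps the diagonal injectively to itself, hence onto it since `X` is finite; injectivity of
the switch puts `(x, y)` on the diagonal. -/
theorem Biquandle.eq_of_star_eq_circ [Finite X] {x y : X} (h : y ⧆ x = x ⊚ y) : x = y := by
  have hi : Function.Injective fun x : X => x ⊚ x := fun x x' e => by
    have : ((x, x) : X × X) = (x', x') := Biquandle.switch_bijective.1 (by
      have e : x ⊚ x = x' ⊚ x' := e
      simp only [← Biquandle.circ_self, e])
    exact congrArg Prod.fst this
  obtain ⟨v, hv⟩ := (Finite.injective_iff_surjective.1 hi) (x ⊚ y)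
  have hv : v ⊚ v = x ⊚ y := hv
  have : ((x, y) : X × X) = (v, v) := Biquandle.switch_bijective.1 (by
    simp only [← Biquandle.circ_self, hv, h])
  exact (congrArg Prod.fst this).trans (congrArg Prod.snd this).symm

theorem Biquandle.exists_circ_self [Finite X] (a : X) : ∃ x : X, x ⊚ x = a := by
  have hi : Function.Injective fun x : X => x ⊚ x := fun x x' e => by
    have : ((x, x) : X × X) = (x', x') := Biquandle.switch_bijective.1 (by
      have e : x ⊚ x = x' ⊚ x' := e
      simp only [← Biquandle.circ_self, e])
    exact congrArg Prod.fst this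
  exact (Finite.injective_iff_surjective.1 hi) a

theorem crossingRule_one {oi oo ui uo : X} :
    CrossingRule 1 oi oo ui uo ↔ oo = oi ⧆ uo ∧ ui = uo ⊚ oi := by
  simp [CrossingRule, show ¬ (1 : ℤˣ) = -1 by decide]

theorem crossingRule_neg_one {oi oo ui uo : X} :
    CrossingRule (-1) oi oo ui uo ↔ oi = oo ⧆ ui ∧ uo = ui ⊚ oo := by
  simp [CrossingRule, show ¬ (-1 : ℤˣ) = 1 by decide]

namespace Tangle

theorem isColored_kink_true {s : ℤˣ} {a m b : Fin 1 → X} :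
    IsColored (kinkLayout true) (fun _ => s) a m b ↔ CrossingRule s (a 0) (m 0) (m 0) (b 0) := by
  constructor
  · exact fun h => h 0
  · intro h k
    rw [Subsingleton.elim k 0]
    exact h

theorem isColored_kink_false {s : ℤˣ} {a m b : Fin 1 → X} :
    IsColored (kinkLayout false) (fun _ => s) a m b ↔ CrossingRule s (m 0) (b 0) (a 0) (m 0) := by
  constructor
  · exact fun h => h 0
  · intro h k
    rw [Subsingleton.elim k 0]
    exact h

theorem strandsCoeff_kink_true (s : ℤˣ) (a m b : Fin 1 → X) :
    strandsCoeff (kinkLayout true) (fun _ => s) a m b j = fun _ => skeinCoeff j s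
      (crossingLabels s (a 0) (m 0) (m 0) (b 0)).1 (crossingLabels s (a 0) (m 0) (m 0) (b 0)).2 := by
  funext k
  rw [Subsingleton.elim k 0]
  rfl

theorem strandsCoeff_kink_false (s : ℤˣ) (a m b : Fin 1 → X) :
    strandsCoeff (kinkLayout false) (fun _ => s) a m b j = fun _ => skeinCoeff j s
      (crossingLabels s (m 0) (b 0) (a 0) (m 0)).1 (crossingLabels s (m 0) (b 0) (a 0) (m 0)).2 := by
  funext k
  rw [Subsingleton.elim k 0]
  rfl

theorem crossingLabels_one (oi oo ui uo : X) : crossingLabels 1 oi oo ui uo = (uo, oi) :=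
  if_pos rfl

theorem crossingLabels_neg_one (oi oo ui uo : X) : crossingLabels (-1) oi oo ui uo = (ui, oo) :=
  if_neg (by decide)

/-- In two of the four kinks the edge inside supplies both labels. In the other two it is the common
value `y ⧆ x = x ⊚ y` of the outer colours, which then coincide. -/
theorem eq_of_isColored_kink [Finite X] {t : Bool} {s : ℤˣ} {a m b : Fin 1 → X}
    (h : IsColored (kinkLayout t) (fun _ => s) a m b) :
    a = b ∧ ∃ x, strandsCoeff (kinkLayout t) (fun _ => s) a m b j = fun _ => skeinCoeff j s x x := by
  have key : a 0 = b 0 → a = b := fun e => funext fun k => by rw [Subsingleton.elim k 0, e]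
  rcases Int.units_eq_one_or s with rfl | rfl <;> cases t
  · rw [isColored_kink_false, crossingRule_one] at h
    refine ⟨key ?_, m 0, ?_⟩
    · rw [h.1, h.2, Biquandle.circ_self]
    · rw [strandsCoeff_kink_false, crossingLabels_one]
  · rw [isColored_kink_true, crossingRule_one] at h
    have e := Biquandle.eq_of_star_eq_circ (h.1.symm.trans h.2)
    refine ⟨key e.symm, b 0, ?_⟩
    rw [strandsCoeff_kink_true, crossingLabels_one, e]
  · rw [isColored_kink_false, crossingRule_neg_one] at h
    have e := Biquandle.eq_of_star_eq_circ (h.1.symm.trans h.2)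
    refine ⟨key e, b 0, ?_⟩
    rw [strandsCoeff_kink_false, crossingLabels_neg_one, e]
  · rw [isColored_kink_true, crossingRule_neg_one] at h
    refine ⟨key ?_, m 0, ?_⟩
    · rw [h.1, h.2, Biquandle.circ_self]
    · rw [strandsCoeff_kink_true, crossingLabels_neg_one]

theorem exists_isColored_kink [Finite X] (t : Bool) (s : ℤˣ) (a : Fin 1 → X) :
    ∃ m, IsColored (kinkLayout t) (fun _ => s) a m a := by
  obtain ⟨x, hx⟩ := Biquandle.exists_circ_self (a 0)
  rcases Int.units_eq_one_or s with rfl | rfl <;> cases t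
  · exact ⟨fun _ => x, isColored_kink_false.2
      (crossingRule_one.2 ⟨by rw [← Biquandle.circ_self, hx], hx.symm⟩)⟩
  · exact ⟨fun _ => a 0 ⧆ a 0, isColored_kink_true.2
      (crossingRule_one.2 ⟨rfl, (Biquandle.circ_self _).symm⟩)⟩
  · exact ⟨fun _ => a 0 ⧆ a 0, isColored_kink_false.2
      (crossingRule_neg_one.2 ⟨rfl, (Biquandle.circ_self _).symm⟩)⟩
  · exact ⟨fun _ => x, isColored_kink_true.2
      (crossingRule_neg_one.2 ⟨by rw [← Biquandle.circ_self, hx], hx.symm⟩)⟩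

theorem isColored_bigon_false {s : ℤˣ} {a m b : Fin 2 → X} :
    IsColored (bigonLayout false) ![s, -s] a m b ↔ CrossingRule s (a 0) (m 0) (a 1) (m 1) ∧
      CrossingRule (-s) (m 0) (b 0) (m 1) (b 1) := by
  rw [IsColored, Fin.forall_fin_two]
  rfl

theorem isColored_bigon_true {s : ℤˣ} {a m b : Fin 2 → X} :
    IsColored (bigonLayout true) ![s, -s] a m b ↔ CrossingRule s (a 0) (m 0) (m 1) (b 1) ∧
      CrossingRule (-s) (m 0) (b 0) (a 1) (m 1) := by
  rw [IsColored, Fin.forall_fin_two]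
  rfl

theorem strandsCoeff_bigon_eq {t : Bool} {s : ℤˣ} {a m b : Fin 2 → X} {x y : X}
    (h : crossingLabels s (before a m (bigonLayout t (0, true))) (before m b (bigonLayout t (0, true)))
      (before a m (bigonLayout t (0, false))) (before m b (bigonLayout t (0, false))) = (x, y))
    (h' : crossingLabels (-s) (before a m (bigonLayout t (1, true)))
      (before m b (bigonLayout t (1, true))) (before a m (bigonLayout t (1, false)))
      (before m b (bigonLayout t (1, false))) = (x, y)) :
    strandsCoeff (bigonLayout t) ![s, -s] a m b j = ![skeinCoeff j s x y, skeinCoeff j (-s) x y] := by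
  funext k
  revert k
  refine Fin.forall_fin_two.2 ⟨?_, ?_⟩
  · simp only [strandsCoeff, Matrix.cons_val_zero]
    rw [h]
  · simp only [strandsCoeff, Matrix.cons_val_one, Matrix.cons_val_zero]
    rw [h']

/-- The two crossings impose the same equations on the incoming and on the outgoing colours.
Depending on sign and direction, equality follows by cancelling one of the right operations or the
switch, or is immediate. -/
theorem eq_of_isColored_bigon {t : Bool} {s : ℤˣ} {a m b : Fin 2 → X}
    (h : IsColored (bigonLayout t) ![s, -s] a m b) :
    a = b ∧ ∃ x y, strandsCoeff (bigonLayout t) ![s, -s] a m b j =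
      ![skeinCoeff j s x y, skeinCoeff j (-s) x y] := by
  have key : a 0 = b 0 → a 1 = b 1 → a = b := fun e e' => funext fun k => by
    fin_cases k
    · exact e
    · exact e'
  rcases Int.units_eq_one_or s with rfl | rfl <;> cases t
  · rw [isColored_bigon_false, crossingRule_one, crossingRule_neg_one] at h
    obtain ⟨⟨h1, h2⟩, h3, h4⟩ := h
    have e : a 0 = b 0 := (Biquandle.star_bijective (m 1)).1 (h1.symm.trans h3)
    refine ⟨key e ?_, m 1, a 0, strandsCoeff_bigon_eq (crossingLabels_one _ _ _ _) ?_⟩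
    · rw [h2, h4, e]
    · rw [e]
      exact crossingLabels_neg_one _ _ _ _
  · rw [isColored_bigon_true, crossingRule_one, crossingRule_neg_one] at h
    obtain ⟨⟨h1, h2⟩, h3, h4⟩ := h
    have e : ((b 1, a 0) : X × X) = (a 1, b 0) := Biquandle.switch_bijective.1
      (Prod.ext (h1.symm.trans h3) (h2.symm.trans h4))
    have e0 : a 0 = b 0 := congrArg Prod.snd e
    have e1 : b 1 = a 1 := congrArg Prod.fst e
    refine ⟨key e0 e1.symm, b 1, a 0, strandsCoeff_bigon_eq (crossingLabels_one _ _ _ _) ?_⟩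
    rw [e0, e1]
    exact crossingLabels_neg_one _ _ _ _
  · rw [isColored_bigon_false, neg_neg, crossingRule_one, crossingRule_neg_one] at h
    obtain ⟨⟨h1, h2⟩, h3, h4⟩ := h
    have e : a 1 = b 1 := (Biquandle.circ_bijective (m 0)).1 (h2.symm.trans h4)
    refine ⟨key ?_ e, a 1, m 0, strandsCoeff_bigon_eq (crossingLabels_neg_one _ _ _ _) ?_⟩
    · rw [h1, h3, e]
    · rw [neg_neg, e]
      exact crossingLabels_one _ _ _ _
  · rw [isColored_bigon_true, neg_neg, crossingRule_one, crossingRule_neg_one] at h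
    obtain ⟨⟨h1, h2⟩, h3, h4⟩ := h
    refine ⟨key (h1.trans h3.symm) (h4.trans h2.symm), m 1, m 0,
      strandsCoeff_bigon_eq (crossingLabels_neg_one _ _ _ _) ?_⟩
    rw [neg_neg]
    exact crossingLabels_one _ _ _ _

/-- The surjectivity counterpart: the middle colours are computed, or solved for by the right
operations or the switch. -/
theorem exists_isColored_bigon (t : Bool) (s : ℤˣ) (a : Fin 2 → X) :
    ∃ m, IsColored (bigonLayout t) ![s, -s] a m a := by
  rcases Int.units_eq_one_or s with rfl | rfl <;> cases t
  · obtain ⟨x, hx⟩ := (Biquandle.circ_bijective (a 0)).2 (a 1)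
    have hx : x ⊚ a 0 = a 1 := hx
    refine ⟨![a 0 ⧆ x, x], ?_⟩
    rw [isColored_bigon_false, crossingRule_one, crossingRule_neg_one]
    exact ⟨⟨rfl, hx.symm⟩, rfl, hx.symm⟩
  · refine ⟨![a 0 ⧆ a 1, a 1 ⊚ a 0], ?_⟩
    rw [isColored_bigon_true, crossingRule_one, crossingRule_neg_one]
    exact ⟨⟨rfl, rfl⟩, rfl, rfl⟩
  · obtain ⟨y, hy⟩ := (Biquandle.star_bijective (a 1)).2 (a 0)
    have hy : y ⧆ a 1 = a 0 := hy
    refine ⟨![y, a 1 ⊚ y], ?_⟩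
    rw [isColored_bigon_false, neg_neg, crossingRule_one, crossingRule_neg_one]
    exact ⟨⟨hy.symm, rfl⟩, hy.symm, rfl⟩
  · obtain ⟨⟨x, y⟩, h⟩ := Biquandle.switch_bijective.2 (a 0, a 1)
    have h1 : y ⧆ x = a 0 := congrArg Prod.fst h
    have h2 : x ⊚ y = a 1 := congrArg Prod.snd h
    refine ⟨![y, x], ?_⟩
    rw [isColored_bigon_true, neg_neg, crossingRule_one, crossingRule_neg_one]
    exact ⟨⟨h1.symm, h2.symm⟩, h1.symm, h2.symm⟩

theorem isColored_triangle {a m b : Fin 3 → X} :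
    IsColored triangleLayout (fun _ => 1) a m b ↔ CrossingRule 1 (a 0) (m 0) (a 1) (m 1) ∧
      CrossingRule 1 (m 0) (b 0) (a 2) (m 2) ∧ CrossingRule 1 (m 1) (b 1) (m 2) (b 2) := by
  rw [IsColored, Fin.forall_fin_succ, Fin.forall_fin_two]
  rfl

theorem isColored_triangle' {a m b : Fin 3 → X} :
    IsColored triangleLayout' (fun _ => 1) a m b ↔ CrossingRule 1 (m 0) (b 0) (m 1) (b 1) ∧
      CrossingRule 1 (a 0) (m 0) (m 2) (b 2) ∧ CrossingRule 1 (a 1) (m 1) (a 2) (m 2) := by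
  rw [IsColored, Fin.forall_fin_succ, Fin.forall_fin_two]
  rfl

theorem strandsCoeff_triangle (a m b : Fin 3 → X) :
    strandsCoeff triangleLayout (fun _ => 1) a m b j =
      ![skeinCoeff j 1 (m 1) (a 0), skeinCoeff j 1 (m 2) (m 0), skeinCoeff j 1 (b 2) (m 1)] := by
  funext k
  fin_cases k <;> rfl

theorem strandsCoeff_triangle' (a m b : Fin 3 → X) :
    strandsCoeff triangleLayout' (fun _ => 1) a m b j =
      ![skeinCoeff j 1 (b 1) (m 0), skeinCoeff j 1 (b 2) (a 0), skeinCoeff j 1 (m 2) (a 1)] := by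
  funext k
  fin_cases k <;> rfl

/-- With `x = b 2`, `y = m 1` and `z = a 0`, the labels on both sides take exactly the form that
occurs in the third relations. -/
theorem strandsBracket_of_isColored_triangle {a m m' b : Fin 3 → X}
    (h : IsColored triangleLayout (fun _ => 1) a m b)
    (h' : IsColored triangleLayout' (fun _ => 1) a m' b) (O : Tangle (Position 3)) :
    strandsBracket j X O triangleLayout' (strandsCoeff triangleLayout' (fun _ => 1) a m' b j) =
      strandsBracket j X O triangleLayout (strandsCoeff triangleLayout (fun _ => 1) a m b j) := by
  rw [isColored_triangle, crossingRule_one, crossingRule_one, crossingRule_one] at h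
  rw [isColored_triangle', crossingRule_one, crossingRule_one, crossingRule_one] at h'
  obtain ⟨⟨h1, h2⟩, ⟨h3, h4⟩, h5, h6⟩ := h
  obtain ⟨⟨k1, k2⟩, ⟨k3, k4⟩, k5, k6⟩ := h'
  rw [strandsCoeff_triangle, strandsCoeff_triangle', h1, h2, h5, h6, k3, k4]
  exact (strandsBracket_triangle O _ _ _).symm

/-- The outgoing colours agree on the two sides by the three exchange laws, one for each strand. -/
theorem exists_isColored_triangle' {a m b : Fin 3 → X}
    (h : IsColored triangleLayout (fun _ => 1) a m b) :
    ∃ m', IsColored triangleLayout' (fun _ => 1) a m' b := by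
  rw [isColored_triangle, crossingRule_one, crossingRule_one, crossingRule_one] at h
  obtain ⟨⟨h1, h2⟩, ⟨h3, h4⟩, h5, h6⟩ := h
  refine ⟨![a 0 ⧆ b 2, b 1 ⊚ (a 0 ⧆ b 2), b 2 ⊚ a 0], ?_⟩
  rw [isColored_triangle', crossingRule_one, crossingRule_one, crossingRule_one]
  refine ⟨⟨?_, rfl⟩, ⟨rfl, rfl⟩, ?_, ?_⟩
  · change b 0 = (a 0 ⧆ b 2) ⧆ b 1
    rw [h3, h1, h5, h6, Biquandle.exchange_star]
  · change b 1 ⊚ (a 0 ⧆ b 2) = a 1 ⧆ (b 2 ⊚ a 0)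
    rw [h5, h2, Biquandle.exchange_mixed]
  · change a 2 = (b 2 ⊚ a 0) ⊚ a 1
    rw [h4, h6, h1, h2, Biquandle.exchange_circ]

/-- In this direction the middle colour `y` of the second strand is not given by a formula; it is
solved from `y ⊚ a 0 = a 1`. The mixed exchange law then yields `b 1 = y ⧆ b 2` after cancellation.
-/
theorem exists_isColored_triangle {a m b : Fin 3 → X}
    (h : IsColored triangleLayout' (fun _ => 1) a m b) :
    ∃ m', IsColored triangleLayout (fun _ => 1) a m' b := by
  rw [isColored_triangle', crossingRule_one, crossingRule_one, crossingRule_one] at h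
  obtain ⟨⟨h1, h2⟩, ⟨h3, h4⟩, h5, h6⟩ := h
  obtain ⟨y, hy⟩ := (Biquandle.circ_bijective (a 0)).2 (a 1)
  have hy : y ⊚ a 0 = a 1 := hy
  have e : b 1 = y ⧆ b 2 := (Biquandle.circ_bijective (m 0)).1 (by
    change b 1 ⊚ m 0 = (y ⧆ b 2) ⊚ m 0
    rw [← h2, h5, ← hy, h4, h3, Biquandle.exchange_mixed])
  refine ⟨![a 0 ⧆ y, y, b 2 ⊚ y], ?_⟩
  rw [isColored_triangle, crossingRule_one, crossingRule_one, crossingRule_one]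
  refine ⟨⟨rfl, hy.symm⟩, ⟨?_, ?_⟩, e, rfl⟩
  · change b 0 = (a 0 ⧆ y) ⧆ (b 2 ⊚ y)
    rw [h1, h3, e, Biquandle.exchange_star]
  · change a 2 = (b 2 ⊚ y) ⊚ (a 0 ⧆ y)
    rw [h6, h4, ← hy, Biquandle.exchange_circ]

end Tangle

namespace LinkDiagram

/-- The window of the crossings `cr` after these have been removed. -/
def windowOf (L : LinkDiagram) {n : ℕ} (cr : Fin n ↪ L.Cr) (S : Set L.Cr) (hS : ∀ k, cr k ∈ S)
    (ℓ : Layout n)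
    (h : ∀ i, L.next (L.pos (cr (ℓ.symm (i, false)).1, (ℓ.symm (i, false)).2)) =
      L.pos (cr (ℓ.symm (i, true)).1, (ℓ.symm (i, true)).2)) : (L.erase S).Window n where
  pt := ⟨fun p => L.pos (cr (ℓ.symm p).1, (ℓ.symm p).2), fun p p' e => by
    have e := L.pos.injective e
    simp only [Prod.mk.injEq] at e
    exact ℓ.symm.injective (Prod.ext (cr.injective e.1) e.2)⟩
  marked p x e := by
    obtain ⟨⟨c, hc⟩, t⟩ := x
    have e : c = cr (ℓ.symm p).1 := congrArg Prod.fst (L.pos.injective e)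
    exact hc (e ▸ hS _)
  next_eq := h

/-- Brings a diagram `L'` before or after a move into the form of one common diagram with a filled
window: the crossings in `S` are removed from `L` and put back with the layout `ℓ'`. -/
theorem sameBrackets_fill_windowOf (L : LinkDiagram) {n : ℕ} (cr : Fin n ↪ L.Cr) (S : Set L.Cr)
    (hS : ∀ c, c ∈ S ↔ ∃ k, cr k = c) (ℓ : Layout n)
    (h : ∀ i, L.next (L.pos (cr (ℓ.symm (i, false)).1, (ℓ.symm (i, false)).2)) =
      L.pos (cr (ℓ.symm (i, true)).1, (ℓ.symm (i, true)).2)) (ℓ' : Layout n) {sg : Fin n → ℤˣ}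
    (hsg : ∀ k, L.sign (cr k) = sg k) (L' : LinkDiagram) (e : L'.Pt ≃ L.Pt)
    (g : L'.Cr ≃ L.Cr) (next_eq : ∀ p, e (L'.next p) = L.next (e p))
    (pos_eq : ∀ c t, g c ∉ S → e (L'.pos (c, t)) = L.pos (g c, t))
    (pos_eq' : ∀ k t, e (L'.pos (g.symm (cr k), t)) =
      L.pos (cr (ℓ.symm (ℓ' (k, t))).1, (ℓ.symm (ℓ' (k, t))).2))
    (sign_eq : ∀ c, L'.sign c = L.sign (g c)) :
    SameBrackets j X L'
      ((L.erase S).fill (L.windowOf cr S (fun k => (hS _).2 ⟨k, rfl⟩) ℓ h) ℓ' sg) := by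
  let g' : {c // c ∉ S} ⊕ Fin n ≃ L'.Cr := Equiv.ofBijective
    (Sum.elim (fun c => g.symm c.1) fun k => g.symm (cr k)) (by
      constructor
      · rintro (c | k) (c' | k') e
        · exact congrArg _ (Subtype.ext (g.symm.injective e))
        · exact (c.2 ((hS _).2 ⟨k', (g.symm.injective e).symm⟩)).elim
        · exact (c'.2 ((hS _).2 ⟨k, g.symm.injective e⟩)).elim
        · exact congrArg _ (cr.injective (g.symm.injective e))
      · intro c
        by_cases hc : g c ∈ S
        · obtain ⟨k, hk⟩ := (hS _).1 hc
          exact ⟨.inr k, g.symm_apply_eq.2 hk⟩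
        · exact ⟨.inl ⟨g c, hc⟩, g.symm_apply_apply c⟩)
  refine (sameBrackets_of_iso (L := (L.erase S).fill _ ℓ' sg) (L' := L') e.symm g' (fun p => ?_) ?_ ?_).symm
  · exact e.symm_apply_eq.2 ((next_eq _).trans (congrArg L.next (e.apply_symm_apply p))).symm
  · rintro (⟨c, hc⟩ | k) t
    · refine e.symm_apply_eq.2 ((pos_eq (g.symm c) t (by rwa [Equiv.apply_symm_apply])).trans ?_).symm
      rw [Equiv.apply_symm_apply]
      rfl
    · exact e.symm_apply_eq.2 (pos_eq' k t).symm
  · rintro (⟨c, hc⟩ | k)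
    · exact ((sign_eq (g.symm c)).trans (congrArg L.sign (g.apply_symm_apply c))).symm
    · exact ((sign_eq (g.symm (cr k))).trans
        ((congrArg L.sign (g.apply_symm_apply _)).trans (hsg k))).symm

end LinkDiagram

end

/-! ### The first and second moves, and one third move -/

noncomputable section

open FramedGraph Tangle

variable {X : Type u} [Biquandle X] {j : Version}

namespace LinkDiagram

theorem sameBrackets_first [Finite X] (L : LinkDiagram) (c : L.Cr) (t : Bool)
    (h : L.next (L.pos (c, t)) = L.pos (c, !t)) : SameBrackets j X L (L.erase {c}) := by
  have hS : ∀ c', c' ∈ ({c} : Set L.Cr) ↔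
      ∃ k, (⟨fun _ : Fin 1 => c, fun _ _ _ => Subsingleton.elim _ _⟩ : Fin 1 ↪ L.Cr) k = c' :=
    fun c' => ⟨fun e => ⟨0, e.symm⟩, fun ⟨_, e⟩ => e.symm⟩
  have h' : ∀ i : Fin 1, L.next (L.pos (c, ((kinkLayout t).symm (i, false)).2)) =
      L.pos (c, ((kinkLayout t).symm (i, true)).2) := by
    intro i
    rw [Subsingleton.elim i 0]
    exact h
  refine (L.sameBrackets_fill_windowOf _ {c} hS (kinkLayout t) h' (kinkLayout t)
    (sg := fun _ => L.sign c) (fun _ => rfl) L (Equiv.refl _) (Equiv.refl _) (fun _ => rfl)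
    (fun _ _ _ => rfl) (fun k t' => ?_) fun _ => rfl).trans
    (Window.sameBrackets_fill_self _ (fun a m b hc => ?_) fun a => exists_isColored_kink _ _ a)
  · rw [Equiv.symm_apply_apply]
    rfl
  · obtain ⟨h1, x, hx⟩ := eq_of_isColored_kink (j := j) hc
    refine ⟨h1, fun O => ?_⟩
    rw [hx]
    exact strandsBracket_kink O t _ x

theorem sameBrackets_second (L : LinkDiagram) (a b : L.Cr) (h_sign : L.sign a = -L.sign b)
    (h_over : L.next (L.overPt a) = L.overPt b)
    (h_under : L.next (L.underPt a) = L.underPt b ∨ L.next (L.underPt b) = L.underPt a) :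
    SameBrackets j X L (L.erase {a, b}) := by
  -- A sign is never equal to its negative.
  have hab : a ≠ b := by
    rintro rfl
    rcases Int.units_eq_one_or (L.sign a) with e | e <;> rw [e] at h_sign <;> revert h_sign <;>
      decide
  let cr : Fin 2 ↪ L.Cr := ⟨![a, b], by
    intro k k' e
    fin_cases k <;> fin_cases k'
    · rfl
    · exact (hab e).elim
    · exact (hab e.symm).elim
    · rfl⟩
  have hS : ∀ c, c ∈ ({a, b} : Set L.Cr) ↔ ∃ k, cr k = c := fun c => by
    rw [Fin.exists_fin_two]
    exact or_congr eq_comm eq_comm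
  obtain ⟨t, h'⟩ : ∃ t, ∀ i : Fin 2, L.next (L.pos (cr ((bigonLayout t).symm (i, false)).1,
      ((bigonLayout t).symm (i, false)).2)) = L.pos (cr ((bigonLayout t).symm (i, true)).1,
        ((bigonLayout t).symm (i, true)).2) := by
    rcases h_under with h | h
    · refine ⟨false, Fin.forall_fin_two.2 ⟨h_over, h⟩⟩
    · refine ⟨true, Fin.forall_fin_two.2 ⟨h_over, h⟩⟩
  refine (L.sameBrackets_fill_windowOf cr {a, b} hS (bigonLayout t) h' (bigonLayout t)
    (sg := ![L.sign a, -L.sign a]) (Fin.forall_fin_two.2 ⟨rfl, ?_⟩) L (Equiv.refl _) (Equiv.refl _)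
    (fun _ => rfl) (fun _ _ _ => rfl) (fun k t' => ?_) fun _ => rfl).trans
    (Window.sameBrackets_fill_self _ (fun a m b hc => ?_) fun a => exists_isColored_bigon _ _ a)
  · rw [h_sign]
    exact (neg_neg _).symm
  · rw [Equiv.symm_apply_apply]
    rfl
  · obtain ⟨h1, x, y, hx⟩ := eq_of_isColored_bigon (j := j) hc
    refine ⟨h1, fun O => ?_⟩
    rw [hx]
    exact strandsBracket_bigon O t _ x y

open Classical in
/-- The exchange of the crossings on each side of the triangle with the vertices `r`, `s`, `t`. -/
def triangleSwap {C : Type} (r s t : C) (σ τ : Bool) : Equiv.Perm (C × Bool) :=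
  Equiv.swap (r, true) (s, σ) * Equiv.swap (r, false) (t, τ) * Equiv.swap (s, !σ) (t, !τ)

section triangleSwap

variable {C : Type} {r s t : C} (σ τ : Bool)

/-- The three transpositions are disjoint, one for each side of the triangle. -/
theorem triangleSwap_apply (hrs : r ≠ s) (hrt : r ≠ t) (hst : s ≠ t) :
    triangleSwap r s t σ τ (r, true) = (s, σ) ∧ triangleSwap r s t σ τ (r, false) = (t, τ) ∧
    triangleSwap r s t σ τ (s, σ) = (r, true) ∧ triangleSwap r s t σ τ (t, τ) = (r, false) ∧
    triangleSwap r s t σ τ (s, !σ) = (t, !τ) ∧ triangleSwap r s t σ τ (t, !τ) = (s, !σ) ∧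
    ∀ c b, c ≠ r → c ≠ s → c ≠ t → triangleSwap r s t σ τ (c, b) = (c, b) := by
  classical
  refine ⟨?_, ?_, ?_, ?_, ?_, ?_, fun c b h1 h2 h3 => ?_⟩ <;>
    cases σ <;> cases τ <;>
    simp [triangleSwap, Equiv.swap_apply_def, hrs, hrt, hst, hrs.symm, hrt.symm, hst.symm, *]

end triangleSwap

/-- The third Reidemeister move on a triangle with the vertices `r`, `s`, `t`. -/
def slideAt (L : LinkDiagram) (r s t : L.Cr) (σ τ : Bool) : LinkDiagram where
  Pt := L.Pt
  Cr := L.Cr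
  finite_pt := inferInstance
  finite_cr := inferInstance
  next := L.next
  pos := (triangleSwap r s t σ τ).toEmbedding.trans L.pos
  sign := L.sign

theorem slide_eq_slideAt (L : LinkDiagram) (a b c : L.Cr) :
    L.slide a b c = L.slideAt a b c true true := by
  classical
  have : ∀ x, (Equiv.swap (L.overPt a) (L.overPt b) * Equiv.swap (L.underPt a) (L.overPt c) *
    Equiv.swap (L.underPt b) (L.underPt c) : Equiv.Perm L.Pt) (L.pos x) =
      L.pos (triangleSwap a b c true true x) := by
    intro x
    simp only [triangleSwap, Equiv.Perm.mul_apply, overPt, underPt, Bool.not_true,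
      Function.Embedding.swap_apply]
  simp only [slide, slideAt]
  congr 1
  ext x
  exact this x

/-- The only third move computed directly. Both diagrams fill one window, with `triangleLayout` and
`triangleLayout'`. -/
theorem sameBrackets_slide_base (L : LinkDiagram) (a b c : L.Cr) (hab : a ≠ b) (hac : a ≠ c)
    (hbc : b ≠ c) (h1 : L.next (L.overPt a) = L.overPt b) (h2 : L.next (L.underPt a) = L.overPt c)
    (h3 : L.next (L.underPt b) = L.underPt c) (ha : L.sign a = 1) (hb : L.sign b = 1)
    (hc : L.sign c = 1) : SameBrackets j X L (L.slideAt a b c true true) := by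
  let cr : Fin 3 ↪ L.Cr := ⟨![a, b, c], by
    intro k k' e
    fin_cases k <;> fin_cases k'
    · rfl
    · exact (hab e).elim
    · exact (hac e).elim
    · exact (hab e.symm).elim
    · rfl
    · exact (hbc e).elim
    · exact (hac e.symm).elim
    · exact (hbc e.symm).elim
    · rfl⟩
  have hS : ∀ c', c' ∈ ({a, b, c} : Set L.Cr) ↔ ∃ k, cr k = c' := fun c' => by
    rw [Fin.exists_fin_succ, Fin.exists_fin_two]
    exact or_congr eq_comm (or_congr eq_comm eq_comm)
  have h' : ∀ i : Fin 3, L.next (L.pos (cr (triangleLayout.symm (i, false)).1,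
      (triangleLayout.symm (i, false)).2)) = L.pos (cr (triangleLayout.symm (i, true)).1,
        (triangleLayout.symm (i, true)).2) := by
    rw [Fin.forall_fin_succ, Fin.forall_fin_two]
    exact ⟨h1, h2, h3⟩
  have hsg : ∀ k, L.sign (cr k) = (fun _ => 1 : Fin 3 → ℤˣ) k := by
    rw [Fin.forall_fin_succ, Fin.forall_fin_two]
    exact ⟨ha, hb, hc⟩
  obtain ⟨t1, t2, t3, t4, t5, t6, t7⟩ := triangleSwap_apply true true hab hac hbc
  refine (L.sameBrackets_fill_windowOf cr {a, b, c} hS triangleLayout h' triangleLayout hsg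
    L (Equiv.refl _) (Equiv.refl _) (fun _ => rfl) (fun _ _ _ => rfl) (fun k t' => ?_)
    fun _ => rfl).trans ((Window.sameBrackets_fill_fill _ (ℓ' := triangleLayout')
      (sg' := fun _ => 1) (fun a m b hc => ?_) (fun a m b hc => ?_)).trans
    (L.sameBrackets_fill_windowOf cr {a, b, c} hS triangleLayout h' triangleLayout' hsg
    (L.slideAt a b c true true) (Equiv.refl _) (Equiv.refl _) (fun _ => rfl) ?_ ?_
    fun _ => rfl).symm)
  · rw [Equiv.symm_apply_apply]
    rfl
  · obtain ⟨m', hm'⟩ := exists_isColored_triangle' hc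
    exact ⟨m', hm', fun O => strandsBracket_of_isColored_triangle hc hm' O⟩
  · obtain ⟨m', hm'⟩ := exists_isColored_triangle hc
    exact ⟨m', hm', fun O => (strandsBracket_of_isColored_triangle hm' hc O).symm⟩
  · intro c' t' hc'
    have n1 : c' ≠ a := fun e => hc' (.inl e)
    have n2 : c' ≠ b := fun e => hc' (.inr (.inl e))
    have n3 : c' ≠ c := fun e => hc' (.inr (.inr e))
    exact congrArg L.pos (t7 c' t' n1 n2 n3)
  · rw [Fin.forall_fin_succ, Fin.forall_fin_two]
    exact ⟨Bool.forall_bool.2 ⟨congrArg L.pos t2, congrArg L.pos t1⟩,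
      Bool.forall_bool.2 ⟨congrArg L.pos t5, congrArg L.pos t3⟩,
      Bool.forall_bool.2 ⟨congrArg L.pos t6, congrArg L.pos t4⟩⟩

end LinkDiagram

end

/-! ### Moving crossings along edges past marked points -/

noncomputable section

variable {X : Type u} [Biquandle X] {j : Version}

namespace LinkDiagram

/-- Move the points of the crossings by a permutation of all points. -/
def permute (L : LinkDiagram) (π : Equiv.Perm L.Pt) : LinkDiagram where
  Pt := L.Pt
  Cr := L.Cr
  finite_pt := inferInstance
  finite_cr := inferInstance
  next := L.next
  pos := L.pos.trans π.toEmbedding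
  sign := L.sign

theorem notMem_range_permute {L : LinkDiagram} {π : Equiv.Perm L.Pt} {q q' : L.Pt}
    (hq : π q' = q) (h : q' ∉ Set.range L.pos) : q ∉ Set.range (L.permute π).pos := by
  rintro ⟨x, e⟩
  exact h ⟨x, π.injective (e.trans hq.symm)⟩

open Classical in
/-- Remove a marked point. -/
def unmark (L : LinkDiagram) (m : L.Pt) (hm : m ∉ Set.range L.pos) : LinkDiagram where
  Pt := {q : L.Pt // q ≠ m}
  Cr := L.Cr
  finite_pt := inferInstance
  finite_cr := inferInstance
  next := Equiv.Perm.subtypePerm (L.next.trans (Equiv.swap m (L.next m))) fun q => by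
    refine not_congr ?_
    rw [Equiv.trans_apply, Equiv.swap_apply_eq_iff, Equiv.swap_apply_left,
      L.next.injective.eq_iff]
  pos := ⟨fun x => ⟨L.pos x, fun e => hm ⟨x, e⟩⟩, fun x y e =>
    L.pos.injective (congrArg Subtype.val e)⟩
  sign := L.sign

theorem unmark_next (L : LinkDiagram) {m : L.Pt} (hm : m ∉ Set.range L.pos) (q : L.Pt)
    (hq : q ≠ m) (h : L.next q ≠ m) : ((L.unmark m hm).next ⟨q, hq⟩).1 = L.next q := by
  classical
  exact Equiv.swap_apply_of_ne_of_ne h fun e => hq (L.next.injective e)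

theorem unmark_next_of_eq (L : LinkDiagram) {m : L.Pt} (hm : m ∉ Set.range L.pos) (q : L.Pt)
    (hq : q ≠ m) (h : L.next q = m) : ((L.unmark m hm).next ⟨q, hq⟩).1 = L.next m := by
  classical
  exact (congrArg _ h).trans (Equiv.swap_apply_left _ _)

open Classical in
-- Without the mark `m` the two diagrams agree. One arises by marking the edge after `p`, the other
-- by marking the edge before it.
theorem sameBrackets_shift_next (L : LinkDiagram) {p m : L.Pt} (h : L.next p = m) (hp : p ≠ m)
    (hm : m ∉ Set.range L.pos) : SameBrackets j X L (L.permute (Equiv.swap p m)) := by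
  let K := L.unmark m hm
  let p' : K.Pt := ⟨p, hp⟩
  have h1 : SameBrackets j X (K.mark p') L := by
    refine sameBrackets_of_iso (Equiv.optionSubtypeNe m) (Equiv.refl _) ?_ (fun _ _ => rfl)
      fun _ => rfl
    rintro (_ | ⟨q, hq⟩)
    · exact (congrArg (Equiv.optionSubtypeNe m) (K.mark_next_none p')).trans
        (L.unmark_next_of_eq hm p hp h)
    · by_cases e : q = p
      · subst e
        exact (congrArg (Equiv.optionSubtypeNe m) (K.mark_next_self p')).trans h.symm
      · refine (congrArg (Equiv.optionSubtypeNe m) (K.mark_next_of_ne (p := p')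
          (q := ⟨q, hq⟩) fun e' => e (congrArg Subtype.val e'))).trans ?_
        exact L.unmark_next hm q hq fun e' => e (L.next.injective (e'.trans h.symm))
  have h2 : SameBrackets j X (K.mark (K.next.symm p')) (L.permute (Equiv.swap p m)) := by
    obtain ⟨r, hr'⟩ := K.next.surjective p'
    rw [K.next.symm_apply_eq.2 hr'.symm]
    obtain ⟨r, hr⟩ := r
    have hr'' : ((L.unmark m hm).next ⟨r, hr⟩).1 = p := congrArg Subtype.val hr'
    refine sameBrackets_of_iso (L' := L.permute (Equiv.swap p m))
      ((Equiv.optionSubtypeNe m).trans (Equiv.swap p m)) (Equiv.refl _) ?_ (fun _ _ => rfl)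
      fun _ => rfl
    have f1 : Equiv.swap p m p = m := Equiv.swap_apply_left _ _
    have f2 : Equiv.swap p m m = p := Equiv.swap_apply_right _ _
    rintro (_ | ⟨q, hq⟩)
    · refine (congrArg (Equiv.swap p m ∘ Equiv.optionSubtypeNe m) (K.mark_next_none _)).trans ?_
      refine (congrArg (Equiv.swap p m) hr'').trans (f1.trans ?_)
      exact (h.symm.trans (congrArg L.next f2.symm))
    · by_cases e : q = r
      · subst e
        refine (congrArg (Equiv.swap p m ∘ Equiv.optionSubtypeNe m) (K.mark_next_self _)).trans ?_
        refine f2.trans ?_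
        change p = L.next (Equiv.swap p m q)
        -- This happens when `p` is the only point left on its circle and so its own predecessor.
        by_cases e : q = p
        · rw [e, f1, ← L.unmark_next_of_eq hm p hp h]
          subst e
          exact hr''.symm
        · rw [Equiv.swap_apply_of_ne_of_ne e hq, ← L.unmark_next hm q hq
            fun e' => e (L.next.injective (e'.trans h.symm)), hr'']
      · refine (congrArg (Equiv.swap p m ∘ Equiv.optionSubtypeNe m) (K.mark_next_of_ne
          (q := ⟨q, hq⟩) fun e' => e (congrArg Subtype.val e'))).trans ?_
        change Equiv.swap p m ((L.unmark m hm).next ⟨q, hq⟩).1 = L.next (Equiv.swap p m q)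
        have e2 : ((L.unmark m hm).next ⟨q, hq⟩).1 ≠ p := fun e' => e
          (congrArg Subtype.val ((L.unmark m hm).next.injective
            (Subtype.ext (e'.trans hr''.symm) : (L.unmark m hm).next ⟨q, hq⟩ =
              (L.unmark m hm).next ⟨r, hr⟩)))
        rw [Equiv.swap_apply_of_ne_of_ne e2 ((L.unmark m hm).next ⟨q, hq⟩).2]
        by_cases e3 : q = p
        · rw [show Equiv.swap p m q = m by rw [e3, f1]]
          exact L.unmark_next_of_eq hm q hq (by rw [e3, h])
        · rw [Equiv.swap_apply_of_ne_of_ne e3 hq]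
          exact L.unmark_next hm q hq fun e' => e3 (L.next.injective (e'.trans h.symm))
  exact h1.symm.trans ((K.sameBrackets_mark p').symm.trans ((K.sameBrackets_mark _).trans h2))

open Classical in
theorem sameBrackets_shift (L : LinkDiagram) {e : ℤˣ} {p m : L.Pt} (h : L.Adjacent e p m)
    (hp : p ≠ m) (hm : m ∉ Set.range L.pos) :
    SameBrackets j X L (L.permute (Equiv.swap p m)) := by
  rcases h with ⟨-, h⟩ | ⟨-, h⟩
  · exact L.sameBrackets_shift_next h hp hm
  · have h1 := (L.permute (Equiv.swap p m)).sameBrackets_shift_next (j := j) (X := X) (p := m)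
      (m := p) h hp.symm (notMem_range_permute (Equiv.swap_apply_right _ _) hm)
    have h2 : (L.permute (Equiv.swap p m)).permute (Equiv.swap m p) = L.permute 1 := by
      change L.permute (Equiv.swap m p * Equiv.swap p m) = _
      rw [Equiv.swap_comm m p, Equiv.swap_mul_self]
    refine SameBrackets.symm (h1.trans ?_)
    have h3 : SameBrackets j X (L.permute 1) L := SameBrackets.refl L
    exact h2 ▸ h3

/-- Exchange `a` with `c` and `b` with `d`. -/
def doubleSwap {P : Type} [DecidableEq P] (a b c d : P) : Equiv.Perm P :=
  Equiv.swap a c * Equiv.swap b d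

open Classical in
-- The farther point `b` goes first, via `c` to `d`; then `a` follows via `b` to `c`. In this order
-- each single shift meets a free mark.
theorem sameBrackets_shift_two (L : LinkDiagram) {e : ℤˣ} {a b c d : L.Pt}
    (h1 : L.Adjacent e a b) (h2 : L.Adjacent e b c) (h3 : L.Adjacent e c d)
    (hab : a ≠ b) (hac : a ≠ c) (had : a ≠ d) (hbc : b ≠ c) (hbd : b ≠ d) (hcd : c ≠ d)
    (hc : c ∉ Set.range L.pos) (hd : d ∉ Set.range L.pos) :
    SameBrackets j X L (L.permute (doubleSwap a b c d)) := by
  have s1 := L.sameBrackets_shift (j := j) (X := X) h2 hbc hc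
  have s2 := (L.permute (Equiv.swap b c)).sameBrackets_shift (j := j) (X := X) (p := c) (m := d) h3
    hcd (notMem_range_permute (Equiv.swap_apply_of_ne_of_ne hbd.symm hcd.symm) hd)
  have s3 := (L.permute (Equiv.swap c d * Equiv.swap b c)).sameBrackets_shift (j := j) (X := X)
    (p := a) (m := b) h1 hab (notMem_range_permute (q' := c) (by
      rw [Equiv.Perm.mul_apply, Equiv.swap_apply_right, Equiv.swap_apply_of_ne_of_ne hbc hbd]) hc)
  have s4 := (L.permute (Equiv.swap a b * (Equiv.swap c d * Equiv.swap b c))).sameBrackets_shift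
    (j := j) (X := X) (p := b) (m := c) h2 hbc (notMem_range_permute (q' := d) (by
      rw [Equiv.Perm.mul_apply, Equiv.Perm.mul_apply,
        Equiv.swap_apply_of_ne_of_ne hbd.symm hcd.symm, Equiv.swap_apply_right,
        Equiv.swap_apply_of_ne_of_ne hac.symm hbc.symm]) hd)
  have e : Equiv.swap b c * (Equiv.swap a b * (Equiv.swap c d * Equiv.swap b c)) =
      doubleSwap a b c d := by
    ext x
    simp only [doubleSwap, Equiv.Perm.mul_apply, Equiv.swap_apply_def]
    by_cases xa : x = a
    · subst xa
      simp [hab, hac, had, hbc.symm, hab.symm, hac.symm, had.symm]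
    by_cases xb : x = b
    · subst xb
      simp [hab, hac, had, hbc, hbd, hcd, hbc.symm, hab.symm, hac.symm, had.symm, hbd.symm,
        hcd.symm]
    by_cases xc : x = c
    · subst xc
      simp [hab, hac, had, hbc, hbd, hcd, hbc.symm, hab.symm, hac.symm, had.symm, hbd.symm,
        hcd.symm]
    by_cases xd : x = d
    · subst xd
      simp [hab, hac, had, hbc, hbd, hcd, hbc.symm, hab.symm, hac.symm, had.symm, hbd.symm,
        hcd.symm]
    simp [xa, xb, xc, xd]
  rw [← e]
  exact s1.trans (s2.trans (s3.trans s4))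

end LinkDiagram

end

/-! ### A third move from another one by inserting a cancelling pair -/

noncomputable section

variable {X : Type u} [Biquandle X] {j : Version}

namespace LinkDiagram

theorem Adjacent.symm {L : LinkDiagram} {e : ℤˣ} {p q : L.Pt} (h : L.Adjacent e p q) :
    L.Adjacent (-e) q p := by
  rcases h with ⟨rfl, h⟩ | ⟨rfl, h⟩
  · exact .inr ⟨rfl, h⟩
  · exact .inl ⟨neg_neg _, h⟩

theorem sameBrackets_erase_pair (L : LinkDiagram) {a b : L.Cr} {e e' : ℤˣ}
    (h_sign : L.sign a = -L.sign b) (h_over : L.Adjacent e (L.pos (a, true)) (L.pos (b, true)))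
    (h_under : L.Adjacent e' (L.pos (a, false)) (L.pos (b, false))) :
    SameBrackets j X L (L.erase {a, b}) := by
  have h : ∀ {a b : L.Cr}, L.Adjacent e' (L.pos (a, false)) (L.pos (b, false)) →
      L.next (L.underPt a) = L.underPt b ∨ L.next (L.underPt b) = L.underPt a :=
    fun h => h.imp And.right And.right
  rcases h_over with ⟨-, ho⟩ | ⟨-, ho⟩
  · exact L.sameBrackets_second a b h_sign ho (h h_under)
  · rw [Set.pair_comm]
    exact L.sameBrackets_second b a (by rw [h_sign, neg_neg]) ho (h h_under).symm

theorem doubleSwap_apply {P : Type} [DecidableEq P] {a b c d : P} (hab : a ≠ b) (had : a ≠ d)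
    (hcd : c ≠ d) : doubleSwap a b c d a = c ∧ doubleSwap a b c d b = d ∧
      ∀ x, x ≠ a → x ≠ b → x ≠ c → x ≠ d → doubleSwap a b c d x = x := by
  refine ⟨?_, ?_, fun x h1 h2 h3 h4 => ?_⟩
  · rw [doubleSwap, Equiv.Perm.mul_apply, Equiv.swap_apply_of_ne_of_ne hab had,
      Equiv.swap_apply_left]
  · rw [doubleSwap, Equiv.Perm.mul_apply, Equiv.swap_apply_left,
      Equiv.swap_apply_of_ne_of_ne had.symm hcd.symm]
  · rw [doubleSwap, Equiv.Perm.mul_apply, Equiv.swap_apply_of_ne_of_ne h2 h4,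
      Equiv.swap_apply_of_ne_of_ne h1 h3]

/-- Insert two crossings of opposite signs at marked points. -/
def insertPair (L : LinkDiagram) (pt : Bool × Bool ↪ L.Pt) (hpt : ∀ x y, L.pos x ≠ pt y) (s : ℤˣ) :
    LinkDiagram where
  Pt := L.Pt
  Cr := L.Cr ⊕ Bool
  finite_pt := inferInstance
  finite_cr := inferInstance
  next := L.next
  pos := ⟨fun x => x.1.elim (fun c => L.pos (c, x.2)) fun i => pt (i, x.2), by
    rintro ⟨c | i, t⟩ ⟨c' | i', t'⟩ e
    · have e := L.pos.injective e
      simp only [Prod.mk.injEq] at e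
      rw [e.1, e.2]
    · exact (hpt _ _ e).elim
    · exact (hpt _ _ e.symm).elim
    · have e := pt.injective e
      simp only [Prod.mk.injEq] at e
      rw [e.1, e.2]⟩
  sign := Sum.elim L.sign fun i => bif i then s else -s

/-- A second move read backwards; the signs of the two new crossings are opposite by construction.
-/
theorem sameBrackets_insertPair (L : LinkDiagram) (pt : Bool × Bool ↪ L.Pt)
    (hpt : ∀ x y, L.pos x ≠ pt y) (s : ℤˣ) {e e' : ℤˣ}
    (h_over : L.Adjacent e (pt (false, true)) (pt (true, true)))
    (h_under : L.Adjacent e' (pt (false, false)) (pt (true, false))) :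
    SameBrackets j X L (L.insertPair pt hpt s) := by
  refine SameBrackets.symm (SameBrackets.trans (sameBrackets_erase_pair (a := .inr false)
    (b := .inr true) (L.insertPair pt hpt s) rfl h_over h_under) (SameBrackets.symm ?_))
  refine sameBrackets_of_iso (L := L) (L' := (L.insertPair pt hpt s).erase _) (Equiv.refl _)
    (Equiv.ofBijective (fun c => ⟨.inl c, by rintro (e | e) <;> cases e⟩) ⟨fun c c' e => ?_, ?_⟩)
    (fun _ => rfl) (fun _ _ => rfl) fun _ => rfl
  · exact Sum.inl_injective (congrArg Subtype.val e)
  · rintro ⟨c | i, hc⟩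
    · exact ⟨c, rfl⟩
    · cases i
      · exact (hc (.inl rfl)).elim
      · exact (hc (.inr rfl)).elim

/-- The third Reidemeister moves with the given over- and underpasses, directions and signs
preserve the brackets. -/
def SlideInvariant (j : Version) (X : Type u) [Biquandle X] (σ τ : Bool) (e₁ e₂ e₃ s₁ s₂ s₃ : ℤˣ) :
    Prop :=
  ∀ (L : LinkDiagram) (r s t : L.Cr), r ≠ s → r ≠ t → s ≠ t →
    L.Adjacent e₁ (L.pos (r, true)) (L.pos (s, σ)) →
    L.Adjacent e₂ (L.pos (r, false)) (L.pos (t, τ)) →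
    L.Adjacent e₃ (L.pos (s, !σ)) (L.pos (t, !τ)) →
    L.sign r = s₁ → L.sign s = s₂ → L.sign t = s₃ →
    SameBrackets j X L (L.slideAt r s t σ τ)

variable {σ τ : Bool} {e₁ e₂ e₃ s₁ s₂ s₃ : ℤˣ}

/-- The move on the triangle `r`, `s`, `t`, if there are marked points beyond `s` and `t`. -/
theorem SlideInvariant.sameBrackets_of_marked
    (H : SlideInvariant j X σ τ (-e₁) (-e₂) e₃ (-s₁) s₂ s₃) (L : LinkDiagram) {r s t : L.Cr}
    (hrs : r ≠ s) (hrt : r ≠ t) (hst : s ≠ t)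
    (h₁ : L.Adjacent e₁ (L.pos (r, true)) (L.pos (s, σ)))
    (h₂ : L.Adjacent e₂ (L.pos (r, false)) (L.pos (t, τ)))
    (h₃ : L.Adjacent e₃ (L.pos (s, !σ)) (L.pos (t, !τ)))
    (hr : L.sign r = s₁) (hs : L.sign s = s₂) (ht : L.sign t = s₃)
    (pt : Bool × Bool ↪ L.Pt) (hpt : ∀ x y, L.pos x ≠ pt y)
    (k₁ : L.Adjacent e₁ (L.pos (s, σ)) (pt (false, true)))
    (k₂ : L.Adjacent e₁ (pt (false, true)) (pt (true, true)))
    (k₃ : L.Adjacent e₂ (L.pos (t, τ)) (pt (false, false)))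
    (k₄ : L.Adjacent e₂ (pt (false, false)) (pt (true, false))) :
    SameBrackets j X L (L.slideAt r s t σ τ) := by
  classical
  let M := L.insertPair pt hpt s₁
  let M' := M.slideAt (.inr false) (.inl s) (.inl t) σ τ
  -- Behind `s` and `t`, the two strands through `r` are made to cross twice more. The nearer new
  -- crossing, of sign `-s₁`, forms a triangle with `s` and `t` on the other side of the side
  -- joining them.
  have m1 : SameBrackets j X L M := L.sameBrackets_insertPair pt hpt s₁ k₂ k₄
  have m2 : SameBrackets j X M M' := H M (.inr false) (.inl s) (.inl t) Sum.inr_ne_inl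
    Sum.inr_ne_inl (fun e => hst (Sum.inl_injective e)) k₁.symm k₃.symm h₃ rfl hs ht
  obtain ⟨t1, t2, t3, t4, t5, t6, t7⟩ := triangleSwap_apply (r := (.inr false : L.Cr ⊕ Bool))
    (s := .inl s) (t := .inl t) σ τ (by simp) (by simp) (by simpa using hst)
  obtain ⟨u1, u2, u3, u4, u5, u6, u7⟩ := triangleSwap_apply σ τ hrs hrt hst
  -- After the move on the new triangle the nearer new crossing stands next to `r` on both strands
  -- and has the opposite sign, so the two cancel. The farther new crossing takes the place of `r`.
  have m3 : SameBrackets j X M' (M'.erase {.inl r, .inr false}) := by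
    have f : ∀ b, M'.pos (.inl r, b) = L.pos (r, b) := fun b =>
      congrArg M.pos (t7 (.inl r) b (by simp) (by simpa using hrs) (by simpa using hrt))
    refine sameBrackets_erase_pair (e := e₁) (e' := e₂) M' ?_ ?_ ?_
    · exact hr.trans (neg_neg _).symm
    · exact cast (congrArg₂ (M'.Adjacent e₁) (f true).symm (congrArg M.pos t1).symm) h₁
    · exact cast (congrArg₂ (M'.Adjacent e₂) (f false).symm (congrArg M.pos t2).symm) h₂
  have hp : ∀ {x y}, x ≠ y → L.pos x ≠ L.pos y := L.pos.injective.ne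
  have hq : ∀ {x y}, x ≠ y → pt x ≠ pt y := pt.injective.ne
  have hpt' : ∀ x y, pt y ≠ L.pos x := fun x y => (hpt x y).symm
  have n1 : ∀ {b b' : Bool}, ((r, b) : L.Cr × Bool) ≠ (s, b') := fun e => hrs (congrArg Prod.fst e)
  have n2 : ∀ {b b' : Bool}, ((r, b) : L.Cr × Bool) ≠ (t, b') := fun e => hrt (congrArg Prod.fst e)
  have n3 : ∀ {b b' : Bool}, ((s, b) : L.Cr × Bool) ≠ (t, b') := fun e => hst (congrArg Prod.fst e)
  have n4 : ∀ (c : L.Cr) (b : Bool), ((c, b) : L.Cr × Bool) ≠ (c, !b) := fun c b e => by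
    cases b <;> cases e
  have n5 : ((false, true) : Bool × Bool) ≠ (true, true) := by decide
  have n6 : ((false, false) : Bool × Bool) ≠ (true, false) := by decide
  let D := L.slideAt r s t σ τ
  let dO : Equiv.Perm L.Pt :=
    doubleSwap (L.pos (r, true)) (L.pos (s, σ)) (pt (false, true)) (pt (true, true))
  let dU : Equiv.Perm L.Pt :=
    doubleSwap (L.pos (r, false)) (L.pos (t, τ)) (pt (false, false)) (pt (true, false))
  obtain ⟨o1, o2, o3⟩ : dO (L.pos (r, true)) = pt (false, true) ∧
      dO (L.pos (s, σ)) = pt (true, true) ∧ _ :=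
    doubleSwap_apply (hp n1) (hpt _ _) (hq n5)
  obtain ⟨v1, v2, v3⟩ : dU (L.pos (r, false)) = pt (false, false) ∧
      dU (L.pos (t, τ)) = pt (true, false) ∧ _ :=
    doubleSwap_apply (hp n2) (hpt _ _) (hq n6)
  have o4 : ∀ x, x ≠ (r, true) → x ≠ (s, σ) → dO (L.pos x) = L.pos x := fun x h h' =>
    o3 _ (hp h) (hp h') (hpt _ _) (hpt _ _)
  have v4 : ∀ x, x ≠ (r, false) → x ≠ (t, τ) → dU (L.pos x) = L.pos x := fun x h h' =>
    v3 _ (hp h) (hp h') (hpt _ _) (hpt _ _)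
  have o5 : ∀ i, dO (pt (i, false)) = pt (i, false) := fun i =>
    o3 _ (hpt' _ _) (hpt' _ _) (hq (by simp)) (hq (by simp))
  have v5 : ∀ i, dU (pt (i, true)) = pt (i, true) := fun i =>
    v3 _ (hpt' _ _) (hpt' _ _) (hq (by simp)) (hq (by simp))
  have hD : ∀ y, pt y ∉ Set.range D.pos := fun y ⟨x, e⟩ => hpt _ _ e
  -- In the diagram of the desired move the crossings are pushed forward to the marked points on
  -- both strands, where they stand in the diagram obtained through the pair.
  have m4 : SameBrackets j X D (D.permute dO) := D.sameBrackets_shift_two h₁ k₁ k₂ (hp n1)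
    (hpt _ _) (hpt _ _) (hpt _ _) (hpt _ _) (hq n5) (hD _) (hD _)
  have m5 : SameBrackets j X (D.permute dO) ((D.permute dO).permute dU) :=
    (D.permute dO).sameBrackets_shift_two h₂ k₃ k₄ (hp n2)
    (hpt _ _) (hpt _ _) (hpt _ _) (hpt _ _) (hq n6) (notMem_range_permute (o5 _) (hD _))
    (notMem_range_permute (o5 _) (hD _))
  suffices m6 : SameBrackets j X (M'.erase {.inl r, .inr false}) ((D.permute dO).permute dU) from
    m1.trans (m2.trans (m3.trans (m6.trans (m4.trans m5).symm)))
  -- Now the points agree, and only the farther new crossing has to be renamed `r`.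
  refine sameBrackets_of_iso (j := j) (X := X) (L := M'.erase {.inl r, .inr false})
    (L' := (D.permute dO).permute dU) (Equiv.refl L.Pt)
    (Equiv.ofBijective (fun c => c.1.elim id fun _ => r) ⟨?_, fun c => ?_⟩) (fun _ => rfl) ?_ ?_
  · rintro ⟨c | i, hc⟩ ⟨c' | i', hc'⟩ e
    · have e : c = c' := e
      subst e
      rfl
    · have e : c = r := e
      exact (hc (.inl (congrArg Sum.inl e))).elim
    · have e : r = c' := e
      exact (hc' (.inl (congrArg Sum.inl e.symm))).elim
    · cases i
      · exact (hc (.inr rfl)).elim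
      · cases i'
        · exact (hc' (.inr rfl)).elim
        · rfl
  · by_cases hc : c = r
    · exact ⟨⟨.inr true, by rintro (e | e) <;> cases e⟩, hc.symm⟩
    · refine ⟨⟨.inl c, ?_⟩, rfl⟩
      rintro (e | e)
      · exact hc (Sum.inl_injective e)
      · cases e
  · rintro ⟨c | i, hc⟩ b
    · change M'.pos (.inl c, b) = dU (dO (L.pos (triangleSwap r s t σ τ (c, b))))
      change M.pos (triangleSwap (.inr false) (.inl s) (.inl t) σ τ (.inl c, b)) = _
      have hcr : c ≠ r := fun e => hc (.inl (congrArg Sum.inl e))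
      by_cases hcs : c = s
      · subst hcs
        by_cases hb : b = σ
        · subst hb
          refine (congrArg M.pos t3).trans ?_
          rw [u3, o1, v5]
          rfl
        · rw [Bool.eq_not_of_ne hb]
          refine (congrArg M.pos t5).trans ?_
          rw [u5, o4 _ n2.symm n3.symm, v4 _ n2.symm (n4 _ _).symm]
          rfl
      · by_cases hct : c = t
        · subst hct
          by_cases hb : b = τ
          · subst hb
            refine (congrArg M.pos t4).trans ?_
            rw [u4, o4 _ (by simp) n1, v1]
            rfl
          · rw [Bool.eq_not_of_ne hb]
            refine (congrArg M.pos t6).trans ?_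
            rw [u6, o4 _ n1.symm (n4 _ _).symm, v4 _ n1.symm n3]
            rfl
        · refine (congrArg M.pos (t7 _ _ Sum.inl_ne_inr (fun e => hcs (Sum.inl_injective e))
            (fun e => hct (Sum.inl_injective e)))).trans ?_
          rw [u7 _ _ hcr hcs hct,
            o4 _ (fun e => hcr (congrArg Prod.fst e)) (fun e => hcs (congrArg Prod.fst e)),
            v4 _ (fun e => hcr (congrArg Prod.fst e)) (fun e => hct (congrArg Prod.fst e))]
          rfl
    · cases i
      · exact (hc (.inr rfl)).elim
      · change M.pos (triangleSwap (.inr false) (.inl s) (.inl t) σ τ (.inr true, b)) =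
          dU (dO (L.pos (triangleSwap r s t σ τ (r, b))))
        refine (congrArg M.pos (t7 _ _ (by simp) Sum.inr_ne_inl Sum.inr_ne_inl)).trans ?_
        cases b
        · rw [u2, o4 _ n2.symm n3.symm, v2]
          rfl
        · rw [u1, o2, v5]
          rfl
  · rintro ⟨c | i, hc⟩
    · rfl
    · cases i
      · exact (hc (.inr rfl)).elim
      · exact hr.symm

end LinkDiagram

end

/-! ### Creating the marked points needed for the pair -/

noncomputable section

variable {X : Type u} [Biquandle X] {j : Version}

namespace LinkDiagram

/-- Put one more marked point on the edge at `p` in the direction `e`. -/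
def markBeyond (L : LinkDiagram) (e : ℤˣ) (p : L.Pt) : LinkDiagram :=
  L.mark (if e = 1 then p else L.next.symm p)

theorem adjacent_markBeyond_self (L : LinkDiagram) (e : ℤˣ) (p : L.Pt) :
    (L.markBeyond e p).Adjacent e (some p) none := by
  rcases Int.units_eq_one_or e with rfl | rfl
  · exact .inl ⟨rfl, L.mark_next_self p⟩
  · refine .inr ⟨rfl, (L.mark_next_none (L.next.symm p)).trans ?_⟩
    rw [Equiv.apply_symm_apply]

theorem Adjacent.markBeyond_none {L : LinkDiagram} {e : ℤˣ} {p q : L.Pt} (h : L.Adjacent e p q) :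
    (L.markBeyond e p).Adjacent e none (some q) := by
  rcases h with ⟨rfl, rfl⟩ | ⟨rfl, rfl⟩
  · exact .inl ⟨rfl, L.mark_next_none p⟩
  · have h : L.next.symm (L.next q) = q := L.next.symm_apply_apply q
    exact .inr ⟨rfl, (congrArg (fun x => (L.markBeyond (-1) (L.next q)).next (some x)) h).symm.trans
      (L.mark_next_self _)⟩

theorem Adjacent.markBeyond_some {L : LinkDiagram} {e e' : ℤˣ} {p x y : L.Pt}
    (h : L.Adjacent e' x y) (hx : e' = e → x ≠ p) (hy : e' = -e → y ≠ p) :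
    (L.markBeyond e p).Adjacent e' (some x) (some y) := by
  rcases h with ⟨rfl, rfl⟩ | ⟨rfl, rfl⟩ <;> rcases Int.units_eq_one_or e with rfl | rfl
  · exact .inl ⟨rfl, L.mark_next_of_ne (hx rfl)⟩
  · exact .inl ⟨rfl, L.mark_next_of_ne fun h => hy rfl (L.next.eq_symm_apply.1 h)⟩
  · exact .inr ⟨rfl, L.mark_next_of_ne (hy rfl)⟩
  · exact .inr ⟨rfl, L.mark_next_of_ne fun h => hx rfl (L.next.eq_symm_apply.1 h)⟩

theorem sameBrackets_slideAt_of_markBeyond {L : LinkDiagram} {e : ℤˣ} {p : L.Pt} {r s t : L.Cr}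
    {σ τ : Bool}
    (h : SameBrackets j X (L.markBeyond e p) ((L.markBeyond e p).slideAt r s t σ τ)) :
    SameBrackets j X L (L.slideAt r s t σ τ) := by
  have h' : SameBrackets j X (L.slideAt r s t σ τ) ((L.markBeyond e p).slideAt r s t σ τ) :=
    (L.slideAt r s t σ τ).sameBrackets_mark _
  exact (L.sameBrackets_mark _).trans (h.trans h'.symm)

variable {σ τ : Bool} {e₁ e₂ e₃ s₁ s₂ s₃ : ℤˣ}

/-- Inserting a pair of crossings reverses two edges of the triangle. -/
theorem SlideInvariant.flip (H : SlideInvariant j X σ τ (-e₁) (-e₂) e₃ (-s₁) s₂ s₃) :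
    SlideInvariant j X σ τ e₁ e₂ e₃ s₁ s₂ s₃ := by
  intro L r s t hrs hrt hst h₁ h₂ h₃ hr hs ht
  have hp : ∀ {x y}, x ≠ y → L.pos x ≠ L.pos y := L.pos.injective.ne
  have hs' : ∀ {P : Type} {x y : P}, x ≠ y → some x ≠ some y := (Option.some_injective _).ne
  have n1 : ∀ {b b' : Bool}, ((r, b) : L.Cr × Bool) ≠ (s, b') := fun e => hrs (congrArg Prod.fst e)
  have n2 : ∀ {b b' : Bool}, ((r, b) : L.Cr × Bool) ≠ (t, b') := fun e => hrt (congrArg Prod.fst e)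
  have n3 : ∀ {b b' : Bool}, ((s, b) : L.Cr × Bool) ≠ (t, b') := fun e => hst (congrArg Prod.fst e)
  have n4 : ∀ (c : L.Cr) (b : Bool), ((c, !b) : L.Cr × Bool) ≠ (c, b) := fun c b e => by
    cases b <;> cases e
  have n5 : ∀ (e : ℤˣ), e ≠ -e := by decide
  -- Two marks are put beyond `s` and then two beyond `t`. Of each two, the later mark is the one
  -- closer to the crossing, which determines the names in `pt`.
  let L₁ := L.markBeyond e₁ (L.pos (s, σ))
  let L₂ := L₁.markBeyond e₁ (some (L.pos (s, σ)))
  let L₃ := L₂.markBeyond e₂ (some (some (L.pos (t, τ))))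
  let L₄ := L₃.markBeyond e₂ (some (some (some (L.pos (t, τ)))))
  let pt : Bool × Bool → Option (Option (Option (Option L.Pt))) := fun
    | (false, true) => some (some none)
    | (true, true) => some (some (some none))
    | (false, false) => none
    | (true, false) => some none
  have a₁ : L₁.Adjacent e₁ (some (L.pos (s, σ))) none := L.adjacent_markBeyond_self _ _
  have a₂ : L₂.Adjacent e₁ (some (some (L.pos (s, σ)))) none := L₁.adjacent_markBeyond_self _ _
  have a₃ : L₂.Adjacent e₁ none (some none) := a₁.markBeyond_none
  have b₃ : L₃.Adjacent e₂ (some (some (some (L.pos (t, τ))))) none :=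
    L₂.adjacent_markBeyond_self _ _
  have b₄ : L₄.Adjacent e₂ (some (some (some (some (L.pos (t, τ)))))) none :=
    L₃.adjacent_markBeyond_self _ _
  have b₅ : L₄.Adjacent e₂ none (some none) := b₃.markBeyond_none
  have T : ∀ {x y e}, L₂.Adjacent e x y → (e = e₂ → x ≠ some (some (L.pos (t, τ)))) →
      (e = -e₂ → y ≠ some (some (L.pos (t, τ)))) → L₄.Adjacent e (some (some x)) (some (some y)) :=
    fun h hx hy => (h.markBeyond_some hx hy).markBeyond_some (fun e => hs' (hx e))
      (fun e => hs' (hy e))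
  have S : ∀ {x y e}, L.Adjacent e x y → (e = e₁ → x ≠ L.pos (s, σ)) →
      (e = -e₁ → y ≠ L.pos (s, σ)) → L₂.Adjacent e (some (some x)) (some (some y)) :=
    fun h hx hy => (h.markBeyond_some hx hy).markBeyond_some (fun e => hs' (hx e))
      (fun e => hs' (hy e))
  have f₁ := T (S h₁ (fun _ => hp n1) fun e => (n5 _ e).elim) (fun _ => hs' (hs' (hp n2)))
    fun _ => hs' (hs' (hp n3))
  have f₂ := T (S h₂ (fun _ => hp n1) fun e => hp n3.symm) (fun _ => hs' (hs' (hp n2)))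
    fun e => (n5 _ e).elim
  have f₃ := T (S h₃ (fun _ => hp (n4 _ _)) fun e => hp n3.symm) (fun _ => hs' (hs' (hp n3)))
    fun e => hs' (hs' (hp (n4 _ _)))
  have k₁ := T a₂ (fun _ => hs' (hs' (hp n3))) fun _ => (Option.some_ne_none _).symm
  have k₂ := T a₃ (fun _ => (Option.some_ne_none _).symm) fun _ => hs' (Option.some_ne_none _).symm
  suffices SameBrackets j X L₄ (L₄.slideAt r s t σ τ) from
    sameBrackets_slideAt_of_markBeyond (sameBrackets_slideAt_of_markBeyond
      (sameBrackets_slideAt_of_markBeyond (sameBrackets_slideAt_of_markBeyond this)))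
  refine H.sameBrackets_of_marked L₄ hrs hrt hst f₁ f₂ f₃ hr hs ht ⟨pt, ?_⟩ ?_ k₁ k₂ b₄ b₅
  · rintro ⟨_ | _, _ | _⟩ ⟨_ | _, _ | _⟩ e <;> first | rfl | cases e
  · rintro x ⟨_ | _, _ | _⟩ e <;> cases e

end LinkDiagram

end

/-! ### All planar third moves from a single one -/

noncomputable section

variable {X : Type u} [Biquandle X] {j : Version}

namespace LinkDiagram

section triangleSwap

variable {C : Type} {r s t : C}

theorem commute_swap_swap {P : Type} [DecidableEq P] {x y z w : P} (h : [x, y, z, w].Nodup) :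
    Commute (Equiv.swap x y) (Equiv.swap z w) :=
  (Equiv.Perm.disjoint_swap_swap h).commute

/-- Any vertex of the triangle may be listed first, as the exchanges on its three sides commute. -/
theorem triangleSwap_second (hrs : r ≠ s) (hrt : r ≠ t) (hst : s ≠ t) :
    triangleSwap s r t true false = triangleSwap r s t true true := by
  classical
  have h : Commute (Equiv.swap (s, false) (t, false)) (Equiv.swap (r, false) (t, true)) :=
    commute_swap_swap (by simp [hrs.symm, hrt.symm, hst])
  simp only [triangleSwap, Bool.not_true, Bool.not_false]
  rw [mul_assoc, mul_assoc, Equiv.swap_comm (s, true)]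
  congr 1

theorem triangleSwap_third (hrs : r ≠ s) (hrt : r ≠ t) (hst : s ≠ t) :
    triangleSwap t r s false false = triangleSwap r s t true true := by
  classical
  have h : Commute (Equiv.swap (r, false) (t, true) * Equiv.swap (s, false) (t, false))
      (Equiv.swap (r, true) (s, true)) := by
    refine Commute.mul_left (commute_swap_swap ?_) (commute_swap_swap ?_) <;>
      simp [hrs, hrt, hst, hrs.symm, hrt.symm, hst.symm]
  simp only [triangleSwap, Bool.not_true, Bool.not_false]
  rw [mul_assoc (Equiv.swap (r, true) (s, true)), Equiv.swap_comm (t, true),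
    Equiv.swap_comm (t, false)]
  convert h.eq

end triangleSwap

section

variable {L : LinkDiagram} {r s t : L.Cr}

theorem slideAt_congr {r' s' t' : L.Cr} {σ τ σ' τ' : Bool}
    (h : triangleSwap r s t σ τ = triangleSwap r' s' t' σ' τ') :
    L.slideAt r s t σ τ = L.slideAt r' s' t' σ' τ' := by
  unfold slideAt
  rw [h]

/-- The exchange on each side is an involution. -/
theorem slideAt_slideAt (hrs : r ≠ s) (hrt : r ≠ t) (hst : s ≠ t) (σ τ : Bool) :
    (L.slideAt r s t σ τ).slideAt r s t σ τ = L := by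
  obtain ⟨h1, h2, h3, h4, h5, h6, h7⟩ := triangleSwap_apply σ τ hrs hrt hst
  have h : ∀ x, triangleSwap r s t σ τ (triangleSwap r s t σ τ x) = x := by
    rintro ⟨c, b⟩
    by_cases hr : c = r
    · subst hr
      cases b
      · rw [h2, h4]
      · rw [h1, h3]
    · by_cases hs : c = s
      · subst hs
        by_cases hb : b = σ
        · rw [hb, h3, h1]
        · rw [Bool.eq_not_of_ne hb, h5, h6]
      · by_cases ht : c = t
        · subst ht
          by_cases hb : b = τ
          · rw [hb, h4, h2]
          · rw [Bool.eq_not_of_ne hb, h6, h5]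
        · rw [h7 _ _ hr hs ht, h7 _ _ hr hs ht]
  have : ((triangleSwap r s t σ τ).toEmbedding.trans
      ((triangleSwap r s t σ τ).toEmbedding.trans L.pos)) = L.pos :=
    DFunLike.ext _ _ fun x => congrArg L.pos (h x)
  exact congrArg (fun f => (⟨L.Pt, L.Cr, L.finite_pt, L.finite_cr, L.next, f, L.sign⟩ :
    LinkDiagram)) this

end

namespace SlideInvariant

variable {e₁ e₂ e₃ s₁ s₂ s₃ : ℤˣ}

/-- The move reverses the order of the two crossings on each side, so the move back is a move on a
triangle with all three directions reversed and the same signs. -/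
theorem inverse {σ τ : Bool} (H : SlideInvariant j X σ τ (-e₁) (-e₂) (-e₃) s₁ s₂ s₃) :
    SlideInvariant j X σ τ e₁ e₂ e₃ s₁ s₂ s₃ := by
  intro L r s t hrs hrt hst h₁ h₂ h₃ hr hs ht
  obtain ⟨t1, t2, t3, t4, t5, t6, -⟩ := triangleSwap_apply σ τ hrs hrt hst
  let D := L.slideAt r s t σ τ
  have h : SameBrackets j X D (D.slideAt r s t σ τ) := H D r s t hrs hrt hst
    (cast (congrArg₂ (D.Adjacent (-e₁)) (congrArg L.pos t1).symm (congrArg L.pos t3).symm) h₁.symm)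
    (cast (congrArg₂ (D.Adjacent (-e₂)) (congrArg L.pos t2).symm (congrArg L.pos t4).symm) h₂.symm)
    (cast (congrArg₂ (D.Adjacent (-e₃)) (congrArg L.pos t5).symm (congrArg L.pos t6).symm) h₃.symm)
    hr hs ht
  have h' : D.slideAt r s t σ τ = L := slideAt_slideAt hrs hrt hst σ τ
  rw [h'] at h
  exact h.symm

/-- The same move with the vertex `s` listed first, so that the reversal of two sides can be applied
at that vertex. -/
theorem iff_second : SlideInvariant j X true true e₁ e₂ e₃ s₁ s₂ s₃ ↔
    SlideInvariant j X true false (-e₁) e₃ e₂ s₂ s₁ s₃ := by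
  constructor
  · intro H L r s t hrs hrt hst h₁ h₂ h₃ hr hs ht
    rw [slideAt_congr (triangleSwap_second hrs.symm hst hrt)]
    exact H L s r t hrs.symm hst hrt (neg_neg e₁ ▸ h₁.symm) h₃ h₂ hs hr ht
  · intro H L r s t hrs hrt hst h₁ h₂ h₃ hr hs ht
    rw [← slideAt_congr (triangleSwap_second hrs hrt hst)]
    exact H L s r t hrs.symm hst hrt h₁.symm h₃ h₂ hs hr ht

theorem iff_third : SlideInvariant j X true true e₁ e₂ e₃ s₁ s₂ s₃ ↔
    SlideInvariant j X false false (-e₂) (-e₃) e₁ s₃ s₁ s₂ := by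
  constructor
  · intro H L r s t hrs hrt hst h₁ h₂ h₃ hr hs ht
    rw [slideAt_congr (triangleSwap_third hst hrs.symm hrt.symm)]
    exact H L s t r hst hrs.symm hrt.symm h₃ (neg_neg e₂ ▸ h₁.symm) (neg_neg e₃ ▸ h₂.symm) hs ht hr
  · intro H L r s t hrs hrt hst h₁ h₂ h₃ hr hs ht
    rw [← slideAt_congr (triangleSwap_third hrs hrt hst)]
    exact H L t r s hrt.symm hst.symm hrs h₂.symm h₃.symm h₁ ht hr hs

theorem flip_second (H : SlideInvariant j X true true (-e₁) e₂ (-e₃) s₁ (-s₂) s₃) :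
    SlideInvariant j X true true e₁ e₂ e₃ s₁ s₂ s₃ :=
  iff_second.2 (flip (iff_second.1 H))

theorem flip_third (H : SlideInvariant j X true true e₁ (-e₂) (-e₃) s₁ s₂ (-s₃)) :
    SlideInvariant j X true true e₁ e₂ e₃ s₁ s₂ s₃ :=
  iff_third.2 (flip (iff_third.1 H))

end SlideInvariant

/-- The third Reidemeister moves on planar triangles with given directions preserve the
brackets; `k` tells apart the two kinds of triangles with the same directions. -/
def PlanarSlideInvariant (j : Version) (X : Type u) [Biquandle X] (k e₁ e₂ e₃ : ℤˣ) : Prop :=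
  SlideInvariant j X true true e₁ e₂ e₃ (k * e₁ * e₂) (k * e₁ * e₃) (k * e₂ * e₃)

namespace PlanarSlideInvariant

variable {k e₁ e₂ e₃ : ℤˣ}

theorem inverse (H : PlanarSlideInvariant j X k (-e₁) (-e₂) (-e₃)) :
    PlanarSlideInvariant j X k e₁ e₂ e₃ := by
  refine SlideInvariant.inverse ?_
  simpa only [PlanarSlideInvariant, neg_mul, mul_neg, neg_neg] using H

/-- Reversing the two sides at a vertex changes the sign of that vertex; followed by the inverse
move, this amounts to reversing the third side only. In terms of the planar type, `k` changes its
sign. -/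
theorem neg_third (H : PlanarSlideInvariant j X (-k) e₁ e₂ (-e₃)) :
    PlanarSlideInvariant j X k e₁ e₂ e₃ := by
  refine inverse (SlideInvariant.flip ?_)
  simpa only [PlanarSlideInvariant, neg_mul, mul_neg, neg_neg] using H

theorem neg_second (H : PlanarSlideInvariant j X (-k) e₁ (-e₂) e₃) :
    PlanarSlideInvariant j X k e₁ e₂ e₃ := by
  refine inverse (SlideInvariant.flip_second ?_)
  simpa only [PlanarSlideInvariant, neg_mul, mul_neg, neg_neg] using H

theorem neg_first (H : PlanarSlideInvariant j X (-k) (-e₁) e₂ e₃) :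
    PlanarSlideInvariant j X k e₁ e₂ e₃ := by
  refine inverse (SlideInvariant.flip_third ?_)
  simpa only [PlanarSlideInvariant, neg_mul, mul_neg, neg_neg] using H

theorem base : PlanarSlideInvariant j X 1 1 1 1 := by
  intro L r s t hrs hrt hst h₁ h₂ h₃ hr hs ht
  have h : ∀ {p q}, L.Adjacent 1 p q → L.next p = q := fun h => by
    rcases h with ⟨-, h⟩ | ⟨e, -⟩
    · exact h
    · exact absurd e (by decide)
  exact L.sameBrackets_slide_base r s t hrs hrt hst (h h₁) (h h₂) (h h₃) hr hs ht

/-- Reversing all three sides one by one and then passing to the inverse move restores the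
directions but changes `k`. Both values of `k` are thus reached from the base case, and then all
directions. -/
theorem all (k e₁ e₂ e₃ : ℤˣ) : PlanarSlideInvariant j X k e₁ e₂ e₃ := by
  have h : ∀ k, PlanarSlideInvariant j X k 1 1 1 := fun k => by
    rcases Int.units_eq_one_or k with rfl | rfl
    · exact base
    · refine inverse (neg_first (neg_second (neg_third ?_)))
      simpa only [neg_neg] using base
  have h₁ : ∀ k, PlanarSlideInvariant j X k e₁ 1 1 := fun k => by
    rcases Int.units_eq_one_or e₁ with rfl | rfl
    · exact h k
    · exact neg_first ((neg_neg (1 : ℤˣ)).symm ▸ h _)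
  have h₂ : ∀ k, PlanarSlideInvariant j X k e₁ e₂ 1 := fun k => by
    rcases Int.units_eq_one_or e₂ with rfl | rfl
    · exact h₁ k
    · exact neg_second ((neg_neg (1 : ℤˣ)).symm ▸ h₁ _)
  rcases Int.units_eq_one_or e₃ with rfl | rfl
  · exact h₂ k
  · exact neg_third ((neg_neg (1 : ℤˣ)).symm ▸ h₂ _)

end PlanarSlideInvariant

/-- The sign conditions of a planar triangle say that the three products of a sign with the
directions of the two adjacent sides have a common value, which is `k`. -/
theorem sameBrackets_third (L : LinkDiagram) {a b c : L.Cr} (h : L.IsTriangle a b c) :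
    SameBrackets j X L (L.slide a b c) := by
  obtain ⟨hab, hac, hbc, e₁, e₂, e₃, h₁, h₂, h₃, ha, hb⟩ := h
  have h : ∀ s e e' : ℤˣ, s = s * e * e' * e * e' := by decide
  rw [slide_eq_slideAt]
  refine PlanarSlideInvariant.all (L.sign a * e₁ * e₂) e₁ e₂ e₃ L a b c hab hac hbc h₁ h₂ h₃
    (h _ _ _) ?_ ?_
  · rw [ha]
    exact h _ _ _
  · rw [ha, hb]
    exact h _ _ _

theorem Step.sameBrackets [Finite X] {L L' : LinkDiagram} (h : Step L L') :
    SameBrackets j X L L' := by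
  cases h with
  | iso _ e g next_eq pos_eq sign_eq => exact sameBrackets_of_iso e g next_eq pos_eq sign_eq
  | mark p => exact sameBrackets_mark _ p
  | first c t h => exact sameBrackets_first _ c t h
  | second a b h_sign h_over h_under => exact sameBrackets_second _ a b h_sign h_over h_under
  | third a b c h => exact sameBrackets_third _ h

end LinkDiagram

end

theorem mainTheorem2 {X : Type*} [Biquandle X] [Finite X] (j : Version) (L : LinkDiagram)
    (f : Coloring L X) (G : FramedGraph) (hG : f.IsLeadingTerm j G) :
    (∀ L' : LinkDiagram, L.Equivalent L' → G.vertexNumber ≤ L'.crossingNumber) ∧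
    (G.vertexNumber = L.crossingNumber →
      ∀ L' : LinkDiagram, L.Equivalent L' →
        ∃ s : L'.State, (LinkDiagram.State.graph s).HomeoUpToCircles L.shadow) :=
  hG.minimal fun h => h.sameBrackets_of_step LinkDiagram.Step.sameBrackets
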